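/- Work over $\mathbb{C}$, with homogeneous coordinates $((x_0:x_1),(y_0:y_1),(z_0:z_1))$ on $(\mathbb{P}^1)^3$. Let $P_1=\{x_0=y_0=z_0=0\}$ and $P_2=\{x_1=y_1=z_1=0\}$, two antipodal torus fixed points, and let $\ell_1,\dots,\ell_6$ be the torus invariant lines $\{x_0=y_0=0\}$, $\{x_0=z_0=0\}$, $\{y_0=z_0=0\}$, $\{x_1=y_1=0\}$, $\{x_1=z_1=0\}$, $\{y_1=z_1=0\}$ through them. Let $\pi:\hat{\tilde X}\to(\mathbb{P}^1)^3$ be the permutohedral blowup, that is, the blowup at $P_1,P_2$ followed by the blowup along the (disjoint) proper transforms of $\ell_1,\dots,\ell_6$. In the Chow group $A_1(\hat{\tilde X})$ let $h_1,h_2,h_3$ be the classes of the proper transforms of general lines in the directions of the third, the second and the first factor respectively (so $h_1=H_1H_2$, $h_2=H_1H_3$, $h_3=H_2H_3$ for the pulled back hyperplane classes $H_1,H_2,H_3$ of the three factors), let $e_i$ be the class of the proper transform of a general line in the exceptional plane over $P_i$, and let $f_i$ be the class of the fibre of the exceptional divisor over a general point of $\ell_i$. The blowup $\hat{\tilde X}$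 exists, and it admits a nontrivial toric automorphism $\hat\zeta\neq\mathrm{id}$, acting on the cocharacter lattice $\mathbb{Z}^3$ of the torus (with coordinates $x_0/x_1,\ y_0/y_1,\ z_0/z_1$) by $$v\mapsto\begin{pmatrix}-1&0&0\\-1&1&0\\-1&0&1\end{pmatrix}v ,$$ which resolves the birational map $$\zeta:(\mathbb{P}^1)^3\dashrightarrow(\mathbb{P}^1)^3,\qquad ((x_0:x_1),(y_0:y_1),(z_0:z_1))\mapsto((x_1:x_0),(x_1y_0:x_0y_1),(x_1z_0:x_0z_1)),$$ in the sense that $\pi\circ\hat\zeta=\zeta\circ\pi$ as rational maps. For all integers $d_1,d_2,d_3,a_1,a_2,b_1,\dots,b_6$, $$\hat\zeta_*\Big(\sum_{j=1}^3 d_jh_j-\sum_{i=1}^2a_ie_i-\sum_{i=1}^6b_if_i\Big)=\sum_{j=1}^3 d'_jh_j-\sum_{i=1}^2a'_ie_i-\sum_{i=1}^6b'_if_i\quad\text{in }A_1(\hat{\tilde X}),$$ where $$d_1'=d_1+d_3-a_1-a_2-b_2-b_5,\quad d_2'=d_2+d_3-a_1-a_2-b_1-b_4,\quad d_3'=d_3,$$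 $$a_1'=d_3-a_2-b_4-b_5,\quad a_2'=d_3-a_1-b_1-b_2,$$ $$b_1'=b_5,\quad b_2'=b_4,\quad b_3'=b_3,\quad b_4'=b_2,\quad b_5'=b_1,\quad b_6'=b_6 .$$ -/

import Mathlib

open CategoryTheory CategoryTheory.Limits AlgebraicGeometry TopologicalSpace

noncomputable section

namespace CubeCremona

universe u

/-! ## Blowups -/

/-- An ideal sheaf is invertible (its subscheme is an effective Cartier divisor) if it is
generated by one nonzerodivisor on an affine neighbourhood of every point. -/
def IsInvertible {X : Scheme.{u}} (I : X.IdealSheafData) : Prop :=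
  ∀ x : X, ∃ U : X.affineOpens, x ∈ U.1 ∧
    ∃ f ∈ nonZeroDivisors Γ(X, U.1), I.ideal U = Ideal.span {f}

/-- `π : X ⟶ Y` is the blowup of `Y` along the closed subscheme with ideal sheaf `I`: the inverse
image ideal sheaf of `I` on `X` is invertible, and `π` is universal with this property. -/
structure IsBlowup {X Y : Scheme.{u}} (π : X ⟶ Y) (I : Y.IdealSheafData) : Prop where
  isInvertible : IsInvertible (I.comap π)
  existsUnique_lift : ∀ {T : Scheme.{u}} (g : T ⟶ Y), IsInvertible (I.comap g) →
    ∃! h : T ⟶ X, h ≫ π = g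

/-! ## Chow groups

A point `x` of a scheme stands for the integral closed subscheme `closure {x}`; its dimension is
`Order.height x`, as the preorder on points is specialization with generic points on top. -/

/-- The group of `k`-dimensional cycles. -/
def cycles (X : Scheme.{u}) (k : ℕ) : AddSubgroup (AlgebraicCycle X ℤ) where
  carrier := {c | ∀ x, c x ≠ 0 → Order.height x = k}
  zero_mem' := fun x h ↦ absurd rfl h
  add_mem' := by
    intro a b ha hb x h
    by_cases h0 : a x = 0
    · refine hb x fun h1 ↦ h ?_
      simp [h0, h1]
    · exact ha x h0
  neg_mem' := by
    intro a ha x h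
    exact ha x fun h0 ↦ h (by simp [h0])

/-- `c` is the `k`-cycle on `X` of the divisor of a nonzero rational function `f` on a
`(k+1)`-dimensional integral closed subscheme `g : W ⟶ X`. -/
def IsPrincipal {X : Scheme.{u}} (k : ℕ) (c : AlgebraicCycle X ℤ) : Prop :=
  ∃ (W : Scheme.{u}) (_ : IsIntegral W) (_ : IsLocallyNoetherian W) (g : W ⟶ X)
    (_ : IsClosedImmersion g) (f : W.functionField),
    Order.height (g (genericPoint W)) = (k + 1 : ℕ) ∧ f ≠ 0 ∧
      (∀ w : W, c (g w) = Scheme.ord f w) ∧ ∀ x ∉ Set.range g, c x = 0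

/-- The subgroup of `k`-cycles rationally equivalent to zero. -/
def ratEquivZero (X : Scheme.{u}) (k : ℕ) : AddSubgroup (cycles X k) :=
  AddSubgroup.closure {c | IsPrincipal k c.1}

/-- The Chow group `A_k(X)` of `k`-cycles modulo rational equivalence. -/
abbrev Chow (X : Scheme.{u}) (k : ℕ) : Type u := cycles X k ⧸ ratEquivZero X k

section Pushforward

variable {X Y : Scheme.{u}}

lemma height_iso (φ : X ≅ Y) (x : X) : Order.height (φ.hom x) = Order.height x := by
  let e : X ≃ₜ Y := Scheme.homeoOfIso φ
  let o : X ≃o Y :=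
    { toEquiv := e.toEquiv
      map_rel_iff' := by
        intro a b
        exact e.isInducing.specializes_iff }
  exact Order.height_orderIso o x

lemma residueDegree_iso (φ : X ≅ Y) (x : X) : φ.hom.residueDegree x = 1 := by
  unfold Scheme.Hom.residueDegree
  let := (φ.hom.residueFieldMap x).hom.toAlgebra
  have hb : Function.Bijective (φ.hom.residueFieldMap x).hom :=
    ConcreteCategory.bijective_of_isIso (φ.hom.residueFieldMap x)
  let e : Y.residueField (φ.hom x) ≃ₐ[Y.residueField (φ.hom x)] X.residueField x :=
    AlgEquiv.ofBijective (Algebra.ofId _ _) hb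
  rw [← e.toLinearEquiv.finrank_eq]
  exact Module.finrank_self _

/-- The pushforward of cycles along an isomorphism (an instance of proper pushforward). -/
def mapCycle (φ : X ≅ Y) (c : AlgebraicCycle X ℤ) : AlgebraicCycle Y ℤ :=
  AlgebraicCycle.map φ.hom Order.height Order.height c

lemma mapCycle_apply (φ : X ≅ Y) (c : AlgebraicCycle X ℤ) (x : X) :
    mapCycle φ c (φ.hom x) = c x := by
  have hpre : φ.hom ⁻¹' {φ.hom x} = {x} := by
    ext z
    simp only [Set.mem_preimage, Set.mem_singleton_iff]
    exact (Scheme.homeoOfIso φ).injective.eq_iff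
  have h1 : AlgebraicCycle.mapCoeff φ.hom Order.height Order.height x = 1 := by
    unfold AlgebraicCycle.mapCoeff
    rw [if_pos (height_iso φ x).symm, residueDegree_iso]
  unfold mapCycle AlgebraicCycle.map
  rw [Function.locallyFinsupp.map_apply, hpre, finsum_mem_singleton, h1]
  simp

lemma iso_surj (φ : X ≅ Y) (y : Y) : ∃ x, φ.hom x = y := (Scheme.homeoOfIso φ).surjective y

/-- The pushforward of `k`-cycles along an isomorphism, as a homomorphism. -/
def mapCycles (φ : X ≅ Y) (k : ℕ) : cycles X k →+ cycles Y k where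
  toFun c := ⟨mapCycle φ c.1, by
    intro y hy
    obtain ⟨x, rfl⟩ := iso_surj φ y
    rw [mapCycle_apply] at hy
    rw [height_iso]
    exact c.2 x hy⟩
  map_zero' := by
    apply Subtype.ext
    ext y
    obtain ⟨x, rfl⟩ := iso_surj φ y
    change mapCycle φ 0 (φ.hom x) = 0
    rw [mapCycle_apply]
    rfl
  map_add' a b := by
    apply Subtype.ext
    ext y
    obtain ⟨x, rfl⟩ := iso_surj φ y
    change mapCycle φ (a.1 + b.1) (φ.hom x) = (mapCycle φ a.1 + mapCycle φ b.1) (φ.hom x)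
    simp only [Function.locallyFinsuppWithin.coe_add, Pi.add_apply, mapCycle_apply]

lemma isPrincipal_mapCycle (φ : X ≅ Y) (k : ℕ) {c : AlgebraicCycle X ℤ} (hc : IsPrincipal k c) :
    IsPrincipal k (mapCycle φ c) := by
  obtain ⟨W, hW, hN, g, hg, f, h1, h2, h3, h4⟩ := hc
  refine ⟨W, hW, hN, g ≫ φ.hom, inferInstance, f, ?_, h2, ?_, ?_⟩
  · rw [Scheme.Hom.comp_apply, height_iso, h1]
  · intro w
    rw [Scheme.Hom.comp_apply, mapCycle_apply, h3]
  · intro y hy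
    obtain ⟨x, rfl⟩ := iso_surj φ y
    rw [mapCycle_apply]
    refine h4 x ?_
    rintro ⟨w, rfl⟩
    exact hy ⟨w, Scheme.Hom.comp_apply _ _ _⟩

lemma ratEquivZero_le_comap (φ : X ≅ Y) (k : ℕ) :
    ratEquivZero X k ≤ (ratEquivZero Y k).comap (mapCycles φ k) := by
  unfold ratEquivZero
  rw [AddSubgroup.closure_le]
  intro c hc
  exact AddSubgroup.subset_closure (isPrincipal_mapCycle φ k hc)

/-- The pushforward `φ_* : A_k(X) → A_k(Y)` along an isomorphism. -/
def pushforward (φ : X ≅ Y) (k : ℕ) : Chow X k →+ Chow Y k :=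
  QuotientAddGroup.map _ _ (mapCycles φ k) (ratEquivZero_le_comap φ k)

end Pushforward

open Classical in
/-- The cycle `[C]` of an irreducible closed subset `C` of dimension `k`: coefficient one at its
generic point (and the zero cycle if `C` is not of this kind). -/
def primeCycle {X : Scheme.{u}} (k : ℕ) (C : Set X) : cycles X k :=
  ⟨{ toFun := fun x ↦ if IsGenericPoint x C ∧ Order.height x = k then 1 else 0
     supportWithinDomain' := Set.subset_univ _
     supportLocallyFiniteWithinDomain' := by
       intro z _
       refine ⟨Set.univ, Filter.univ_mem, ?_⟩
       refine Set.Subsingleton.finite ?_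
       rintro x ⟨-, hx⟩ y ⟨-, hy⟩
       have hx' : IsGenericPoint x C := by
         by_contra h
         simp [h] at hx
       have hy' : IsGenericPoint y C := by
         by_contra h
         simp [h] at hy
       exact hx'.eq hy' },
    by
      intro x hx
      by_contra h
      exact hx (if_neg fun h' ↦ h h'.2)⟩

/-- The class in `A_k(X)` of an irreducible closed subset of dimension `k`. -/
def fundClass {X : Scheme.{u}} (k : ℕ) (C : Set X) : Chow X k :=
  QuotientAddGroup.mk (primeCycle k C)

/-! ## The variety `(ℙ¹)³` over `ℂ` -/

/-- The homogeneous coordinate ring `ℂ[X₀, X₁]` of `ℙ¹`, graded by degree. -/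
abbrev grading : ℕ → Submodule ℂ (MvPolynomial (Fin 2) ℂ) :=
  MvPolynomial.homogeneousSubmodule (Fin 2) ℂ

instance gradingGradedAlgebra : GradedAlgebra grading := MvPolynomial.gradedAlgebra

/-- The base scheme `Spec ℂ`. -/
abbrev SpecC : Scheme.{0} := Spec (CommRingCat.of ℂ)

/-- The complex projective line. -/
abbrev P1 : Scheme.{0} := Proj grading

/-- The structure morphism of the projective line. -/
def P1.toSpecC : P1 ⟶ SpecC :=
  Proj.toSpecZero grading ≫ Spec.map (CommRingCat.ofHom (algebraMap ℂ (grading 0)))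

/-- The closed subset `X_b = 0` of the projective line. -/
def P1.coordZero (b : Fin 2) : Closeds P1 :=
  (Proj.basicOpen grading (MvPolynomial.X b)).compl

lemma isUnit_aeval_X {R : Type} [CommRing R] [Algebra ℂ R] (a : Fin 2 → R) (b : Fin 2)
    (h : IsUnit (a b)) : IsUnit ((MvPolynomial.aeval (R := ℂ) a).toRingHom (MvPolynomial.X b)) := by
  simpa using h

/-- The ring homomorphism from the degree zero part of `ℂ[X₀, X₁][1 / X_b]` to `R` given by
`X_i ↦ a i`, for `a b` a unit. -/
def P1.awayHom {R : Type} [CommRing R] [Algebra ℂ R] (a : Fin 2 → R) (b : Fin 2)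
    (h : IsUnit (a b)) : HomogeneousLocalization.Away grading (MvPolynomial.X b) →+* R :=
  (Localization.awayLift (MvPolynomial.aeval (R := ℂ) a).toRingHom (MvPolynomial.X b)
    (isUnit_aeval_X a b h)).comp (algebraMap _ _)

lemma X_mem_grading (b : Fin 2) : (MvPolynomial.X b : MvPolynomial (Fin 2) ℂ) ∈ grading 1 :=
  MvPolynomial.isHomogeneous_X ℂ b

/-- The `R`-valued point `(a 0 : a 1)` of the projective line, where `a b` is a unit. -/
def P1.point {R : Type} [CommRing R] [Algebra ℂ R] (a : Fin 2 → R) (b : Fin 2)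
    (h : IsUnit (a b)) : Spec (CommRingCat.of R) ⟶ P1 :=
  Spec.map (CommRingCat.ofHom (P1.awayHom a b h)) ≫
    Proj.awayι grading (MvPolynomial.X b) (X_mem_grading b) one_pos

lemma P1.point_toSpecC {R : Type} [CommRing R] [Algebra ℂ R] (a : Fin 2 → R) (b : Fin 2)
    (h : IsUnit (a b)) :
    P1.point a b h ≫ P1.toSpecC = Spec.map (CommRingCat.ofHom (algebraMap ℂ R)) := by
  unfold P1.point P1.toSpecC
  rw [Category.assoc, Proj.awayι_toSpecZero_assoc, ← Spec.map_comp, ← Spec.map_comp,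
    ← CommRingCat.ofHom_comp, ← CommRingCat.ofHom_comp]
  congr 2
  ext r
  change Localization.awayLift _ _ (isUnit_aeval_X a b h) (HomogeneousLocalization.val
    (HomogeneousLocalization.fromZeroRingHom grading _ (algebraMap ℂ (grading 0) r))) = _
  have : HomogeneousLocalization.val (HomogeneousLocalization.fromZeroRingHom grading
      (Submonoid.powers (MvPolynomial.X b)) (algebraMap ℂ (grading 0) r)) =
      algebraMap _ _ (MvPolynomial.C r : MvPolynomial (Fin 2) ℂ) := by
    exact Localization.mk_one_eq_algebraMap _
  rw [this]
  unfold Localization.awayLift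
  rw [IsLocalization.Away.lift_eq]
  simp

/-- The product `ℙ¹ × ℙ¹ × ℙ¹` over `ℂ`. -/
def P1Cube : Scheme.{0} :=
  pullback (pullback.fst P1.toSpecC P1.toSpecC ≫ P1.toSpecC) P1.toSpecC

/-- The three projections `(ℙ¹)³ ⟶ ℙ¹`. -/
def P1Cube.proj : Fin 3 → (P1Cube ⟶ P1) :=
  ![pullback.fst (pullback.fst P1.toSpecC P1.toSpecC ≫ P1.toSpecC) P1.toSpecC ≫
      pullback.fst P1.toSpecC P1.toSpecC,
    pullback.fst (pullback.fst P1.toSpecC P1.toSpecC ≫ P1.toSpecC) P1.toSpecC ≫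
      pullback.snd P1.toSpecC P1.toSpecC,
    pullback.snd (pullback.fst P1.toSpecC P1.toSpecC ≫ P1.toSpecC) P1.toSpecC]

/-- The structure morphism of `(ℙ¹)³`. -/
def P1Cube.toSpecC : P1Cube ⟶ SpecC := P1Cube.proj 0 ≫ P1.toSpecC

/-- The morphism to `(ℙ¹)³` with given components. -/
def P1Cube.lift {T : Scheme.{0}} (p : Fin 3 → (T ⟶ P1))
    (h : ∀ i, p i ≫ P1.toSpecC = p 0 ≫ P1.toSpecC) : T ⟶ P1Cube :=
  pullback.lift (pullback.lift (p 0) (p 1) (h 1).symm) (p 2) (by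
    rw [pullback.lift_fst_assoc]
    exact (h 2).symm)

/-- The `R`-valued point `((a 0 0 : a 0 1), (a 1 0 : a 1 1), (a 2 0 : a 2 1))` of `(ℙ¹)³`, where
all the `a i b` are units for a fixed `b`. -/
def P1Cube.point {R : Type} [CommRing R] [Algebra ℂ R] (a : Fin 3 → Fin 2 → R) (b : Fin 2)
    (h : ∀ i, IsUnit (a i b)) : Spec (CommRingCat.of R) ⟶ P1Cube :=
  P1Cube.lift (fun i ↦ P1.point (a i) b (h i))
    (fun i ↦ by rw [P1.point_toSpecC, P1.point_toSpecC])

/-- The affine chart `𝔸³ ⟶ (ℙ¹)³` around the torus fixed point where the homogeneous coordinates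
of index `b` vanish: the `i`-th affine coordinate is the quotient of the `i`-th homogeneous
coordinate of index `b` by the other one. -/
def P1Cube.chart (b : Fin 2) :
    Spec (CommRingCat.of (MvPolynomial (Fin 3) ℂ)) ⟶ P1Cube :=
  P1Cube.point (fun i c ↦ if c = b then MvPolynomial.X i else 1) (b + 1) (by
    intro i
    rw [if_neg (by revert b; decide)]
    exact isUnit_one)

/-! ## The torus and the birational map -/

/-- The ring of the torus: the group algebra `ℂ[M]` of the character lattice `M = ℤ³`. -/
abbrev TorusRing : Type := AddMonoidAlgebra ℂ (Fin 3 → ℤ)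

/-- The torus `(ℂˣ)³ = Spec ℂ[M]`. -/
abbrev Torus : Scheme.{0} := Spec (CommRingCat.of TorusRing)

/-- The `i`-th coordinate function of the torus. -/
def coord (i : Fin 3) : TorusRing := AddMonoidAlgebra.single (Pi.single i 1) 1

lemma isUnit_coord (i : Fin 3) : IsUnit (coord i) := by
  refine IsUnit.of_mul_eq_one (AddMonoidAlgebra.single (-Pi.single i 1) 1) ?_
  rw [coord, AddMonoidAlgebra.single_mul_single, add_neg_cancel, mul_one]
  rfl

/-- The inclusion of the torus as the open orbit: `(x, y, z) ↦ ((x : 1), (y : 1), (z : 1))`. -/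
def torusInclusion : Torus ⟶ P1Cube :=
  P1Cube.point (fun i ↦ ![coord i, 1]) 1 (fun _ ↦ isUnit_one)

/-- The endomorphism of the torus given by an integer matrix `A`, acting on the cocharacter lattice
`ℤ³` by `v ↦ A v`, so on characters by `m ↦ Aᵀ m`. -/
def torusEnd (A : Matrix (Fin 3) (Fin 3) ℤ) : Torus ⟶ Torus :=
  Spec.map (CommRingCat.ofHom
    (AddMonoidAlgebra.mapDomainRingHom ℂ (Matrix.mulVecLin A.transpose).toAddMonoidHom))

/-- The matrix of the toric symmetry. -/
def zetaMatrix : Matrix (Fin 3) (Fin 3) ℤ :=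
  !![-1, 0, 0;
     -1, 1, 0;
     -1, 0, 1]

/-- The restriction to the dense torus `x₀ x₁ y₀ y₁ z₀ z₁ ≠ 0` of the birational map `ζ`,
`((x₀ : x₁), (y₀ : y₁), (z₀ : z₁)) ↦ ((x₁ : x₀), (x₁ y₀ : x₀ y₁), (x₁ z₀ : x₀ z₁))`,
written at the point `((x : 1), (y : 1), (z : 1))`. -/
def zetaOnTorus : Torus ⟶ P1Cube :=
  P1Cube.point
    ![![1, coord 0],
      ![coord 1, coord 0],
      ![coord 2, coord 0]] 1 (by
    intro i
    fin_cases i <;> exact isUnit_coord 0)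

/-! ## The permutohedral blowup -/

/-- The torus fixed point of `(ℙ¹)³` where the three homogeneous coordinates of index `b` vanish.
The fixed points for `b = 0` and `b = 1` are antipodal. -/
def fixedPoint (b : Fin 2) : Closeds P1Cube :=
  ⨅ i : Fin 3, (P1.coordZero b).preimage (P1Cube.proj i).continuous

/-- The torus invariant line through `fixedPoint b` parallel to the `j`-th factor. -/
def invariantLine (b : Fin 2) (j : Fin 3) : Closeds P1Cube :=
  ⨅ i : {i : Fin 3 // i ≠ j}, (P1.coordZero b).preimage (P1Cube.proj i).continuous

/-- The union of the two antipodal fixed points. -/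
def twoPoints : Closeds P1Cube := fixedPoint 0 ⊔ fixedPoint 1

/-- The union of the proper transforms, under `π : X ⟶ (ℙ¹)³`, of the six invariant lines through
the two antipodal fixed points. -/
def properTransformSixLines {X : Scheme.{0}} (π : X ⟶ P1Cube) : Closeds X :=
  Closeds.closure (π ⁻¹' ((⋃ b : Fin 2, ⋃ j : Fin 3, (invariantLine b j : Set P1Cube)) \ twoPoints))

/-- The permutohedral blowup of `(ℙ¹)³`: the blowup at two antipodal torus fixed points, followed by
the blowup along the (disjoint) proper transforms of the six torus invariant lines through them.
All centres carry the reduced scheme structure. -/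
structure PermutohedralBlowup where
  /-- The blowup at the two points. -/
  X₁ : Scheme.{0}
  /-- The blowup at the two points and the six lines. -/
  X₂ : Scheme.{0}
  /-- The first blowdown. -/
  π₁ : X₁ ⟶ P1Cube
  /-- The second blowdown. -/
  π₂ : X₂ ⟶ X₁
  isBlowup₁ : IsBlowup π₁ (Scheme.IdealSheafData.vanishingIdeal twoPoints)
  isBlowup₂ : IsBlowup π₂ (Scheme.IdealSheafData.vanishingIdeal (properTransformSixLines π₁))

/-- The choice of general members of the families of curves below. -/
structure GeneralChoice where
  /-- The constant values on the lines parallel to the `j`-th factor. -/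
  line : Fin 3 → Fin 3 → ℂˣ
  /-- The coefficients of the linear forms defining lines in the exceptional planes. -/
  plane : Fin 2 → Fin 3 → ℂˣ
  /-- The coordinate of a point on an invariant line. -/
  point : Fin 2 → Fin 3 → ℂˣ

namespace PermutohedralBlowup

variable (B : PermutohedralBlowup)

/-- The composite blowdown to `(ℙ¹)³`. -/
def π : B.X₂ ⟶ P1Cube := B.π₂ ≫ B.π₁

/-- The class of the proper transform of a general line parallel to the `j`-th factor of `(ℙ¹)³`,
namely the line on which the coordinates `i ≠ j` have the nonzero constant values `p.line j i`.
This line does not meet the centre of the blowup. -/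
def lineClass (p : GeneralChoice) (j : Fin 3) : Chow B.X₂ 1 :=
  fundClass 1 (B.π ⁻¹' closure (P1Cube.chart 0 '' PrimeSpectrum.zeroLocus
    {f | ∃ i ≠ j, f = MvPolynomial.X i - MvPolynomial.C (p.line j i : ℂ)}))

/-- A general line in the exceptional plane of the first blowup over `fixedPoint b`: its intersection
with the proper transform of the surface `∑ i, α i * x i = 0` through `fixedPoint b`, where the `x i`
are the local coordinates at that point and all the coefficients `α i` are nonzero. This line does
not meet the proper transforms of the invariant lines. -/
def exceptionalLine (p : GeneralChoice) (b : Fin 2) : Set B.X₁ :=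
  B.π₁ ⁻¹' fixedPoint b ∩
    closure (B.π₁ ⁻¹' (P1Cube.chart b '' PrimeSpectrum.zeroLocus
      {∑ i : Fin 3, MvPolynomial.C (p.plane b i : ℂ) * MvPolynomial.X i} \ fixedPoint b))

/-- The class of the proper transform of a general line in the exceptional plane over
`fixedPoint b`. -/
def exceptionalClass (p : GeneralChoice) (b : Fin 2) : Chow B.X₂ 1 :=
  fundClass 1 (B.π₂ ⁻¹' B.exceptionalLine p b)

/-- The class of the fibre of the exceptional divisor over `invariantLine b j`, over the point of
this line whose coordinate in the chart around `fixedPoint b` is the nonzero number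
`p.point b j`. -/
def fiberClass (p : GeneralChoice) (b : Fin 2) (j : Fin 3) : Chow B.X₂ 1 :=
  fundClass 1 (B.π ⁻¹' (P1Cube.chart b '' PrimeSpectrum.zeroLocus
    {f | f = MvPolynomial.X j - MvPolynomial.C (p.point b j : ℂ) ∨
      ∃ i ≠ j, f = MvPolynomial.X i}))

/-- The classes `h₁, h₂, h₃` of lines parallel to the third, second and first factor, which are
the products `H₁ H₂`, `H₁ H₃`, `H₂ H₃` of hyperplane classes. -/
def h (p : GeneralChoice) : Fin 3 → Chow B.X₂ 1 :=
  ![B.lineClass p 2, B.lineClass p 1, B.lineClass p 0]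

/-- The classes `e₁, e₂` of lines in the exceptional divisors over the two fixed points. -/
def e (p : GeneralChoice) : Fin 2 → Chow B.X₂ 1 :=
  ![B.exceptionalClass p 0, B.exceptionalClass p 1]

/-- The fibre classes `f₁, …, f₆` over the lines `x₀ = y₀ = 0`, `x₀ = z₀ = 0`, `y₀ = z₀ = 0`,
`x₁ = y₁ = 0`, `x₁ = z₁ = 0`, `y₁ = z₁ = 0`. -/
def f (p : GeneralChoice) : Fin 6 → Chow B.X₂ 1 :=
  ![B.fiberClass p 0 2, B.fiberClass p 0 1, B.fiberClass p 0 0,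
    B.fiberClass p 1 2, B.fiberClass p 1 1, B.fiberClass p 1 0]

/-- The class `∑ d_j h_j - ∑ a_i e_i - ∑ b_i f_i` in `A₁` of the permutohedral blowup. -/
def curveClass (p : GeneralChoice) (d : Fin 3 → ℤ) (a : Fin 2 → ℤ) (b : Fin 6 → ℤ) :
    Chow B.X₂ 1 :=
  ∑ j, d j • B.h p j - ∑ i, a i • B.e p i - ∑ i, b i • B.f p i

/-- The automorphism `ζ` of the permutohedral blowup is toric and on the torus it is given by the
matrix `A`: for the dense open embedding `ι` of the torus that lifts its inclusion in `(ℙ¹)³`, it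
restricts to the automorphism of the torus with matrix `A`. -/
def IsToricSymmetry (ζ : B.X₂ ≅ B.X₂) (A : Matrix (Fin 3) (Fin 3) ℤ) : Prop :=
  ζ.hom ≫ B.π ≫ P1Cube.toSpecC = B.π ≫ P1Cube.toSpecC ∧
    ∃ ι : Torus ⟶ B.X₂, IsOpenImmersion ι ∧ IsDominant ι ∧ ι ≫ B.π = torusInclusion ∧
      ι ≫ ζ.hom = torusEnd A ≫ ι

/-- The automorphism `ζ` resolves the rational map from `(ℙ¹)³` to itself that is defined on the
dense torus by `r`: the rational maps `π ∘ ζ` and `r ∘ π` agree, on the preimage of the torus. -/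
def Resolves (ζ : B.X₂ ≅ B.X₂) (r : Torus ⟶ P1Cube) : Prop :=
  pullback.snd torusInclusion B.π ≫ ζ.hom ≫ B.π = pullback.fst torusInclusion B.π ≫ r

end PermutohedralBlowup

end CubeCremona

end

/-!
The permutohedral blowup is the toric variety whose fan is that of the permutohedron, and on this
model the map `ζ` is visible: if the coordinates of the torus are written as ratios `t i / t 0` of four
homogeneous coordinates `t 0, …, t 3`, then `ζ` exchanges `t 0` and `t 1`. So `ζ` extends to the closure
of the torus in the product of projective lines with the coordinates `t i : t j`.

A toric variety is realized here as the closure of the image of a torus in a product of projective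
spaces (`ToricData`), with smooth affine charts (`ToricData.Chart`). This makes morphisms to it
computable from homogeneous coordinates. The criterion `ToricData.isBlowup` reduces the universal
property of a blowup to a comparison of weights on charts; it gives `isBlowup_firstBlowdown` and
`isBlowup_secondBlowdown`, hence the model `toricModel`. By the universal property any other
permutohedral blowup is isomorphic to it over `(ℙ¹)³`, and all classes are transported along this
isomorphism (`PermutohedralBlowup.exists_iso`, `PermutohedralBlowup.pushforward_curveClass`).

For the action on `A₁`, every point of the toric model is written as a limit for `ε → 0` of a point
`ε ^ (l i) * a i` of the torus over a field (`orbitPoint`); symmetries act on the levels `l` and the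
coordinates `a`, and `orbitPoint_specializes` decides which points lie in the closure of which. A
rational function on a toric surface in the model gives a relation between classes of curves
(`orbitClass_eq_sum`). The relations for the permutohedral surface and for `ℙ¹ × ℙ¹`
(`line_relation`, `pencil_relation`, `plane_relation`, `fiber_relation`) express the classes of general
lines, of lines in the exceptional planes and of fibres as sums of classes of torus invariant curves
(`lineClass_toricModel`, `exceptionalClass_toricModel`, `fiberClass_toricModel`). Since these sums are
known for every order of the four labels, the images under the exchange of two labels are found by
comparing lists of torus invariant curves (`pushforward_swapIso_labelLine`,
`pushforward_swapIso_planeSum`, `pushforward_swapIso_fiberSum`, `labelLine_zero`), and the formula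
follows by linearity.
-/

open CategoryTheory CategoryTheory.Limits AlgebraicGeometry TopologicalSpace

noncomputable section

namespace CubeCremona

/-! ### Points of projective spaces -/

/-- The polynomial ring over `ℂ` in the variables `X i`, graded by degree. -/
abbrev grad (ι : Type) : ℕ → Submodule ℂ (MvPolynomial ι ℂ) :=
  MvPolynomial.homogeneousSubmodule ι ℂ

instance gradGradedAlgebra (ι : Type) : GradedAlgebra (grad ι) := MvPolynomial.gradedAlgebra

/-- The projective space over `ℂ` with homogeneous coordinates indexed by `ι`. -/
abbrev PP (ι : Type) : Scheme.{0} := Proj (grad ι)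

namespace PP

variable {ι : Type}

lemma X_mem (b : ι) : (MvPolynomial.X b : MvPolynomial ι ℂ) ∈ grad ι 1 :=
  MvPolynomial.isHomogeneous_X ℂ b

/-- The coordinate ring of the affine chart `X b ≠ 0`. -/
abbrev AwayRing (b : ι) : Type := HomogeneousLocalization.Away (grad ι) (MvPolynomial.X b)

/-- The constant functions on the chart `X b ≠ 0`. -/
def const (b : ι) : ℂ →+* AwayRing b :=
  (HomogeneousLocalization.fromZeroRingHom (grad ι) _).comp (algebraMap ℂ (grad ι 0))

/-- The function `X i / X b` on the chart `X b ≠ 0`. -/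
def ratio (b i : ι) : AwayRing b :=
  HomogeneousLocalization.Away.mk (grad ι) (X_mem b) 1 (MvPolynomial.X i) (X_mem i)

lemma val_const (b : ι) (r : ℂ) :
    (const b r).val = algebraMap _ _ (MvPolynomial.C r : MvPolynomial ι ℂ) :=
  Localization.mk_one_eq_algebraMap _

lemma val_ratio_mul (b i : ι) :
    (ratio b i).val * algebraMap _ _ (MvPolynomial.X b : MvPolynomial ι ℂ) =
      algebraMap _ _ (MvPolynomial.X i : MvPolynomial ι ℂ) := by
  rw [ratio, HomogeneousLocalization.Away.val_mk, ← Localization.mk_one_eq_algebraMap,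
    ← Localization.mk_one_eq_algebraMap, Localization.mk_mul, Localization.mk_eq_mk_iff,
    Localization.r_iff_exists]
  exact ⟨1, by simp [mul_comm]⟩

@[simp] lemma ratio_self (b : ι) : ratio b b = 1 := by
  apply HomogeneousLocalization.val_injective
  have h := val_ratio_mul b b
  have hu : IsUnit (algebraMap _ (Localization.Away (MvPolynomial.X b : MvPolynomial ι ℂ))
      (MvPolynomial.X b : MvPolynomial ι ℂ)) := IsLocalization.Away.algebraMap_isUnit _
  rw [HomogeneousLocalization.val_one]
  exact hu.mul_right_cancel (by rw [h, one_mul])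

lemma eval₂_ratio (b : ι) (n : ℕ) (F : MvPolynomial ι ℂ) (hF : F ∈ grad ι (n • 1)) :
    MvPolynomial.eval₂ (const b) (ratio b) F =
      HomogeneousLocalization.Away.mk (grad ι) (X_mem b) n F hF := by
  apply HomogeneousLocalization.val_injective
  have hu : IsUnit (algebraMap _ (Localization.Away (MvPolynomial.X b : MvPolynomial ι ℂ))
      (MvPolynomial.X b : MvPolynomial ι ℂ)) := IsLocalization.Away.algebraMap_isUnit _
  refine (hu.pow n).mul_right_cancel ?_
  have h1 : ∀ G : MvPolynomial ι ℂ, G.IsHomogeneous n →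
      (MvPolynomial.eval₂ (const b) (ratio b) G).val *
        (algebraMap _ (Localization.Away (MvPolynomial.X b : MvPolynomial ι ℂ))
          (MvPolynomial.X b : MvPolynomial ι ℂ)) ^ n =
        algebraMap _ _ G := by
    intro G hG
    have hval : (MvPolynomial.eval₂ (const b) (ratio b) G).val =
        MvPolynomial.eval₂ ((algebraMap (MvPolynomial ι ℂ)
          (Localization.Away (MvPolynomial.X b : MvPolynomial ι ℂ))).comp MvPolynomial.C)
          (fun i ↦ (ratio b i).val) G := by
      have := MvPolynomial.hom_eval₂ G (const b) (algebraMap (AwayRing b)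
        (Localization.Away (MvPolynomial.X b : MvPolynomial ι ℂ))) (ratio b)
      rw [HomogeneousLocalization.algebraMap_apply] at this
      rw [this]
      congr 1
    rw [hval, MvPolynomial.eval₂_eq, Finset.sum_mul]
    conv_rhs => rw [G.as_sum, map_sum]
    refine Finset.sum_congr rfl fun d hd ↦ ?_
    have hdn : ∑ i ∈ d.support, d i = n := by
      have := hG (MvPolynomial.mem_support_iff.mp hd)
      rw [← this, Finsupp.weight_apply, Finsupp.sum]
      simp
    rw [MvPolynomial.monomial_eq, map_mul, Finsupp.prod, map_prod, RingHom.comp_apply, mul_assoc]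
    congr 1
    rw [← hdn, ← Finset.prod_pow_eq_pow_sum, ← Finset.prod_mul_distrib]
    refine Finset.prod_congr rfl fun i _ ↦ ?_
    rw [← mul_pow, val_ratio_mul, map_pow]
  rw [h1 F (by simpa using hF), HomogeneousLocalization.Away.val_mk, ← map_pow,
    ← Localization.mk_one_eq_algebraMap, ← Localization.mk_one_eq_algebraMap, Localization.mk_mul,
    Localization.mk_eq_mk_iff, Localization.r_iff_exists]
  exact ⟨1, by simp [mul_comm]⟩

lemma awayRing_hom_ext {R : Type} [CommRing R] (b : ι) {φ ψ : AwayRing b →+* R}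
    (hc : φ.comp (const b) = ψ.comp (const b)) (hX : ∀ i, φ (ratio b i) = ψ (ratio b i)) :
    φ = ψ := by
  ext x
  obtain ⟨n, F, hF, rfl⟩ := x.mk_surjective _ (X_mem b)
  rw [← eval₂_ratio, MvPolynomial.hom_eval₂, MvPolynomial.hom_eval₂, hc]
  congr 1
  funext i
  exact hX i

variable {R : Type} [CommRing R]

lemma isUnit_eval₂Hom_X (γ : ℂ →+* R) (a : ι → R) (b : ι) (h : IsUnit (a b)) :
    IsUnit (MvPolynomial.eval₂Hom γ a (MvPolynomial.X b)) := by
  simpa using h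

/-- The homomorphism from the coordinate ring of the chart `X b ≠ 0` to `R` that is `γ` on constants
and maps `X i / X b` to `a i / a b`. -/
def awayHom (γ : ℂ →+* R) (a : ι → R) (b : ι) (h : IsUnit (a b)) : AwayRing b →+* R :=
  (Localization.awayLift (MvPolynomial.eval₂Hom γ a) (MvPolynomial.X b)
    (isUnit_eval₂Hom_X γ a b h)).comp (algebraMap _ _)

lemma awayHom_const (γ : ℂ →+* R) (a : ι → R) (b : ι) (h : IsUnit (a b)) (r : ℂ) :
    awayHom γ a b h (const b r) = γ r := by
  rw [awayHom, RingHom.comp_apply, HomogeneousLocalization.algebraMap_apply, val_const,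
    Localization.awayLift, IsLocalization.Away.lift_eq]
  simp

lemma awayHom_ratio_mul (γ : ℂ →+* R) (a : ι → R) (b : ι) (h : IsUnit (a b)) (i : ι) :
    awayHom γ a b h (ratio b i) * a b = a i := by
  have := congr_arg (Localization.awayLift (MvPolynomial.eval₂Hom γ a) (MvPolynomial.X b)
    (isUnit_eval₂Hom_X γ a b h)) (val_ratio_mul b i)
  rw [map_mul] at this
  unfold Localization.awayLift at this
  rw [IsLocalization.Away.lift_eq, IsLocalization.Away.lift_eq] at this
  rw [MvPolynomial.coe_eval₂Hom, MvPolynomial.eval₂_X, MvPolynomial.eval₂_X] at this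
  exact this

lemma awayHom_ratio (γ : ℂ →+* R) (a : ι → R) (b : ι) (h : IsUnit (a b)) (h1 : a b = 1) (i : ι) :
    awayHom γ a b h (ratio b i) = a i := by
  simpa [h1] using awayHom_ratio_mul γ a b h i

/-- The `R`-valued point of projective space with the homogeneous coordinates `a i`, one of which,
`a b`, is a unit. The homomorphism `γ` makes `R` a `ℂ`-algebra: different structures on one ring
occur, so they are not instances. -/
def pt (γ : ℂ →+* R) (a : ι → R) (b : ι) (h : IsUnit (a b)) : Spec (CommRingCat.of R) ⟶ PP ι :=
  Spec.map (CommRingCat.ofHom (awayHom γ a b h)) ≫ Proj.awayι (grad ι) _ (X_mem b) one_pos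

lemma map_pt {S : Type} [CommRing S] (φ : R →+* S) (γ : ℂ →+* R) (a : ι → R) (b : ι)
    (h : IsUnit (a b)) :
    Spec.map (CommRingCat.ofHom φ) ≫ pt γ a b h = pt (φ.comp γ) (fun i ↦ φ (a i)) b (h.map φ) := by
  unfold pt
  rw [← Category.assoc, ← Spec.map_comp, ← CommRingCat.ofHom_comp]
  congr 3
  apply awayRing_hom_ext
  · ext r
    simp only [RingHom.comp_apply, awayHom_const]
  · intro i
    refine (h.map φ).mul_right_cancel ?_
    rw [RingHom.comp_apply, ← map_mul, awayHom_ratio_mul]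
    exact (awayHom_ratio_mul (φ.comp γ) (fun i ↦ φ (a i)) b (h.map φ) i).symm

/-- The point does not depend on the choice of the coordinate that is a unit. -/
lemma pt_congr_index (γ : ℂ →+* R) (a : ι → R) (b b' : ι) (h : IsUnit (a b)) (h' : IsUnit (a b')) :
    pt γ a b h = pt γ a b' h' := by
  let x : MvPolynomial ι ℂ := MvPolynomial.X b * MvPolynomial.X b'
  have hx' : x = MvPolynomial.X b' * MvPolynomial.X b := mul_comm _ _
  have hu : IsUnit (MvPolynomial.eval₂Hom γ a x) := by
    rw [map_mul]
    simpa using h.mul h'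
  let ψ : HomogeneousLocalization.Away (grad ι) x →+* R :=
    (Localization.awayLift (MvPolynomial.eval₂Hom γ a) x hu).comp (algebraMap _ _)
  have key : ∀ (c d : ι) (hc : IsUnit (a c)) (hcd : x = MvPolynomial.X c * MvPolynomial.X d),
      awayHom γ a c hc = ψ.comp (HomogeneousLocalization.awayMap (grad ι) (X_mem d) hcd) := by
    intro c d hc hcd
    ext z
    simp only [RingHom.comp_apply, ψ, awayHom, HomogeneousLocalization.algebraMap_apply]
    rw [HomogeneousLocalization.val_awayMap]
    generalize z.val = w
    have : Localization.awayLift (MvPolynomial.eval₂Hom γ a) (MvPolynomial.X c)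
        (isUnit_eval₂Hom_X γ a c hc) = (Localization.awayLift (MvPolynomial.eval₂Hom γ a) x hu).comp
        (Localization.awayLift (algebraMap _ (Localization.Away x)) (MvPolynomial.X c)
          (isUnit_of_dvd_unit (map_dvd _ (Dvd.intro _ hcd.symm))
            (IsLocalization.Away.algebraMap_isUnit x))) := by
      apply IsLocalization.ringHom_ext (Submonoid.powers (MvPolynomial.X c : MvPolynomial ι ℂ))
      ext z
      · simp [Localization.awayLift, IsLocalization.Away.lift_eq]
      · simp [Localization.awayLift, IsLocalization.Away.lift_eq]
    rw [this]
    rfl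
  unfold pt
  rw [key b b' h rfl, key b' b h' hx']
  clear_value ψ
  rw [CommRingCat.ofHom_comp, CommRingCat.ofHom_comp, Spec.map_comp, Spec.map_comp,
    Category.assoc, Category.assoc, Proj.SpecMap_awayMap_awayι (grad ι) (hx := rfl),
    Proj.SpecMap_awayMap_awayι (grad ι)]

/-- Proportional vectors are homogeneous coordinates of the same point. -/
lemma pt_eq_pt {γ : ℂ →+* R} {a a' : ι → R} {b b' : ι} {h : IsUnit (a b)} {h' : IsUnit (a' b')}
    (H : ∀ i j, a i * a' j = a j * a' i) : pt γ a b h = pt γ a' b' h' := by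
  have hb : IsUnit (a' b) := by
    have : IsUnit (a b' * a' b) := by
      rw [← H]
      exact h.mul h'
    exact isUnit_of_mul_isUnit_right this
  rw [← pt_congr_index γ a' b b' hb h']
  unfold pt
  congr 3
  apply awayRing_hom_ext
  · ext r
    simp only [RingHom.comp_apply, awayHom_const]
  · intro i
    refine (h.mul hb).mul_right_cancel ?_
    rw [← mul_assoc, awayHom_ratio_mul, mul_comm (a b), ← mul_assoc, awayHom_ratio_mul, H, mul_comm]

lemma pt_congr {γ γ' : ℂ →+* R} {a a' : ι → R} {b : ι} {h : IsUnit (a b)} {h' : IsUnit (a' b)}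
    (hγ : γ = γ') (ha : a = a') : pt γ a b h = pt γ' a' b h' := by
  subst hγ ha
  rfl

/-- The affine open subset `X b ≠ 0`. -/
def dPlus (b : ι) : (PP ι).Opens := Proj.basicOpen (grad ι) (MvPolynomial.X b)

lemma pt_preimage (γ : ℂ →+* R) (a : ι → R) (b : ι) (h : IsUnit (a b)) (c : ι) :
    pt γ a b h ⁻¹ᵁ dPlus c = PrimeSpectrum.basicOpen (a c) := by
  unfold pt dPlus
  rw [Scheme.Hom.comp_preimage, Proj.awayι_preimage_basicOpen _ _ _ (X_mem c) one_pos]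
  have : HomogeneousLocalization.Away.isLocalizationElem (X_mem b) (X_mem c) = ratio b c := by
    apply HomogeneousLocalization.val_injective
    simp [HomogeneousLocalization.Away.isLocalizationElem, ratio,
      HomogeneousLocalization.Away.val_mk]
  rw [this]
  ext p
  have : a c ∈ p.asIdeal ↔ awayHom γ a b h (ratio b c) ∈ p.asIdeal := by
    rw [← awayHom_ratio_mul γ a b h c]
    exact (p.asIdeal.mul_unit_mem_iff_mem h)
  change ¬ (awayHom γ a b h (ratio b c) ∈ p.asIdeal) ↔ ¬ (a c ∈ p.asIdeal)
  rw [this]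

lemma mem_dPlus_pt (γ : ℂ →+* R) (a : ι → R) (b : ι) (h : IsUnit (a b)) (c : ι)
    (p : Spec (CommRingCat.of R)) :
    pt γ a b h p ∈ dPlus c ↔ a c ∉ p.asIdeal := by
  have := pt_preimage γ a b h c
  have h2 := congr_arg (p ∈ ·) this
  simp only [eq_iff_iff] at h2
  exact h2

lemma iSup_dPlus : ⨆ b, dPlus (ι := ι) b = ⊤ := by
  apply Proj.iSup_basicOpen_eq_top'
  · intro i
    exact ⟨1, X_mem i⟩
  · rw [eq_top_iff]
    rintro F -
    induction F using MvPolynomial.induction_on with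
    | C r =>
      have := (Algebra.adjoin (grad ι 0) (Set.range (MvPolynomial.X : ι → MvPolynomial ι ℂ))).algebraMap_mem
        (algebraMap ℂ (grad ι 0) r)
      exact this
    | add p q hp hq => exact add_mem hp hq
    | mul_X p i hp => exact mul_mem hp (Algebra.subset_adjoin ⟨i, rfl⟩)

lemma exists_mem_dPlus (x : PP ι) : ∃ b, x ∈ dPlus b := by
  have : x ∈ ⨆ b, dPlus (ι := ι) b := by
    rw [iSup_dPlus]
    trivial
  simpa using this

/-- The morphism to an affine scheme given by a homomorphism to the ring of global functions. -/
def _root_.CubeCremona.toSpec {T : Scheme.{0}} (φ : R →+* Γ(T, ⊤)) : T ⟶ Spec (CommRingCat.of R) :=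
  T.toSpecΓ ≫ Spec.map (CommRingCat.ofHom φ)

lemma _root_.CubeCremona.comp_toSpec {T T' : Scheme.{0}} (f : T' ⟶ T) (φ : R →+* Γ(T, ⊤)) :
    f ≫ toSpec φ = toSpec (f.appTop.hom.comp φ) := by
  unfold toSpec
  rw [← Category.assoc, Scheme.toSpecΓ_naturality, Category.assoc, ← Spec.map_comp]
  rfl

lemma _root_.CubeCremona.toSpec_map {S : Type} [CommRing S] {T : Scheme.{0}} (φ : R →+* Γ(T, ⊤))
    (ψ : S →+* R) : toSpec φ ≫ Spec.map (CommRingCat.ofHom ψ) = toSpec (φ.comp ψ) := by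
  unfold toSpec
  rw [Category.assoc, ← Spec.map_comp]
  rfl

lemma _root_.CubeCremona.toSpec_injective {T : Scheme.{0}} {φ ψ : R →+* Γ(T, ⊤)}
    (h : toSpec φ = toSpec ψ) : φ = ψ := by
  have := congr_arg (fun k ↦ (Scheme.ΓSpecIso _).inv ≫ Scheme.Hom.appTop k) h
  simp only [Scheme.Hom.comp_appTop, toSpec] at this
  rw [← Scheme.ΓSpecIso_inv_naturality_assoc, ← Scheme.ΓSpecIso_inv_naturality_assoc,
    Scheme.toSpecΓ_appTop, Iso.inv_hom_id, Category.comp_id, Category.comp_id] at this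
  exact congr_arg CommRingCat.Hom.hom this

lemma _root_.CubeCremona.exists_eq_toSpec {T : Scheme.{0}} (f : T ⟶ Spec (CommRingCat.of R)) :
    ∃ φ : R →+* Γ(T, ⊤), f = toSpec φ := by
  refine ⟨((Scheme.ΓSpecIso _).inv ≫ f.appTop).hom, ?_⟩
  unfold toSpec
  simp only [CommRingCat.ofHom_hom, Spec.map_comp]
  rw [← Scheme.toSpecΓ_naturality_assoc]
  simp

/-- The pullback of global functions along a morphism from a spectrum. -/
def _root_.CubeCremona.evalHom {S : Type} [CommRing S] {T : Scheme.{0}}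
    (f : Spec (CommRingCat.of S) ⟶ T) : Γ(T, ⊤) →+* S :=
  (f.appTop ≫ (Scheme.ΓSpecIso (CommRingCat.of S)).hom).hom

lemma _root_.CubeCremona.spec_comp_toSpec {S : Type} [CommRing S] {T : Scheme.{0}}
    (f : Spec (CommRingCat.of S) ⟶ T) (φ : R →+* Γ(T, ⊤)) :
    f ≫ toSpec φ = Spec.map (CommRingCat.ofHom ((evalHom f).comp φ)) := by
  have : CommRingCat.ofHom ((evalHom f).comp φ) =
    CommRingCat.ofHom φ ≫ f.appTop ≫ (Scheme.ΓSpecIso (CommRingCat.of S)).hom := rfl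
  unfold toSpec
  rw [this, ← Category.assoc, Scheme.toSpecΓ_naturality, Category.assoc, ← Spec.map_comp]
  simp

/-- The morphism to a projective space given by global functions. -/
def ptΓ {T : Scheme.{0}} (γ : ℂ →+* Γ(T, ⊤)) (a : ι → Γ(T, ⊤)) (b : ι) (h : IsUnit (a b)) :
    T ⟶ PP ι :=
  toSpec (awayHom γ a b h) ≫ Proj.awayι (grad ι) _ (X_mem b) one_pos

lemma toSpec_pt {T : Scheme.{0}} (φ : R →+* Γ(T, ⊤)) (γ : ℂ →+* R) (a : ι → R) (b : ι)
    (h : IsUnit (a b)) :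
    toSpec φ ≫ pt γ a b h = ptΓ (φ.comp γ) (fun i ↦ φ (a i)) b (h.map φ) := by
  unfold ptΓ pt
  rw [← Category.assoc, toSpec_map]
  congr 2
  apply awayRing_hom_ext
  · ext r
    simp only [RingHom.comp_apply, awayHom_const]
  · intro i
    refine (h.map φ).mul_right_cancel ?_
    rw [RingHom.comp_apply, ← map_mul, awayHom_ratio_mul]
    exact (awayHom_ratio_mul (φ.comp γ) (fun i ↦ φ (a i)) b (h.map φ) i).symm

lemma ptΓ_eq_toSpec_pt {T : Scheme.{0}} (γ : ℂ →+* Γ(T, ⊤)) (a : ι → Γ(T, ⊤)) (b : ι)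
    (h : IsUnit (a b)) : ptΓ γ a b h = toSpec (RingHom.id _) ≫ pt γ a b h := by
  rw [toSpec_pt]
  rfl

lemma spec_comp_ptΓ {T : Scheme.{0}} (f : Spec (CommRingCat.of R) ⟶ T) (γ : ℂ →+* Γ(T, ⊤))
    (a : ι → Γ(T, ⊤)) (b : ι) (h : IsUnit (a b)) :
    f ≫ ptΓ γ a b h =
      pt ((evalHom f).comp γ) (fun i ↦ evalHom f (a i)) b (h.map (evalHom f)) := by
  rw [ptΓ_eq_toSpec_pt, ← Category.assoc, spec_comp_toSpec, map_pt]
  rfl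

lemma comp_ptΓ {T T' : Scheme.{0}} (f : T' ⟶ T) (γ : ℂ →+* Γ(T, ⊤))
    (a : ι → Γ(T, ⊤)) (b : ι) (h : IsUnit (a b)) :
    f ≫ ptΓ γ a b h =
      ptΓ (f.appTop.hom.comp γ) (fun i ↦ f.appTop.hom (a i)) b (h.map f.appTop.hom) := by
  rw [ptΓ_eq_toSpec_pt, ← Category.assoc, comp_toSpec, toSpec_pt]
  rfl

/-- A morphism to projective space with image in the open subset `X b ≠ 0` is given by global
functions, normalized such that the coordinate of index `b` is one. -/
lemma exists_eq_ptΓ {T : Scheme.{0}} (f : T ⟶ PP ι) (b : ι) (h : ∀ t, f t ∈ dPlus b) :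
    ∃ (γ : ℂ →+* Γ(T, ⊤)) (a : ι → Γ(T, ⊤)) (h : a b = 1),
      f = ptΓ γ a b (h ▸ isUnit_one) := by
  have hr : Set.range f ⊆ Set.range (Proj.awayι (grad ι) _ (X_mem b) one_pos) := by
    rintro _ ⟨t, rfl⟩
    have := h t
    rw [dPlus, ← Proj.opensRange_awayι _ _ (X_mem b) one_pos] at this
    exact this
  obtain ⟨φ, hφ⟩ := exists_eq_toSpec (R := AwayRing b)
    (IsOpenImmersion.lift (Proj.awayι (grad ι) _ (X_mem b) one_pos) f hr)
  have hg := IsOpenImmersion.lift_fac (Proj.awayι (grad ι) _ (X_mem b) one_pos) f hr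
  rw [hφ] at hg
  refine ⟨φ.comp (const b), fun i ↦ φ (ratio b i), by simp, ?_⟩
  rw [← hg]
  unfold ptΓ
  congr 2
  symm
  apply awayRing_hom_ext
  · ext r
    simp only [RingHom.comp_apply, awayHom_const]
  · intro i
    rw [awayHom_ratio _ _ _ _ (by simp)]

lemma ptΓ_inj {T : Scheme.{0}} {b : ι} {γ γ' : ℂ →+* Γ(T, ⊤)} {a a' : ι → Γ(T, ⊤)}
    {h : IsUnit (a b)} {h' : IsUnit (a' b)} (h1 : a b = 1) (h1' : a' b = 1)
    (H : ptΓ γ a b h = ptΓ γ' a' b h') : γ = γ' ∧ a = a' := by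
  unfold ptΓ at H
  rw [cancel_mono] at H
  have H2 := toSpec_injective H
  constructor
  · ext r
    rw [← awayHom_const γ a b h, H2, awayHom_const]
  · funext i
    rw [← awayHom_ratio γ a b h h1, H2, awayHom_ratio γ' a' b h' h1']

lemma pt_inj {b : ι} {γ γ' : ℂ →+* R} {a a' : ι → R}
    {h : IsUnit (a b)} {h' : IsUnit (a' b)} (h1 : a b = 1) (h1' : a' b = 1)
    (H : pt γ a b h = pt γ' a' b h') : γ = γ' ∧ a = a' := by
  unfold pt at H
  rw [cancel_mono] at H
  have H2 : awayHom γ a b h = awayHom γ' a' b h' := by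
    have := Spec.map_injective H
    exact congr_arg CommRingCat.Hom.hom this
  constructor
  · ext r
    rw [← awayHom_const γ a b h, H2, awayHom_const]
  · funext i
    rw [← awayHom_ratio γ a b h h1, H2, awayHom_ratio γ' a' b h' h1']

end PP

/-! ### Affine charts of schemes over products of projective spaces -/

/-- A morphism to `X` is determined by its compositions with the morphisms `q k`. -/
def JointlyMono {X : Scheme.{0}} {K : Type} {Y : K → Scheme.{0}} (q : ∀ k, X ⟶ Y k) : Prop :=
  ∀ {T : Scheme.{0}} (f g : T ⟶ X), (∀ k, f ≫ q k = g ≫ q k) → f = g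

section Chart

variable {X : Scheme.{0}} {K : Type} [Finite K] {ι : K → Type} (q : ∀ k, X ⟶ PP (ι k))

/-- The open subset where, for each `k`, the homogeneous coordinate of index `c k` of the morphism
`q k` to a projective space does not vanish. -/
def chartOpen (c : ∀ k, ι k) : X.Opens := ⟨⋂ k, (q k ⁻¹ᵁ PP.dPlus (c k) : Set X),
  isOpen_iInter_of_finite fun k ↦ (q k ⁻¹ᵁ PP.dPlus (c k)).isOpen⟩

lemma mem_chartOpen (c : ∀ k, ι k) (x : X) :
    x ∈ chartOpen q c ↔ ∀ k, q k x ∈ PP.dPlus (c k) := by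
  change x ∈ ⋂ k, (q k ⁻¹ᵁ PP.dPlus (c k) : Set X) ↔ _
  simp

variable {q} {R : Type} [CommRing R] {γ : ℂ →+* R} {a : ∀ k, ι k → R} {c : ∀ k, ι k}
  (h1 : ∀ k, a k (c k) = 1) (s : Spec (CommRingCat.of R) ⟶ X)
  (hs : ∀ k, s ≫ q k = PP.pt γ (a k) (c k) (h1 k ▸ isUnit_one))

include hs in
lemma range_subset_chartOpen : Set.range s ⊆ Set.range (chartOpen q c).ι := by
  rintro _ ⟨p, rfl⟩
  rw [Scheme.Opens.range_ι]
  refine (mem_chartOpen q c _).2 fun k ↦ ?_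
  rw [← Scheme.Hom.comp_apply, hs k, PP.mem_dPlus_pt, h1]
  exact fun h ↦ p.2.ne_top ((Ideal.eq_top_iff_one _).2 h)

include hs in
/-- A morphism `s` from an affine scheme is an isomorphism to the open subset `chartOpen q c` if the
homogeneous coordinates of this open subset are pulled back from those of `s` by functions. -/
lemma isOpenImmersion_of_section (hq : JointlyMono q) (φ : R →+* Γ((chartOpen q c).toScheme, ⊤))
    (hφ : ∀ k, (chartOpen q c).ι ≫ q k = PP.ptΓ (φ.comp γ) (fun i ↦ φ (a k i)) (c k)
      ((h1 k ▸ isUnit_one : IsUnit (a k (c k))).map φ))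
    (gen : ∀ ψ : R →+* R, ψ.comp γ = γ → (∀ k i, ψ (a k i) = a k i) → ψ = RingHom.id R)
    [Nonempty K] :
    ∃ _ : IsOpenImmersion s, s.opensRange = chartOpen q c := by
  have hr := range_subset_chartOpen h1 s hs
  let s' := IsOpenImmersion.lift (chartOpen q c).ι s hr
  have hs' : s' ≫ (chartOpen q c).ι = s := IsOpenImmersion.lift_fac _ _ _
  let r : (chartOpen q c).toScheme ⟶ Spec (CommRingCat.of R) :=
    toSpec φ
  have e1 : s' ≫ r = 𝟙 _ := by
    let ψ := (Spec.preimage (s' ≫ r)).hom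
    have hψ : Spec.map (CommRingCat.ofHom ψ) = s' ≫ r := by simp [ψ]
    have key : ∀ k, PP.pt γ (a k) (c k) (h1 k ▸ isUnit_one) =
        PP.pt (ψ.comp γ) (fun i ↦ ψ (a k i)) (c k)
          ((h1 k ▸ isUnit_one : IsUnit (a k (c k))).map ψ) := by
      intro k
      rw [← PP.map_pt, hψ, Category.assoc, PP.toSpec_pt, ← hφ, ← Category.assoc, hs', hs k]
      exact h1 k ▸ isUnit_one
    have h : ψ = RingHom.id R := by
      apply gen
      · obtain ⟨k⟩ := ‹Nonempty K›
        exact (PP.pt_inj (h1 k) (by simp [h1 k]) (key k)).1.symm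
      · intro k i
        exact (congr_fun (PP.pt_inj (h1 k) (by simp [h1 k]) (key k)).2 i).symm
    rw [← hψ, h]
    exact Spec.map_id _
  have e2 : r ≫ s' = 𝟙 _ := by
    rw [← cancel_mono (chartOpen q c).ι, Category.assoc, hs', Category.id_comp]
    apply hq
    intro k
    rw [Category.assoc, hs k, hφ k, PP.toSpec_pt]
  have : IsIso s' := ⟨r, e1, e2⟩
  have : IsOpenImmersion s := by
    rw [← hs']
    infer_instance
  refine ⟨this, ?_⟩
  have h3 : s.opensRange = (s' ≫ (chartOpen q c).ι).opensRange := by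
    congr 1
    exact hs'.symm
  rw [h3, Scheme.Hom.opensRange_comp_of_isIso, Scheme.Opens.opensRange_ι]

end Chart

section Dense

variable {X : Scheme.{0}} [IsReduced X] {K : Type} [Finite K] {ι : K → Type}
  {q : ∀ k, X ⟶ PP (ι k)}
  {R : Type} [CommRing R] {γ : ℂ →+* R} {a : ∀ k, ι k → R} {c : ∀ k, ι k}
  (h1 : ∀ k, a k (c k) = 1) (s : Spec (CommRingCat.of R) ⟶ X)
  (hs : ∀ k, s ≫ q k = PP.pt γ (a k) (c k) (h1 k ▸ isUnit_one))
  {S : Type} [CommRing S] (θ : R →+* S)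
  [IsDominant (Spec.map (CommRingCat.ofHom θ) ≫ s)] [IsNoetherianRing S]

omit [IsReduced X] in
/-- A dominant morphism to an open subscheme. -/
lemma isDominant_lift_of_isDominant {T : Scheme.{0}} (U : X.Opens) (j' : T ⟶ U)
    [IsDominant (j' ≫ U.ι)] : IsDominant j' := by
  constructor
  intro x
  rw [mem_closure_iff]
  intro V hV hx
  have h1 : IsOpen (U.ι '' V) := U.ι.isOpenEmbedding.isOpenMap V hV
  obtain ⟨_, ⟨y, hy, hyy⟩, ⟨t, rfl⟩⟩ := mem_closure_iff.1
    ((j' ≫ U.ι).denseRange (U.ι x)) _ h1 ⟨x, hx, rfl⟩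
  refine ⟨j' t, ?_, ⟨t, rfl⟩⟩
  rw [Scheme.Hom.comp_apply] at hyy
  rwa [← U.ι.isOpenEmbedding.injective hyy]

include hs θ in
/-- On a reduced scheme with a dense affine scheme `Spec S` mapping through `s`, the morphism `s` is an
open immersion onto `chartOpen q c` as soon as its homogeneous coordinates generate the ring `R`: the
functions on `chartOpen q c` embed in `S`, and their coordinates lie in the image of `R`. -/
lemma isOpenImmersion_of_isDominant (hq : JointlyMono q)
    (gen : Subring.closure (Set.range γ ∪ ⋃ k, Set.range (a k)) = ⊤) [Nonempty K] :
    ∃ _ : IsOpenImmersion s, s.opensRange = chartOpen q c := by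
  have hr := range_subset_chartOpen h1 s hs
  let s' := IsOpenImmersion.lift (chartOpen q c).ι s hr
  have hs' : s' ≫ (chartOpen q c).ι = s := IsOpenImmersion.lift_fac _ _ _
  let U := chartOpen q c
  let j' : Spec (CommRingCat.of S) ⟶ U := Spec.map (CommRingCat.ofHom θ) ≫ s'
  have hj' : j' ≫ U.ι = Spec.map (CommRingCat.ofHom θ) ≫ s := by
    simp only [j', U, Category.assoc, hs']
  have : IsDominant (j' ≫ U.ι) := by rw [hj']; infer_instance
  have : IsDominant j' := isDominant_lift_of_isDominant U j'
  have hsd : IsSchemeTheoreticallyDominant j' := .of_isDominant _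
  let jr : Γ(U.toScheme, ⊤) →+* S := evalHom j'
  have hjr : Function.Injective jr := by
    have h0 : Function.Injective j'.appTop := j'.app_injective ⊤
    have h2 : Function.Injective (Scheme.ΓSpecIso (CommRingCat.of S)).hom :=
      (ConcreteCategory.bijective_of_isIso _).1
    exact h2.comp h0
  have hf : ∀ k, ∃ (γ' : ℂ →+* Γ(U.toScheme, ⊤)) (a' : ι k → Γ(U.toScheme, ⊤)) (h : a' (c k) = 1),
      U.ι ≫ q k = PP.ptΓ γ' a' (c k) (h ▸ isUnit_one) := by
    intro k
    apply PP.exists_eq_ptΓ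
    intro t
    exact (mem_chartOpen q c _).1 t.2 k
  choose γ' a' h' hf using hf
  have hcomp : ∀ k, θ.comp γ = jr.comp (γ' k) ∧ (fun i ↦ θ (a k i)) = fun i ↦ jr (a' k i) := by
    intro k
    have : j' ≫ U.ι ≫ q k = Spec.map (CommRingCat.ofHom θ) ≫ s ≫ q k := by
      rw [← Category.assoc, hj', Category.assoc]
    rw [hf k, PP.spec_comp_ptΓ, hs k, PP.map_pt] at this
    have := PP.pt_inj (by simp [h']) (by simp [h1]) this
    exact ⟨this.1.symm, this.2.symm⟩
  have hrange : ∀ x, θ x ∈ jr.range := by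
    have : (⊤ : Subring R) ≤ jr.range.comap θ := by
      rw [← gen, Subring.closure_le]
      rintro x (⟨z, rfl⟩ | hx)
      · obtain ⟨k⟩ := ‹Nonempty K›
        exact ⟨γ' k z, (RingHom.congr_fun (hcomp k).1 z).symm⟩
      · obtain ⟨k, i, rfl⟩ := Set.mem_iUnion.1 hx
        exact ⟨a' k i, (congr_fun (hcomp k).2 i).symm⟩
    exact fun x ↦ this trivial
  let e : Γ(U.toScheme, ⊤) ≃+* jr.range := RingEquiv.ofBijective jr.rangeRestrict
    ⟨fun x y h ↦ hjr (congr_arg Subtype.val h), jr.rangeRestrict_surjective⟩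
  let φ : R →+* Γ(U.toScheme, ⊤) :=
    (e.symm : jr.range →+* Γ(U.toScheme, ⊤)).comp (θ.codRestrict jr.range hrange)
  have hφ : ∀ x, jr (φ x) = θ x := by
    intro x
    have : e (φ x) = ⟨θ x, hrange x⟩ := by simp [φ]; rfl
    exact congr_arg Subtype.val this
  refine isOpenImmersion_of_section h1 s hs hq φ ?_ ?_
  · intro k
    change U.ι ≫ q k = _
    rw [hf k]
    unfold PP.ptΓ
    congr 3
    · ext z
      apply hjr
      rw [RingHom.comp_apply, hφ]
      exact (RingHom.congr_fun (hcomp k).1 z).symm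
    · funext i
      apply hjr
      rw [hφ]
      exact (congr_fun (hcomp k).2 i).symm
  · intro ψ hψ1 hψ2
    have : (⊤ : Subring R) ≤ RingHom.eqLocus ψ (RingHom.id R) := by
      rw [← gen, Subring.closure_le]
      rintro x (⟨z, rfl⟩ | hx)
      · exact RingHom.congr_fun hψ1 z
      · obtain ⟨k, i, rfl⟩ := Set.mem_iUnion.1 hx
        exact hψ2 k i
    ext x
    exact this (x := x) trivial

end Dense

/-! ### Tori and toric varieties -/

section SpecHom

variable {R : Type} [CommRing R] {T T' : Scheme.{0}}

/-- The ring homomorphism `R → Γ(T, 𝒪)` of a morphism `T ⟶ Spec R`. -/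
def specHom (u : T ⟶ Spec (CommRingCat.of R)) : R →+* Γ(T, ⊤) :=
  ((Scheme.ΓSpecIso (CommRingCat.of R)).inv ≫ u.appTop).hom

lemma toSpec_specHom (u : T ⟶ Spec (CommRingCat.of R)) : toSpec (specHom u) = u := by
  unfold toSpec specHom
  simp only [CommRingCat.ofHom_hom, Spec.map_comp]
  rw [← Scheme.toSpecΓ_naturality_assoc]
  simp

lemma specHom_comp (j : T' ⟶ T) (u : T ⟶ Spec (CommRingCat.of R)) :
    specHom (j ≫ u) = j.appTop.hom.comp (specHom u) := by
  apply toSpec_injective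
  rw [toSpec_specHom, ← comp_toSpec, toSpec_specHom]

lemma specHom_comp_map {S : Type} [CommRing S] (u : T ⟶ Spec (CommRingCat.of R)) (ψ : S →+* R) :
    specHom (u ≫ Spec.map (CommRingCat.ofHom ψ)) = (specHom u).comp ψ := by
  apply toSpec_injective
  rw [toSpec_specHom, ← toSpec_map, toSpec_specHom]

lemma comp_pt_eq {ι : Type} (u : T ⟶ Spec (CommRingCat.of R)) (γ : ℂ →+* R) (a : ι → R) (b : ι)
    (h : IsUnit (a b)) : u ≫ PP.pt γ a b h =
      PP.ptΓ ((specHom u).comp γ) (fun i ↦ specHom u (a i)) b (h.map _) := by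
  rw [← PP.toSpec_pt, toSpec_specHom]

end SpecHom

namespace PP

variable {ι : Type}

/-- The structure morphism of a projective space. -/
def toSpecC (ι : Type) : PP ι ⟶ SpecC :=
  Proj.toSpecZero (grad ι) ≫ Spec.map (CommRingCat.ofHom (algebraMap ℂ (grad ι 0)))

lemma pt_toSpecC {R : Type} [CommRing R] (γ : ℂ →+* R) (a : ι → R) (b : ι) (h : IsUnit (a b)) :
    pt γ a b h ≫ toSpecC ι = Spec.map (CommRingCat.ofHom γ) := by
  unfold pt toSpecC
  rw [Category.assoc, Proj.awayι_toSpecZero_assoc, ← Spec.map_comp, ← Spec.map_comp,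
    ← CommRingCat.ofHom_comp, ← CommRingCat.ofHom_comp]
  congr 2
  ext r
  exact awayHom_const γ a b h r

lemma ptΓ_toSpecC {T : Scheme.{0}} (γ : ℂ →+* Γ(T, ⊤)) (a : ι → Γ(T, ⊤)) (b : ι)
    (h : IsUnit (a b)) : ptΓ γ a b h ≫ toSpecC ι = toSpec γ := by
  rw [ptΓ_eq_toSpec_pt, Category.assoc, pt_toSpecC, toSpec_map]
  rfl

/-- Equality of points given by functions with proportional coordinate vectors. -/
lemma ptΓ_eq_ptΓ {T : Scheme.{0}} {γ : ℂ →+* Γ(T, ⊤)} {a a' : ι → Γ(T, ⊤)} {b b' : ι}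
    {h : IsUnit (a b)} {h' : IsUnit (a' b')} (H : ∀ i j, a i * a' j = a j * a' i) :
    ptΓ γ a b h = ptΓ γ a' b' h' := by
  rw [ptΓ_eq_toSpec_pt, ptΓ_eq_toSpec_pt, pt_eq_pt H]

/-- Two points with equal images have proportional coordinate vectors. -/
lemma mul_eq_mul_of_ptΓ_eq {T : Scheme.{0}} {γ γ' : ℂ →+* Γ(T, ⊤)} {a a' : ι → Γ(T, ⊤)} {b b' : ι}
    {h : IsUnit (a b)} {h' : IsUnit (a' b')} (H : ptΓ γ a b h = ptΓ γ' a' b' h') (i j : ι) :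
    a i * a' j = a j * a' i := by
  have hb : IsUnit (a' b) := by
    by_contra hb
    have hall : ∀ t : T, t ∈ T.basicOpen (a' b) := by
      intro t
      have h1 : ptΓ γ a b h t ∈ dPlus b := by
        rw [ptΓ_eq_toSpec_pt, Scheme.Hom.comp_apply, mem_dPlus_pt]
        exact fun h2 ↦ (toSpec (RingHom.id Γ(T, ⊤)) t : PrimeSpectrum Γ(T, ⊤)).2.ne_top
          (Ideal.eq_top_of_isUnit_mem _ h2 h)
      rw [H, ptΓ_eq_toSpec_pt, Scheme.Hom.comp_apply, mem_dPlus_pt] at h1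
      have h2 : T.toSpecΓ ⁻¹ᵁ PrimeSpectrum.basicOpen (a' b) = T.basicOpen (a' b) :=
        Scheme.toSpecΓ_preimage_basicOpen T (a' b)
      rw [← h2]
      unfold toSpec at h1
      exact h1
    refine hb ?_
    refine RingedSpace.isUnit_of_isUnit_germ T.toRingedSpace ⊤ (a' b) fun t ht ↦ ?_
    exact (RingedSpace.mem_basicOpen T.toRingedSpace (a' b) t ht).1 (hall t)
  obtain ⟨u, hu⟩ := h
  obtain ⟨v, hv⟩ := hb
  have key : ∀ (γ : ℂ →+* Γ(T, ⊤)) (a : ι → Γ(T, ⊤)) (b' : ι) (h : IsUnit (a b'))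
      (u : Γ(T, ⊤)ˣ) (hu : u = a b), ∃ h' : IsUnit ((fun i ↦ ↑u⁻¹ * a i) b),
      ptΓ γ a b' h = ptΓ γ (fun i ↦ ↑u⁻¹ * a i) b h' := by
    intro γ a b' h u hu
    refine ⟨by simp [← hu], ptΓ_eq_ptΓ fun i j ↦ by ring⟩
  obtain ⟨g1, e1⟩ := key γ a b (hu ▸ u.isUnit) u hu
  obtain ⟨g2, e2⟩ := key γ' a' b' h' v hv
  have e3 := e1.symm.trans (H.trans e2)
  have h3 := (ptΓ_inj (by simp [← hu]) (by simp [← hv]) e3).2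
  have h4 : ∀ i, a i * v = a' i * u := by
    intro i
    have := congr_fun h3 i
    rw [Units.inv_mul_eq_iff_eq_mul, mul_left_comm, ← Units.inv_mul_eq_iff_eq_mul, inv_inv] at this
    rw [mul_comm, this, mul_comm]
  apply v.isUnit.mul_right_cancel
  linear_combination a' j * h4 i - a' i * h4 j

end PP

/-- The coordinate ring of an `n`-dimensional torus. -/
abbrev TR (n : ℕ) : Type := AddMonoidAlgebra ℂ (Fin n → ℤ)

/-- The character of weight `m`. -/
def mono {n : ℕ} (m : Fin n → ℤ) : TR n := AddMonoidAlgebra.single m 1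

section Mono

variable {n : ℕ}

lemma mono_add (m m' : Fin n → ℤ) : mono (m + m') = mono m * mono m' := by
  simp [mono, AddMonoidAlgebra.single_mul_single]

@[simp] lemma mono_zero : mono (0 : Fin n → ℤ) = 1 := rfl

lemma mono_mul_neg (m : Fin n → ℤ) : mono m * mono (-m) = 1 := by
  rw [← mono_add, add_neg_cancel, mono_zero]

lemma isUnit_mono (m : Fin n → ℤ) : IsUnit (mono m) := .of_mul_eq_one _ (mono_mul_neg m)

lemma mono_nsmul (k : ℕ) (m : Fin n → ℤ) : mono (k • m) = mono m ^ k := by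
  simp [mono, AddMonoidAlgebra.single_pow]

lemma mono_sum {α : Type} (s : Finset α) (f : α → Fin n → ℤ) :
    mono (∑ i ∈ s, f i) = ∏ i ∈ s, mono (f i) := by
  classical
  induction s using Finset.induction_on with
  | empty => simp
  | insert a s ha ih => rw [Finset.sum_insert ha, Finset.prod_insert ha, mono_add, ih]

instance : IsDomain (TR n) := inferInstance

instance : IsNoetherianRing (TR n) := Algebra.FiniteType.isNoetherianRing ℂ _

end Mono

/-- Projective spaces `PP (ι k)` together with characters as homogeneous coordinates, one family
for each `k`: this describes a morphism from the torus to a product of projective spaces. -/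
structure ToricData (n : ℕ) where
  /-- The index set of the projective spaces. -/
  K : Type
  [finite : Finite K]
  [nonempty : Nonempty K]
  /-- The coordinates of the projective spaces. -/
  ι : K → Type
  /-- The weights of the homogeneous coordinates. -/
  χ : ∀ k, ι k → Fin n → ℤ
  /-- A coordinate of each projective space. -/
  base : ∀ k, ι k

attribute [instance] ToricData.finite ToricData.nonempty

namespace ToricData

variable {n : ℕ} (D : ToricData n)

/-- The morphism from the torus to one projective space. -/
def torusPt (k : D.K) : Spec (CommRingCat.of (TR n)) ⟶ PP (D.ι k) :=
  PP.pt (algebraMap ℂ _) (fun i ↦ mono (D.χ k i)) (D.base k) (isUnit_mono _)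

/-- The product of the projective spaces. -/
def ambient : Scheme.{0} := ∏ᶜ fun k ↦ PP (D.ι k)

/-- The projections of the product. -/
def ambientProj (k : D.K) : D.ambient ⟶ PP (D.ι k) := Pi.π (fun k ↦ PP (D.ι k)) k

variable {D} in
lemma ambient_hom_ext {T : Scheme.{0}} {f g : T ⟶ D.ambient}
    (h : ∀ k, f ≫ D.ambientProj k = g ≫ D.ambientProj k) : f = g :=
  Limits.Pi.hom_ext _ _ h

variable {D} in
lemma exists_ambient_lift {T : Scheme.{0}} (f : ∀ k, T ⟶ PP (D.ι k)) :
    ∃ F : T ⟶ D.ambient, ∀ k, F ≫ D.ambientProj k = f k :=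
  ⟨Pi.lift f, fun k ↦ Limits.Pi.lift_π f k⟩

/-- The morphism from the torus to the product. -/
def toAmbient : Spec (CommRingCat.of (TR n)) ⟶ D.ambient := Pi.lift D.torusPt

lemma toAmbient_proj (k : D.K) : D.toAmbient ≫ D.ambientProj k = D.torusPt k :=
  Limits.Pi.lift_π _ _

/-- The toric variety: the closure of the image of the torus in the product of projective spaces. It is
integral by construction, and its morphisms are controlled by homogeneous coordinates. -/
def X : Scheme.{0} := D.toAmbient.image

/-- The morphism from the torus to the toric variety. -/
def torus : Spec (CommRingCat.of (TR n)) ⟶ D.X := D.toAmbient.toImage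

/-- The inclusion of the toric variety in the product. -/
def embed : D.X ⟶ D.ambient := D.toAmbient.imageι

instance : IsClosedImmersion D.embed := inferInstanceAs (IsClosedImmersion D.toAmbient.imageι)

lemma embed_ker : D.embed.ker = D.toAmbient.ker := Scheme.IdealSheafData.ker_subschemeι _

lemma torus_embed : D.torus ≫ D.embed = D.toAmbient := D.toAmbient.toImage_imageι

/-- The projections of the toric variety. -/
def q (k : D.K) : D.X ⟶ PP (D.ι k) := D.embed ≫ D.ambientProj k

instance : IsDominant D.torus := inferInstanceAs (IsDominant D.toAmbient.toImage)

@[simp]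
lemma torus_q (k : D.K) : D.torus ≫ D.q k = D.torusPt k := by
  unfold q
  rw [← Category.assoc, torus_embed, toAmbient_proj]

@[simp]
lemma torus_q_assoc (k : D.K) {Z : Scheme.{0}} (h : PP (D.ι k) ⟶ Z) :
    D.torus ≫ D.q k ≫ h = D.torusPt k ≫ h := by
  rw [← Category.assoc, torus_q]

lemma jointlyMono : JointlyMono D.q := by
  intro T f g h
  rw [← cancel_mono D.embed]
  apply ambient_hom_ext
  intro k
  simpa [q] using h k

instance : IsReduced D.X := by
  have : IsSchemeTheoreticallyDominant D.torus := by
    refine ⟨Scheme.IdealSheafData.ext_of_iSup_eq_top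
      (fun U : D.ambient.affineOpens ↦ ⟨D.embed ⁻¹ᵁ U.1, U.2.preimage _⟩) ?_ fun U ↦ ?_⟩
    · change ⨆ U : D.ambient.affineOpens, D.embed ⁻¹ᵁ U.1 = ⊤
      rw [← Scheme.Hom.preimage_iSup, iSup_affineOpens_eq_top]
      rfl
    · rw [Scheme.Hom.ker_apply]
      exact (RingHom.injective_iff_ker_eq_bot _).1 (D.toAmbient.toImage_app_injective U)
  exact IsSchemeTheoreticallyDominant.isReduced D.torus

instance : IrreducibleSpace D.X := by
  have h1 : IsIrreducible (closure (Set.range D.torus)) := by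
    rw [← Set.image_univ]
    exact ((IrreducibleSpace.isIrreducible_univ _).image _ D.torus.continuous.continuousOn).closure
  rw [D.torus.denseRange.closure_eq] at h1
  exact (irreducibleSpace_def _).2 h1

instance : IsIntegral D.X := isIntegral_of_irreducibleSpace_of_isReduced _

variable {D}

/-- Morphisms to the toric variety that agree after a dominant morphism are equal. -/
lemma ext_of_dominant {T S : Scheme.{0}} [IsReduced T] (j : S ⟶ T) [IsDominant j] {f g : T ⟶ D.X}
    (h : j ≫ f = j ≫ g) : f = g := by
  apply D.jointlyMono
  intro k
  apply ext_of_isDominant j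
  rw [reassoc_of% h]

/-- A morphism to the toric variety is given by its coordinates, if on a dense part these are the
coordinates of a morphism to the torus. -/
lemma exists_lift {T S : Scheme.{0}} [IsReduced T] (j : S ⟶ T) [IsDominant j]
    (u : S ⟶ Spec (CommRingCat.of (TR n))) (f : ∀ k, T ⟶ PP (D.ι k))
    (h : ∀ k, j ≫ f k = u ≫ D.torusPt k) :
    ∃ g : T ⟶ D.X, (∀ k, g ≫ D.q k = f k) ∧ j ≫ g = u ≫ D.torus := by
  obtain ⟨F, hFk⟩ := exists_ambient_lift f
  have hF : j ≫ F = u ≫ D.toAmbient := by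
    apply ambient_hom_ext
    intro k
    rw [Category.assoc, Category.assoc, toAmbient_proj, hFk, h]
  have hk : D.embed.ker ≤ F.ker := by
    have h0 : IsSchemeTheoreticallyDominant j := .of_isDominant _
    have h1 : (j ≫ F).ker = F.ker := by
      rw [Scheme.Hom.ker_comp, j.ker_eq_bot, Scheme.IdealSheafData.map_bot]
    rw [← h1, hF, embed_ker]
    exact Scheme.Hom.le_ker_comp _ _
  have hg : ∀ k, IsClosedImmersion.lift D.embed F hk ≫ D.q k = f k := by
    intro k
    unfold q
    rw [IsClosedImmersion.lift_fac_assoc, hFk]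
  refine ⟨IsClosedImmersion.lift D.embed F hk, hg, ?_⟩
  apply D.jointlyMono
  intro k
  rw [Category.assoc, hg, h, Category.assoc, torus_q]

variable (D)

/-- The structure morphism of the toric variety. -/
def toSpecC : D.X ⟶ SpecC := D.q (Classical.arbitrary _) ≫ PP.toSpecC _

lemma torus_toSpecC : D.torus ≫ D.toSpecC = Spec.map (CommRingCat.ofHom (algebraMap ℂ (TR n))) := by
  unfold toSpecC
  rw [torus_q_assoc, torusPt, PP.pt_toSpecC]

lemma q_toSpecC (k : D.K) : D.q k ≫ PP.toSpecC _ = D.toSpecC := by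
  apply ext_of_isDominant D.torus
  rw [torus_q_assoc, torusPt, PP.pt_toSpecC, torus_toSpecC]

end ToricData
namespace ToricData

/-! ### Charts of toric varieties -/

variable {n : ℕ} {D : ToricData n}

section Regular

/-- The character of weight `m` extends to a regular function near the point `x` of the toric
variety. The extension is characterized through all morphisms to the torus. -/
def RegAt (x : D.X) (m : Fin n → ℤ) : Prop :=
  ∃ (U : D.X.Opens) (_ : x ∈ U) (f : Γ(U.toScheme, ⊤)), ∀ (T : Scheme.{0}) (j : T ⟶ U.toScheme)
    (u : T ⟶ Spec (CommRingCat.of (TR n))), j ≫ U.ι = u ≫ D.torus →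
      j.appTop.hom f = specHom u (mono m)

lemma RegAt.add {x : D.X} {m m' : Fin n → ℤ} (h : RegAt x m) (h' : RegAt x m') :
    RegAt x (m + m') := by
  obtain ⟨U, hU, f, hf⟩ := h
  obtain ⟨U', hU', f', hf'⟩ := h'
  let r : (U ⊓ U').toScheme ⟶ U.toScheme := D.X.homOfLE inf_le_left
  let r' : (U ⊓ U').toScheme ⟶ U'.toScheme := D.X.homOfLE inf_le_right
  refine ⟨U ⊓ U', ⟨hU, hU'⟩, r.appTop.hom f * r'.appTop.hom f', fun T j u hj ↦ ?_⟩
  have e1 := hf T (j ≫ r) u (by simpa [r] using hj)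
  have e2 := hf' T (j ≫ r') u (by simpa [r'] using hj)
  rw [map_mul, mono_add, map_mul, ← e1, ← e2]
  rfl

lemma RegAt.congr {x : D.X} {m m' : Fin n → ℤ} (h : RegAt x m) (e : m = m') : RegAt x m' := e ▸ h

lemma regAt_zero (x : D.X) : RegAt x (0 : Fin n → ℤ) :=
  ⟨⊤, trivial, 1, fun T j u _ ↦ by rw [mono_zero, map_one, map_one]⟩

lemma comp_torusPt {T : Scheme.{0}} (u : T ⟶ Spec (CommRingCat.of (TR n))) (k : D.K) :
    u ≫ D.torusPt k = PP.ptΓ ((specHom u).comp (algebraMap ℂ _))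
      (fun i ↦ specHom u (mono (D.χ k i))) (D.base k) ((isUnit_mono _).map _) :=
  comp_pt_eq u _ _ _ _

lemma regAt_of_mem_dPlus {x : D.X} {k : D.K} {c : D.ι k} (h : D.q k x ∈ PP.dPlus c) (i : D.ι k) :
    RegAt x (D.χ k i - D.χ k c) := by
  let U : D.X.Opens := D.q k ⁻¹ᵁ PP.dPlus c
  obtain ⟨γ, a, ha, e⟩ := PP.exists_eq_ptΓ (U.ι ≫ D.q k) c fun t ↦ t.2
  refine ⟨U, h, a i, fun T j u hj ↦ ?_⟩
  have e1 : j ≫ U.ι ≫ D.q k = u ≫ D.torusPt k := by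
    rw [reassoc_of% hj, torus_q]
  rw [e, PP.comp_ptΓ, comp_torusPt] at e1
  have e2 := PP.mul_eq_mul_of_ptΓ_eq e1 i c
  simp only [ha, map_one, one_mul] at e2
  have e3 : specHom u (mono (D.χ k c)) * specHom u (mono (- D.χ k c)) = 1 := by
    rw [← map_mul, mono_mul_neg, map_one]
  rw [sub_eq_add_neg, mono_add, map_mul, ← e2, mul_assoc, e3, mul_one]

/-- The restriction of a dominant morphism to the preimage of an open subset is dominant. -/
instance isDominant_restrict {S T : Scheme.{0}} (f : S ⟶ T) [IsDominant f] (U : T.Opens) :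
    IsDominant (f ∣_ U) :=
  IsZariskiLocalAtTarget.restrict (P := @IsDominant) inferInstance U

lemma mem_dPlus_of_regAt {x : D.X} {k : D.K} {c : D.ι k}
    (h : ∀ i, RegAt x (D.χ k i - D.χ k c)) : D.q k x ∈ PP.dPlus c := by
  obtain ⟨c', hc'⟩ := PP.exists_mem_dPlus (D.q k x)
  obtain ⟨V, hV, f, hf⟩ := h c'
  let V' : D.X.Opens := D.q k ⁻¹ᵁ PP.dPlus c'
  let U := V ⊓ V'
  let r : U.toScheme ⟶ V.toScheme := D.X.homOfLE inf_le_left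
  obtain ⟨γ, a, ha, e⟩ := PP.exists_eq_ptΓ (U.ι ≫ D.q k) c' fun t ↦ t.2.2
  -- the coordinate `a c` is invertible, with inverse the extension of the quotient
  let j := D.torus ∣_ U
  let u := (D.torus ⁻¹ᵁ U).ι
  have hju : j ≫ U.ι = u ≫ D.torus := morphismRestrict_ι _ _
  have e1 : j ≫ U.ι ≫ D.q k = u ≫ D.torusPt k := by
    rw [reassoc_of% hju, torus_q]
  rw [e, PP.comp_ptΓ, comp_torusPt] at e1
  have e2 := PP.mul_eq_mul_of_ptΓ_eq e1 c c'
  simp only [ha, map_one, one_mul] at e2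
  have e3 := hf _ (j ≫ r) u (by simpa [r] using hju)
  have e4 : a c * r.appTop.hom f = 1 := by
    have hd : IsSchemeTheoreticallyDominant j := .of_isDominant _
    have hinj : Function.Injective j.appTop.hom := j.app_injective ⊤
    apply hinj
    rw [map_mul, map_one]
    have e5 : j.appTop.hom (r.appTop.hom f) = specHom u (mono (D.χ k c' - D.χ k c)) := by
      rw [← e3]
      rfl
    rw [e5]
    have e6 : (mono (D.χ k c') : TR n) = mono (D.χ k c' - D.χ k c) * mono (D.χ k c) := by
      rw [← mono_add, sub_add_cancel]
    have hu : IsUnit (specHom u (mono (D.χ k c))) := (isUnit_mono _).map _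
    apply hu.mul_right_cancel
    rw [mul_assoc, ← map_mul, ← e6, e2, one_mul]
  have hx : x ∈ U := ⟨hV, hc'⟩
  have e7 : PP.ptΓ γ a c' (ha ▸ isUnit_one) = PP.ptΓ γ a c (.of_mul_eq_one _ e4) :=
    PP.ptΓ_eq_ptΓ fun i j ↦ mul_comm _ _
  let x' : U.toScheme := ⟨x, hx⟩
  have e8 : D.q k x = (U.ι ≫ D.q k) x' := rfl
  rw [e8, e, e7, PP.ptΓ_eq_toSpec_pt, Scheme.Hom.comp_apply, PP.mem_dPlus_pt]
  exact fun h2 ↦ (toSpec (RingHom.id Γ(U.toScheme, ⊤)) x' : PrimeSpectrum _).2.ne_top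
          (Ideal.eq_top_of_isUnit_mem _ h2 (.of_mul_eq_one _ e4))

end Regular

/-- A smooth affine chart of the toric variety, given by dual bases of the lattices of characters
and cocharacters, and a choice of one coordinate on each projective space. -/
structure Chart (D : ToricData n) where
  /-- The weights of the coordinates of the chart. -/
  E : Fin n → Fin n → ℤ
  /-- The exponents of a character in terms of the coordinates. -/
  ρ : Fin n → Fin n → ℤ
  /-- The homogeneous coordinates that do not vanish on the chart. -/
  c : ∀ k, D.ι k
  pos : ∀ l k i, 0 ≤ ρ l ⬝ᵥ (D.χ k i - D.χ k (c k))
  gen : ∀ l, ∃ k i, E l = D.χ k i - D.χ k (c k)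
  span : ∀ l i, ∑ j, ρ j l * E j i = if l = i then 1 else 0
  dual : ∀ l j, ρ l ⬝ᵥ E j = if l = j then 1 else 0

/-- The coordinate ring of affine space. -/
abbrev AR (n : ℕ) : Type := MvPolynomial (Fin n) ℂ

namespace Chart

variable (C : D.Chart)

lemma sum_smul (m : Fin n → ℤ) : ∑ l, (C.ρ l ⬝ᵥ m) • C.E l = m := by
  funext i
  simp only [Finset.sum_apply, Pi.smul_apply, smul_eq_mul, dotProduct, Finset.sum_mul]
  rw [Finset.sum_comm]
  have : ∀ j, ∑ l, C.ρ l j * m j * C.E l i = m j * if j = i then 1 else 0 := by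
    intro j
    rw [← C.span j i, Finset.mul_sum]
    exact Finset.sum_congr rfl fun l _ ↦ by ring
  simp [this]

/-- The inclusion of the coordinate ring of the chart in that of the torus. -/
def θ : AR n →+* TR n := MvPolynomial.eval₂Hom (algebraMap ℂ (TR n)) fun l ↦ mono (C.E l)

lemma θ_X (l : Fin n) : C.θ (MvPolynomial.X l) = mono (C.E l) := by simp [θ]

lemma θ_comp_C : C.θ.comp MvPolynomial.C = algebraMap ℂ (TR n) := by
  ext r
  simp [θ]

/-- The monomial in the coordinates of the chart with a given weight (which has to be nonnegative
on the cone of the chart). -/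
def monomial (m : Fin n → ℤ) : AR n := ∏ l, MvPolynomial.X l ^ (C.ρ l ⬝ᵥ m).toNat

@[simp] lemma monomial_zero : C.monomial 0 = 1 := by simp [monomial]

lemma θ_monomial {m : Fin n → ℤ} (h : ∀ l, 0 ≤ C.ρ l ⬝ᵥ m) : C.θ (C.monomial m) = mono m := by
  unfold monomial
  rw [map_prod]
  conv_rhs => rw [← C.sum_smul m, mono_sum]
  refine Finset.prod_congr rfl fun l _ ↦ ?_
  rw [map_pow, θ_X, ← mono_nsmul]
  congr 1
  rw [← natCast_zsmul, Int.toNat_of_nonneg (h l)]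

lemma monomial_E (l : Fin n) : C.monomial (C.E l) = MvPolynomial.X l := by
  unfold monomial
  rw [Finset.prod_eq_single l]
  · simp [C.dual]
  · intro j _ hj
    simp [C.dual, hj]
  · simp

/-- The weight of a monomial. -/
def weight : (Fin n →₀ ℕ) →+ (Fin n → ℤ) where
  toFun d := ∑ l, (d l : ℤ) • C.E l
  map_zero' := by simp
  map_add' d d' := by simp [add_smul, Finset.sum_add_distrib]

lemma weight_injective : Function.Injective C.weight := by
  intro d d' h
  ext l
  have key : ∀ d, C.ρ l ⬝ᵥ C.weight d = d l := by
    intro d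
    change C.ρ l ⬝ᵥ (∑ j, (d j : ℤ) • C.E j) = d l
    rw [dotProduct_sum]
    simp only [dotProduct_smul, C.dual]
    simp
  have := key d
  rw [h, key d'] at this
  exact_mod_cast this.symm

lemma θ_eq : C.θ = AddMonoidAlgebra.mapDomainRingHom ℂ C.weight := by
  apply MvPolynomial.ringHom_ext
  · intro r
    have : C.θ (MvPolynomial.C r) = algebraMap ℂ (TR n) r := by simp [θ]
    rw [this]
    change _ = AddMonoidAlgebra.mapDomain C.weight (AddMonoidAlgebra.single 0 r)
    rw [AddMonoidAlgebra.mapDomain_single, map_zero]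
    rfl
  · intro l
    rw [θ_X]
    change _ = AddMonoidAlgebra.mapDomain C.weight (AddMonoidAlgebra.single (Finsupp.single l 1) 1)
    rw [AddMonoidAlgebra.mapDomain_single]
    unfold mono
    congr 1
    change _ = ∑ j, ((Finsupp.single l 1 j : ℕ) : ℤ) • C.E j
    simp [Finsupp.single_apply]

lemma θ_injective : Function.Injective C.θ := by
  rw [θ_eq]
  exact AddMonoidAlgebra.mapDomain_injective C.weight_injective

instance : IsDominant (Spec.map (CommRingCat.ofHom C.θ)) := by
  constructor
  have := (PrimeSpectrum.denseRange_comap_iff_ker_le_nilRadical C.θ).2 (by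
    rw [(RingHom.injective_iff_ker_eq_bot _).1 C.θ_injective]
    exact bot_le)
  exact this

/-- The homogeneous coordinates of the points of the chart. -/
def coords (k : D.K) (i : D.ι k) : AR n := C.monomial (D.χ k i - D.χ k (C.c k))

lemma coords_c (k : D.K) : C.coords k (C.c k) = 1 := by simp [coords]

lemma θ_coords (k : D.K) (i : D.ι k) : C.θ (C.coords k i) = mono (D.χ k i - D.χ k (C.c k)) :=
  C.θ_monomial fun l ↦ C.pos l k i

/-- The morphism to a projective space with the coordinates of the chart. -/
def coordPt (k : D.K) : Spec (CommRingCat.of (AR n)) ⟶ PP (D.ι k) :=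
  PP.pt MvPolynomial.C (C.coords k) (C.c k) (C.coords_c k ▸ isUnit_one)

lemma θ_coordPt (k : D.K) :
    Spec.map (CommRingCat.ofHom C.θ) ≫ C.coordPt k = D.torusPt k := by
  unfold coordPt torusPt
  have h : IsUnit (C.coords k (C.c k)) := C.coords_c k ▸ isUnit_one
  rw [PP.map_pt]
  refine (PP.pt_congr (a' := fun i ↦ C.θ (C.coords k i)) (h' := h.map C.θ) C.θ_comp_C rfl).trans ?_
  apply PP.pt_eq_pt
  intro i j
  simp only [θ_coords, ← mono_add]
  congr 1
  abel

lemma exists_map : ∃ s : Spec (CommRingCat.of (AR n)) ⟶ D.X, (∀ k, s ≫ D.q k = C.coordPt k) ∧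
    Spec.map (CommRingCat.ofHom C.θ) ≫ s = D.torus := by
  obtain ⟨s, h1, h2⟩ := exists_lift (D := D) (Spec.map (CommRingCat.ofHom C.θ))
    (𝟙 (Spec (CommRingCat.of (TR n)))) C.coordPt
    (fun k ↦ (C.θ_coordPt k).trans (Category.id_comp _).symm)
  exact ⟨s, h1, h2.trans (Category.id_comp _)⟩

/-- The embedding of the chart. -/
def map : Spec (CommRingCat.of (AR n)) ⟶ D.X := C.exists_map.choose

lemma map_q (k : D.K) : C.map ≫ D.q k =
    PP.pt MvPolynomial.C (C.coords k) (C.c k) (C.coords_c k ▸ isUnit_one) :=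
  C.exists_map.choose_spec.1 k

lemma θ_map : Spec.map (CommRingCat.ofHom C.θ) ≫ C.map = D.torus := C.exists_map.choose_spec.2

lemma map_toSpecC : C.map ≫ D.toSpecC = Spec.map (CommRingCat.ofHom MvPolynomial.C) := by
  rw [← D.q_toSpecC (Classical.arbitrary _), ← Category.assoc, map_q, PP.pt_toSpecC]

lemma closure_coords : Subring.closure
    (Set.range (MvPolynomial.C : ℂ →+* AR n) ∪ ⋃ k, Set.range (C.coords k)) = ⊤ := by
  rw [eq_top_iff]
  rintro p -
  induction p using MvPolynomial.induction_on with
  | C r => exact Subring.subset_closure (.inl ⟨r, rfl⟩)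
  | add p q hp hq => exact add_mem hp hq
  | mul_X p l hp =>
    refine mul_mem hp (Subring.subset_closure (.inr ?_))
    obtain ⟨k, i, h⟩ := C.gen l
    refine Set.mem_iUnion.2 ⟨k, i, ?_⟩
    rw [coords, ← h, monomial_E]

lemma isOpenImmersion_and : ∃ _ : IsOpenImmersion C.map, C.map.opensRange = chartOpen D.q C.c := by
  have : IsDominant (Spec.map (CommRingCat.ofHom C.θ) ≫ C.map) := by
    rw [θ_map]
    infer_instance
  exact isOpenImmersion_of_isDominant C.coords_c C.map C.map_q C.θ D.jointlyMono C.closure_coords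

instance : IsOpenImmersion C.map := C.isOpenImmersion_and.choose

lemma opensRange_map : C.map.opensRange = chartOpen D.q C.c := C.isOpenImmersion_and.choose_spec

lemma mem_range_map {x : D.X} : x ∈ Set.range C.map ↔ ∀ k, D.q k x ∈ PP.dPlus (C.c k) := by
  rw [← mem_chartOpen, ← opensRange_map]
  rfl

/-- A point at which all coordinates of a chart are regular lies in the chart. -/
lemma mem_range_map_of_regAt {x : D.X} (h : ∀ l, RegAt x (C.E l)) : x ∈ Set.range C.map := by
  have hm : ∀ m, (∀ l, 0 ≤ C.ρ l ⬝ᵥ m) → RegAt x m := by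
    intro m hm
    have h1 : ∀ (l : Fin n) (N : ℕ), RegAt x (N • C.E l) := by
      intro l N
      induction N with
      | zero => exact (regAt_zero x).congr (by simp)
      | succ N ih => exact (ih.add (h l)).congr (by rw [succ_nsmul])
    have h2 : ∀ s : Finset (Fin n), RegAt x (∑ l ∈ s, (C.ρ l ⬝ᵥ m) • C.E l) := by
      intro s
      induction s using Finset.induction_on with
      | empty => exact (regAt_zero x).congr (by simp)
      | insert a s ha ih =>
        refine ((h1 a (C.ρ a ⬝ᵥ m).toNat).add ih).congr ?_
        rw [Finset.sum_insert ha, ← natCast_zsmul, Int.toNat_of_nonneg (hm a)]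
    exact (h2 Finset.univ).congr (C.sum_smul m)
  rw [mem_range_map]
  intro k
  exact mem_dPlus_of_regAt fun i ↦ hm _ fun l ↦ C.pos l k i

/-- The torus is the open subset of the chart on which all coordinates are invertible. -/
lemma isLocalization : let := C.θ.toAlgebra
    IsLocalization.Away (∏ l, MvPolynomial.X l : AR n) (TR n) := by
  let := C.θ.toAlgebra
  have hprod : C.θ (∏ l, MvPolynomial.X l) = mono (∑ l, C.E l) := by
    rw [map_prod, mono_sum]
    exact Finset.prod_congr rfl fun l _ ↦ C.θ_X l
  refine ⟨?_, ?_, ?_⟩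
  · rintro ⟨_, N, rfl⟩
    change IsUnit (C.θ (_ ^ N))
    rw [map_pow, hprod]
    exact (isUnit_mono _).pow _
  · intro f
    suffices h : ∃ (N : ℕ) (p : AR n), f * mono (∑ l, C.E l) ^ N = C.θ p by
      obtain ⟨N, p, h⟩ := h
      refine ⟨⟨p, ⟨_, N, rfl⟩⟩, ?_⟩
      change f * C.θ (_ ^ N) = C.θ p
      rw [map_pow, hprod, h]
    have hone : ∀ m : Fin n → ℤ, ∃ (N : ℕ) (p : AR n), mono m * mono (∑ l, C.E l) ^ N = C.θ p := by
      intro m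
      obtain ⟨N, hN⟩ : ∃ N : ℕ, ∀ l, 0 ≤ C.ρ l ⬝ᵥ (m + N • ∑ j, C.E j) := by
        refine ⟨∑ l, (C.ρ l ⬝ᵥ m).natAbs, fun l ↦ ?_⟩
        rw [dotProduct_add, dotProduct_smul, dotProduct_sum]
        simp only [C.dual, Finset.sum_ite_eq, Finset.mem_univ, if_true]
        have h1 : (C.ρ l ⬝ᵥ m).natAbs ≤ ∑ l, (C.ρ l ⬝ᵥ m).natAbs :=
          Finset.single_le_sum (f := fun l ↦ (C.ρ l ⬝ᵥ m).natAbs) (fun _ _ ↦ Nat.zero_le _)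
            (Finset.mem_univ l)
        rw [nsmul_eq_mul, mul_one]
        omega
      refine ⟨N, C.monomial (m + N • ∑ j, C.E j), ?_⟩
      rw [C.θ_monomial hN, mono_add, mono_nsmul]
    have hadd : ∀ f g : TR n, (∃ (N : ℕ) (p : AR n), f * mono (∑ l, C.E l) ^ N = C.θ p) →
        (∃ (N : ℕ) (p : AR n), g * mono (∑ l, C.E l) ^ N = C.θ p) →
        ∃ (N : ℕ) (p : AR n), (f + g) * mono (∑ l, C.E l) ^ N = C.θ p := by
      rintro f g ⟨N, p, h⟩ ⟨N', p', h'⟩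
      refine ⟨N + N', p * (∏ l, MvPolynomial.X l) ^ N' + p' * (∏ l, MvPolynomial.X l) ^ N, ?_⟩
      rw [map_add, map_mul, map_mul, map_pow, map_pow, hprod, ← h, ← h']
      ring
    induction f using AddMonoidAlgebra.induction_on with
    | of m => exact hone m
    | add f g hf hg => exact hadd f g hf hg
    | smul r f hf =>
      obtain ⟨N, p, h⟩ := hf
      refine ⟨N, MvPolynomial.C r * p, ?_⟩
      rw [map_mul, ← h, ← RingHom.comp_apply, θ_comp_C, Algebra.smul_def, mul_assoc]
  · intro p p' h
    exact ⟨1, by rw [C.θ_injective h]⟩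

instance : IsOpenImmersion (Spec.map (CommRingCat.ofHom C.θ)) := by
  let := C.θ.toAlgebra
  have := C.isLocalization
  exact IsOpenImmersion.of_isLocalization (∏ l, MvPolynomial.X l : AR n)

lemma isOpenImmersion_torus (C : D.Chart) : IsOpenImmersion D.torus := by
  rw [← C.θ_map]
  infer_instance

end Chart
end ToricData

/-! ### Blowups in affine charts -/

section PullIdeal

open Scheme.IdealSheafData

/-- The ideal of an ideal sheaf on a spectrum. -/
def idealOf {R : Type} [CommRing R] (J : (Spec (CommRingCat.of R)).IdealSheafData) : Ideal R :=
  (J.ideal ⟨⊤, isAffineOpen_top _⟩).comap (Scheme.ΓSpecIso (CommRingCat.of R)).inv.hom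

variable {R S : Type} [CommRing R] [CommRing S]

lemma comap_bijective_of_isIso {A B : CommRingCat.{0}} (e : A ⟶ B) [IsIso e] :
    Function.Bijective (Ideal.comap e.hom) := by
  have h : Function.Bijective e.hom := ConcreteCategory.bijective_of_isIso e
  refine ⟨Ideal.comap_injective_of_surjective _ h.2, fun K ↦ ⟨K.map e.hom, ?_⟩⟩
  exact Ideal.comap_map_of_bijective e.hom h

lemma idealOf_le_iff {J J' : (Spec (CommRingCat.of R)).IdealSheafData} :
    idealOf J ≤ idealOf J' ↔ J ≤ J' := by
  have h : Function.Bijective (Scheme.ΓSpecIso (CommRingCat.of R)).inv.hom :=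
    ConcreteCategory.bijective_of_isIso _
  refine Iff.trans ?_ ((equivOfIsAffine (X := Spec (CommRingCat.of R))).map_le_map_iff' (a := J) (b := J'))
  exact Ideal.comap_le_comap_iff_of_surjective _ h.2 _ _

lemma exists_idealOf_eq (K : Ideal R) : ∃ J, idealOf J = K := by
  obtain ⟨K', h⟩ := (comap_bijective_of_isIso (Scheme.ΓSpecIso (CommRingCat.of R)).inv).2 K
  obtain ⟨J, hJ⟩ := (equivOfIsAffine (X := Spec (CommRingCat.of R))).surjective K'
  refine ⟨J, ?_⟩
  rw [idealOf, ← h, ← hJ]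
  rfl

lemma idealOf_map (α : R →+* S) (J : (Spec (CommRingCat.of S)).IdealSheafData) :
    idealOf (J.map (Spec.map (CommRingCat.ofHom α))) = (idealOf J).comap α := by
  unfold idealOf
  rw [Scheme.IdealSheafData.ideal_map J _ _ (isAffineOpen_top _), Ideal.comap_comap,
    Ideal.comap_comap]
  congr 1
  exact congr_arg CommRingCat.Hom.hom (Scheme.ΓSpecIso_inv_naturality (CommRingCat.ofHom α)).symm

lemma idealOf_comap (α : R →+* S) (J : (Spec (CommRingCat.of R)).IdealSheafData) :
    idealOf (J.comap (Spec.map (CommRingCat.ofHom α))) = (idealOf J).map α := by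
  apply eq_of_forall_ge_iff
  intro K
  obtain ⟨K', rfl⟩ := exists_idealOf_eq K
  rw [Ideal.map_le_iff_le_comap, ← idealOf_map, idealOf_le_iff, idealOf_le_iff,
    le_map_iff_comap_le]

/-- The ideal generated by an ideal sheaf on `Y` in the ring `R`, for a morphism `Spec R ⟶ Y`. -/
def pullIdeal {Y : Scheme.{0}} (I : Y.IdealSheafData) (h : Spec (CommRingCat.of R) ⟶ Y) : Ideal R :=
  idealOf (I.comap h)

variable {X Y : Scheme.{0}}

lemma pullIdeal_map_comp (I : Y.IdealSheafData) (h : Spec (CommRingCat.of R) ⟶ Y) (α : R →+* S) :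
    pullIdeal I (Spec.map (CommRingCat.ofHom α) ≫ h) = (pullIdeal I h).map α := by
  unfold pullIdeal
  rw [Scheme.IdealSheafData.comap_comp, idealOf_comap]

lemma pullIdeal_comap (I : Y.IdealSheafData) (π : X ⟶ Y) (h : Spec (CommRingCat.of R) ⟶ X) :
    pullIdeal (I.comap π) h = pullIdeal I (h ≫ π) := by
  unfold pullIdeal
  rw [Scheme.IdealSheafData.comap_comp]

/-- The identification of `R` with the ring of sections over the image of `Spec R`. -/
def imageIso (h : Spec (CommRingCat.of R) ⟶ X) [IsOpenImmersion h] :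
    CommRingCat.of R ≅ Γ(X, h ''ᵁ ⊤) :=
  (Scheme.ΓSpecIso (CommRingCat.of R)).symm ≪≫ (h.appIso ⊤).symm

lemma pullIdeal_eq_comap (I : X.IdealSheafData) (h : Spec (CommRingCat.of R) ⟶ X)
    [IsOpenImmersion h] : pullIdeal I h =
      (I.ideal ⟨h ''ᵁ ⊤, (isAffineOpen_top _).image_of_isOpenImmersion h⟩).comap
        (imageIso h).hom.hom := by
  unfold pullIdeal idealOf
  rw [ideal_comap_of_isOpenImmersion, Ideal.comap_comap]
  rfl

lemma comap_span_singleton_of_isIso {A B : CommRingCat.{0}} (e : A ≅ B) (f : B) :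
    (Ideal.span {f}).comap e.hom.hom = Ideal.span {e.inv.hom f} := by
  have := Ideal.comap_symm (I := Ideal.span {f}) e.symm.commRingCatIsoToRingEquiv
  have h2 : (Ideal.span {f}).comap e.hom.hom = (Ideal.span {f}).map e.inv.hom := this
  rw [h2, Ideal.map_span, Set.image_singleton]

lemma mem_nonZeroDivisors_of_isIso {A B : CommRingCat.{0}} (e : A ≅ B) {f : A}
    (hf : f ∈ nonZeroDivisors A) : e.hom.hom f ∈ nonZeroDivisors B :=
  map_mem_nonZeroDivisors_of_injective hf
where
  map_mem_nonZeroDivisors_of_injective {f : A} (hf : f ∈ nonZeroDivisors A) :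
      e.hom.hom f ∈ nonZeroDivisors B := by
    rw [mem_nonZeroDivisors_iff_right] at hf ⊢
    intro b hb
    have h1 : e.inv.hom b * f = 0 := by
      have := congr_arg e.inv.hom hb
      rw [map_mul, map_zero] at this
      simpa using this
    have h2 := hf _ h1
    have := congr_arg e.hom.hom h2
    simpa using this

lemma isInvertible_iff (I : X.IdealSheafData) : IsInvertible I ↔
    ∀ x : X, ∃ (R : Type) (_ : CommRing R) (h : Spec (CommRingCat.of R) ⟶ X)
      (_ : IsOpenImmersion h), x ∈ Set.range h ∧
      ∃ f ∈ nonZeroDivisors R, pullIdeal I h = Ideal.span {f} := by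
  constructor
  · intro H x
    obtain ⟨U, hxU, f, hf, e⟩ := H x
    have key : ∀ U' : X.affineOpens, U' = U → ∃ f ∈ nonZeroDivisors Γ(X, U'.1),
        I.ideal U' = Ideal.span {f} := by
      rintro _ rfl
      exact ⟨f, hf, e⟩
    let h : Spec (CommRingCat.of Γ(X, U.1)) ⟶ X := U.2.fromSpec
    have : IsOpenImmersion h := U.2.isOpenImmersion_fromSpec
    have hr : Set.range h = U.1 := U.2.range_fromSpec
    obtain ⟨f, hf, e⟩ := key ⟨h ''ᵁ ⊤, (isAffineOpen_top _).image_of_isOpenImmersion h⟩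
      (Subtype.ext (TopologicalSpace.Opens.ext (by simpa using hr)))
    refine ⟨Γ(X, U.1), inferInstance, h, this, hr ▸ hxU, (imageIso h).inv.hom f,
      mem_nonZeroDivisors_of_isIso (imageIso h).symm hf, ?_⟩
    rw [pullIdeal_eq_comap, e, comap_span_singleton_of_isIso]
  · intro H x
    obtain ⟨R, _, h, _, hx, f, hf, e⟩ := H x
    refine ⟨⟨h ''ᵁ ⊤, (isAffineOpen_top _).image_of_isOpenImmersion h⟩, by simpa using hx,
      (imageIso h).hom.hom f, mem_nonZeroDivisors_of_isIso (imageIso h) hf, ?_⟩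
    rw [pullIdeal_eq_comap] at e
    have h2 : Ideal.span {f} = (Ideal.span {(imageIso h).hom.hom f}).comap (imageIso h).hom.hom := by
      rw [comap_span_singleton_of_isIso, ← CommRingCat.comp_apply, Iso.hom_inv_id,
        CommRingCat.id_apply]
    exact (comap_bijective_of_isIso (imageIso h).hom).1 (e.trans h2)

lemma comap_vanishingIdeal (h : X ⟶ Y) [IsOpenImmersion h] (Z : Closeds Y) :
    (vanishingIdeal Z).comap h = vanishingIdeal (Z.preimage h.continuous) := by
  have h1 : ((vanishingIdeal Z).comap h).support = Z.preimage h.continuous := by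
    rw [support_comap]
    congr 1
  rw [← h1, vanishingIdeal_support]
  apply le_antisymm (le_radical _)
  intro U
  change (((vanishingIdeal Z).comap h).ideal U).radical ≤ _
  rw [ideal_comap_of_isOpenImmersion, ← Ideal.comap_radical]
  apply Ideal.comap_mono
  exact (PrimeSpectrum.isRadical_vanishingIdeal _)

lemma pullIdeal_vanishingIdeal (h : Spec (CommRingCat.of R) ⟶ X) [IsOpenImmersion h]
    (Z : Closeds X) : pullIdeal (vanishingIdeal Z) h =
      PrimeSpectrum.vanishingIdeal (h ⁻¹' (Z : Set X) : Set (PrimeSpectrum R)) := by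
  apply eq_of_forall_le_iff
  intro K
  obtain ⟨K', rfl⟩ := exists_idealOf_eq K
  rw [pullIdeal, comap_vanishingIdeal, idealOf_le_iff, ← le_support_iff_le_vanishingIdeal,
    ← PrimeSpectrum.subset_zeroLocus_iff_le_vanishingIdeal]
  suffices h : ∀ p : PrimeSpectrum R, p ∈ K'.support ↔
      p ∈ PrimeSpectrum.zeroLocus (idealOf K' : Set R) from
    ⟨fun H p hp ↦ (h p).1 (H hp), fun H p hp ↦ (h p).2 (H hp)⟩
  intro p
  refine (mem_support_iff_of_mem (U := ⟨⊤, isAffineOpen_top _⟩) (show p ∈ ⊤ from trivial)).trans ?_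
  refine (Scheme.mem_zeroLocus_iff _ _ _).trans ?_
  rw [PrimeSpectrum.mem_zeroLocus]
  constructor
  · intro H f hf
    have h1 := H _ hf
    rw [basicOpen_eq_of_affine] at h1
    by_contra h2
    exact h1 h2
  · intro H f hf
    rw [basicOpen_eq_of_affine']
    intro h1
    have h2 : (Scheme.ΓSpecIso (CommRingCat.of R)).hom.hom f ∈ (idealOf K' : Set R) := by
      change (Scheme.ΓSpecIso (CommRingCat.of R)).inv.hom
        ((Scheme.ΓSpecIso (CommRingCat.of R)).hom.hom f) ∈ K'.ideal ⟨⊤, isAffineOpen_top _⟩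
      rw [← CommRingCat.comp_apply, Iso.hom_inv_id]
      exact hf
    exact h1 (H h2)

end PullIdeal

section Blowup

/-- Shrinking an affine open neighbourhood to a basic open subset. -/
lemma exists_localization_range_subset {R : Type} [CommRing R] {T : Scheme.{0}}
    (h : Spec (CommRingCat.of R) ⟶ T) (p : Spec (CommRingCat.of R)) (W : T.Opens)
    (hp : h p ∈ W) : ∃ (a : R),
      (∃ p', Spec.map (CommRingCat.ofHom (algebraMap R (Localization.Away a))) p' = p) ∧
      Set.range (Spec.map (CommRingCat.ofHom (algebraMap R (Localization.Away a))) ≫ h) ⊆ W := by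
  let U : TopologicalSpace.Opens (PrimeSpectrum R) := h ⁻¹ᵁ W
  obtain ⟨_, ⟨a, rfl⟩, h1, h2⟩ :=
    PrimeSpectrum.isTopologicalBasis_basic_opens.exists_subset_of_mem_open
      (show p ∈ (U : Set (PrimeSpectrum R)) from hp) U.isOpen
  have h3 := PrimeSpectrum.localization_away_comap_range (Localization.Away a) a
  refine ⟨a, h3.ge h1, ?_⟩
  rintro _ ⟨p', rfl⟩
  rw [Scheme.Hom.comp_apply]
  exact h2 (h3.le ⟨p', rfl⟩)

lemma algebraMap_localization_mem_nonZeroDivisors {R : Type} [CommRing R] (a : R) {f : R}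
    (hf : f ∈ nonZeroDivisors R) :
    algebraMap R (Localization.Away a) f ∈ nonZeroDivisors (Localization.Away a) :=
  IsLocalization.map_nonZeroDivisors_le (Submonoid.powers a) (Localization.Away a)
    (Submonoid.mem_map_of_mem _ hf)

/-- The pullback of an invertible ideal sheaf along an open immersion is invertible. -/
lemma IsInvertible.comap {T O : Scheme.{0}} {I : T.IdealSheafData} (hI : IsInvertible I)
    (o : O ⟶ T) [IsOpenImmersion o] : IsInvertible (I.comap o) := by
  rw [isInvertible_iff] at hI ⊢
  intro y
  obtain ⟨R, _, h, _, ⟨p, hp⟩, f, hf, e⟩ := hI (o y)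
  obtain ⟨a, ⟨p', hp'⟩, hr⟩ := exists_localization_range_subset h p o.opensRange (hp ▸ ⟨y, rfl⟩)
  have hr' : Set.range (Spec.map (CommRingCat.ofHom (algebraMap R (Localization.Away a))) ≫ h) ⊆
      Set.range o := hr
  let l := IsOpenImmersion.lift o _ hr'
  have hl : l ≫ o = _ := IsOpenImmersion.lift_fac o _ hr'
  have : IsOpenImmersion (l ≫ o) := by
    rw [hl]
    infer_instance
  have : IsOpenImmersion l := .of_comp l o
  refine ⟨Localization.Away a, inferInstance, l, this, ⟨p', ?_⟩, algebraMap _ _ f,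
    algebraMap_localization_mem_nonZeroDivisors a hf, ?_⟩
  · apply o.isOpenEmbedding.injective
    rw [← Scheme.Hom.comp_apply, hl, Scheme.Hom.comp_apply, hp', hp]
  · rw [pullIdeal_comap, hl, pullIdeal_map_comp, e, Ideal.map_span, Set.image_singleton]

section Criterion

variable {X Y : Scheme.{0}} {π : X ⟶ Y} {I : Y.IdealSheafData} {V : Type} {A : V → Type}
  [∀ v, CommRing (A v)] {c : ∀ v, Spec (CommRingCat.of (A v)) ⟶ Y} [∀ v, IsOpenImmersion (c v)]
  {σ : V → Type} {x : ∀ v, σ v → A v}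

/-- The function `x s` generates the ideal generated by all `x s'`, and it is not a zero divisor. -/
def IsGenerator {σ R : Type} [CommRing R] (x : σ → R) (s : σ) : Prop :=
  x s ∈ nonZeroDivisors R ∧ ∀ s', x s ∣ x s'

/-- If the inverse image ideal is invertible, then locally it is generated by one of the given
generators. -/
lemma exists_generator (hc : ∀ y, ∃ v, y ∈ Set.range (c v))
    (hI : ∀ v, pullIdeal I (c v) = Ideal.span (Set.range (x v))) {T : Scheme.{0}} (g : T ⟶ Y)
    (hg : IsInvertible (I.comap g)) (t : T) :
    ∃ (R : Type) (_ : CommRing R) (h : Spec (CommRingCat.of R) ⟶ T) (_ : IsOpenImmersion h)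
      (v : V) (α : A v →+* R) (s : σ v), t ∈ Set.range h ∧
      h ≫ g = Spec.map (CommRingCat.ofHom α) ≫ c v ∧ IsGenerator (fun s ↦ α (x v s)) s := by
  obtain ⟨R, _, h, _, ⟨p, hp⟩, f, hf, e⟩ := (isInvertible_iff _).1 hg t
  obtain ⟨v, hv⟩ := hc (g t)
  obtain ⟨a, ⟨p', hp'⟩, hr⟩ := exists_localization_range_subset h p (g ⁻¹ᵁ (c v).opensRange)
    (hp ▸ hv)
  let h1 := Spec.map (CommRingCat.ofHom (algebraMap R (Localization.Away a))) ≫ h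
  have hr' : Set.range (h1 ≫ g) ⊆ Set.range (c v) := by
    rintro _ ⟨z, rfl⟩
    rw [Scheme.Hom.comp_apply]
    exact hr ⟨z, rfl⟩
  let l := IsOpenImmersion.lift (c v) (h1 ≫ g) hr'
  have hl : l ≫ c v = h1 ≫ g := IsOpenImmersion.lift_fac _ _ hr'
  let α : A v →+* Localization.Away a := (Spec.preimage l).hom
  have hα : Spec.map (CommRingCat.ofHom α) = l := Spec.map_preimage l
  let f1 := algebraMap R (Localization.Away a) f
  have hf1 : f1 ∈ nonZeroDivisors (Localization.Away a) :=
    algebraMap_localization_mem_nonZeroDivisors a hf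
  have e1 : Ideal.span {f1} = Ideal.span (Set.range fun s ↦ α (x v s)) := by
    have h2 : pullIdeal (I.comap g) h1 = Ideal.span {f1} := by
      rw [pullIdeal_map_comp, e, Ideal.map_span, Set.image_singleton]
    rw [← h2, pullIdeal_comap, ← hl, ← hα, pullIdeal_map_comp, hI, Ideal.map_span, ← Set.range_comp]
    rfl
  have hd : ∀ s, ∃ d, α (x v s) = f1 * d := by
    intro s
    have : α (x v s) ∈ Ideal.span {f1} := e1 ▸ Ideal.subset_span ⟨s, rfl⟩
    exact Ideal.mem_span_singleton.1 this
  choose d hd using hd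
  -- if all quotients `d s` vanished at the point, then `f1` would lie in `p' * (f1)`, so `1 ∈ p'`
  obtain ⟨s, hs⟩ : ∃ s, d s ∉ p'.asIdeal := by
    by_contra! H
    have h2 : Ideal.span {f1} ≤ p'.asIdeal * Ideal.span {f1} := by
      rw [e1, Ideal.span_le, ← e1]
      rintro _ ⟨s, rfl⟩
      simp only [SetLike.mem_coe, hd]
      exact Ideal.mem_mul_span_singleton.2 ⟨d s, H s, mul_comm _ _⟩
    obtain ⟨z, hz, hz'⟩ := Ideal.mem_mul_span_singleton.1 (h2 (Ideal.mem_span_singleton_self f1))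
    have h3 : (1 - z) * f1 = 0 := by rw [sub_mul, hz']; ring
    have h4 := (mem_nonZeroDivisors_iff_right.1 hf1) _ h3
    apply p'.2.ne_top
    rw [Ideal.eq_top_iff_one, ← sub_add_cancel 1 z, h4, zero_add]
    exact hz
  -- where `d s` is invertible, the generator of index `s` generates the ideal
  let ψ := algebraMap (Localization.Away a) (Localization.Away (d s))
  have hu : IsUnit (ψ (d s)) := IsLocalization.Away.algebraMap_isUnit _
  have hp2 : ∃ p2, Spec.map (CommRingCat.ofHom ψ) p2 = p' := by
    have h3 := PrimeSpectrum.localization_away_comap_range (Localization.Away (d s)) (d s)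
    have h4 : p' ∈ (PrimeSpectrum.basicOpen (d s) : Set (PrimeSpectrum (Localization.Away a))) := hs
    rw [← h3] at h4
    exact h4
  obtain ⟨p2, hp2⟩ := hp2
  refine ⟨Localization.Away (d s), inferInstance, Spec.map (CommRingCat.ofHom ψ) ≫ h1,
    inferInstance, v, ψ.comp α, s, ⟨p2, ?_⟩, ?_, ?_, ?_⟩
  · simp only [h1, Scheme.Hom.comp_apply]
    rw [hp2, hp', hp]
  · have e2 : Spec.map (CommRingCat.ofHom (ψ.comp α)) =
        Spec.map (CommRingCat.ofHom ψ) ≫ Spec.map (CommRingCat.ofHom α) := by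
      rw [CommRingCat.ofHom_comp, Spec.map_comp]
    rw [e2, hα, Category.assoc]
    exact (Category.assoc _ _ _).trans (congr_arg _ hl.symm)
  · change ψ (α (x v s)) ∈ _
    rw [hd, map_mul]
    exact mul_mem (algebraMap_localization_mem_nonZeroDivisors _ hf1) hu.mem_nonZeroDivisors
  · intro s'
    change ψ (α (x v s)) ∣ ψ (α (x v s'))
    rw [hd, hd, map_mul, map_mul]
    exact mul_dvd_mul_left _ (hu.dvd)

/-- Two morphisms that agree on an open cover by spectra are equal. -/
lemma hom_ext_of_local {T Z : Scheme.{0}} {f g : T ⟶ Z}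
    (H : ∀ t, ∃ (R : Type) (_ : CommRing R) (h : Spec (CommRingCat.of R) ⟶ T)
      (_ : IsOpenImmersion h), t ∈ Set.range h ∧ h ≫ f = h ≫ g) : f = g := by
  choose R _ h _ hr e using H
  exact Scheme.Cover.hom_ext (Scheme.Cover.mkOfCovers T (fun t ↦ Spec (CommRingCat.of (R t))) h
    (fun t ↦ ⟨t, hr t⟩) : T.OpenCover) _ _ e

/-- A criterion for `π` to be a blowup, in terms of affine charts of the base on which the centre is
given by explicit equations: it suffices to check the universal property for morphisms from spectra
for which the centre becomes a principal divisor with one of the given equations. -/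
theorem isBlowup_of_charts (hinv : IsInvertible (I.comap π))
    (hc : ∀ y, ∃ v, y ∈ Set.range (c v))
    (hI : ∀ v, pullIdeal I (c v) = Ideal.span (Set.range (x v)))
    (hex : ∀ (v : V) (s : σ v) (R : Type) [CommRing R] (α : A v →+* R),
      IsGenerator (fun s ↦ α (x v s)) s →
        ∃ h : Spec (CommRingCat.of R) ⟶ X, h ≫ π = Spec.map (CommRingCat.ofHom α) ≫ c v)
    (huniq : ∀ (v : V) (s : σ v) (R : Type) [CommRing R] (α : A v →+* R),
      IsGenerator (fun s ↦ α (x v s)) s → ∀ h h' : Spec (CommRingCat.of R) ⟶ X,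
        h ≫ π = Spec.map (CommRingCat.ofHom α) ≫ c v →
        h' ≫ π = Spec.map (CommRingCat.ofHom α) ≫ c v → h = h') : IsBlowup π I := by
  have uniq : ∀ {T : Scheme.{0}} (g : T ⟶ Y), IsInvertible (I.comap g) → ∀ h h' : T ⟶ X,
      h ≫ π = g → h' ≫ π = g → h = h' := by
    intro T g hg h h' e e'
    apply hom_ext_of_local
    intro t
    obtain ⟨R, _, o, _, v, α, s, ht, hog, hs⟩ := exists_generator hc hI g hg t
    refine ⟨R, inferInstance, o, inferInstance, ht, ?_⟩
    exact huniq v s R α hs _ _ (by rw [Category.assoc, e, hog]) (by rw [Category.assoc, e', hog])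
  refine ⟨hinv, fun {T} g hg ↦ ?_⟩
  choose R _ o _ v α s ht hog hs using exists_generator hc hI g hg
  -- the local lifts agree on overlaps by uniqueness
  choose l hl using fun t ↦ hex (v t) (s t) (R t) (α t) (hs t)
  let 𝒰 : T.OpenCover := Scheme.Cover.mkOfCovers T (fun t ↦ Spec (CommRingCat.of (R t))) o
    (fun t ↦ ⟨t, ht t⟩)
  have hcompat : ∀ a b : T, pullback.fst (o a) (o b) ≫ l a = pullback.snd _ _ ≫ l b := by
    intro a b
    apply uniq (pullback.fst (o a) (o b) ≫ o a ≫ g)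
    · rw [← Category.assoc, Scheme.IdealSheafData.comap_comp]
      exact hg.comap _
    · rw [Category.assoc, hl, hog]
    · rw [Category.assoc, hl, ← hog, pullback.condition_assoc]
  have hglue : ∀ t, o t ≫ Scheme.Cover.glueMorphisms 𝒰 l hcompat = l t :=
    Scheme.Cover.ι_glueMorphisms 𝒰 l hcompat
  refine ⟨Scheme.Cover.glueMorphisms 𝒰 l hcompat, ?_, ?_⟩
  · apply Scheme.Cover.hom_ext 𝒰
    intro (t : T)
    change o t ≫ _ ≫ π = o t ≫ g
    rw [← Category.assoc, hglue t, hl, hog]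
  · intro h he
    refine uniq g hg _ _ he ?_
    apply Scheme.Cover.hom_ext 𝒰
    intro (t : T)
    change o t ≫ _ ≫ π = o t ≫ g
    rw [← Category.assoc, hglue t, hl, hog]

end Criterion
end Blowup

/-! ### Toric blowups -/

lemma specMap_comp {R S T : Type} [CommRing R] [CommRing S] [CommRing T] (g : S →+* T)
    (f : R →+* S) : Spec.map (CommRingCat.ofHom (g.comp f)) =
      Spec.map (CommRingCat.ofHom g) ≫ Spec.map (CommRingCat.ofHom f) := by
  rw [CommRingCat.ofHom_comp, Spec.map_comp]

lemma PP.exists_eq_pt {ι R : Type} [CommRing R] (f : Spec (CommRingCat.of R) ⟶ PP ι) (b : ι)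
    (h : ∀ t, f t ∈ dPlus b) : ∃ (γ : ℂ →+* R) (a : ι → R) (h : a b = 1),
      f = pt γ a b (h ▸ isUnit_one) := by
  obtain ⟨γ, a, ha, e⟩ := exists_eq_ptΓ f b h
  refine ⟨_, fun i ↦ evalHom (𝟙 _) (a i), (congr_arg _ ha).trans (map_one _),
    ((Category.id_comp f).symm.trans (congr_arg (𝟙 _ ≫ ·) e)).trans (spec_comp_ptΓ _ _ _ _ _)⟩

namespace ToricData

variable {n : ℕ} {D D' : ToricData n}

namespace Chart

variable (C : D.Chart)

/-- The weight is a nonnegative combination of the weights of the coordinates of the chart. -/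
def Nonneg (m : Fin n → ℤ) : Prop := ∀ l, 0 ≤ C.ρ l ⬝ᵥ m

instance (m : Fin n → ℤ) : Decidable (C.Nonneg m) :=
  inferInstanceAs (Decidable (∀ l, 0 ≤ C.ρ l ⬝ᵥ m))

variable {C}

lemma Nonneg.add {m m' : Fin n → ℤ} (h : C.Nonneg m) (h' : C.Nonneg m') : C.Nonneg (m + m') :=
  fun l ↦ by rw [dotProduct_add]; exact add_nonneg (h l) (h' l)

lemma nonneg_zero : C.Nonneg 0 := fun l ↦ by simp

lemma monomial_add {m m' : Fin n → ℤ} (h : C.Nonneg m) (h' : C.Nonneg m') :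
    C.monomial (m + m') = C.monomial m * C.monomial m' := by
  apply C.θ_injective
  rw [map_mul, C.θ_monomial h, C.θ_monomial h', C.θ_monomial (h.add h'), mono_add]

lemma monomial_ne_zero (m : Fin n → ℤ) : C.monomial m ≠ 0 :=
  Finset.prod_ne_zero_iff.2 fun _ _ ↦ pow_ne_zero _ (MvPolynomial.X_ne_zero _)

/-- The ring homomorphism between two charts, if all coordinates of `C` are monomials in those
of `W`. -/
def toChart (C : D.Chart) (W : D'.Chart) : AR n →+* AR n :=
  MvPolynomial.eval₂Hom MvPolynomial.C fun l ↦ W.monomial (C.E l)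

lemma θ_comp_toChart {W : D'.Chart} (h : ∀ l, W.Nonneg (C.E l)) :
    W.θ.comp (C.toChart W) = C.θ := by
  apply MvPolynomial.ringHom_ext
  · intro r
    simp [toChart, θ]
  · intro l
    simp only [toChart, RingHom.comp_apply, MvPolynomial.coe_eval₂Hom, MvPolynomial.eval₂_X]
    rw [W.θ_monomial (h l), θ_X]

lemma toChart_monomial {W : D'.Chart} (h : ∀ l, W.Nonneg (C.E l)) {m : Fin n → ℤ}
    (hm : C.Nonneg m) : C.toChart W (C.monomial m) = W.monomial m := by
  apply W.θ_injective
  rw [← RingHom.comp_apply, θ_comp_toChart h, C.θ_monomial hm, W.θ_monomial]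
  intro l
  rw [← C.sum_smul m, dotProduct_sum]
  refine Finset.sum_nonneg fun j _ ↦ ?_
  rw [dotProduct_smul]
  exact mul_nonneg (hm j) (h j l)

lemma map_comp_eq {π : D'.X ⟶ D.X} (hπ : D'.torus ≫ π = D.torus) (W : D'.Chart)
    (h : ∀ l, W.Nonneg (C.E l)) :
    W.map ≫ π = Spec.map (CommRingCat.ofHom (C.toChart W)) ≫ C.map := by
  apply ext_of_dominant (Spec.map (CommRingCat.ofHom W.θ))
  rw [reassoc_of% W.θ_map, hπ, ← Category.assoc, ← specMap_comp, θ_comp_toChart h, C.θ_map]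

end Chart

/-- On a morphism to the toric variety, the homogeneous coordinates are proportional to monomials
of suitable weights in the coordinates of a chart of the base. -/
lemma mul_eq_of_comp_q {π : D'.X ⟶ D.X} (hπ : D'.torus ≫ π = D.torus) (C : D.Chart) {k : D'.K}
    {w : Fin n → ℤ} (hw : ∀ i, C.Nonneg (D'.χ k i + w)) {R : Type} [CommRing R] {α : AR n →+* R}
    {h : Spec (CommRingCat.of R) ⟶ D'.X} (e : h ≫ π = Spec.map (CommRingCat.ofHom α) ≫ C.map)
    {γ : ℂ →+* R} {a : D'.ι k → R} {i : D'.ι k} {ha : IsUnit (a i)} (h1 : a i = 1)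
    (ea : h ≫ D'.q k = PP.pt γ a i ha) (j : D'.ι k) :
    α (C.monomial (D'.χ k j + w)) = a j * α (C.monomial (D'.χ k i + w)) := by
  let U : D'.X.Opens := (π ⁻¹ᵁ C.map.opensRange) ⊓ (D'.q k ⁻¹ᵁ PP.dPlus i)
  have hr : Set.range (U.ι ≫ π) ⊆ Set.range C.map := by
    rintro _ ⟨t, rfl⟩
    exact t.2.1
  let l := IsOpenImmersion.lift C.map (U.ι ≫ π) hr
  have hl : l ≫ C.map = U.ι ≫ π := IsOpenImmersion.lift_fac _ _ _
  obtain ⟨γ', b, hb, eb⟩ := PP.exists_eq_ptΓ (U.ι ≫ D'.q k) i fun t ↦ t.2.2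
  -- the relation holds on the open subset `U`, because it holds on the torus
  have key : specHom l (C.monomial (D'.χ k j + w)) =
      b j * specHom l (C.monomial (D'.χ k i + w)) := by
    let t := D'.torus ∣_ U
    let u := (D'.torus ⁻¹ᵁ U).ι
    have htu : t ≫ U.ι = u ≫ D'.torus := morphismRestrict_ι _ _
    have hd : IsSchemeTheoreticallyDominant t := .of_isDominant _
    have hinj : Function.Injective t.appTop.hom := t.app_injective ⊤
    have e1 : t ≫ l = u ≫ Spec.map (CommRingCat.ofHom C.θ) := by
      rw [← cancel_mono C.map, Category.assoc, hl, reassoc_of% htu, hπ, Category.assoc, C.θ_map]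
    have e2 : ∀ m, C.Nonneg m → t.appTop.hom (specHom l (C.monomial m)) = specHom u (mono m) := by
      intro m hm
      have := specHom_comp t l
      rw [e1, specHom_comp_map] at this
      rw [← RingHom.comp_apply, ← this, RingHom.comp_apply, C.θ_monomial hm]
    have e3 : t ≫ U.ι ≫ D'.q k = u ≫ D'.torusPt k := by
      rw [reassoc_of% htu, torus_q]
    rw [eb, PP.comp_ptΓ, comp_torusPt] at e3
    have e4 := PP.mul_eq_mul_of_ptΓ_eq e3 j i
    simp only [hb, map_one, one_mul] at e4
    apply hinj
    rw [map_mul, e2 _ (hw j), e2 _ (hw i), mono_add, mono_add, map_mul, map_mul, ← e4]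
    ring
  have hrU : Set.range h ⊆ Set.range U.ι := by
    rintro _ ⟨p, rfl⟩
    rw [Scheme.Opens.range_ι]
    constructor
    · change π (h p) ∈ C.map.opensRange
      rw [← Scheme.Hom.comp_apply, e]
      exact ⟨_, rfl⟩
    · change D'.q k (h p) ∈ PP.dPlus i
      rw [← Scheme.Hom.comp_apply, ea, PP.mem_dPlus_pt, h1]
      exact fun h2 ↦ p.2.ne_top ((Ideal.eq_top_iff_one _).2 h2)
  let hU := IsOpenImmersion.lift U.ι h hrU
  have ehU : hU ≫ U.ι = h := IsOpenImmersion.lift_fac _ _ _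
  have e5 : hU ≫ l = Spec.map (CommRingCat.ofHom α) := by
    rw [← cancel_mono C.map, Category.assoc, hl, reassoc_of% ehU, e]
  have e6 : hU ≫ U.ι ≫ D'.q k = PP.pt γ a i ha := by
    rw [reassoc_of% ehU, ea]
  rw [eb, PP.spec_comp_ptΓ] at e6
  have e7 := (PP.pt_inj (by rw [hb, map_one]) h1 e6).2
  have e8 : ∀ m, evalHom hU (specHom l m) = α m := by
    intro m
    have h2 : Spec.map (CommRingCat.ofHom ((evalHom hU).comp (specHom l))) =
        Spec.map (CommRingCat.ofHom α) := by
      rw [← spec_comp_toSpec, toSpec_specHom, e5]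
    exact RingHom.congr_fun (congr_arg CommRingCat.Hom.hom (Spec.map_injective h2)) m
  have := congr_arg (evalHom hU) key
  rw [map_mul, e8, e8] at this
  rw [this, ← congr_fun e7 j]

/-- A morphism to the toric variety is determined by the induced morphism to the base if the
homogeneous coordinates, expressed in a chart of the base, have a common divisor among them which
is not a zero divisor. -/
lemma comp_q_eq_pt {π : D'.X ⟶ D.X} (hπ : D'.torus ≫ π = D.torus) (C : D.Chart) {k : D'.K}
    {w : Fin n → ℤ} (hw : ∀ i, C.Nonneg (D'.χ k i + w)) {R : Type} [CommRing R] {α : AR n →+* R}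
    {h : Spec (CommRingCat.of R) ⟶ D'.X} (e : h ≫ π = Spec.map (CommRingCat.ofHom α) ≫ C.map)
    {i₀ : D'.ι k} (hnz : α (C.monomial (D'.χ k i₀ + w)) ∈ nonZeroDivisors R)
    {b : D'.ι k → R} (hb : ∀ i, α (C.monomial (D'.χ k i + w)) =
      α (C.monomial (D'.χ k i₀ + w)) * b i) (hb0 : b i₀ = 1) :
    h ≫ D'.q k = PP.pt (α.comp MvPolynomial.C) b i₀ (hb0 ▸ isUnit_one) := by
  apply hom_ext_of_local
  intro p
  obtain ⟨i, hi⟩ := PP.exists_mem_dPlus ((h ≫ D'.q k) p)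
  obtain ⟨a, ⟨p', hp'⟩, hr⟩ := exists_localization_range_subset (𝟙 _) p
    ((h ≫ D'.q k) ⁻¹ᵁ PP.dPlus i) hi
  rw [Category.comp_id] at hr
  have hnz' : algebraMap R _ (α (C.monomial (D'.χ k i₀ + w))) ∈
      nonZeroDivisors (Localization.Away a) := algebraMap_localization_mem_nonZeroDivisors a hnz
  have ho : IsOpenImmersion (Spec.map (CommRingCat.ofHom (algebraMap R (Localization.Away a)))) :=
    inferInstance
  generalize algebraMap R (Localization.Away a) = ψ at *
  refine ⟨Localization.Away a, inferInstance, Spec.map (CommRingCat.ofHom ψ), ho,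
    ⟨p', hp'⟩, ?_⟩
  let h' := Spec.map (CommRingCat.ofHom ψ) ≫ h
  obtain ⟨γ, c, hc, ec⟩ := PP.exists_eq_pt (h' ≫ D'.q k) i (by
    intro t
    have := hr ⟨t, rfl⟩
    simpa [h'] using this)
  have e' : h' ≫ π = Spec.map (CommRingCat.ofHom (ψ.comp α)) ≫ C.map := by
    rw [Category.assoc, e, specMap_comp, Category.assoc]
  have key := mul_eq_of_comp_q hπ C hw e' hc ec
  -- locally the homogeneous coordinate `c i` is `1`; cancel the common divisor
  have key2 : ∀ j, ψ (b j) = c j * ψ (b i) := by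
    intro j
    have h2 : (ψ (b j) - c j * ψ (b i)) * ψ (α (C.monomial (D'.χ k i₀ + w))) = 0 := by
      have h3 := key j
      rw [RingHom.comp_apply, RingHom.comp_apply, hb j, hb i, map_mul, map_mul] at h3
      linear_combination h3
    exact sub_eq_zero.1 ((mem_nonZeroDivisors_iff_right.1 hnz') _ h2)
  have hγ : γ = ψ.comp (α.comp MvPolynomial.C) := by
    have h2 : h' ≫ D'.q k ≫ PP.toSpecC _ = h' ≫ π ≫ D.toSpecC := by
      rw [D'.q_toSpecC]
      congr 1
      apply ext_of_isDominant D'.torus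
      rw [torus_toSpecC, reassoc_of% hπ, torus_toSpecC]
    rw [← Category.assoc, ec, PP.pt_toSpecC, reassoc_of% e', C.map_toSpecC, ← specMap_comp] at h2
    exact congr_arg CommRingCat.Hom.hom (Spec.map_injective h2)
  rw [← Category.assoc]
  refine ec.trans ?_
  rw [PP.map_pt, hγ]
  apply PP.pt_eq_pt
  intro j j'
  rw [key2 j, key2 j']
  ring

/-- A combinatorial criterion for a toric morphism to be a blowup. The centre is given on the chart
`C v` by the monomials of weights `w v s`, and `B v s` is the chart of the blowup on which the
generator of index `s` generates the inverse image. -/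
theorem isBlowup {π : D'.X ⟶ D.X} (hπ : D'.torus ≫ π = D.torus) {I : D.X.IdealSheafData}
    {V σ : Type} (C : V → D.Chart) (hC : ∀ y, ∃ v, y ∈ Set.range (C v).map)
    (w : V → σ → Fin n → ℤ) (hw : ∀ v s, (C v).Nonneg (w v s))
    (hI : ∀ v, pullIdeal I (C v).map = Ideal.span (Set.range fun s ↦ (C v).monomial (w v s)))
    (B : V → σ → D'.Chart) (hB : ∀ y, ∃ v s, y ∈ Set.range (B v s).map)
    (hCB : ∀ v s l, (B v s).Nonneg ((C v).E l))
    (hgen : ∀ v s s', (B v s).Nonneg (w v s' - w v s))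
    (hBC : ∀ v s l, (C v).Nonneg ((B v s).E l) ∨ ∃ s', (B v s).E l = w v s' - w v s)
    (hq : ∀ v s k, (∃ i₀, ∀ i, (C v).Nonneg (D'.χ k i - D'.χ k i₀)) ∨
      ∃ i₀, ∀ i, ∃ s', (C v).Nonneg (D'.χ k i - D'.χ k i₀ + w v s - w v s')) :
    IsBlowup π I := by
  refine isBlowup_of_charts (c := fun v ↦ (C v).map) (x := fun v s ↦ (C v).monomial (w v s))
    ?_ hC hI ?_ ?_
  -- on the chart `B v s` the inverse image ideal is generated by the monomial of weight `w v s`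
  · rw [isInvertible_iff]
    intro y
    obtain ⟨v, s, hy⟩ := hB y
    refine ⟨AR n, inferInstance, (B v s).map, inferInstance, hy, (B v s).monomial (w v s),
      mem_nonZeroDivisors_of_ne_zero (Chart.monomial_ne_zero _), ?_⟩
    rw [pullIdeal_comap, Chart.map_comp_eq hπ (B v s) (hCB v s), pullIdeal_map_comp, hI,
      Ideal.map_span, ← Set.range_comp]
    have h2 : ∀ s', (C v).toChart (B v s) ((C v).monomial (w v s')) = (B v s).monomial (w v s') :=
      fun s' ↦ Chart.toChart_monomial (hCB v s) (hw v s')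
    have h3 : (B v s).Nonneg (w v s) := by
      intro l
      rw [← (C v).sum_smul (w v s), dotProduct_sum]
      refine Finset.sum_nonneg fun j _ ↦ ?_
      rw [dotProduct_smul]
      exact mul_nonneg (hw v s j) (hCB v s j l)
    apply le_antisymm
    · rw [Ideal.span_le]
      rintro _ ⟨s', rfl⟩
      simp only [Function.comp_apply, h2, SetLike.mem_coe]
      have h4 : w v s' = w v s' - w v s + w v s := by abel
      rw [h4, Chart.monomial_add (hgen v s s') h3]
      exact Ideal.mul_mem_left _ _ (Ideal.mem_span_singleton_self _)
    · rw [Ideal.span_singleton_le_iff_mem]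
      exact Ideal.subset_span ⟨s, h2 s⟩
  -- the lift sends the coordinate of weight `(B v s).E l` to a quotient by the generator
  · intro v s R _ α hs
    choose d hd using hs.2
    have hβ : ∀ l, ∃ r : R, r * α ((C v).monomial (w v s)) =
        α ((C v).monomial ((B v s).E l + w v s)) := by
      intro l
      rcases hBC v s l with h | ⟨s', h⟩
      · refine ⟨α ((C v).monomial ((B v s).E l)), ?_⟩
        rw [Chart.monomial_add h (hw v s), map_mul]
      · refine ⟨d s', ?_⟩
        rw [h, sub_add_cancel, mul_comm]
        exact (hd s').symm
    choose r hr using hβ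
    have hnn : ∀ l, (C v).Nonneg ((B v s).E l + w v s) := by
      intro l
      rcases hBC v s l with h | ⟨s', h⟩
      · exact h.add (hw v s)
      · rw [h, sub_add_cancel]
        exact hw v s'
    let β : AR n →+* R := MvPolynomial.eval₂Hom (α.comp MvPolynomial.C) r
    have hβ : β.comp ((C v).toChart (B v s)) = α := by
      apply MvPolynomial.ringHom_ext
      · intro z
        simp [β, Chart.toChart]
      · intro l
        simp only [Chart.toChart, RingHom.comp_apply, MvPolynomial.coe_eval₂Hom,
          MvPolynomial.eval₂_X]
        -- both sides agree after multiplication with a power of the generator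
        have h1 : ∀ (N : Fin n → ℕ) (t : Finset (Fin n)), (C v).Nonneg
            (∑ j ∈ t, N j • ((B v s).E j + w v s)) ∧
            β (∏ j ∈ t, MvPolynomial.X j ^ N j) * α ((C v).monomial (w v s)) ^ (∑ j ∈ t, N j) =
            α ((C v).monomial (∑ j ∈ t, N j • ((B v s).E j + w v s))) := by
          intro N t
          induction t using Finset.induction_on with
          | empty => simp [Chart.nonneg_zero]
          | insert a t ha ih =>
            have h2 : ∀ N : ℕ, (C v).Nonneg (N • ((B v s).E a + w v s)) ∧
                r a ^ N * α ((C v).monomial (w v s)) ^ N =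
                  α ((C v).monomial (N • ((B v s).E a + w v s))) := by
              intro N
              induction N with
              | zero => simp [Chart.nonneg_zero]
              | succ N ih =>
                rw [succ_nsmul]
                refine ⟨ih.1.add (hnn a), ?_⟩
                rw [Chart.monomial_add ih.1 (hnn a), map_mul, ← ih.2, ← hr]
                ring
            rw [Finset.sum_insert ha, Finset.sum_insert ha, Finset.prod_insert ha]
            refine ⟨(h2 _).1.add ih.1, ?_⟩
            rw [Chart.monomial_add (h2 _).1 ih.1, map_mul, map_mul, ← ih.2, ← (h2 _).2, map_pow]
            have : β (MvPolynomial.X a) = r a := by simp [β]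
            rw [this]
            ring
        have h3 := h1 (fun j ↦ ((B v s).ρ j ⬝ᵥ (C v).E l).toNat) Finset.univ
        have hN : ∑ j, ((B v s).ρ j ⬝ᵥ (C v).E l).toNat • ((B v s).E j + w v s) =
            (C v).E l + (∑ j, ((B v s).ρ j ⬝ᵥ (C v).E l).toNat) • w v s := by
          simp only [smul_add, Finset.sum_add_distrib, Finset.sum_smul]
          congr 1
          conv_rhs => rw [← (B v s).sum_smul ((C v).E l)]
          refine Finset.sum_congr rfl fun j _ ↦ ?_
          rw [← natCast_zsmul, Int.toNat_of_nonneg (hCB v s l j)]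
        have h4 : ∀ N : ℕ, (C v).Nonneg (N • w v s) ∧
            α ((C v).monomial (N • w v s)) = α ((C v).monomial (w v s)) ^ N := by
          intro N
          induction N with
          | zero => simp [Chart.nonneg_zero]
          | succ N ih =>
            rw [succ_nsmul]
            refine ⟨ih.1.add (hw v s), ?_⟩
            rw [Chart.monomial_add ih.1 (hw v s), map_mul, ih.2, pow_succ]
        have h5 : (C v).Nonneg ((C v).E l) := fun j ↦ by
          rw [(C v).dual]
          split_ifs <;> simp
        rw [hN, Chart.monomial_add h5 (h4 _).1, map_mul, (h4 _).2, Chart.monomial_E] at h3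
        have h6 := pow_mem hs.1 (∑ j, ((B v s).ρ j ⬝ᵥ (C v).E l).toNat)
        exact (mul_cancel_right_mem_nonZeroDivisors h6).1 h3.2
    refine ⟨Spec.map (CommRingCat.ofHom β) ≫ (B v s).map, ?_⟩
    rw [Category.assoc, Chart.map_comp_eq hπ _ (hCB v s), ← Category.assoc, ← specMap_comp, hβ]
  -- a lift is unique because its homogeneous coordinates are determined
  · intro v s R _ α hs h h' e e'
    apply D'.jointlyMono
    intro k
    obtain ⟨i₀, w', hw', hnz, b, hb, hb0⟩ : ∃ (i₀ : D'.ι k) (w' : Fin n → ℤ)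
        (_ : ∀ i, (C v).Nonneg (D'.χ k i + w'))
        (_ : α ((C v).monomial (D'.χ k i₀ + w')) ∈ nonZeroDivisors R) (b : D'.ι k → R)
        (_ : ∀ i, α ((C v).monomial (D'.χ k i + w')) =
          α ((C v).monomial (D'.χ k i₀ + w')) * b i), b i₀ = 1 := by
      rcases hq v s k with ⟨i₀, hi⟩ | ⟨i₀, hi⟩
      · refine ⟨i₀, - D'.χ k i₀, fun i ↦ sub_eq_add_neg (D'.χ k i) _ ▸ hi i, ?_,
          fun i ↦ α ((C v).monomial (D'.χ k i + -D'.χ k i₀)), ?_, ?_⟩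
        · rw [add_neg_cancel, Chart.monomial_zero, map_one]
          exact one_mem _
        · intro i
          rw [add_neg_cancel, Chart.monomial_zero, map_one, one_mul]
        · simp only [add_neg_cancel, Chart.monomial_zero, map_one]
      · have e1 : D'.χ k i₀ + (w v s - D'.χ k i₀) = w v s := by abel
        choose s' hs' using hi
        have e2 : ∀ i, D'.χ k i + (w v s - D'.χ k i₀) =
            (D'.χ k i - D'.χ k i₀ + w v s - w v (s' i)) + w v (s' i) := fun i ↦ by abel
        have h2 : ∀ i, α ((C v).monomial (w v s)) ∣
            α ((C v).monomial (D'.χ k i + (w v s - D'.χ k i₀))) := by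
          intro i
          rw [e2, Chart.monomial_add (hs' i) (hw v _), map_mul]
          exact (hs.2 (s' i)).mul_left _
        choose b hb using h2
        refine ⟨i₀, w v s - D'.χ k i₀, fun i ↦ ?_, ?_, b, fun i ↦ ?_, ?_⟩
        · rw [e2]
          exact (hs' i).add (hw v _)
        · rw [e1]
          exact hs.1
        · rw [e1]
          exact hb i
        · have := hb i₀
          rw [e1] at this
          have h3 : (b i₀ - 1) * α ((C v).monomial (w v s)) = 0 := by linear_combination - this
          exact sub_eq_zero.1 ((mem_nonZeroDivisors_iff_right.1 hs.1) _ h3)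
    rw [comp_q_eq_pt hπ (C v) hw' e hnz hb hb0, comp_q_eq_pt hπ (C v) hw' e' hnz hb hb0]

end ToricData

namespace ToricData

/-- A chart of a toric variety, where the duality of the bases is checked on one side only. -/
def Chart.mk' {n : ℕ} {D : ToricData n} (E ρ : Fin n → Fin n → ℤ) (c : ∀ k, D.ι k)
    (pos : ∀ l k i, 0 ≤ ρ l ⬝ᵥ (D.χ k i - D.χ k (c k)))
    (gen : ∀ l, ∃ k i, E l = D.χ k i - D.χ k (c k))
    (dual : ∀ l j, ρ l ⬝ᵥ E j = if l = j then 1 else 0) : D.Chart where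
  E := E
  ρ := ρ
  c := c
  pos := pos
  gen := gen
  span := by
    have h : Matrix.of ρ * (Matrix.of E).transpose = 1 := by
      ext l j
      rw [Matrix.mul_apply, Matrix.one_apply]
      exact dual l j
    have h2 := mul_eq_one_comm.1 h
    intro l i
    have h3 := congr_fun (congr_fun h2 i) l
    rw [Matrix.mul_apply, Matrix.one_apply] at h3
    simp only [eq_comm (a := l) (b := i), ← h3]
    exact Finset.sum_congr rfl fun j _ ↦ mul_comm _ _
  dual := dual

end ToricData

open ToricData

/-! ### The product of three projective lines -/

/-- The standard basis of the character lattice. -/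
abbrev stdE {n : ℕ} (i : Fin n) : Fin n → ℤ := Pi.single i 1

/-- The toric data of `(ℙ¹)³`. -/
abbrev cubeData : ToricData 3 where
  K := Fin 3
  ι _ := Fin 2
  χ k := ![stdE k, 0]
  base _ := 1

/-- The sign of the exponents of the coordinates at a torus fixed point. -/
def sgn (b : Fin 2) : ℤ := if b = 0 then 1 else -1

/-- The affine chart of `(ℙ¹)³` around the torus fixed point where the homogeneous coordinate of
index `v k` of the `k`-th factor vanishes. -/
def cubeChart (v : Fin 3 → Fin 2) : cubeData.Chart :=
  Chart.mk' (fun l ↦ sgn (v l) • stdE l) (fun l ↦ sgn (v l) • stdE l) (fun k ↦ (v k + 1 : Fin 2))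
    (by
      have : ∀ (v : Fin 3 → Fin 2) (l k : Fin 3) (i : Fin 2), 0 ≤ (sgn (v l) • stdE l) ⬝ᵥ
        ((![stdE k, 0] : Fin 2 → Fin 3 → ℤ) i - (![stdE k, 0] : Fin 2 → Fin 3 → ℤ) (v k + 1)) := by
        decide +kernel
      exact this v)
    (by
      have : ∀ (v : Fin 3 → Fin 2) (l : Fin 3), ∃ (k : Fin 3) (i : Fin 2), sgn (v l) • stdE l =
        (![stdE k, 0] : Fin 2 → Fin 3 → ℤ) i - (![stdE k, 0] : Fin 2 → Fin 3 → ℤ) (v k + 1) := by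
        decide +kernel
      exact this v)
    (by revert v; decide +kernel)

lemma exists_mem_range_cubeChart (x : cubeData.X) : ∃ v, x ∈ Set.range (cubeChart v).map := by
  have h : ∀ k : Fin 3, ∃ b : Fin 2, cubeData.q k x ∈ PP.dPlus b :=
    fun k ↦ PP.exists_mem_dPlus _
  choose b hb using h
  refine ⟨fun k ↦ b k - 1, (Chart.mem_range_map _).2 fun k ↦ ?_⟩
  have : (cubeChart fun k ↦ b k - 1).c k = b k := sub_add_cancel _ _
  rw [this]
  exact hb k

/-! ### The permutohedral variety -/

/-- The weights of the `n + 1` homogeneous coordinates of the torus. -/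
def hw {n : ℕ} : Fin (n + 1) → Fin n → ℤ := Fin.cons 0 stdE

/-- The toric data of the permutohedral variety: the homogeneous coordinates are the ratios
`t i : t j` of the `n + 1` coordinates of the torus. -/
abbrev permData (n : ℕ) : ToricData n where
  K := Fin (n + 1) × Fin (n + 1)
  ι _ := Fin 2
  χ k := ![hw k.1, hw k.2]
  base _ := 1

/-- The dual basis of the chart of the permutohedral variety. -/
def permRho {n : ℕ} (τ : Fin (n + 1) → Fin (n + 1)) (l k : Fin n) : ℤ :=
  (if τ k.succ ≤ l.castSucc then 1 else 0) - (if τ 0 ≤ l.castSucc then 1 else 0)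

lemma permRho_hw {n : ℕ} (τ : Fin (n + 1) → Fin (n + 1)) (l : Fin n) (i : Fin (n + 1)) :
    permRho τ l ⬝ᵥ hw i =
      (if τ i ≤ l.castSucc then 1 else 0) - (if τ 0 ≤ l.castSucc then 1 else 0) := by
  induction i using Fin.cases with
  | zero => simp [hw]
  | succ i => simp [hw, permRho]

/-- The chart of the permutohedral variety on which the ratios `t (σ l) / t (σ (l + 1))` are
coordinates. -/
def permChart {n : ℕ} (σ : Equiv.Perm (Fin (n + 1))) : (permData n).Chart :=
  Chart.mk' (fun l ↦ hw (σ l.castSucc) - hw (σ l.succ)) (permRho σ.symm)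
    (fun k ↦ (if σ.symm k.1 ≤ σ.symm k.2 then 1 else 0 : Fin 2))
    (by
      rintro l ⟨i, j⟩ (b : Fin 2)
      have key : ∀ a b : Fin (n + 1), permRho σ.symm l ⬝ᵥ (hw a - hw b) =
          (if σ.symm a ≤ l.castSucc then 1 else 0) - (if σ.symm b ≤ l.castSucc then 1 else 0) := by
        intro a b
        rw [dotProduct_sub, permRho_hw, permRho_hw]
        ring
      change 0 ≤ permRho σ.symm l ⬝ᵥ ((![hw i, hw j] : Fin 2 → Fin n → ℤ) b -
        (![hw i, hw j] : Fin 2 → Fin n → ℤ) (if σ.symm i ≤ σ.symm j then 1 else 0))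
      have hb : ∀ b : Fin 2, b = 0 ∨ b = 1 := by decide
      rcases hb b with rfl | rfl <;> split_ifs with h <;>
        simp only [Matrix.cons_val_zero, Matrix.cons_val_one, key] <;> split_ifs <;> omega)
    (by
      intro l
      refine ⟨(σ l.castSucc, σ l.succ), (0 : Fin 2), ?_⟩
      change hw _ - hw _ = (![hw (σ l.castSucc), hw (σ l.succ)] : Fin 2 → Fin n → ℤ) 0 -
        (![hw (σ l.castSucc), hw (σ l.succ)] : Fin 2 → Fin n → ℤ)
          (if σ.symm (σ l.castSucc) ≤ σ.symm (σ l.succ) then 1 else 0)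
      rw [if_pos (by simp [Fin.le_def])]
      rfl)
    (by
      intro l j
      rw [dotProduct_sub, permRho_hw, permRho_hw]
      simp only [Equiv.symm_apply_apply, Fin.le_def, Fin.ext_iff, Fin.val_succ, Fin.val_castSucc]
      split_ifs <;> omega)

/-- A total preorder on a finite ordinal is sorted by some permutation. -/
lemma exists_sorting {n : ℕ} (r : Fin (n + 1) → Fin (n + 1) → Prop)
    (htot : ∀ i j, r i j ∨ r j i) (htrans : ∀ i j k, r i j → r j k → r i k) :
    ∃ σ : Equiv.Perm (Fin (n + 1)), ∀ l : Fin n, r (σ l.castSucc) (σ l.succ) := by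
  classical
  let f : Fin (n + 1) → ℕ := fun i ↦ (Finset.univ.filter fun j ↦ r j i).card
  refine ⟨Tuple.sort f, fun l ↦ ?_⟩
  have h := Tuple.monotone_sort f (Fin.castSucc_le_succ l)
  by_contra hr
  have hr' := (htot _ _).resolve_left hr
  refine absurd h (not_le.2 (Finset.card_lt_card ?_))
  rw [Finset.ssubset_iff_of_subset]
  · exact ⟨_, by simpa using (htot _ _).elim id id, by simpa using hr⟩
  · intro j hj
    simp only [Finset.mem_filter, Finset.mem_univ, true_and] at hj ⊢
    exact htrans _ _ _ hj hr'

lemma regAt_or_regAt {n : ℕ} (x : (permData n).X) (i j : Fin (n + 1)) :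
    RegAt x (hw i - hw j) ∨ RegAt x (hw j - hw i) := by
  obtain ⟨b, hb⟩ : ∃ b : Fin 2, (permData n).q (i, j) x ∈ PP.dPlus b := PP.exists_mem_dPlus _
  have hb' : ∀ b : Fin 2, b = 0 ∨ b = 1 := by decide
  rcases hb' b with rfl | rfl
  · exact .inr (regAt_of_mem_dPlus hb (1 : Fin 2))
  · exact .inl (regAt_of_mem_dPlus hb (0 : Fin 2))

lemma exists_mem_range_permChart {n : ℕ} (x : (permData n).X) :
    ∃ σ, x ∈ Set.range (permChart σ).map := by
  obtain ⟨σ, hσ⟩ := exists_sorting (fun i j ↦ RegAt x (hw i - hw j)) (regAt_or_regAt x)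
    fun i j k h h' ↦ (h.add h').congr (by abel)
  exact ⟨σ, Chart.mem_range_map_of_regAt _ hσ⟩

/-! ### The blowup of two points -/

/-- The weights of the six homogeneous coordinates `x, y, z, yz, xz, xy`. -/
def monomialWeights : Fin 6 → Fin 3 → ℤ :=
  ![![1, 0, 0], ![0, 1, 0], ![0, 0, 1], ![0, 1, 1], ![1, 0, 1], ![1, 1, 0]]

/-- The toric data of the blowup of `(ℙ¹)³` at two antipodal points: in addition to the coordinates
of `(ℙ¹)³` there is a morphism to `ℙ⁵` given by monomials. -/
abbrev twoPointData : ToricData 3 where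
  K := Option (Fin 3)
  ι k := Option.elim k (Fin 6) fun _ ↦ Fin 2
  χ
    | none => monomialWeights
    | some k => ![stdE k, 0]
  base
    | none => (0 : Fin 6)
    | some _ => (1 : Fin 2)

/-- The index set of the charts of the blowup at two points. For two of the coordinates `t 1, t 2`,
`t 3` of the torus, say `t j` and `t k`, and the remaining one together with `t 0 = 1`, say `t c`
and `t d`, there are the chart with coordinates `t j / t c, t k / t c, t c / t d` and the one with
the inverse coordinates (`inv = 1`). Here `c = s + 1, d = 0` or conversely (`flip = 1`). -/
structure TPIndex where
  /-- Whether the coordinates are inverted. -/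
  inv : Fin 2
  /-- Whether the last two coordinates are interchanged. -/
  flip : Fin 2
  /-- The distinguished coordinate. -/
  s : Fin 3

/-- The weights of the coordinates of a chart. -/
def tpE (inv flip : Fin 2) (s l : Fin 3) : Fin 3 → ℤ :=
  sgn inv • if l = s then sgn flip • stdE s else stdE l - if flip = 0 then stdE s else 0

/-- The dual basis of the weights of a chart. -/
def tpRho (inv flip : Fin 2) (s l : Fin 3) : Fin 3 → ℤ :=
  sgn inv • if l = s then (if flip = 0 then 1 else - stdE s) else stdE l

/-- The homogeneous coordinate of `ℙ⁵` that does not vanish on a chart. -/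
def tpIndex (inv : Fin 2) (s : Fin 3) : Fin 6 :=
  if inv = 0 then ⟨s, by omega⟩ else ⟨s + 3, by omega⟩

/-- The homogeneous coordinate of a projective line that does not vanish on a chart. -/
def tpIndex' (inv flip : Fin 2) (s k : Fin 3) : Fin 2 :=
  if k = s then inv + flip + 1 else inv + 1

/-- The affine chart of the blowup at two points with the given index. -/
def tpChart (v : TPIndex) : twoPointData.Chart :=
  Chart.mk' (tpE v.inv v.flip v.s) (tpRho v.inv v.flip v.s)
    (fun
      | none => tpIndex v.inv v.s
      | some k => tpIndex' v.inv v.flip v.s k)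
    (by
      rintro l (_ | k) i
      · have : ∀ (inv flip : Fin 2) (s l : Fin 3) (i : Fin 6), 0 ≤ tpRho inv flip s l ⬝ᵥ
          (monomialWeights i - monomialWeights (tpIndex inv s)) := by decide +kernel
        exact this _ _ _ l i
      · have : ∀ (inv flip : Fin 2) (s l k : Fin 3) (i : Fin 2), 0 ≤ tpRho inv flip s l ⬝ᵥ
          ((![stdE k, 0] : Fin 2 → Fin 3 → ℤ) i -
            (![stdE k, 0] : Fin 2 → Fin 3 → ℤ) (tpIndex' inv flip s k)) := by decide +kernel
        exact this _ _ _ l k i)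
    (by
      intro l
      have : ∀ (inv flip : Fin 2) (s l : Fin 3), (∃ i : Fin 6, tpE inv flip s l =
          monomialWeights i - monomialWeights (tpIndex inv s)) ∨
          ∃ (k : Fin 3) (i : Fin 2), tpE inv flip s l = (![stdE k, 0] : Fin 2 → Fin 3 → ℤ) i -
            (![stdE k, 0] : Fin 2 → Fin 3 → ℤ) (tpIndex' inv flip s k) := by decide +kernel
      rcases this v.inv v.flip v.s l with ⟨i, h⟩ | ⟨k, i, h⟩
      · exact ⟨none, i, h⟩
      · exact ⟨some k, i, h⟩)
    (by
      have : ∀ (inv flip : Fin 2) (s l j : Fin 3), tpRho inv flip s l ⬝ᵥ tpE inv flip s j =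
        if l = j then 1 else 0 := by decide +kernel
      exact this _ _ _)

lemma exists_mem_range_tpChart (x : twoPointData.X) : ∃ v, x ∈ Set.range (tpChart v).map := by
  obtain ⟨S, hS⟩ : ∃ S : Fin 6, twoPointData.q none x ∈ PP.dPlus S := PP.exists_mem_dPlus _
  have hex : ∀ k : Fin 3, ∃ b : Fin 2, twoPointData.q (some k) x ∈ PP.dPlus b :=
    fun k ↦ PP.exists_mem_dPlus _
  choose b hb using hex
  have h1 : ∀ i, RegAt x (monomialWeights i - monomialWeights S) := regAt_of_mem_dPlus hS
  have h2 : ∀ (k : Fin 3) (i : Fin 2), RegAt x ((![stdE k, 0] : Fin 2 → Fin 3 → ℤ) i -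
      (![stdE k, 0] : Fin 2 → Fin 3 → ℤ) (b k)) := fun k ↦ regAt_of_mem_dPlus (hb k)
  have key : ∀ (S : Fin 6) (b : Fin 3 → Fin 2), ∃ inv flip : Fin 2, ∃ s : Fin 3, ∀ l,
      (∃ i, tpE inv flip s l = monomialWeights i - monomialWeights S) ∨
      ∃ (k : Fin 3) (i : Fin 2), tpE inv flip s l = (![stdE k, 0] : Fin 2 → Fin 3 → ℤ) i -
        (![stdE k, 0] : Fin 2 → Fin 3 → ℤ) (b k) := by decide +kernel
  obtain ⟨inv, flip, s, h⟩ := key S b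
  refine ⟨⟨inv, flip, s⟩, Chart.mem_range_map_of_regAt _ fun l ↦ ?_⟩
  change RegAt x (tpE inv flip s l)
  rcases h l with ⟨i, hi⟩ | ⟨k, i, hi⟩
  · exact (h1 i).congr hi.symm
  · exact (h2 k i).congr hi.symm


/-! ### The product of three projective lines as a toric variety -/

open ToricData

namespace P1Cube

/-- The projections of `(ℙ¹)³` to the three projective lines. -/
def pr (k : Fin 3) : P1Cube ⟶ PP (Fin 2) := P1Cube.proj k

lemma lift_pr {T : Scheme.{0}} (p : Fin 3 → (T ⟶ P1))
    (h : ∀ i, p i ≫ P1.toSpecC = p 0 ≫ P1.toSpecC) (k : Fin 3) : P1Cube.lift p h ≫ pr k = p k := by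
  unfold pr P1Cube.lift P1Cube.proj
  fin_cases k
  · exact (pullback.lift_fst_assoc _ _ _ _).trans (pullback.lift_fst _ _ _)
  · exact (pullback.lift_fst_assoc _ _ _ _).trans (pullback.lift_snd _ _ _)
  · exact pullback.lift_snd _ _ _

lemma jointlyMono_pr : JointlyMono pr := by
  intro T f g h
  have h0 := h 0
  have h1 := h 1
  have h2 := h 2
  unfold P1Cube
  apply pullback.hom_ext
  · apply pullback.hom_ext
    · exact (Category.assoc _ _ _).trans (h0.trans (Category.assoc _ _ _).symm)
    · exact (Category.assoc _ _ _).trans (h1.trans (Category.assoc _ _ _).symm)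
  · exact h2

lemma P1_toSpecC_eq : P1.toSpecC = PP.toSpecC (Fin 2) := rfl

lemma pr_toSpecC (k : Fin 3) : pr k ≫ PP.toSpecC (Fin 2) = P1Cube.toSpecC := by
  rw [← P1_toSpecC_eq]
  fin_cases k
  · rfl
  · change (pullback.fst _ _ ≫ pullback.snd _ _) ≫ _ = (pullback.fst _ _ ≫ pullback.fst _ _) ≫ _
    rw [Category.assoc, Category.assoc]
    exact congr_arg (pullback.fst _ _ ≫ ·) pullback.condition.symm
  · change pullback.snd _ _ ≫ _ = (pullback.fst _ _ ≫ pullback.fst _ _) ≫ _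
    rw [Category.assoc]
    exact pullback.condition.symm

lemma exists_lift_pr {T : Scheme.{0}} (p : Fin 3 → (T ⟶ PP (Fin 2)))
    (h : ∀ i, p i ≫ PP.toSpecC _ = p 0 ≫ PP.toSpecC _) : ∃ s : T ⟶ P1Cube, ∀ k, s ≫ pr k = p k :=
  ⟨P1Cube.lift p h, P1Cube.lift_pr p h⟩

lemma point_pr {R : Type} [CommRing R] [Algebra ℂ R] (a : Fin 3 → Fin 2 → R) (b : Fin 2)
    (h : ∀ i, IsUnit (a i b)) (k : Fin 3) :
    P1Cube.point a b h ≫ pr k = PP.pt (algebraMap ℂ R) (a k) b (h k) :=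
  lift_pr _ _ k

end P1Cube

lemma cubeChart_coords (v : Fin 3 → Fin 2) (k : Fin 3) (i : Fin 2) :
    (cubeChart v).coords k i = if i = v k then MvPolynomial.X k else 1 := by
  unfold Chart.coords
  have h : ∀ a i : Fin 2, (i = a ∧ ∀ k : Fin 3, (![stdE k, 0] : Fin 2 → Fin 3 → ℤ) i -
    (![stdE k, 0] : Fin 2 → Fin 3 → ℤ) (a + 1) = sgn a • stdE k) ∨ (i = a + 1 ∧ i ≠ a) := by decide
  rcases h (v k) i with ⟨h1, h2⟩ | ⟨h1, h2⟩
  · rw [if_pos h1]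
    refine Eq.trans ?_ ((cubeChart v).monomial_E k)
    exact congr_arg _ (h2 k)
  · rw [if_neg h2, h1]
    exact (congr_arg _ (sub_self _)).trans (Chart.monomial_zero _)

lemma exists_cubeSection (v : Fin 3 → Fin 2) : ∃ s : Spec (CommRingCat.of (AR 3)) ⟶ P1Cube,
    (∀ k, s ≫ P1Cube.pr k = (cubeChart v).coordPt k) ∧ ∃ _ : IsOpenImmersion s,
      s.opensRange = chartOpen P1Cube.pr fun k ↦ v k + 1 := by
  obtain ⟨s, hs⟩ := P1Cube.exists_lift_pr (fun k ↦ (cubeChart v).coordPt k) fun k ↦ by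
    unfold Chart.coordPt
    rw [PP.pt_toSpecC, PP.pt_toSpecC]
  refine ⟨s, hs, ?_⟩
  let U := chartOpen P1Cube.pr fun k ↦ v k + 1
  have hf : ∀ k, ∃ (γ' : ℂ →+* Γ(U.toScheme, ⊤)) (a' : Fin 2 → Γ(U.toScheme, ⊤))
      (h : a' (v k + 1) = 1),
      U.ι ≫ P1Cube.pr k = PP.ptΓ γ' a' (v k + 1) (h ▸ isUnit_one) := by
    intro k
    apply PP.exists_eq_ptΓ
    intro t
    exact (mem_chartOpen P1Cube.pr _ _).1 t.2 k
  choose γ' a' h' hf using hf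
  have hγ : ∀ k, γ' k = γ' 0 := by
    intro k
    apply toSpec_injective
    rw [← PP.ptΓ_toSpecC _ _ _ (h' k ▸ isUnit_one), ← PP.ptΓ_toSpecC _ _ _ (h' 0 ▸ isUnit_one),
      ← hf, ← hf, Category.assoc, Category.assoc, P1Cube.pr_toSpecC, P1Cube.pr_toSpecC]
  let φ : AR 3 →+* Γ(U.toScheme, ⊤) := MvPolynomial.eval₂Hom (γ' 0) fun k ↦ a' k (v k)
  refine isOpenImmersion_of_section (K := Fin 3) (ι := fun _ ↦ Fin 2) (γ := MvPolynomial.C)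
    (a := fun k ↦ (cubeChart v).coords k) (c := fun k ↦ v k + 1)
    (fun k ↦ (cubeChart v).coords_c k) s hs P1Cube.jointlyMono_pr φ ?_ ?_
  · intro k
    refine (hf k).trans ?_
    unfold PP.ptΓ
    congr 3
    · rw [hγ k]
      ext z
      simp [φ]
    · funext i
      rw [cubeChart_coords]
      have h2 : ∀ a i : Fin 2, i = a ∨ (i = a + 1 ∧ i ≠ a) := by decide
      rcases h2 (v k) i with rfl | ⟨rfl, h3⟩
      · simp [φ]
      · rw [if_neg h3, map_one, h']
  · intro ψ h1 h2
    apply MvPolynomial.ringHom_ext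
    · exact fun r ↦ RingHom.congr_fun h1 r
    · intro l
      have := h2 l (v l)
      rw [cubeChart_coords, if_pos rfl] at this
      exact this

/-- The section of `(ℙ¹)³` around a torus fixed point. -/
def cubeSection (v : Fin 3 → Fin 2) : Spec (CommRingCat.of (AR 3)) ⟶ P1Cube :=
  (exists_cubeSection v).choose

lemma cubeSection_pr (v : Fin 3 → Fin 2) (k : Fin 3) :
    cubeSection v ≫ P1Cube.pr k = (cubeChart v).coordPt k :=
  (exists_cubeSection v).choose_spec.1 k

instance (v : Fin 3 → Fin 2) : IsOpenImmersion (cubeSection v) :=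
  (exists_cubeSection v).choose_spec.2.choose

lemma exists_mem_range_cubeSection (x : P1Cube) : ∃ v, x ∈ Set.range (cubeSection v) := by
  have h : ∀ k : Fin 3, ∃ b : Fin 2, P1Cube.pr k x ∈ PP.dPlus b :=
    fun k ↦ PP.exists_mem_dPlus _
  choose b hb using h
  refine ⟨fun k ↦ b k - 1, ?_⟩
  have h1 := (exists_cubeSection fun k ↦ b k - 1).choose_spec.2.choose_spec
  have h2 : x ∈ (cubeSection fun k ↦ b k - 1).opensRange := by
    refine h1 ▸ (mem_chartOpen _ _ _).2 fun k ↦ ?_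
    rw [sub_add_cancel]
    exact hb k
  exact h2

lemma exists_cubeHom : ∃ e : cubeData.X ⟶ P1Cube, ∀ k : Fin 3, e ≫ P1Cube.pr k = cubeData.q k :=
  P1Cube.exists_lift_pr (fun k ↦ cubeData.q k) fun k ↦
    (cubeData.q_toSpecC k).trans (cubeData.q_toSpecC (0 : Fin 3)).symm

instance : IsReduced P1Cube := by
  have (x : P1Cube) : _root_.IsReduced (P1Cube.presheaf.stalk x) := by
    obtain ⟨v, y, rfl⟩ := exists_mem_range_cubeSection x
    have e := (asIso ((cubeSection v).stalkMap y)).commRingCatIsoToRingEquiv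
    exact isReduced_of_injective e.toRingHom e.injective
  exact isReduced_of_isReduced_stalk _

lemma exists_cubeIso : ∃ e : cubeData.X ≅ P1Cube,
    ∀ k : Fin 3, e.hom ≫ P1Cube.pr k = cubeData.q k := by
  obtain ⟨e, he⟩ := exists_cubeHom
  have h1 : ∀ v, (cubeChart v).map ≫ e = cubeSection v := by
    intro v
    apply P1Cube.jointlyMono_pr
    intro k
    rw [Category.assoc, he, cubeSection_pr]
    exact (cubeChart v).map_q k
  have : Surjective e := by
    constructor
    intro x
    obtain ⟨v, y, rfl⟩ := exists_mem_range_cubeSection x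
    refine ⟨(cubeChart v).map y, ?_⟩
    rw [← h1]
    rfl
  obtain ⟨g, hg, -⟩ := exists_lift (D := cubeData) (T := P1Cube) (cubeData.torus ≫ e) (𝟙 _)
    P1Cube.pr fun k ↦ by
      rw [Category.assoc, he, torus_q]
      exact (Category.id_comp _).symm
  refine ⟨⟨e, g, ?_, ?_⟩, he⟩
  · apply cubeData.jointlyMono
    intro k
    rw [Category.assoc, hg, he]
    exact (Category.id_comp _).symm
  · apply P1Cube.jointlyMono_pr
    intro k
    rw [Category.assoc, he, hg]
    exact (Category.id_comp _).symm

/-- The toric variety of the data `cubeData` is `(ℙ¹)³`. -/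
def cubeIso : cubeData.X ≅ P1Cube := exists_cubeIso.choose

lemma cubeIso_pr (k : Fin 3) : cubeIso.hom ≫ P1Cube.pr k = cubeData.q k :=
  exists_cubeIso.choose_spec k

lemma torusInclusion_eq : torusInclusion = cubeData.torus ≫ cubeIso.hom := by
  apply P1Cube.jointlyMono_pr
  intro k
  rw [Category.assoc, cubeIso_pr, torus_q]
  refine (P1Cube.point_pr _ _ _ k).trans ?_
  refine PP.pt_congr rfl ?_
  funext i
  fin_cases i <;> rfl

lemma chart_eq (b : Fin 2) : P1Cube.chart b = (cubeChart fun _ ↦ b).map ≫ cubeIso.hom := by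
  apply P1Cube.jointlyMono_pr
  intro k
  rw [Category.assoc, cubeIso_pr]
  refine ((P1Cube.point_pr _ _ _ k).trans ?_).trans ((cubeChart fun _ ↦ b).map_q k).symm
  refine PP.pt_congr rfl ?_
  funext i
  rw [cubeChart_coords]


/-! ### Toric morphisms -/

open ToricData

lemma IsBlowup.comp_iso {X Y Y' : Scheme.{0}} {π : X ⟶ Y} (e : Y ≅ Y') {Z : Closeds Y'}
    (h : IsBlowup π (Scheme.IdealSheafData.vanishingIdeal (Z.preimage e.hom.continuous))) :
    IsBlowup (π ≫ e.hom) (Scheme.IdealSheafData.vanishingIdeal Z) := by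
  rw [← comap_vanishingIdeal] at h
  refine ⟨?_, ?_⟩
  · rw [Scheme.IdealSheafData.comap_comp]
    exact h.isInvertible
  · intro T g hg
    obtain ⟨l, hl, hu⟩ := h.existsUnique_lift (g ≫ e.inv) (by
      rwa [← Scheme.IdealSheafData.comap_comp, Category.assoc, e.inv_hom_id, Category.comp_id])
    refine ⟨l, ?_, fun l' hl' ↦ hu l' ?_⟩
    · change l ≫ π ≫ e.hom = g
      change l ≫ π = _ at hl
      rw [reassoc_of% hl, e.inv_hom_id, Category.comp_id]
    · change l' ≫ π = _
      rw [← hl']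
      simp

/-- A morphism to an open subscheme is dominant if the composition with the inclusion is. -/
lemma isDominant_of_comp_openImmersion {T U X : Scheme.{0}} (j : T ⟶ U) (i : U ⟶ X)
    [IsOpenImmersion i] [IsDominant (j ≫ i)] : IsDominant j := by
  constructor
  intro x
  rw [mem_closure_iff]
  intro V hV hx
  have h1 : IsOpen (i '' V) := i.isOpenEmbedding.isOpenMap V hV
  obtain ⟨_, ⟨y, hy, hyy⟩, ⟨t, rfl⟩⟩ := mem_closure_iff.1
    ((j ≫ i).denseRange (i x)) _ h1 ⟨x, hx, rfl⟩
  refine ⟨j t, ?_, ⟨t, rfl⟩⟩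
  rw [Scheme.Hom.comp_apply] at hyy
  rwa [← i.isOpenEmbedding.injective hyy]

namespace ToricData

variable {n : ℕ} {D D' : ToricData n}

/-- Morphisms on the charts that agree on the torus can be glued. -/
lemma exists_glue {m : ℕ} {E : ToricData m} {V : Type} (C : V → D'.Chart)
    (hC : ∀ y, ∃ v, y ∈ Set.range (C v).map) (f : V → (Spec (CommRingCat.of (AR n)) ⟶ E.X))
    (hf : ∀ a b, Spec.map (CommRingCat.ofHom (C a).θ) ≫ f a =
      Spec.map (CommRingCat.ofHom (C b).θ) ≫ f b) :
    ∃ F : D'.X ⟶ E.X, ∀ v, (C v).map ≫ F = f v := by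
  let 𝒰 : D'.X.OpenCover := Scheme.Cover.mkOfCovers V (fun _ ↦ Spec (CommRingCat.of (AR n)))
    (fun v ↦ (C v).map) hC
  have hcompat : ∀ a b, pullback.fst (C a).map (C b).map ≫ f a = pullback.snd _ _ ≫ f b := by
    intro a b
    have e : Spec.map (CommRingCat.ofHom (C a).θ) ≫ (C a).map =
        Spec.map (CommRingCat.ofHom (C b).θ) ≫ (C b).map := by
      rw [Chart.θ_map, Chart.θ_map]
    let j := pullback.lift _ _ e
    have hj : j ≫ pullback.fst (C a).map (C b).map = Spec.map (CommRingCat.ofHom (C a).θ) :=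
      pullback.lift_fst _ _ _
    have hj' : j ≫ pullback.snd (C a).map (C b).map = Spec.map (CommRingCat.ofHom (C b).θ) :=
      pullback.lift_snd _ _ _
    have : IsReduced (pullback (C a).map (C b).map) :=
      isReduced_of_isOpenImmersion (pullback.fst (C a).map (C b).map)
    have : IsDominant (j ≫ pullback.fst (C a).map (C b).map) := by
      rw [hj]
      infer_instance
    have : IsDominant j := isDominant_of_comp_openImmersion j (pullback.fst (C a).map (C b).map)
    apply ext_of_dominant j
    rw [reassoc_of% hj, reassoc_of% hj', hf]
  exact ⟨Scheme.Cover.glueMorphisms 𝒰 f hcompat, Scheme.Cover.ι_glueMorphisms 𝒰 f hcompat⟩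

/-- A toric morphism exists if every chart of the source is mapped to a chart of the target. -/
lemma exists_toricMorphism {V : Type} (C : V → D'.Chart) (hC : ∀ y, ∃ v, y ∈ Set.range (C v).map)
    (W : V → D.Chart) (h : ∀ v l, (C v).Nonneg ((W v).E l)) :
    ∃ π : D'.X ⟶ D.X, D'.torus ≫ π = D.torus := by
  let f : ∀ v, Spec (CommRingCat.of (AR n)) ⟶ D.X := fun v ↦
    Spec.map (CommRingCat.ofHom ((W v).toChart (C v))) ≫ (W v).map
  have hf : ∀ v, Spec.map (CommRingCat.ofHom (C v).θ) ≫ f v = D.torus := by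
    intro v
    rw [← Category.assoc, ← specMap_comp, Chart.θ_comp_toChart (h v), Chart.θ_map]
  obtain ⟨F, hF⟩ := exists_glue C hC f fun a b ↦ (hf a).trans (hf b).symm
  refine ⟨F, ?_⟩
  obtain ⟨v, -⟩ := hC (Classical.arbitrary _)
  rw [← (C v).θ_map, Category.assoc, hF, hf]

end ToricData

/-! ### The two blowdowns -/

lemma exists_firstBlowdown :
    ∃ π : twoPointData.X ⟶ cubeData.X, (∀ k : Fin 3, π ≫ cubeData.q k = twoPointData.q (some k)) ∧
      twoPointData.torus ≫ π = cubeData.torus := by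
  obtain ⟨π, h1, h2⟩ := exists_lift (D := cubeData) twoPointData.torus (𝟙 _)
    (fun k ↦ twoPointData.q (some k)) fun k ↦
      (twoPointData.torus_q (some k)).trans (Category.id_comp _).symm
  exact ⟨π, h1, h2.trans (Category.id_comp _)⟩

/-- The blowup of two points, as a toric morphism. -/
def firstBlowdown : twoPointData.X ⟶ cubeData.X := exists_firstBlowdown.choose

lemma firstBlowdown_q (k : Fin 3) :
    firstBlowdown ≫ cubeData.q k = twoPointData.q (some k) :=
  exists_firstBlowdown.choose_spec.1 k

lemma torus_firstBlowdown : twoPointData.torus ≫ firstBlowdown = cubeData.torus :=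
  exists_firstBlowdown.choose_spec.2

/-- The inverse of a permutation of four elements given by a list. -/
def posFun (a b c : Fin 4) (i : Fin 4) : Fin 4 :=
  if i = a then 0 else if i = b then 1 else if i = c then 2 else 3

/-- The coordinate other than `s` with number `a`. -/
def oth (s : Fin 3) (a : Fin 2) : Fin 3 := s + 1 + a.castSucc

/-- The order of the coordinates on a chart of the second blowup. -/
def ordFun (inv flip : Fin 2) (s : Fin 3) (a : Fin 2) : Fin 4 → Fin 4 :=
  let j := (oth s (a + 1)).succ
  let k := (oth s a).succ
  let c := if flip = 0 then s.succ else 0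
  let d := if flip = 0 then 0 else s.succ
  if inv = 0 then ![j, k, c, d] else ![d, c, k, j]

/-- The chart of the second blowup over a chart of the first blowup on which the equation of index
`a` generates the ideal of the centre. -/
def permOf (v : TPIndex) (a : Fin 2) : Equiv.Perm (Fin 4) where
  toFun := ordFun v.inv v.flip v.s a
  invFun := posFun (ordFun v.inv v.flip v.s a 0) (ordFun v.inv v.flip v.s a 1)
    (ordFun v.inv v.flip v.s a 2)
  left_inv := by
    have : ∀ inv flip s a, ∀ i, posFun (ordFun inv flip s a 0) (ordFun inv flip s a 1)
      (ordFun inv flip s a 2) (ordFun inv flip s a i) = i := by decide +kernel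
    exact this _ _ _ _
  right_inv := by
    have : ∀ inv flip s a, ∀ i, ordFun inv flip s a (posFun (ordFun inv flip s a 0)
      (ordFun inv flip s a 1) (ordFun inv flip s a 2) i) = i := by decide +kernel
    exact this _ _ _ _

lemma exists_permOf (σ : Equiv.Perm (Fin 4)) : ∃ v a, permOf v a = σ := by
  have : ∀ σ : Equiv.Perm (Fin 4), ∃ inv flip s a, permOf ⟨inv, flip, s⟩ a = σ := by decide +kernel
  obtain ⟨inv, flip, s, a, h⟩ := this σ
  exact ⟨_, a, h⟩

lemma nonneg_tpE (v : TPIndex) (a : Fin 2) (l : Fin 3) :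
    (permChart (permOf v a)).Nonneg ((tpChart v).E l) := by
  have : ∀ inv flip s a l, (permChart (permOf ⟨inv, flip, s⟩ a)).Nonneg
    ((tpChart ⟨inv, flip, s⟩).E l) := by decide +kernel
  exact this _ _ _ _ _

lemma exists_secondBlowdown :
    ∃ π : (permData 3).X ⟶ twoPointData.X, (permData 3).torus ≫ π = twoPointData.torus := by
  refine exists_toricMorphism (V := TPIndex × Fin 2) (fun v ↦ permChart (permOf v.1 v.2)) ?_
    (fun v ↦ tpChart v.1) fun v ↦ nonneg_tpE _ _
  intro y
  obtain ⟨σ, h⟩ := exists_mem_range_permChart y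
  obtain ⟨v, a, rfl⟩ := exists_permOf σ
  exact ⟨(v, a), h⟩

/-- The blowup of the proper transforms of the six lines, as a toric morphism. -/
def secondBlowdown : (permData 3).X ⟶ twoPointData.X := exists_secondBlowdown.choose

lemma torus_secondBlowdown : (permData 3).torus ≫ secondBlowdown = twoPointData.torus :=
  exists_secondBlowdown.choose_spec


/-! ### The blowup of two points -/

open ToricData

/-- An ideal generated by variables is prime. -/
lemma isPrime_span_X_image {n : ℕ} (s : Set (Fin n)) :
    (Ideal.span (MvPolynomial.X '' s) : Ideal (AR n)).IsPrime := by
  classical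
  let φ : AR n →+* AR n := MvPolynomial.eval₂Hom MvPolynomial.C
    fun i ↦ if i ∈ s then 0 else MvPolynomial.X i
  have h : Ideal.span (MvPolynomial.X '' s) = RingHom.ker φ := by
    apply le_antisymm
    · rw [Ideal.span_le]
      rintro _ ⟨i, hi, rfl⟩
      simp [φ, hi]
    · have key : ∀ f : AR n, f - φ f ∈ Ideal.span (MvPolynomial.X '' s) := by
        intro f
        induction f using MvPolynomial.induction_on with
        | C r => simp [φ]
        | add f g hf hg =>
          have := add_mem hf hg
          rw [map_add]
          convert this using 1
          ring
        | mul_X f i hf =>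
          have h1 : (MvPolynomial.X i : AR n) - φ (MvPolynomial.X i) ∈
              Ideal.span (MvPolynomial.X '' s) := by
            by_cases hi : i ∈ s
            · have h2 : (MvPolynomial.X i : AR n) ∈ Ideal.span (MvPolynomial.X '' s) :=
                Ideal.subset_span ⟨i, hi, rfl⟩
              simpa [φ, hi] using h2
            · simp [φ, hi]
          have := add_mem (Ideal.mul_mem_right (MvPolynomial.X i) _ hf)
            (Ideal.mul_mem_left _ (φ f) h1)
          rw [map_mul]
          convert this using 1
          ring
      intro f hf
      have := key f
      rwa [RingHom.mem_ker.1 hf, sub_zero] at this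
  rw [h]
  exact RingHom.ker_isPrime φ

/-- A set of primes that contain some variables, among them the ideal generated by these. -/
lemma vanishingIdeal_eq_span_X {n : ℕ} (A : Set (PrimeSpectrum (AR n))) (s : Set (Fin n))
    (h1 : ∀ p ∈ A, ∀ l ∈ s, MvPolynomial.X l ∈ p.asIdeal)
    (h2 : ⟨Ideal.span (MvPolynomial.X '' s), isPrime_span_X_image s⟩ ∈ A) :
    PrimeSpectrum.vanishingIdeal A = Ideal.span (MvPolynomial.X '' s) := by
  apply le_antisymm
  · intro f hf
    exact (PrimeSpectrum.mem_vanishingIdeal _ _).1 hf _ h2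
  · rw [Ideal.span_le]
    rintro _ ⟨l, hl, rfl⟩
    exact (PrimeSpectrum.mem_vanishingIdeal _ _).2 fun p hp ↦ h1 p hp l hl

lemma X_mem_span_X_image {n : ℕ} {s : Set (Fin n)} {l : Fin n} :
    (MvPolynomial.X l : AR n) ∈ Ideal.span (MvPolynomial.X '' s) ↔ l ∈ s := by
  rw [MvPolynomial.mem_ideal_span_X_image]
  simp [MvPolynomial.support_X, Finsupp.single_apply]

namespace ToricData.Chart

variable {n : ℕ} {D : ToricData n} (C : D.Chart)

lemma monomial_mem_iff (m : Fin n → ℤ) (p : PrimeSpectrum (AR n)) :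
    C.monomial m ∈ p.asIdeal ↔ ∃ l, 0 < C.ρ l ⬝ᵥ m ∧ MvPolynomial.X l ∈ p.asIdeal := by
  unfold monomial
  rw [p.2.prod_mem_iff]
  constructor
  · rintro ⟨l, -, h⟩
    have h0 : 0 < (C.ρ l ⬝ᵥ m).toNat := by
      by_contra h0
      rw [Nat.eq_zero_of_not_pos h0, pow_zero] at h
      exact p.2.ne_top ((Ideal.eq_top_iff_one _).2 h)
    exact ⟨l, by omega, p.2.mem_of_pow_mem _ h⟩
  · rintro ⟨l, h0, h⟩
    exact ⟨l, Finset.mem_univ l, Ideal.pow_mem_of_mem _ h _ (by omega)⟩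

lemma q_map_mem_dPlus (k : D.K) (i : D.ι k) (p : PrimeSpectrum (AR n)) :
    D.q k (C.map p) ∈ PP.dPlus i ↔
      ¬ ∃ l, 0 < C.ρ l ⬝ᵥ (D.χ k i - D.χ k (C.c k)) ∧ MvPolynomial.X l ∈ p.asIdeal := by
  rw [← C.monomial_mem_iff]
  change (C.map ≫ D.q k) p ∈ _ ↔ _
  rw [C.map_q]
  exact PP.mem_dPlus_pt _ _ _ _ _ _

end ToricData.Chart

lemma P1Cube.mem_fixedPoint {b : Fin 2} {x : P1Cube} :
    x ∈ fixedPoint b ↔ ∀ i, P1Cube.pr i x ∉ PP.dPlus b := by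
  unfold fixedPoint
  rw [← SetLike.mem_coe, Closeds.coe_iInf, Set.mem_iInter]
  rfl

lemma P1Cube.mem_invariantLine {b : Fin 2} {j : Fin 3} {x : P1Cube} :
    x ∈ invariantLine b j ↔ ∀ i, i ≠ j → P1Cube.pr i x ∉ PP.dPlus b := by
  unfold invariantLine
  rw [← SetLike.mem_coe, Closeds.coe_iInf, Set.mem_iInter]
  exact ⟨fun h i hi ↦ h ⟨i, hi⟩, fun h i ↦ h i.1 i.2⟩

lemma P1Cube.mem_twoPoints {x : P1Cube} : x ∈ twoPoints ↔ ∃ b, x ∈ fixedPoint b := by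
  unfold twoPoints
  rw [← SetLike.mem_coe, Closeds.coe_sup, Fin.exists_fin_two]
  rfl

/-- The generators of the ideal of the two points on a chart. -/
def twoPointWeights (v : Fin 3 → Fin 2) (s : Fin 3) : Fin 3 → ℤ :=
  if v 0 = v 1 ∧ v 0 = v 2 then sgn (v 0) • stdE s else 0

/-- The chart of the blowup at two points over the chart `v` of `(ℙ¹)³` on which the generator of
index `a` generates the ideal of the two points. -/
def tpIndexOf (v : Fin 3 → Fin 2) (a : Fin 3) : TPIndex :=
  if v 0 = v 1 ∧ v 0 = v 2 then ⟨v 0, 0, a⟩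
  else if v 1 = v 2 then ⟨v 1, 1, 0⟩ else if v 0 = v 2 then ⟨v 0, 1, 1⟩ else ⟨v 0, 1, 2⟩

lemma cubeIso_map_mem_fixedPoint (v : Fin 3 → Fin 2) (p : PrimeSpectrum (AR 3)) (b : Fin 2) :
    cubeIso.hom ((cubeChart v).map p) ∈ fixedPoint b ↔
      ∀ i : Fin 3, ∃ l, 0 < (cubeChart v).ρ l ⬝ᵥ ((![stdE i, 0] : Fin 2 → Fin 3 → ℤ) b -
        (![stdE i, 0] : Fin 2 → Fin 3 → ℤ) (v i + 1)) ∧ MvPolynomial.X l ∈ p.asIdeal := by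
  rw [P1Cube.mem_fixedPoint]
  refine forall_congr' fun i ↦ ?_
  rw [← Scheme.Hom.comp_apply, cubeIso_pr, (cubeChart v).q_map_mem_dPlus, not_not]
  rfl

lemma pullIdeal_twoPoints (v : Fin 3 → Fin 2) :
    pullIdeal (Scheme.IdealSheafData.vanishingIdeal
      (twoPoints.preimage cubeIso.hom.continuous)) (cubeChart v).map =
      Ideal.span (Set.range fun a ↦ (cubeChart v).monomial (twoPointWeights v a)) := by
  have key : ∀ p : PrimeSpectrum (AR 3), (cubeChart v).map p ∈
      twoPoints.preimage cubeIso.hom.continuous ↔ ∃ b, ∀ i : Fin 3, ∃ l,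
        0 < (sgn (v l) • stdE l) ⬝ᵥ ((![stdE i, 0] : Fin 2 → Fin 3 → ℤ) b -
        (![stdE i, 0] : Fin 2 → Fin 3 → ℤ) (v i + 1)) ∧ MvPolynomial.X l ∈ p.asIdeal := by
    intro p
    refine P1Cube.mem_twoPoints.trans ?_
    refine exists_congr fun b ↦ ?_
    rw [cubeIso_map_mem_fixedPoint]
    rfl
  rw [pullIdeal_vanishingIdeal]
  by_cases hv : v 0 = v 1 ∧ v 0 = v 2
  · have h0 : (Set.range fun a ↦ (cubeChart v).monomial (twoPointWeights v a)) =
        MvPolynomial.X '' Set.univ := by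
      rw [Set.image_univ]
      congr 1
      funext a
      rw [← (cubeChart v).monomial_E]
      congr 1
      have : ∀ v : Fin 3 → Fin 2, v 0 = v 1 ∧ v 0 = v 2 → ∀ a, v 0 = v a := by decide
      rw [twoPointWeights, if_pos hv, this v hv a]
      rfl
    rw [h0]
    apply vanishingIdeal_eq_span_X
    · intro p hp l _
      obtain ⟨b, hb⟩ := (key p).1 hp
      obtain ⟨l', h1, h2⟩ := hb l
      have : ∀ (v : Fin 3 → Fin 2) (b : Fin 2) (l l' : Fin 3), 0 < (sgn (v l') • stdE l') ⬝ᵥ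
        ((![stdE l, 0] : Fin 2 → Fin 3 → ℤ) b -
        (![stdE l, 0] : Fin 2 → Fin 3 → ℤ) (v l + 1)) → l' = l := by decide +kernel
      rwa [this v b l l' h1] at h2
    · refine (key _).2 ⟨v 0, fun i ↦ ⟨i, ?_, Ideal.subset_span ⟨i, trivial, rfl⟩⟩⟩
      have : ∀ v : Fin 3 → Fin 2, v 0 = v 1 ∧ v 0 = v 2 → ∀ i, 0 < (sgn (v i) • stdE i) ⬝ᵥ
        ((![stdE i, 0] : Fin 2 → Fin 3 → ℤ) (v 0) -
        (![stdE i, 0] : Fin 2 → Fin 3 → ℤ) (v i + 1)) := by decide +kernel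
      exact this v hv i
  · have h0 : (Set.range fun a ↦ (cubeChart v).monomial (twoPointWeights v a)) = {1} := by
      have : ∀ a, twoPointWeights v a = 0 := fun a ↦ if_neg hv
      simp [this]
    have h1 : ((cubeChart v).map ⁻¹' (twoPoints.preimage cubeIso.hom.continuous :
        Set cubeData.X) : Set (PrimeSpectrum (AR 3))) = ∅ := by
      rw [Set.eq_empty_iff_forall_notMem]
      intro p hp
      obtain ⟨b, hb⟩ := (key p).1 hp
      choose l hl _ using hb
      have : ∀ (v : Fin 3 → Fin 2) (b : Fin 2), (¬ (v 0 = v 1 ∧ v 0 = v 2)) → ¬ ∀ i, ∃ l,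
        0 < (sgn (v l) • stdE l) ⬝ᵥ ((![stdE i, 0] : Fin 2 → Fin 3 → ℤ) b -
        (![stdE i, 0] : Fin 2 → Fin 3 → ℤ) (v i + 1)) := by decide +kernel
      exact this v b hv fun i ↦ ⟨l i, hl i⟩
    rw [h0, h1, PrimeSpectrum.vanishingIdeal_empty, Ideal.span_singleton_one]

theorem isBlowup_firstBlowdown : IsBlowup (firstBlowdown ≫ cubeIso.hom)
    (Scheme.IdealSheafData.vanishingIdeal twoPoints) := by
  apply IsBlowup.comp_iso
  refine isBlowup torus_firstBlowdown (σ := Fin 3) cubeChart exists_mem_range_cubeChart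
    twoPointWeights ?_ pullIdeal_twoPoints (fun v a ↦ tpChart (tpIndexOf v a)) ?_ ?_ ?_ ?_ ?_
  · decide +kernel
  · intro y
    obtain ⟨⟨inv, flip, s⟩, h⟩ := exists_mem_range_tpChart y
    have : ∀ inv flip s, ∃ (v : Fin 3 → Fin 2) (a : Fin 3), (tpIndexOf v a).inv = inv ∧
      (tpIndexOf v a).flip = flip ∧ (tpIndexOf v a).s = s := by decide +kernel
    obtain ⟨v, a, rfl, rfl, rfl⟩ := this inv flip s
    exact ⟨v, a, h⟩
  · decide +kernel
  · decide +kernel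
  · have : ∀ (v : Fin 3 → Fin 2) (a l : Fin 3), (cubeChart v).Nonneg
      ((tpChart (tpIndexOf v a)).E l) ∨ ∃ a', (tpChart (tpIndexOf v a)).E l =
        twoPointWeights v a' - twoPointWeights v a := by decide +kernel
    exact this
  · rintro v a (_ | k)
    · right
      have : ∀ (v : Fin 3 → Fin 2) (a : Fin 3), ∃ i₀ : Fin 6, ∀ i, ∃ a', (cubeChart v).Nonneg
        (monomialWeights i - monomialWeights i₀ + twoPointWeights v a - twoPointWeights v a') := by
        decide +kernel
      exact this v a
    · left
      have : ∀ (v : Fin 3 → Fin 2) (k : Fin 3), ∃ i₀ : Fin 2, ∀ i, (cubeChart v).Nonneg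
        ((![stdE k, 0] : Fin 2 → Fin 3 → ℤ) i - (![stdE k, 0] : Fin 2 → Fin 3 → ℤ) i₀) := by
        decide +kernel
      exact this v k


/-! ### The blowup of the proper transforms of the six lines -/

open ToricData

/-- The blowup of `(ℙ¹)³` at two points. -/
def firstπ : twoPointData.X ⟶ P1Cube := firstBlowdown ≫ cubeIso.hom

lemma firstπ_pr (k : Fin 3) : firstπ ≫ P1Cube.pr k = twoPointData.q (some k) := by
  rw [firstπ, Category.assoc, cubeIso_pr, firstBlowdown_q]

lemma tpChart_pr_notMem (v : TPIndex) (p : PrimeSpectrum (AR 3)) (i : Fin 3) (b : Fin 2) :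
    P1Cube.pr i (firstπ ((tpChart v).map p)) ∉ PP.dPlus b ↔ ∃ l,
      0 < tpRho v.inv v.flip v.s l ⬝ᵥ ((![stdE i, 0] : Fin 2 → Fin 3 → ℤ) b -
        (![stdE i, 0] : Fin 2 → Fin 3 → ℤ) (tpIndex' v.inv v.flip v.s i)) ∧
        MvPolynomial.X l ∈ p.asIdeal := by
  rw [← Scheme.Hom.comp_apply, firstπ_pr]
  exact not_iff_comm.1 ((tpChart v).q_map_mem_dPlus (some i) b p).symm

/-- In a chart of the first blowup, the six lines without the two points are described by the set of
coordinates that vanish. -/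
def OnLine (inv flip : Fin 2) (s : Fin 3) (P : Fin 3 → Bool) : Prop :=
  (∃ (b : Fin 2) (j : Fin 3), ∀ i, i ≠ j → ∃ l, 0 < tpRho inv flip s l ⬝ᵥ
    ((![stdE i, 0] : Fin 2 → Fin 3 → ℤ) b -
      (![stdE i, 0] : Fin 2 → Fin 3 → ℤ) (tpIndex' inv flip s i)) ∧ P l = true) ∧
  ∀ b : Fin 2, ¬ ∀ i : Fin 3, ∃ l, 0 < tpRho inv flip s l ⬝ᵥ
    ((![stdE i, 0] : Fin 2 → Fin 3 → ℤ) b -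
      (![stdE i, 0] : Fin 2 → Fin 3 → ℤ) (tpIndex' inv flip s i)) ∧ P l = true

instance (inv flip : Fin 2) (s : Fin 3) (P : Fin 3 → Bool) : Decidable (OnLine inv flip s P) := by
  unfold OnLine
  infer_instance

open Classical in
lemma tpChart_mem_lines (v : TPIndex) (p : PrimeSpectrum (AR 3)) :
    firstπ ((tpChart v).map p) ∈ (⋃ b : Fin 2, ⋃ j : Fin 3, (invariantLine b j : Set P1Cube)) \
      twoPoints ↔ OnLine v.inv v.flip v.s fun l ↦ decide (MvPolynomial.X l ∈ p.asIdeal) := by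
  rw [Set.mem_sdiff, SetLike.mem_coe, P1Cube.mem_twoPoints]
  simp only [Set.mem_iUnion, SetLike.mem_coe, P1Cube.mem_invariantLine, P1Cube.mem_fixedPoint,
    tpChart_pr_notMem, not_exists, OnLine, decide_eq_true_eq]

lemma pullIdeal_lines (v : TPIndex) :
    pullIdeal (Scheme.IdealSheafData.vanishingIdeal (properTransformSixLines firstπ))
      (tpChart v).map = Ideal.span (Set.range fun a ↦ (tpChart v).monomial
        (tpE v.inv v.flip v.s (oth v.s a))) := by
  classical
  have h0 : (Set.range fun a ↦ (tpChart v).monomial (tpE v.inv v.flip v.s (oth v.s a))) =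
      MvPolynomial.X '' {l | l ≠ v.s} := by
    have h1 : Set.range (oth v.s) = {l | l ≠ v.s} := by
      have : ∀ s l, (∃ a, oth s a = l) ↔ l ≠ s := by decide
      ext l
      exact this v.s l
    rw [← h1, ← Set.range_comp]
    congr 1
    funext a
    exact (tpChart v).monomial_E _
  rw [pullIdeal_vanishingIdeal, h0]
  have h2 : (tpChart v).map ⁻¹' (properTransformSixLines firstπ : Set twoPointData.X) =
      closure ((tpChart v).map ⁻¹' (firstπ ⁻¹'
        ((⋃ b : Fin 2, ⋃ j : Fin 3, (invariantLine b j : Set P1Cube)) \ twoPoints))) :=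
    (tpChart v).map.isOpenEmbedding.isOpenMap.preimage_closure_eq_closure_preimage
      (tpChart v).map.continuous _
  refine (congr_arg PrimeSpectrum.vanishingIdeal h2).trans ?_
  refine (PrimeSpectrum.vanishingIdeal_closure _).trans ?_
  apply vanishingIdeal_eq_span_X
  · intro p hp l hl
    have h3 := (tpChart_mem_lines v p).1 hp
    have : ∀ inv flip s P, OnLine inv flip s P → ∀ l, l ≠ s → P l = true := by decide +kernel
    exact of_decide_eq_true (this _ _ _ _ h3 l hl)
  · refine (tpChart_mem_lines v _).2 ?_
    simp only [X_mem_span_X_image, Set.mem_ofPred_eq]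
    have : ∀ inv flip s, OnLine inv flip s fun l ↦ decide (l ≠ s) := by decide +kernel
    convert this v.inv v.flip v.s

theorem isBlowup_secondBlowdown : IsBlowup secondBlowdown
    (Scheme.IdealSheafData.vanishingIdeal (properTransformSixLines firstπ)) := by
  refine isBlowup torus_secondBlowdown (V := TPIndex) (σ := Fin 2) tpChart exists_mem_range_tpChart
    (fun v a ↦ tpE v.inv v.flip v.s (oth v.s a)) ?_ pullIdeal_lines
    (fun v a ↦ permChart (permOf v a)) ?_ nonneg_tpE ?_ ?_ ?_
  · rintro ⟨inv, flip, s⟩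
    revert inv flip s
    decide +kernel
  · intro y
    obtain ⟨σ, h⟩ := exists_mem_range_permChart y
    obtain ⟨v, a, rfl⟩ := exists_permOf σ
    exact ⟨v, a, h⟩
  · rintro ⟨inv, flip, s⟩
    revert inv flip s
    decide +kernel
  · rintro ⟨inv, flip, s⟩
    have : ∀ (inv flip : Fin 2) (s : Fin 3) (a : Fin 2) (l : Fin 3),
      (tpChart ⟨inv, flip, s⟩).Nonneg ((permChart (permOf ⟨inv, flip, s⟩ a)).E l) ∨
      ∃ a', (permChart (permOf ⟨inv, flip, s⟩ a)).E l =
        tpE inv flip s (oth s a') - tpE inv flip s (oth s a) := by decide +kernel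
    exact this inv flip s
  · rintro ⟨inv, flip, s⟩ a ⟨i, j⟩
    have : ∀ (inv flip : Fin 2) (s : Fin 3) (a : Fin 2) (i j : Fin 4),
      (∃ b₀ : Fin 2, ∀ b, (tpChart ⟨inv, flip, s⟩).Nonneg ((![hw i, hw j] : Fin 2 → Fin 3 → ℤ) b -
        (![hw i, hw j] : Fin 2 → Fin 3 → ℤ) b₀)) ∨
      ∃ b₀ : Fin 2, ∀ b, ∃ a', (tpChart ⟨inv, flip, s⟩).Nonneg
        ((![hw i, hw j] : Fin 2 → Fin 3 → ℤ) b - (![hw i, hw j] : Fin 2 → Fin 3 → ℤ) b₀ +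
          tpE inv flip s (oth s a) - tpE inv flip s (oth s a')) := by decide +kernel
    exact this inv flip s a i j


open ToricData

/-! ### Transport of classes along isomorphisms -/

section Transport

variable {X Y Z : Scheme.{0}}

lemma pushforward_mk (φ : X ≅ Y) (k : ℕ) (c : cycles X k) :
    pushforward φ k (QuotientAddGroup.mk c) = QuotientAddGroup.mk (mapCycles φ k c) := rfl

lemma pushforward_trans (φ : X ≅ Y) (ψ : Y ≅ Z) (k : ℕ) (c : Chow X k) :
    pushforward (φ ≪≫ ψ) k c = pushforward ψ k (pushforward φ k c) := by
  obtain ⟨c, rfl⟩ := QuotientAddGroup.mk_surjective c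
  rw [pushforward_mk, pushforward_mk, pushforward_mk]
  congr 1
  apply Subtype.ext
  ext z
  obtain ⟨y, rfl⟩ := iso_surj ψ z
  obtain ⟨x, rfl⟩ := iso_surj φ y
  change mapCycle (φ ≪≫ ψ) c.1 _ = mapCycle ψ (mapCycle φ c.1) _
  rw [mapCycle_apply, mapCycle_apply, ← Scheme.Hom.comp_apply]
  exact mapCycle_apply (φ ≪≫ ψ) c.1 x

lemma isGenericPoint_preimage_iff (φ : X ≅ Y) (C : Set Y) (x : X) :
    IsGenericPoint x (φ.hom ⁻¹' C) ↔ IsGenericPoint (φ.hom x) C := by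
  have h : φ.hom ⁻¹' closure {φ.hom x} = closure {x} := by
    have h1 := (Scheme.homeoOfIso φ).preimage_closure {φ.hom x}
    have h2 : Scheme.homeoOfIso φ ⁻¹' {φ.hom x} = {x} := by
      ext z
      exact (Scheme.homeoOfIso φ).injective.eq_iff
    rw [h2] at h1
    exact h1
  unfold IsGenericPoint
  rw [← h]
  exact (Scheme.homeoOfIso φ).surjective.preimage_injective.eq_iff

lemma comp_preimage (f : X ⟶ Y) (g : Y ⟶ Z) (S : Set Z) : (f ≫ g) ⁻¹' S = f ⁻¹' (g ⁻¹' S) := rfl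

lemma pushforward_fundClass (φ : X ≅ Y) (k : ℕ) (C : Set Y) :
    pushforward φ k (fundClass k (φ.hom ⁻¹' C)) = fundClass k C := by
  classical
  unfold fundClass
  rw [pushforward_mk]
  congr 1
  apply Subtype.ext
  ext y
  obtain ⟨x, rfl⟩ := iso_surj φ y
  refine (mapCycle_apply φ _ x).trans ?_
  change (if _ then (1 : ℤ) else 0) = if _ then 1 else 0
  rw [isGenericPoint_preimage_iff, height_iso]

/-- Two blowups with the same centre are isomorphic. -/
lemma IsBlowup.exists_iso {π : X ⟶ Z} {π' : Y ⟶ Z} {I : Z.IdealSheafData} (h : IsBlowup π I)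
    (h' : IsBlowup π' I) : ∃ e : X ≅ Y, e.hom ≫ π' = π := by
  obtain ⟨f, hf, -⟩ := h'.existsUnique_lift π h.isInvertible
  obtain ⟨g, hg, -⟩ := h.existsUnique_lift π' h'.isInvertible
  change f ≫ π' = π at hf
  change g ≫ π = π' at hg
  refine ⟨⟨f, g, ?_, ?_⟩, hf⟩
  · exact (h.existsUnique_lift π h.isInvertible).unique
      (by rw [Category.assoc, hg, hf]) (Category.id_comp π)
  · exact (h'.existsUnique_lift π' h'.isInvertible).unique
      (by rw [Category.assoc, hf, hg]) (Category.id_comp π')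

end Transport

namespace PermutohedralBlowup

/-- Any two permutohedral blowups are isomorphic over `(ℙ¹)³`, compatibly with the two steps. -/
lemma exists_iso (B B' : PermutohedralBlowup) : ∃ (e₁ : B.X₁ ≅ B'.X₁) (e₂ : B.X₂ ≅ B'.X₂),
    e₁.hom ≫ B'.π₁ = B.π₁ ∧ e₂.hom ≫ B'.π₂ = B.π₂ ≫ e₁.hom := by
  obtain ⟨e₁, h₁⟩ := B.isBlowup₁.exists_iso B'.isBlowup₁
  have hZ : (properTransformSixLines B'.π₁).preimage e₁.hom.continuous =
      properTransformSixLines B.π₁ := by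
    apply SetLike.coe_injective
    refine ((Scheme.homeoOfIso e₁).preimage_closure _).trans ?_
    rw [← h₁]
    rfl
  have h := B.isBlowup₂
  rw [← hZ] at h
  obtain ⟨e₂, h₂⟩ := (h.comp_iso e₁).exists_iso B'.isBlowup₂
  exact ⟨e₁, e₂, h₁, h₂⟩

variable {B B' : PermutohedralBlowup} {e₁ : B.X₁ ≅ B'.X₁} {e₂ : B.X₂ ≅ B'.X₂}
  (h₁ : e₁.hom ≫ B'.π₁ = B.π₁) (h₂ : e₂.hom ≫ B'.π₂ = B.π₂ ≫ e₁.hom)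

include h₁ h₂

lemma iso_π : e₂.hom ≫ B'.π = B.π := by
  unfold π
  rw [reassoc_of% h₂, h₁]

lemma pushforward_lineClass (p : GeneralChoice) (j : Fin 3) :
    pushforward e₂ 1 (B.lineClass p j) = B'.lineClass p j := by
  unfold lineClass
  rw [← iso_π h₁ h₂, comp_preimage]
  exact pushforward_fundClass e₂ 1 _

lemma pushforward_fiberClass (p : GeneralChoice) (b : Fin 2) (j : Fin 3) :
    pushforward e₂ 1 (B.fiberClass p b j) = B'.fiberClass p b j := by
  unfold fiberClass
  rw [← iso_π h₁ h₂, comp_preimage]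
  exact pushforward_fundClass e₂ 1 _

lemma pushforward_exceptionalClass (p : GeneralChoice) (b : Fin 2) :
    pushforward e₂ 1 (B.exceptionalClass p b) = B'.exceptionalClass p b := by
  unfold exceptionalClass
  have h : B.exceptionalLine p b = e₁.hom ⁻¹' B'.exceptionalLine p b := by
    unfold exceptionalLine
    rw [← h₁, Set.preimage_inter, comp_preimage, comp_preimage]
    congr 1
    exact ((Scheme.homeoOfIso e₁).preimage_closure _).symm
  have h3 : B.π₂ ⁻¹' B.exceptionalLine p b = e₂.hom ⁻¹' (B'.π₂ ⁻¹' B'.exceptionalLine p b) := by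
    rw [h, ← comp_preimage, ← h₂, comp_preimage]
  rw [h3]
  exact pushforward_fundClass e₂ 1 _

lemma pushforward_curveClass (p : GeneralChoice) (d : Fin 3 → ℤ) (a : Fin 2 → ℤ) (b : Fin 6 → ℤ) :
    pushforward e₂ 1 (B.curveClass p d a b) = B'.curveClass p d a b := by
  unfold curveClass h e f
  simp only [map_sub, map_add, map_zero, map_zsmul, Fin.sum_univ_succ, Fin.sum_univ_zero, Matrix.cons_val_zero,
    Matrix.cons_val_succ, pushforward_lineClass h₁ h₂, pushforward_fiberClass h₁ h₂,
    pushforward_exceptionalClass h₁ h₂]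

end PermutohedralBlowup

/-- The toric model of the permutohedral blowup. -/
abbrev toricModel : PermutohedralBlowup where
  X₁ := twoPointData.X
  X₂ := (permData 3).X
  π₁ := firstπ
  π₂ := secondBlowdown
  isBlowup₁ := isBlowup_firstBlowdown
  isBlowup₂ := isBlowup_secondBlowdown

lemma torus_toricModel_π : (permData 3).torus ≫ toricModel.π = torusInclusion := by
  unfold PermutohedralBlowup.π
  refine (Category.assoc _ _ _).symm.trans ?_
  refine (congr_arg (· ≫ firstπ) torus_secondBlowdown).trans ?_
  change twoPointData.torus ≫ firstBlowdown ≫ cubeIso.hom = _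
  rw [← Category.assoc, torus_firstBlowdown, torusInclusion_eq]

lemma PP.map_pt_eq {ι R S : Type} [CommRing R] [CommRing S] {φ : R →+* S} {γ : ℂ →+* R}
    {γ' : ℂ →+* S} (hγ : φ.comp γ = γ') {a : ι → R} {a' : ι → S} {b b' : ι} {h : IsUnit (a b)}
    {h' : IsUnit (a' b')} (H : ∀ i j, φ (a i) * a' j = φ (a j) * a' i) :
    Spec.map (CommRingCat.ofHom φ) ≫ PP.pt γ a b h = PP.pt γ' a' b' h' := by
  subst hγ
  rw [PP.map_pt]
  exact PP.pt_eq_pt H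

/-! ### The symmetry of the permutohedral variety -/

/-- The action of the matrix of the symmetry on the functions on the torus. -/
def zetaRing : TR 3 →+* TR 3 := AddMonoidAlgebra.mapDomainRingHom ℂ
  (Matrix.mulVecLin zetaMatrix.transpose).toAddMonoidHom

lemma torusEnd_eq : torusEnd zetaMatrix = Spec.map (CommRingCat.ofHom zetaRing) := rfl

lemma zetaRing_mono (m : Fin 3 → ℤ) :
    zetaRing (mono m) = mono (zetaMatrix.transpose.mulVec m) :=
  AddMonoidAlgebra.mapDomain_single

lemma zetaRing_comp_algebraMap : zetaRing.comp (algebraMap ℂ (TR 3)) = algebraMap ℂ (TR 3) := by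
  refine RingHom.ext fun r ↦ ?_
  change AddMonoidAlgebra.mapDomain _ (AddMonoidAlgebra.single 0 r) = AddMonoidAlgebra.single 0 r
  rw [AddMonoidAlgebra.mapDomain_single, map_zero]

lemma zetaMatrix_hw (i : Fin 4) :
    zetaMatrix.transpose.mulVec (hw i) = hw (Equiv.swap 0 1 i) - hw 1 := by
  revert i
  decide +kernel

lemma torusEnd_comp_pt {ι : Type} {a a' : ι → TR 3} {b b' : ι} {h : IsUnit (a b)}
    {h' : IsUnit (a' b')} (H : ∀ i j, zetaRing (a i) * a' j = zetaRing (a j) * a' i) :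
    torusEnd zetaMatrix ≫ PP.pt (algebraMap ℂ (TR 3)) a b h =
      PP.pt (algebraMap ℂ (TR 3)) a' b' h' := by
  rw [torusEnd_eq]
  exact PP.map_pt_eq zetaRing_comp_algebraMap H

lemma exists_zetaHom : ∃ z : (permData 3).X ⟶ (permData 3).X,
    (∀ k : Fin 4 × Fin 4, z ≫ (permData 3).q k =
      (permData 3).q (Equiv.swap 0 1 k.1, Equiv.swap 0 1 k.2)) ∧
    (permData 3).torus ≫ z = torusEnd zetaMatrix ≫ (permData 3).torus := by
  refine exists_lift (D := permData 3) (permData 3).torus (torusEnd zetaMatrix)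
    (fun k ↦ (permData 3).q (Equiv.swap 0 1 k.1, Equiv.swap 0 1 k.2)) ?_
  rintro ⟨i, j⟩
  rw [torus_q]
  refine (torusEnd_comp_pt ?_).symm
  have key : ∀ (i j : Fin 4) (b : Fin 2),
      zetaRing (mono ((![hw i, hw j] : Fin 2 → Fin 3 → ℤ) b)) =
      mono ((![hw (Equiv.swap 0 1 i), hw (Equiv.swap 0 1 j)] : Fin 2 → Fin 3 → ℤ) b) *
        mono (- hw 1) := by
    intro i j b
    rw [zetaRing_mono, ← mono_add, ← sub_eq_add_neg]
    have hb : ∀ b : Fin 2, b = 0 ∨ b = 1 := by decide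
    rcases hb b with rfl | rfl <;> exact congr_arg mono (zetaMatrix_hw _)
  intro b b'
  have h1 := key i j b
  have h2 := key i j b'
  refine (congr_arg (· * _) h1).trans (Eq.trans ?_ (congr_arg (· * _) h2).symm)
  ring

/-- The morphism of the permutohedral variety that interchanges the first two of the four
homogeneous coordinates. -/
def zetaHom : (permData 3).X ⟶ (permData 3).X := exists_zetaHom.choose

lemma zetaHom_q (i j : Fin 4) : zetaHom ≫ (permData 3).q (i, j) =
    (permData 3).q (Equiv.swap 0 1 i, Equiv.swap 0 1 j) := exists_zetaHom.choose_spec.1 (i, j)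

lemma torus_zetaHom : (permData 3).torus ≫ zetaHom = torusEnd zetaMatrix ≫ (permData 3).torus :=
  exists_zetaHom.choose_spec.2

lemma zetaHom_zetaHom : zetaHom ≫ zetaHom = 𝟙 _ := by
  apply (permData 3).jointlyMono
  rintro ⟨i, j⟩
  rw [Category.assoc, zetaHom_q, zetaHom_q, Equiv.swap_apply_self, Equiv.swap_apply_self,
    Category.id_comp]

/-- The symmetry of the permutohedral variety. -/
def zetaIso : toricModel.X₂ ≅ toricModel.X₂ := ⟨zetaHom, zetaHom, zetaHom_zetaHom, zetaHom_zetaHom⟩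

instance : IsOpenImmersion (permData 3).torus := (permChart 1).isOpenImmersion_torus

instance : IsOpenImmersion torusInclusion := by
  have := (cubeChart 0).isOpenImmersion_torus
  rw [torusInclusion_eq]
  infer_instance

lemma zetaIso_ne_id : zetaIso.hom ≠ 𝟙 toricModel.X₂ := by
  intro h
  have h1 : torusEnd zetaMatrix ≫ (permData 3).torus = 𝟙 _ ≫ (permData 3).torus := by
    rw [← torus_zetaHom]
    refine (congr_arg ((permData 3).torus ≫ ·) h).trans ?_
    exact (Category.comp_id _).trans (Category.id_comp _).symm
  rw [cancel_mono] at h1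
  have h2 := RingHom.congr_fun (congr_arg CommRingCat.Hom.hom
    (Spec.map_injective (h1.trans (Spec.map_id _).symm))) (mono (hw 1))
  refine absurd ((zetaRing_mono _).symm.trans h2) fun h3 ↦ ?_
  have h4 := AddMonoidAlgebra.single_left_injective (one_ne_zero (α := ℂ)) h3
  exact absurd h4 (by decide +kernel)

lemma torusInclusion_pr (k : Fin 3) : torusInclusion ≫ P1Cube.pr k =
    PP.pt (algebraMap ℂ TorusRing) ![coord k, 1] 1 isUnit_one := P1Cube.point_pr _ _ _ k

lemma toricModel_π_toSpecC : toricModel.π ≫ P1Cube.toSpecC = (permData 3).toSpecC := by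
  rw [← P1Cube.pr_toSpecC 0]
  apply ext_of_isDominant (permData 3).torus
  rw [torus_toSpecC]
  have h : (permData 3).torus ≫ toricModel.π ≫ P1Cube.pr 0 ≫ PP.toSpecC (Fin 2) =
      ((permData 3).torus ≫ toricModel.π) ≫ P1Cube.pr 0 ≫ PP.toSpecC (Fin 2) :=
    (Category.assoc _ _ _).symm
  refine (congr_arg ((permData 3).torus ≫ ·) (Category.assoc _ _ _)).trans (h.trans ?_)
  rw [torus_toricModel_π, ← Category.assoc, torusInclusion_pr]
  exact PP.pt_toSpecC _ _ _ _

lemma isToricSymmetry_zetaIso : toricModel.IsToricSymmetry zetaIso zetaMatrix := by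
  refine ⟨?_, (permData 3).torus, inferInstance, inferInstance, torus_toricModel_π, torus_zetaHom⟩
  rw [toricModel_π_toSpecC, ← (permData 3).q_toSpecC (0, 0)]
  change zetaHom ≫ _ = _
  rw [← Category.assoc, zetaHom_q]
  exact ((permData 3).q_toSpecC _).trans ((permData 3).q_toSpecC _).symm

lemma torusEnd_torusInclusion : torusEnd zetaMatrix ≫ torusInclusion = zetaOnTorus := by
  apply P1Cube.jointlyMono_pr
  intro k
  rw [Category.assoc, torusInclusion_pr]
  refine (torusEnd_comp_pt ?_).trans (P1Cube.point_pr _ _ _ k).symm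
  have h : ∀ k : Fin 3, zetaRing (coord k) =
        mono (hw (Equiv.swap 0 1 k.succ) - hw 1) := by
    intro k
    rw [← zetaMatrix_hw]
    exact zetaRing_mono _
  have hc : ∀ k : Fin 3, coord k = mono (hw k.succ) := fun k ↦ rfl
  have key : ∀ (k : Fin 3) (b : Fin 2),
      zetaRing ((![coord k, 1] : Fin 2 → TR 3) b) * coord 0 =
      (![![1, coord 0], ![coord 1, coord 0], ![coord 2, coord 0]] : Fin 3 → Fin 2 → TR 3) k b := by
    intro k b
    fin_cases b
    · refine (congr_arg (· * _) (h k)).trans ?_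
      rw [hc 0, ← mono_add]
      refine (congr_arg mono (sub_add_cancel _ _)).trans ?_
      fin_cases k <;> rfl
    · refine (congr_arg (· * _) (map_one _)).trans ((one_mul _).trans ?_)
      fin_cases k <;> rfl
  intro b b'
  rw [← key k b, ← key k b']
  ring

lemma resolves_zetaIso : toricModel.Resolves zetaIso zetaOnTorus := by
  unfold PermutohedralBlowup.Resolves
  let j : Torus ⟶ pullback torusInclusion toricModel.π :=
    pullback.lift (𝟙 _) (permData 3).torus (by rw [Category.id_comp, torus_toricModel_π])
  have hj1 : j ≫ pullback.fst torusInclusion toricModel.π = 𝟙 _ := pullback.lift_fst _ _ _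
  have hj2 : j ≫ pullback.snd torusInclusion toricModel.π = (permData 3).torus :=
    pullback.lift_snd _ _ _
  have : IsReduced toricModel.X₂ := inferInstanceAs (IsReduced (permData 3).X)
  have : IsReduced (pullback torusInclusion toricModel.π) :=
    isReduced_of_isOpenImmersion (pullback.snd torusInclusion toricModel.π)
  have hd : IsDominant (j ≫ pullback.snd torusInclusion toricModel.π) := by
    rw [hj2]
    exact inferInstanceAs (IsDominant (permData 3).torus)
  have : IsDominant j :=
    isDominant_of_comp_openImmersion j (pullback.snd torusInclusion toricModel.π)
  apply P1Cube.jointlyMono_pr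
  intro k
  apply ext_of_isDominant j
  have h : j ≫ pullback.snd torusInclusion toricModel.π ≫ zetaIso.hom ≫ toricModel.π =
      j ≫ pullback.fst torusInclusion toricModel.π ≫ zetaOnTorus := by
    rw [reassoc_of% hj1, reassoc_of% hj2, ← torusEnd_torusInclusion, ← torus_toricModel_π]
    exact (Category.assoc _ _ _).symm.trans
      ((congr_arg (· ≫ toricModel.π) torus_zetaHom).trans (Category.assoc _ _ _))
  simpa using congr_arg (· ≫ P1Cube.pr k) h


open ToricData

/-! ### Hyperplanes in projective space -/

namespace PP

variable {ι : Type}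

/-- The complement of the hyperplane `∑ i ∈ s, c i * X i = 0`. -/
def hyperplaneCompl (s : Finset ι) (c : ι → ℂ) : (PP ι).Opens :=
  Proj.basicOpen (grad ι) (∑ i ∈ s, MvPolynomial.C (c i) * MvPolynomial.X i)

lemma linearForm_mem (s : Finset ι) (c : ι → ℂ) :
    (∑ i ∈ s, MvPolynomial.C (c i) * MvPolynomial.X i : MvPolynomial ι ℂ) ∈ grad ι 1 := by
  refine sum_mem fun i _ ↦ ?_
  have := MvPolynomial.IsHomogeneous.mul (MvPolynomial.isHomogeneous_C ι (c i))
    (MvPolynomial.isHomogeneous_X ℂ i)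
  rwa [zero_add] at this

lemma mem_hyperplaneCompl_pt {R : Type} [CommRing R] (γ : ℂ →+* R) (a : ι → R) (b : ι)
    (h : IsUnit (a b)) (s : Finset ι) (c : ι → ℂ) (p : Spec (CommRingCat.of R)) :
    pt γ a b h p ∈ hyperplaneCompl s c ↔ ∑ i ∈ s, γ (c i) * a i ∉ p.asIdeal := by
  have key : pt γ a b h ⁻¹ᵁ hyperplaneCompl s c =
      PrimeSpectrum.basicOpen (∑ i ∈ s, γ (c i) * a i) := by
    unfold pt hyperplaneCompl
    rw [Scheme.Hom.comp_preimage,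
      Proj.awayι_preimage_basicOpen _ _ _ (linearForm_mem s c) one_pos]
    have h1 : HomogeneousLocalization.Away.isLocalizationElem (X_mem b) (linearForm_mem s c) =
        ∑ i ∈ s, const b (c i) * ratio b i := by
      apply HomogeneousLocalization.val_injective
      have hl : HomogeneousLocalization.val (∑ i ∈ s, const b (c i) * ratio b i) =
          ∑ i ∈ s, HomogeneousLocalization.val (const b (c i) * ratio b i) :=
        map_sum (algebraMap (HomogeneousLocalization.Away (grad ι) (MvPolynomial.X b))
          (Localization (Submonoid.powers (MvPolynomial.X b : MvPolynomial ι ℂ)))) _ _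
      rw [hl]
      have hu : IsUnit (algebraMap (MvPolynomial ι ℂ) (Localization (Submonoid.powers
          (MvPolynomial.X b : MvPolynomial ι ℂ))) (MvPolynomial.X b)) :=
        IsLocalization.Away.algebraMap_isUnit _
      apply hu.mul_right_cancel
      rw [Finset.sum_mul]
      simp only [HomogeneousLocalization.val_mul, mul_assoc, val_ratio_mul, val_const]
      rw [HomogeneousLocalization.Away.isLocalizationElem, HomogeneousLocalization.Away.val_mk,
        pow_one, Localization.mk_eq_mk']
      simp only [← map_mul, ← map_sum]
      have h3 := IsLocalization.mk'_spec (Localization (Submonoid.powers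
        (MvPolynomial.X b : MvPolynomial ι ℂ)))
        (∑ i ∈ s, MvPolynomial.C (c i) * MvPolynomial.X i)
        (⟨MvPolynomial.X b ^ 1, 1, rfl⟩ : Submonoid.powers (MvPolynomial.X b : MvPolynomial ι ℂ))
      simp only [pow_one] at h3 ⊢
      exact h3
    rw [h1]
    ext p
    have h2 : ∑ i ∈ s, γ (c i) * a i ∈ p.asIdeal ↔
        awayHom γ a b h (∑ i ∈ s, const b (c i) * ratio b i) ∈ p.asIdeal := by
      rw [← p.asIdeal.mul_unit_mem_iff_mem h (x := awayHom γ a b h _), map_sum, Finset.sum_mul]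
      simp only [map_mul, awayHom_const, mul_assoc, awayHom_ratio_mul]
    exact (not_congr h2).symm
  have h2 := congr_arg (p ∈ ·) key
  simp only [eq_iff_iff] at h2
  exact h2

end PP

/-! ### Points of the permutohedral variety -/

section Points

variable {n : ℕ} {R : Type} [CommRing R]

lemma nonneg_permChart (σ : Equiv.Perm (Fin (n + 1))) {i j : Fin (n + 1)}
    (h : σ.symm i ≤ σ.symm j) : (permChart σ).Nonneg (hw i - hw j) := by
  intro l
  change 0 ≤ permRho σ.symm l ⬝ᵥ _
  rw [dotProduct_sub, permRho_hw, permRho_hw]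
  split_ifs <;> omega

/-- The morphism from `Spec R` to the permutohedral variety for which the ratio of the homogeneous
coordinates `t i : t j` is the given function `x i j` whenever `r i j`. -/
lemma exists_permPoint (γ : ℂ →+* R) (r : Fin (n + 1) → Fin (n + 1) → Prop)
    (htot : ∀ i j, r i j ∨ r j i) (htrans : ∀ i j k, r i j → r j k → r i k)
    (x : Fin (n + 1) → Fin (n + 1) → R) (hx : ∀ i, x i i = 1)
    (hxx : ∀ i j k, r i j → r j k → x i j * x j k = x i k) :
    ∃ f : Spec (CommRingCat.of R) ⟶ (permData n).X, ∀ i j, r i j →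
      f ≫ (permData n).q (i, j) = PP.pt (ι := Fin 2) γ ![x i j, 1] 1 isUnit_one ∧
      f ≫ (permData n).q (j, i) = PP.pt (ι := Fin 2) γ ![1, x i j] 0 isUnit_one := by
  -- on the chart of an ordering of the labels, only ratios of consecutive labels have to be given
  obtain ⟨σ, hσ⟩ := exists_sorting r htot htrans
  have hle : ∀ p p' : Fin (n + 1), p ≤ p' → r (σ p) (σ p') := by
    intro p p' h
    induction p' using Fin.induction with
    | zero =>
      rw [Fin.le_zero_iff.1 h]
      exact (htot _ _).elim id id
    | succ l ih =>
      rcases h.eq_or_lt with rfl | h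
      · exact (htot _ _).elim id id
      · exact htrans _ _ _ (ih (Fin.le_castSucc_iff.2 h)) (hσ l)
  let ev : AR n →+* R := MvPolynomial.eval₂Hom γ fun l ↦ x (σ l.castSucc) (σ l.succ)
  have hev : ∀ p p' : Fin (n + 1), p ≤ p' →
      ev ((permChart σ).monomial (hw (σ p) - hw (σ p'))) = x (σ p) (σ p') := by
    intro p p' h
    induction p' using Fin.induction with
    | zero =>
      rw [Fin.le_zero_iff.1 h, sub_self, Chart.monomial_zero, map_one, hx]
    | succ l ih =>
      rcases h.eq_or_lt with rfl | h
      · rw [sub_self, Chart.monomial_zero, map_one, hx]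
      · have h' := Fin.le_castSucc_iff.2 h
        have e : (hw (σ p) : Fin n → ℤ) - hw (σ l.succ) =
            (hw (σ p) - hw (σ l.castSucc)) + (permChart σ).E l :=
          (sub_add_sub_cancel _ _ _).symm
        rw [e, Chart.monomial_add (nonneg_permChart σ (by simpa using h')) (by
          intro j
          rw [(permChart σ).dual]
          split_ifs <;> simp), map_mul, ih h', Chart.monomial_E]
        have : ev (MvPolynomial.X l) = x (σ l.castSucc) (σ l.succ) :=
          MvPolynomial.eval₂Hom_X' _ _ _
        rw [this]
        exact hxx _ _ _ (hle _ _ h') (hσ l)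
  have hC : ev.comp MvPolynomial.C = γ := RingHom.ext fun z ↦ MvPolynomial.eval₂Hom_C _ _ _
  have key : ∀ i j, σ.symm i ≤ σ.symm j →
      (Spec.map (CommRingCat.ofHom ev) ≫ (permChart σ).map) ≫ (permData n).q (i, j) =
        PP.pt (ι := Fin 2) γ ![x i j, 1] 1 isUnit_one ∧
      (Spec.map (CommRingCat.ofHom ev) ≫ (permChart σ).map) ≫ (permData n).q (j, i) =
        PP.pt (ι := Fin 2) γ ![1, x i j] 0 isUnit_one := by
    intro i j h
    have e := hev _ _ h
    rw [Equiv.apply_symm_apply, Equiv.apply_symm_apply] at e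
    constructor
    · rw [Category.assoc, Chart.map_q]
      have hc : (permChart σ).c (i, j) = (1 : Fin 2) := if_pos h
      have e0 : (permChart σ).coords (i, j) (0 : Fin 2) = (permChart σ).monomial (hw i - hw j) := by
        unfold Chart.coords
        rw [hc]
        rfl
      have e1 : (permChart σ).coords (i, j) (1 : Fin 2) = 1 := by
        unfold Chart.coords
        rw [hc, sub_self, Chart.monomial_zero]
      refine PP.map_pt_eq hC ?_
      intro b b'
      change ev ((permChart σ).coords (i, j) (b : Fin 2)) * _ = ev ((permChart σ).coords (i, j) (b' : Fin 2)) * _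
      have hb : ∀ b : Fin 2, b = 0 ∨ b = 1 := by decide
      rcases hb b with rfl | rfl <;> rcases hb b' with rfl | rfl <;> simp [e0, e1, e]
    · rw [Category.assoc, Chart.map_q]
      by_cases hij : i = j
      · subst hij
        have hc : (permChart σ).c (i, i) = (1 : Fin 2) := if_pos h
        have e1 : ∀ b : Fin 2, (permChart σ).coords (i, i) b = 1 := by
          intro b
          unfold Chart.coords
          have : (![hw i, hw i] : Fin 2 → Fin n → ℤ) b - (![hw i, hw i] : Fin 2 → Fin n → ℤ) 1 = 0 := by
            have hb : ∀ b : Fin 2, b = 0 ∨ b = 1 := by decide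
            rcases hb b with rfl | rfl <;> simp
          rw [hc]
          exact (congr_arg (permChart σ).monomial this).trans (permChart σ).monomial_zero
        refine PP.map_pt_eq hC ?_
        intro b b'
        change ev ((permChart σ).coords (i, i) (b : Fin 2)) * _ = ev ((permChart σ).coords (i, i) (b' : Fin 2)) * _
        have hb : ∀ b : Fin 2, b = 0 ∨ b = 1 := by decide
        rcases hb b with rfl | rfl <;> rcases hb b' with rfl | rfl <;> simp [e1, hx]
      have h' : ¬ σ.symm j ≤ σ.symm i := fun h2 ↦ hij (σ.symm.injective (le_antisymm h h2))
      have hc : (permChart σ).c (j, i) = (0 : Fin 2) := if_neg h'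
      have e0 : (permChart σ).coords (j, i) (1 : Fin 2) = (permChart σ).monomial (hw i - hw j) := by
        unfold Chart.coords
        rw [hc]
        rfl
      have e1 : (permChart σ).coords (j, i) (0 : Fin 2) = 1 := by
        unfold Chart.coords
        rw [hc, sub_self, Chart.monomial_zero]
      refine PP.map_pt_eq hC ?_
      intro b b'
      change ev ((permChart σ).coords (j, i) (b : Fin 2)) * _ = ev ((permChart σ).coords (j, i) (b' : Fin 2)) * _
      have hb : ∀ b : Fin 2, b = 0 ∨ b = 1 := by decide
      rcases hb b with rfl | rfl <;> rcases hb b' with rfl | rfl <;> simp [e0, e1, e]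
  refine ⟨Spec.map (CommRingCat.ofHom ev) ≫ (permChart σ).map, fun i j hij ↦ ?_⟩
  rcases le_total (σ.symm i) (σ.symm j) with h | h
  · exact key i j h
  · have hji : r j i := by simpa using hle _ _ h
    have e : x i j * x j i = 1 := by rw [hxx _ _ _ hij hji, hx]
    rw [(key j i h).1, (key j i h).2]
    constructor
    · apply PP.pt_eq_pt
      intro b b'
      fin_cases b <;> fin_cases b' <;> simp [e, mul_comm]
    · apply PP.pt_eq_pt
      intro b b'
      fin_cases b <;> fin_cases b' <;> simp [e, mul_comm]

/-- Morphisms to the permutohedral variety with the same ratios of homogeneous coordinates agree. -/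
lemma hom_ext_of_ratios {f g : Spec (CommRingCat.of R) ⟶ (permData n).X}
    (H : ∀ i j, f ≫ (permData n).q (i, j) = g ≫ (permData n).q (i, j)) : f = g :=
  (permData n).jointlyMono f g fun k ↦ H k.1 k.2

end Points


open ToricData

/-! ### Limits of points of the torus -/

section Orbits

variable {n : ℕ}

section Ring

variable {K L : Type} [CommRing K] [CommRing L]

/-- The pair of homogeneous coordinates `t i : t j` at the limit for `ε → 0` of the point of the torus
with the homogeneous coordinates `t i = ε ^ (l i) * a i`. -/
def limitRatio (l : Fin (n + 1) → ℤ) (a : Fin (n + 1) → Kˣ) (i j : Fin (n + 1)) : Fin 2 → K :=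
  ![if l i ≤ l j then a i else 0, if l j ≤ l i then a j else 0]

/-- The index of a coordinate of the limit that does not vanish. -/
def limitIndex (l : Fin (n + 1) → ℤ) (i j : Fin (n + 1)) : Fin 2 := if l j ≤ l i then 1 else 0

lemma isUnit_limitRatio (l : Fin (n + 1) → ℤ) (a : Fin (n + 1) → Kˣ) (i j : Fin (n + 1)) :
    IsUnit (limitRatio l a i j (limitIndex l i j)) := by
  unfold limitRatio limitIndex
  by_cases h : l j ≤ l i
  · simp [h]
  · simp [h, le_of_not_ge h]

lemma exists_orbitPt (γ : ℂ →+* K) (l : Fin (n + 1) → ℤ) (a : Fin (n + 1) → Kˣ) :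
    ∃ f : Spec (CommRingCat.of K) ⟶ (permData n).X, ∀ i j, f ≫ (permData n).q (i, j) =
      PP.pt (ι := Fin 2) γ (limitRatio l a i j) (limitIndex l i j) (isUnit_limitRatio l a i j) := by
  obtain ⟨f, hf⟩ := exists_permPoint γ (fun i j ↦ l j ≤ l i) (fun i j ↦ le_total _ _)
    (fun i j k h h' ↦ h'.trans h) (fun i j ↦ if l i = l j then ((a i / a j : Kˣ) : K) else 0)
    (fun i ↦ by simp) (by
      intro i j k h h'
      by_cases h1 : l i = l j
      · by_cases h2 : l j = l k
        · simp only [h1, h2, if_true]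
          rw [← Units.val_mul, div_mul_div_cancel]
        · simp [h1, h2]
      · have : l i ≠ l k := by omega
        simp [h1, this])
  have hb : ∀ b : Fin 2, b = 0 ∨ b = 1 := by decide
  have hd : ∀ i j, (↑(a i / a j) * ↑(a j) : K) = a i := fun i j ↦ by
    rw [← Units.val_mul, div_mul_cancel]
  refine ⟨f, fun i j ↦ ?_⟩
  rcases le_total (l j) (l i) with h | h
  · rw [(hf i j h).1]
    apply PP.pt_eq_pt
    intro b b'
    unfold limitRatio
    by_cases h1 : l i = l j
    · rcases hb b with rfl | rfl <;> rcases hb b' with rfl | rfl <;> simp [h1, hd]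
    · have : ¬ l i ≤ l j := by omega
      rcases hb b with rfl | rfl <;> rcases hb b' with rfl | rfl <;> simp [h1, this]
  · rw [(hf j i h).2]
    apply PP.pt_eq_pt
    intro b b'
    unfold limitRatio
    by_cases h1 : l i = l j
    · rcases hb b with rfl | rfl <;> rcases hb b' with rfl | rfl <;> simp [h1, hd]
    · have h2 : ¬ l j ≤ l i := by omega
      have h3 : ¬ l j = l i := by omega
      rcases hb b with rfl | rfl <;> rcases hb b' with rfl | rfl <;> simp [h2, h3]

/-- The limit for `ε → 0` of the point of the torus with the homogeneous coordinates
`t i = ε ^ (l i) * a i`, as a `K`-valued point of the permutohedral variety. -/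
def orbitPt (γ : ℂ →+* K) (l : Fin (n + 1) → ℤ) (a : Fin (n + 1) → Kˣ) :
    Spec (CommRingCat.of K) ⟶ (permData n).X := (exists_orbitPt γ l a).choose

lemma orbitPt_q (γ : ℂ →+* K) (l : Fin (n + 1) → ℤ) (a : Fin (n + 1) → Kˣ) (i j : Fin (n + 1)) :
    orbitPt γ l a ≫ (permData n).q (i, j) =
      PP.pt (ι := Fin 2) γ (limitRatio l a i j) (limitIndex l i j) (isUnit_limitRatio l a i j) :=
  (exists_orbitPt γ l a).choose_spec i j

/-- A morphism that agrees with a limit point on overlapping ratios. -/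
lemma eq_orbitPt {γ : ℂ →+* K} {l : Fin (n + 1) → ℤ} {a : Fin (n + 1) → Kˣ}
    {f : Spec (CommRingCat.of K) ⟶ (permData n).X} {y : Fin (n + 1) → Fin (n + 1) → Fin 2 → K}
    {c : Fin (n + 1) → Fin (n + 1) → Fin 2} {hu : ∀ i j, IsUnit (y i j (c i j))}
    (hf : ∀ i j, f ≫ (permData n).q (i, j) = PP.pt (ι := Fin 2) γ (y i j) (c i j) (hu i j))
    (H : ∀ i j b b', y i j b * limitRatio l a i j b' = y i j b' * limitRatio l a i j b) :
    f = orbitPt γ l a := by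
  refine hom_ext_of_ratios fun i j ↦ ?_
  rw [hf, orbitPt_q]
  exact PP.pt_eq_pt (H i j)

/-- Two limit points agree if their levels are ordered in the same way and the ratios of coordinates
of equal level correspond under a ring homomorphism. -/
lemma map_orbitPt {γ : ℂ →+* K} {γ' : ℂ →+* L} (φ : K →+* L) (hφ : φ.comp γ = γ')
    {l l' : Fin (n + 1) → ℤ} {a : Fin (n + 1) → Kˣ} {a' : Fin (n + 1) → Lˣ}
    (hl : ∀ i j, l i ≤ l j ↔ l' i ≤ l' j)
    (ha : ∀ i j, l i = l j → φ (a i) * a' j = φ (a j) * a' i) :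
    Spec.map (CommRingCat.ofHom φ) ≫ orbitPt γ l a = orbitPt γ' l' a' := by
  refine hom_ext_of_ratios fun i j ↦ ?_
  rw [Category.assoc, orbitPt_q, orbitPt_q]
  refine PP.map_pt_eq hφ fun b b' ↦ ?_
  have hb : ∀ b : Fin 2, b = 0 ∨ b = 1 := by decide
  have h1 := hl i j
  have h2 := hl j i
  have h3 := ha i j
  unfold limitRatio
  simp only [← h1, ← h2]
  by_cases h4 : l i ≤ l j <;> by_cases h5 : l j ≤ l i <;>
    rcases hb b with rfl | rfl <;> rcases hb b' with rfl | rfl <;> simp [h4, h5] <;>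
    first
    | exact h3 (le_antisymm h4 h5)
    | exact (h3 (le_antisymm h4 h5)).symm

end Ring

variable {K L : Type} [Field K] [Field L]

/-- The point of the spectrum of a field. -/
def fieldPt (K : Type) [Field K] : Spec (CommRingCat.of K) := (⊥ : PrimeSpectrum K)

lemma mem_fieldPt {x : K} : x ∈ PrimeSpectrum.asIdeal (fieldPt K) ↔ x = 0 := Ideal.mem_bot

lemma eq_fieldPt (p : Spec (CommRingCat.of K)) : p = fieldPt K :=
  Subsingleton.elim (α := PrimeSpectrum K) _ _

/-- The point of the permutohedral variety underlying a limit of points of the torus. -/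
def orbitPoint (γ : ℂ →+* K) (l : Fin (n + 1) → ℤ) (a : Fin (n + 1) → Kˣ) : (permData n).X :=
  orbitPt γ l a (fieldPt K)

lemma q_orbitPoint (γ : ℂ →+* K) (l : Fin (n + 1) → ℤ) (a : Fin (n + 1) → Kˣ)
    (i j : Fin (n + 1)) : (permData n).q (i, j) (orbitPoint γ l a) =
      PP.pt (ι := Fin 2) γ (limitRatio l a i j) (limitIndex l i j) (isUnit_limitRatio l a i j)
        (fieldPt K) := by
  rw [← orbitPt_q]
  exact (Scheme.Hom.comp_apply _ _ _).symm

lemma orbitPoint_eq {γ : ℂ →+* K} {γ' : ℂ →+* L} (φ : K →+* L) (hφ : φ.comp γ = γ')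
    {l l' : Fin (n + 1) → ℤ} {a : Fin (n + 1) → Kˣ} {a' : Fin (n + 1) → Lˣ}
    (hl : ∀ i j, l i ≤ l j ↔ l' i ≤ l' j)
    (ha : ∀ i j, l i = l j → φ (a i) * a' j = φ (a j) * a' i) :
    orbitPoint γ l a = orbitPoint γ' l' a' := by
  unfold orbitPoint
  rw [← map_orbitPt φ hφ hl ha, Scheme.Hom.comp_apply]
  exact congr_arg _ (eq_fieldPt _).symm

lemma q_orbitPoint_mem_dPlus (γ : ℂ →+* K) (l : Fin (n + 1) → ℤ) (a : Fin (n + 1) → Kˣ)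
    (i j : Fin (n + 1)) : (permData n).q (i, j) (orbitPoint γ l a) ∈ PP.dPlus (ι := Fin 2) 1 ↔
      l j ≤ l i := by
  rw [q_orbitPoint, PP.mem_dPlus_pt]
  refine (not_congr mem_fieldPt).trans ?_
  simp [limitRatio]

/-- The order of the levels is determined by the limit point. -/
lemma le_iff_of_orbitPoint_eq {γ : ℂ →+* K} {γ' : ℂ →+* L}
    {l l' : Fin (n + 1) → ℤ} {a : Fin (n + 1) → Kˣ} {a' : Fin (n + 1) → Lˣ}
    (h : orbitPoint γ l a = orbitPoint γ' l' a') (i j : Fin (n + 1)) : l i ≤ l j ↔ l' i ≤ l' j := by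
  rw [← q_orbitPoint_mem_dPlus γ l a, h, q_orbitPoint_mem_dPlus]

/-- Every point of the permutohedral variety is a limit of points of the torus. -/
lemma exists_eq_orbitPoint (y : (permData n).X) :
    ∃ (K : Type) (_ : Field K) (γ : ℂ →+* K) (l : Fin (n + 1) → ℤ) (a : Fin (n + 1) → Kˣ),
      y = orbitPoint γ l a := by
  obtain ⟨σ, p, rfl⟩ := exists_mem_range_permChart y
  change PrimeSpectrum (AR n) at p
  let K := p.asIdeal.ResidueField
  let φ : AR n →+* K := algebraMap (AR n) K
  let γ : ℂ →+* K := φ.comp MvPolynomial.C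
  have hp : Spec.map (CommRingCat.ofHom φ) (fieldPt K) = p := by
    apply PrimeSpectrum.ext
    change RingHom.ker φ = p.asIdeal
    exact Ideal.ker_algebraMap_residueField _
  -- the levels and coordinates along the sorted sequence of homogeneous coordinates
  have hex : ∀ m : ℕ, ∃ (l : ℕ → ℤ) (a : ℕ → Kˣ), ∀ k (hk : k < n), k < m →
      (φ (MvPolynomial.X ⟨k, hk⟩) = 0 → l (k + 1) < l k) ∧
      (φ (MvPolynomial.X ⟨k, hk⟩) ≠ 0 → l (k + 1) = l k ∧
        (a k : K) = φ (MvPolynomial.X ⟨k, hk⟩) * a (k + 1)) := by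
    intro m
    induction m with
    | zero => exact ⟨0, 1, fun k _ h ↦ absurd h (by omega)⟩
    | succ m ih =>
      obtain ⟨l, a, h⟩ := ih
      by_cases hm : m < n
      · by_cases h0 : φ (MvPolynomial.X ⟨m, hm⟩) = 0
        · refine ⟨Function.update l (m + 1) (l m - 1), a, fun k hk hkm ↦ ?_⟩
          rcases Nat.lt_succ_iff_lt_or_eq.1 hkm with h1 | rfl
          · have := h k hk h1
            rwa [Function.update_of_ne (by omega), Function.update_of_ne (by omega)]
          · rw [Function.update_self, Function.update_of_ne (by omega)]
            exact ⟨fun _ ↦ by omega, fun h1 ↦ absurd h0 h1⟩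
        · refine ⟨Function.update l (m + 1) (l m),
            Function.update a (m + 1) (a m / Units.mk0 _ h0), fun k hk hkm ↦ ?_⟩
          rcases Nat.lt_succ_iff_lt_or_eq.1 hkm with h1 | rfl
          · have := h k hk h1
            rwa [Function.update_of_ne (by omega), Function.update_of_ne (by omega),
              Function.update_of_ne (by omega), Function.update_of_ne (by omega)]
          · rw [Function.update_self, Function.update_of_ne (by omega), Function.update_self,
              Function.update_of_ne (by omega)]
            refine ⟨fun h1 ↦ absurd h1 h0, fun _ ↦ ⟨rfl, ?_⟩⟩
            rw [Units.val_div_eq_div_val, Units.val_mk0, mul_div_assoc',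
              mul_div_cancel_left₀ _ h0]
      · exact ⟨l, a, fun k hk hkm ↦ h k hk (by omega)⟩
  obtain ⟨l, a, hla⟩ := hex n
  have hla' : ∀ k : Fin n, (φ (MvPolynomial.X k) = 0 → l (k + 1) < l k) ∧
      (φ (MvPolynomial.X k) ≠ 0 → l (k + 1) = l k ∧
        (a k : K) = φ (MvPolynomial.X k) * a (k + 1)) := fun k ↦ hla k k.2 k.2
  have key : ∀ p p' : Fin (n + 1), p ≤ p' → l p' ≤ l p ∧
      (l p = l p' → φ ((permChart σ).monomial (hw (σ p) - hw (σ p'))) * a p' = a p) ∧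
      (l p ≠ l p' → φ ((permChart σ).monomial (hw (σ p) - hw (σ p'))) = 0) := by
    intro p p' h
    induction p' using Fin.induction with
    | zero =>
      rw [Fin.le_zero_iff.1 h, sub_self, Chart.monomial_zero, map_one]
      simp
    | succ k ih =>
      rcases h.eq_or_lt with rfl | h
      · rw [sub_self, Chart.monomial_zero, map_one]
        simp
      · have h' := Fin.le_castSucc_iff.2 h
        obtain ⟨i1, i2, i3⟩ := ih h'
        have e : (hw (σ p) : Fin n → ℤ) - hw (σ k.succ) =
            (hw (σ p) - hw (σ k.castSucc)) + (permChart σ).E k :=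
          (sub_add_sub_cancel _ _ _).symm
        rw [e, Chart.monomial_add (nonneg_permChart σ (by simpa using h')) (by
          intro j
          rw [(permChart σ).dual]
          split_ifs <;> simp), map_mul, Chart.monomial_E]
        rw [Fin.val_castSucc] at i1 i2 i3
        rw [Fin.val_succ]
        obtain ⟨j1, j2⟩ := hla' k
        by_cases h0 : φ (MvPolynomial.X k) = 0
        · have := j1 h0
          exact ⟨by omega, fun h ↦ absurd h (by omega), fun _ ↦ by rw [h0, mul_zero]⟩
        · obtain ⟨j3, j4⟩ := j2 h0
          refine ⟨by omega, fun h ↦ ?_, fun h ↦ ?_⟩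
          · rw [← i2 (by omega), j4]
            ring
          · rw [i3 (by omega), zero_mul]
  refine ⟨K, inferInstance, γ, fun i ↦ l (σ.symm i), fun i ↦ a (σ.symm i), ?_⟩
  suffices h : Spec.map (CommRingCat.ofHom φ) ≫ (permChart σ).map =
      orbitPt γ (fun i ↦ l (σ.symm i)) fun i ↦ a (σ.symm i) by
    refine (congr_arg (permChart σ).map hp.symm).trans ?_
    rw [← Scheme.Hom.comp_apply, h]
    rfl
  refine hom_ext_of_ratios fun i j ↦ ?_
  rw [Category.assoc, Chart.map_q, orbitPt_q]
  refine PP.map_pt_eq rfl ?_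
  have hb : ∀ b : Fin 2, b = 0 ∨ b = 1 := by decide
  intro b b'
  change φ ((permChart σ).coords (i, j) (b : Fin 2)) * _ =
    φ ((permChart σ).coords (i, j) (b' : Fin 2)) * _
  rcases le_or_gt (σ.symm i) (σ.symm j) with h | h
  · have hc : (permChart σ).c (i, j) = (1 : Fin 2) := if_pos h
    have e0 : (permChart σ).coords (i, j) (0 : Fin 2) = (permChart σ).monomial (hw i - hw j) := by
      unfold Chart.coords
      rw [hc]
      rfl
    have e1 : (permChart σ).coords (i, j) (1 : Fin 2) = 1 := by
      unfold Chart.coords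
      rw [hc, sub_self, Chart.monomial_zero]
    obtain ⟨k1, k2, k3⟩ := key _ _ h
    rw [Equiv.apply_symm_apply, Equiv.apply_symm_apply] at k2 k3
    unfold limitRatio
    by_cases h1 : l (σ.symm i) = l (σ.symm j)
    · have := k2 h1
      rcases hb b with rfl | rfl <;> rcases hb b' with rfl | rfl <;> simp [e0, e1, h1, this]
    · have h2 : ¬ l (σ.symm i) ≤ l (σ.symm j) := by omega
      have := k3 h1
      rcases hb b with rfl | rfl <;> rcases hb b' with rfl | rfl <;> simp [e0, e1, h2, this]
  · have hc : (permChart σ).c (i, j) = (0 : Fin 2) := if_neg (not_le.2 h)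
    have e0 : (permChart σ).coords (i, j) (1 : Fin 2) = (permChart σ).monomial (hw j - hw i) := by
      unfold Chart.coords
      rw [hc]
      rfl
    have e1 : (permChart σ).coords (i, j) (0 : Fin 2) = 1 := by
      unfold Chart.coords
      rw [hc, sub_self, Chart.monomial_zero]
    obtain ⟨k1, k2, k3⟩ := key _ _ h.le
    rw [Equiv.apply_symm_apply, Equiv.apply_symm_apply] at k2 k3
    unfold limitRatio
    by_cases h1 : l (σ.symm j) = l (σ.symm i)
    · have := k2 h1
      rcases hb b with rfl | rfl <;> rcases hb b' with rfl | rfl <;> simp [e0, e1, h1, this]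
    · have h2 : ¬ l (σ.symm j) ≤ l (σ.symm i) := by omega
      have := k3 h1
      rcases hb b with rfl | rfl <;> rcases hb b' with rfl | rfl <;> simp [e0, e1, h2, this]

end Orbits


open ToricData

/-! ### Specialization of limit points -/

section Specialization

variable {n : ℕ} {R K L : Type} [CommRing R]

/-- A base change of a morphism with given ratios of homogeneous coordinates. -/
lemma comp_eq_orbitPt [CommRing K] {γ : ℂ →+* R} {r : Fin (n + 1) → Fin (n + 1) → Prop}
    (htot : ∀ i j, r i j ∨ r j i) {x : Fin (n + 1) → Fin (n + 1) → R}
    {f : Spec (CommRingCat.of R) ⟶ (permData n).X}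
    (hf : ∀ i j, r i j →
      f ≫ (permData n).q (i, j) = PP.pt (ι := Fin 2) γ ![x i j, 1] 1 isUnit_one ∧
      f ≫ (permData n).q (j, i) = PP.pt (ι := Fin 2) γ ![1, x i j] 0 isUnit_one)
    (φ : R →+* K) {l : Fin (n + 1) → ℤ} {a : Fin (n + 1) → Kˣ}
    (H : ∀ i j, r i j → (l i = l j ∧ φ (x i j) * a j = a i) ∨ (l j < l i ∧ φ (x i j) = 0)) :
    Spec.map (CommRingCat.ofHom φ) ≫ f = orbitPt (φ.comp γ) l a := by
  have hb : ∀ b : Fin 2, b = 0 ∨ b = 1 := by decide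
  have key : ∀ i j, r i j → ∀ b b', (![φ (x i j), 1] : Fin 2 → K) b * limitRatio l a i j b' =
      (![φ (x i j), 1] : Fin 2 → K) b' * limitRatio l a i j b := by
    intro i j h b b'
    unfold limitRatio
    rcases H i j h with ⟨h1, h2⟩ | ⟨h1, h2⟩
    · rcases hb b with rfl | rfl <;> rcases hb b' with rfl | rfl <;> simp [h1, h2]
    · have : ¬ l i ≤ l j := by omega
      rcases hb b with rfl | rfl <;> rcases hb b' with rfl | rfl <;> simp [this, h2]
  refine hom_ext_of_ratios fun i j ↦ ?_
  rw [Category.assoc, orbitPt_q]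
  rcases htot i j with h | h
  · rw [(hf i j h).1]
    refine PP.map_pt_eq rfl fun b b' ↦ ?_
    have := key i j h b b'
    rcases hb b with rfl | rfl <;> rcases hb b' with rfl | rfl <;> first | rfl | simpa using this
  · rw [(hf j i h).2]
    refine PP.map_pt_eq rfl fun b b' ↦ ?_
    have := key j i h b b'
    have e : ∀ b, limitRatio l a j i b = limitRatio l a i j (b + 1) := by
      intro b
      unfold limitRatio
      rcases hb b with rfl | rfl <;> rfl
    have h2 := key j i h (b + 1) (b' + 1)
    rw [e, e] at h2
    rcases hb b with rfl | rfl <;> rcases hb b' with rfl | rfl <;> first | rfl | simpa using h2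

variable [Field K] [Field L]

/-- A criterion for specialization: the ratios of the homogeneous coordinates of the two points are
the images of fractions with a common numerator and denominator in the domain `R`. -/
lemma orbitPoint_specializes [IsDomain R] (γ : ℂ →+* R) (φ : R →+* L) (hφ : Function.Injective φ)
    (ψ : R →+* K) {l m : Fin (n + 1) → ℤ} {a : Fin (n + 1) → Lˣ} {b : Fin (n + 1) → Kˣ}
    (H : ∀ i j, m j ≤ m i → ∃ x x' : R, ψ x' ≠ 0 ∧
      ((l i = l j ∧ φ x * a j = φ x' * a i) ∨ (l j < l i ∧ x = 0)) ∧
      ((m i = m j ∧ ψ x * b j = ψ x' * b i) ∨ (m j < m i ∧ ψ x = 0))) :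
    orbitPoint (φ.comp γ) l a ⤳ orbitPoint (ψ.comp γ) m b := by
  classical
  -- both points are in the image of the spectrum of the local ring of `R` at `ker ψ`: the first one is
  -- the image of the generic point since `φ` is injective, the second one that of the closed point
  choose! x x' hx1 hx2 hx3 using H
  let P : Ideal R := RingHom.ker ψ
  have hP : P.IsPrime := RingHom.ker_isPrime ψ
  let S := Localization.AtPrime P
  have hmem : ∀ z : P.primeCompl, ψ z ≠ 0 := fun z ↦ z.2
  have hu : ∀ z : P.primeCompl, IsUnit (φ z) := by
    intro z
    refine isUnit_iff_ne_zero.2 fun h ↦ hmem z ?_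
    rw [← map_zero φ] at h
    rw [hφ h, map_zero]
  let φ' : S →+* L := IsLocalization.lift hu
  let ψ' : S →+* K := IsLocalization.lift (M := P.primeCompl) (g := ψ)
    fun z ↦ isUnit_iff_ne_zero.2 (hmem z)
  have hφ' : Function.Injective φ' := by
    rw [IsLocalization.lift_injective_iff]
    intro y z
    have h2 : Function.Injective (algebraMap R S) :=
      IsLocalization.injective S P.primeCompl_le_nonZeroDivisors
    exact ⟨fun h ↦ congr_arg φ (h2 h), fun h ↦ congr_arg _ (hφ h)⟩
  let y : Fin (n + 1) → Fin (n + 1) → S := fun i j ↦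
    if h : m j ≤ m i then IsLocalization.mk' S (x i j) (⟨x' i j, hx1 i j h⟩ : P.primeCompl) else 0
  have hy1 : ∀ i j, m j ≤ m i → (l i = l j ∧ φ' (y i j) * a j = a i) ∨
      (l j < l i ∧ φ' (y i j) = 0) := by
    intro i j h
    have hz : φ (x' i j) ≠ 0 := (hu ⟨x' i j, hx1 i j h⟩).ne_zero
    have e : φ' (y i j) = φ (x i j) / φ (x' i j) := by
      simp only [y, dif_pos h, φ']
      rw [IsLocalization.lift_mk'_spec, mul_div_cancel₀ _ hz]
    rcases hx2 i j h with ⟨h1, h2⟩ | ⟨h1, h2⟩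
    · refine .inl ⟨h1, ?_⟩
      rw [e, div_mul_eq_mul_div, h2, mul_div_cancel_left₀ _ hz]
    · exact .inr ⟨h1, by rw [e, h2, map_zero, zero_div]⟩
  have hy2 : ∀ i j, m j ≤ m i → (m i = m j ∧ ψ' (y i j) * b j = b i) ∨
      (m j < m i ∧ ψ' (y i j) = 0) := by
    intro i j h
    have hz : ψ (x' i j) ≠ 0 := hx1 i j h
    have e : ψ' (y i j) = ψ (x i j) / ψ (x' i j) := by
      simp only [y, dif_pos h, ψ']
      rw [IsLocalization.lift_mk'_spec, mul_div_cancel₀ _ hz]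
    rcases hx3 i j h with ⟨h1, h2⟩ | ⟨h1, h2⟩
    · refine .inl ⟨h1, ?_⟩
      rw [e, div_mul_eq_mul_div, h2, mul_div_cancel_left₀ _ hz]
    · exact .inr ⟨h1, by rw [e, h2, zero_div]⟩
  obtain ⟨f, hf⟩ := exists_permPoint ((algebraMap R S).comp γ) (fun i j ↦ m j ≤ m i)
    (fun i j ↦ le_total _ _) (fun i j k h h' ↦ h'.trans h) y
    (by
      intro i
      apply hφ'
      rcases hy1 i i le_rfl with ⟨-, h⟩ | ⟨h, -⟩
      · rw [map_one]
        exact (a i).isUnit.mul_right_cancel (h.trans (one_mul _).symm)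
      · exact absurd h (lt_irrefl _))
    (by
      intro i j k h h'
      apply hφ'
      rw [map_mul]
      rcases hy1 i j h with ⟨h1, h2⟩ | ⟨h1, h2⟩ <;> rcases hy1 j k h' with ⟨h3, h4⟩ | ⟨h3, h4⟩ <;>
        rcases hy1 i k (h'.trans h) with ⟨h5, h6⟩ | ⟨h5, h6⟩ <;> try omega
      · apply (a k).isUnit.mul_right_cancel
        rw [mul_assoc, h4, h2, h6]
      · rw [h4, h6, mul_zero]
      · rw [h2, h6, zero_mul]
      · rw [h2, h6, zero_mul])
  have e1 := comp_eq_orbitPt (fun i j ↦ le_total (m j) (m i)) hf φ' hy1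
  have e2 := comp_eq_orbitPt (fun i j ↦ le_total (m j) (m i)) hf ψ' hy2
  have hφc : φ'.comp ((algebraMap R S).comp γ) = φ.comp γ := by
    rw [← RingHom.comp_assoc, IsLocalization.lift_comp]
  have hψc : ψ'.comp ((algebraMap R S).comp γ) = ψ.comp γ := by
    rw [← RingHom.comp_assoc, IsLocalization.lift_comp]
  rw [hφc] at e1
  rw [hψc] at e2
  unfold orbitPoint
  rw [← e1, ← e2, Scheme.Hom.comp_apply, Scheme.Hom.comp_apply]
  refine Specializes.map ?_ f.continuous
  refine (PrimeSpectrum.le_iff_specializes _ _).1 ?_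
  intro z hz
  have h1 : φ' z = 0 := mem_fieldPt.1 hz
  rw [hφ' (h1.trans (map_zero φ').symm)]
  exact Ideal.zero_mem _

end Specialization

/-! ### Symmetries of the permutohedral variety -/

section Symmetries

variable {n : ℕ} {K : Type} [Field K]

/-- Morphisms of the permutohedral variety given by endomorphisms of the character lattice. -/
lemma exists_permHom (A : (Fin n → ℤ) →+ (Fin n → ℤ))
    (τ : Fin (n + 1) × Fin (n + 1) → Fin (n + 1) × Fin (n + 1))
    (w : Fin (n + 1) × Fin (n + 1) → Fin n → ℤ)
    (h : ∀ (k : Fin (n + 1) × Fin (n + 1)) (b : Fin 2), A ((![hw k.1, hw k.2] : Fin 2 → Fin n → ℤ) b) =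
      (![hw (τ k).1, hw (τ k).2] : Fin 2 → Fin n → ℤ) b + w k) :
    ∃ z : (permData n).X ⟶ (permData n).X, ∀ k : Fin (n + 1) × Fin (n + 1),
      z ≫ (permData n).q k = (permData n).q (τ k) := by
  let ρ : TR n →+* TR n := AddMonoidAlgebra.mapDomainRingHom ℂ A
  have hmono : ∀ m, ρ (mono m) = mono (A m) := fun m ↦ AddMonoidAlgebra.mapDomain_single
  have hC : ρ.comp (algebraMap ℂ (TR n)) = algebraMap ℂ (TR n) := by
    refine RingHom.ext fun r ↦ ?_
    change AddMonoidAlgebra.mapDomain _ (AddMonoidAlgebra.single 0 r) = AddMonoidAlgebra.single 0 r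
    rw [AddMonoidAlgebra.mapDomain_single, map_zero]
  obtain ⟨z, hz, -⟩ := exists_lift (D := permData n) (permData n).torus
    (Spec.map (CommRingCat.ofHom ρ)) (fun k ↦ (permData n).q (τ k)) (by
      intro k
      rw [torus_q]
      refine (PP.map_pt_eq hC ?_).symm
      intro b b'
      have h1 := (hmono _).trans (congr_arg mono (h k b))
      have h2 := (hmono _).trans (congr_arg mono (h k b'))
      rw [mono_add] at h1 h2
      refine (congr_arg (· * _) h1).trans (Eq.trans ?_ (congr_arg (· * _) h2).symm)
      ring)
  exact ⟨z, hz⟩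

lemma exists_permHom_perm (π : Equiv.Perm (Fin (n + 1))) :
    ∃ z : (permData n).X ⟶ (permData n).X, ∀ i j : Fin (n + 1),
      z ≫ (permData n).q (i, j) = (permData n).q (π i, π j) := by
  obtain ⟨z, hz⟩ := exists_permHom
    (Fintype.linearCombination ℤ fun k : Fin n ↦ (hw (π k.succ) - hw (π 0) : Fin n → ℤ)).toAddMonoidHom
    (fun k ↦ (π k.1, π k.2)) (fun _ ↦ - hw (π 0)) (by
      have h : ∀ i : Fin (n + 1), Fintype.linearCombination ℤ
          (fun k : Fin n ↦ (hw (π k.succ) - hw (π 0) : Fin n → ℤ)) (hw i) =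
            hw (π i) + - hw (π 0) := by
        intro i
        induction i using Fin.cases with
        | zero => simp [hw]
        | succ i =>
          rw [show (hw i.succ : Fin n → ℤ) = Pi.single i 1 from Fin.cons_succ _ _ _,
            Fintype.linearCombination_apply_single, one_smul, sub_eq_add_neg]
      intro k b
      have hb : ∀ b : Fin 2, b = 0 ∨ b = 1 := by decide
      rcases hb b with rfl | rfl <;> exact h _)
  exact ⟨z, fun i j ↦ hz (i, j)⟩

lemma exists_permHom_inv :
    ∃ z : (permData n).X ⟶ (permData n).X, ∀ i j : Fin (n + 1),
      z ≫ (permData n).q (i, j) = (permData n).q (j, i) := by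
  obtain ⟨z, hz⟩ := exists_permHom (n := n) (-(AddMonoidHom.id _))
    (fun k ↦ (k.2, k.1)) (fun k ↦ - (hw k.1 + hw k.2)) (by
      intro k b
      have hb : ∀ b : Fin 2, b = 0 ∨ b = 1 := by decide
      rcases hb b with rfl | rfl
      · change - hw k.1 = hw k.2 + - (hw k.1 + hw k.2)
        abel
      · change - hw k.2 = hw k.1 + - (hw k.1 + hw k.2)
        abel)
  exact ⟨z, fun i j ↦ hz (i, j)⟩

/-- The permutation of the homogeneous coordinates of the torus, as an automorphism of the
permutohedral variety. -/
def permIso (π : Equiv.Perm (Fin (n + 1))) : (permData n).X ≅ (permData n).X where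
  hom := (exists_permHom_perm π).choose
  inv := (exists_permHom_perm π⁻¹).choose
  hom_inv_id := hom_ext_of_ratios' fun i j ↦ by
    rw [Category.assoc, (exists_permHom_perm π⁻¹).choose_spec, (exists_permHom_perm π).choose_spec,
      Category.id_comp]
    exact q_congr (π.apply_symm_apply _) (π.apply_symm_apply _)
  inv_hom_id := hom_ext_of_ratios' fun i j ↦ by
    rw [Category.assoc, (exists_permHom_perm π).choose_spec,
      (exists_permHom_perm π⁻¹).choose_spec, Category.id_comp]
    exact q_congr (π.symm_apply_apply _) (π.symm_apply_apply _)
where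
  hom_ext_of_ratios' {f g : (permData n).X ⟶ (permData n).X}
    (H : ∀ i j, f ≫ (permData n).q (i, j) = g ≫ (permData n).q (i, j)) : f = g :=
  (permData n).jointlyMono f g fun k ↦ H k.1 k.2
  q_congr {i j i' j' : Fin (n + 1)} (hi : i = i') (hj : j = j') :
      ((permData n).q (i, j) : (permData n).X ⟶ PP (Fin 2)) = (permData n).q (i', j') := by
    rw [hi, hj]

lemma permIso_q (π : Equiv.Perm (Fin (n + 1))) (i j : Fin (n + 1)) :
    (permIso π).hom ≫ (permData n).q (i, j) = (permData n).q (π i, π j) :=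
  (exists_permHom_perm π).choose_spec i j

variable (n) in
/-- The inversion of the torus, as an automorphism of the permutohedral variety. -/
def invIso : (permData n).X ≅ (permData n).X where
  hom := exists_permHom_inv.choose
  inv := exists_permHom_inv.choose
  hom_inv_id := (permData n).jointlyMono _ _ fun k ↦ by
    rw [Category.assoc]
    refine (congr_arg (_ ≫ ·) (exists_permHom_inv.choose_spec k.1 k.2)).trans ?_
    exact (exists_permHom_inv.choose_spec k.2 k.1).trans (Category.id_comp _).symm
  inv_hom_id := (permData n).jointlyMono _ _ fun k ↦ by
    rw [Category.assoc]
    refine (congr_arg (_ ≫ ·) (exists_permHom_inv.choose_spec k.1 k.2)).trans ?_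
    exact (exists_permHom_inv.choose_spec k.2 k.1).trans (Category.id_comp _).symm

lemma invIso_q (i j : Fin (n + 1)) :
    (invIso n).hom ≫ (permData n).q (i, j) = (permData n).q (j, i) :=
  exists_permHom_inv.choose_spec i j

lemma permIso_orbitPoint (π : Equiv.Perm (Fin (n + 1))) (γ : ℂ →+* K) (l : Fin (n + 1) → ℤ)
    (a : Fin (n + 1) → Kˣ) : (permIso π).hom (orbitPoint γ l a) = orbitPoint γ (l ∘ π) (a ∘ π) := by
  unfold orbitPoint
  rw [← Scheme.Hom.comp_apply]
  congr 1
  rw [eq_orbitPt (f := orbitPt γ l a ≫ (permIso π).hom)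
    (y := fun i j ↦ limitRatio l a (π i) (π j)) (c := fun i j ↦ limitIndex l (π i) (π j))
    (hu := fun i j ↦ isUnit_limitRatio l a _ _) (γ := γ) (l := l ∘ π) (a := a ∘ π)]
  · intro i j
    rw [Category.assoc, permIso_q, orbitPt_q]
  · intro i j b b'
    exact mul_comm _ _

lemma invIso_orbitPoint (γ : ℂ →+* K) (l : Fin (n + 1) → ℤ) (a : Fin (n + 1) → Kˣ) :
    (invIso n).hom (orbitPoint γ l a) = orbitPoint γ (-l) a⁻¹ := by
  unfold orbitPoint
  rw [← Scheme.Hom.comp_apply]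
  congr 1
  rw [eq_orbitPt (f := orbitPt γ l a ≫ (invIso n).hom)
    (y := fun i j ↦ limitRatio l a j i) (c := fun i j ↦ limitIndex l j i)
    (hu := fun i j ↦ isUnit_limitRatio l a _ _) (γ := γ) (l := -l) (a := a⁻¹)]
  · intro i j
    rw [Category.assoc, invIso_q, orbitPt_q]
  · intro i j b b'
    have hb : ∀ b : Fin 2, b = 0 ∨ b = 1 := by decide
    unfold limitRatio
    by_cases h1 : l i ≤ l j <;> by_cases h2 : l j ≤ l i <;>
    rcases hb b with rfl | rfl <;> rcases hb b' with rfl | rfl <;> simp [h1, h2]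

lemma pushforward_closure_singleton {X Y : Scheme.{0}} (φ : X ≅ Y) (k : ℕ) (x : X) :
    pushforward φ k (fundClass k (closure {x})) = fundClass k (closure {φ.hom x}) := by
  have h : closure {x} = φ.hom ⁻¹' closure {φ.hom x} := by
    have := (Scheme.homeoOfIso φ).preimage_closure {φ.hom x}
    refine Eq.trans ?_ this.symm
    congr 1
    ext z
    exact ((Scheme.homeoOfIso φ).injective.eq_iff (a := z) (b := x)).symm
  rw [h, pushforward_fundClass]

end Symmetries

/-! ### Classes of curves -/

section Classes

/-- The field of rational functions in one variable, over which generic points of curves are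
defined. -/
abbrev FF : Type := RatFunc ℂ

/-- The variable of the function field. -/
def FF.s : FFˣ := Units.mk0 RatFunc.X RatFunc.X_ne_zero

/-- The constants of the function field. -/
def FF.c : ℂˣ →* FFˣ := Units.map (algebraMap ℂ FF).toMonoidHom

/-- A nonconstant rational function. -/
def FF.Nonconst (y : FF) : Prop := ∀ z : ℂ, algebraMap ℂ FF z ≠ y

/-- The substitution of a nonconstant rational function for the variable. -/
lemma FF.exists_subst {y : FF} (hy : FF.Nonconst y) :
    ∃ φ : FF →+* FF, φ.comp (algebraMap ℂ FF) = algebraMap ℂ FF ∧ φ FF.s = y := by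
  have ht : Transcendental ℂ y := by
    intro h
    have h1 : (minpoly ℂ y).degree = 1 :=
      IsAlgClosed.degree_eq_one_of_irreducible ℂ (minpoly.irreducible h.isIntegral)
    obtain ⟨z, hz⟩ := minpoly.mem_range_of_degree_eq_one ℂ y h1
    exact hy z hz
  have hinj : Function.Injective (Polynomial.aeval (R := ℂ) y) :=
    transcendental_iff_injective.1 ht
  have hle := nonZeroDivisors_le_comap_nonZeroDivisors_of_injective _ hinj
  let φ : FF →ₐ[ℂ] FF := RatFunc.liftAlgHom (Polynomial.aeval y) hle
  refine ⟨φ, φ.comp_algebraMap, ?_⟩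
  change RatFunc.liftAlgHom (Polynomial.aeval y) hle RatFunc.X = y
  rw [← RatFunc.algebraMap_X, RatFunc.liftAlgHom_apply, RatFunc.num_algebraMap,
    RatFunc.denom_algebraMap, map_one, div_one, Polynomial.aeval_X]

lemma FF.nonconst_zpow {k : ℤ} (hk : k ≠ 0) : FF.Nonconst ((FF.s ^ k : FFˣ) : FF) := by
  have key : ∀ m : ℕ, m ≠ 0 → FF.Nonconst ((RatFunc.X : FF) ^ m) := by
    intro m hm z hz
    have h1 : algebraMap (Polynomial ℂ) FF (Polynomial.C z) =
        algebraMap (Polynomial ℂ) FF (Polynomial.X ^ m) := by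
      rw [map_pow, RatFunc.algebraMap_X, ← hz, RatFunc.algebraMap_C]
      rfl
    have h2 := congr_arg Polynomial.natDegree (RatFunc.algebraMap_injective ℂ h1)
    rw [Polynomial.natDegree_C, Polynomial.natDegree_X_pow] at h2
    exact hm h2.symm
  obtain ⟨m, rfl | rfl⟩ := Int.eq_nat_or_neg k
  · have := key m (by omega)
    simpa [FF.s] using this
  · intro z hz
    refine key m (by omega) z⁻¹ ?_
    rw [map_inv₀, hz]
    simp [FF.s]

/-- The class of the closure of a limit point. -/
def orbitClass (l : Fin 4 → ℤ) (a : Fin 4 → FFˣ) : Chow (permData 3).X 1 :=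
  fundClass 1 (closure {orbitPoint (algebraMap ℂ FF) l a})

lemma orbitClass_eq {l l' : Fin 4 → ℤ} {a a' : Fin 4 → FFˣ} {y : FF} (hy : FF.Nonconst y)
    (hl : ∀ i j, l i ≤ l j ↔ l' i ≤ l' j)
    (ha : ∀ φ : FF →+* FF, φ FF.s = y → (∀ z, φ (algebraMap ℂ FF z) = algebraMap ℂ FF z) →
      ∀ i j, l i = l j → φ (a i) * a' j = φ (a j) * a' i) :
    orbitClass l a = orbitClass l' a' := by
  obtain ⟨φ, h1, h2⟩ := FF.exists_subst hy
  unfold orbitClass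
  rw [orbitPoint_eq φ h1 hl (ha φ h2 fun z ↦ RingHom.congr_fun h1 z)]

lemma pushforward_permIso_orbitClass (π : Equiv.Perm (Fin 4)) (l : Fin 4 → ℤ) (a : Fin 4 → FFˣ) :
    pushforward (permIso π) 1 (orbitClass l a) = orbitClass (l ∘ π) (a ∘ π) := by
  unfold orbitClass
  rw [pushforward_closure_singleton, permIso_orbitPoint]

lemma pushforward_invIso_orbitClass (l : Fin 4 → ℤ) (a : Fin 4 → FFˣ) :
    pushforward (invIso 3) 1 (orbitClass l a) = orbitClass (-l) a⁻¹ := by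
  unfold orbitClass
  rw [pushforward_closure_singleton, invIso_orbitPoint]

end Classes


/-! ### Orders of vanishing on affine charts -/

section Order

variable {X : Scheme.{0}} {R : Type} [CommRing R] (h : Spec (CommRingCat.of R) ⟶ X)
  [IsOpenImmersion h]

/-- The localization homomorphism from the coordinate ring of an affine chart to the stalk at a
point. -/
def stalkHom (p : Spec (CommRingCat.of R)) : CommRingCat.of R ⟶ X.presheaf.stalk (h p) :=
  let i := inv (h.stalkMap p)
  StructureSheaf.toStalk R p ≫ i

lemma spec_stalkHom (p : Spec (CommRingCat.of R)) :
    Spec.map (stalkHom h p) ≫ h = X.fromSpecStalk (h p) := by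
  have h1 := Scheme.SpecMap_stalkMap_fromSpecStalk h (x := p)
  rw [Spec.fromSpecStalk_eq'] at h1
  have key : ∀ i, h.stalkMap p ≫ i = 𝟙 (X.presheaf.stalk (h p)) →
      Spec.map (StructureSheaf.toStalk R p ≫ i) ≫ h = X.fromSpecStalk (h p) := by
    intro i hi
    refine (congr_arg (· ≫ h) (Spec.map_comp _ _)).trans ?_
    refine (Category.assoc _ _ _).trans ?_
    refine (congr_arg (Spec.map i ≫ ·) h1.symm).trans ?_
    rw [← Category.assoc, ← Spec.map_comp, hi, Spec.map_id, Category.id_comp]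
  exact key _ (IsIso.hom_inv_id _)

lemma isUnit_stalkHom_iff (p : Spec (CommRingCat.of R)) (a : R) :
    IsUnit ((stalkHom h p).hom a) ↔ a ∉ PrimeSpectrum.asIdeal p := by
  have e : (stalkHom h p).hom a = (inv (h.stalkMap p)).hom ((StructureSheaf.toStalk R p).hom a) :=
    rfl
  rw [e]
  have h1 : IsUnit ((inv (h.stalkMap p)).hom ((StructureSheaf.toStalk R p).hom a)) ↔
      IsUnit ((StructureSheaf.toStalk R p).hom a) := by
    refine ⟨fun hu ↦ ?_, fun hu ↦ hu.map _⟩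
    have h2 : ∀ z, (h.stalkMap p).hom ((inv (h.stalkMap p)).hom z) = z := by
      intro z
      rw [← CommRingCat.comp_apply, IsIso.inv_hom_id]
      rfl
    have := hu.map (h.stalkMap p).hom
    exact Eq.mp (congr_arg IsUnit (h2 ((StructureSheaf.toStalk R p).hom a))) this
  rw [h1]
  have hp : (PrimeSpectrum.asIdeal p).IsPrime := PrimeSpectrum.isPrime p
  let _ : Algebra R ((Spec (CommRingCat.of R)).presheaf.stalk p) :=
    (StructureSheaf.toStalk R p).hom.toAlgebra
  have : IsLocalization.AtPrime ((Spec (CommRingCat.of R)).presheaf.stalk p)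
    (PrimeSpectrum.asIdeal p) := StructureSheaf.IsLocalization.to_stalk R p
  exact IsLocalization.AtPrime.isUnit_to_map_iff
    ((Spec (CommRingCat.of R)).presheaf.stalk p) (PrimeSpectrum.asIdeal p) a

lemma exists_stalkHom_mul_eq (p : Spec (CommRingCat.of R)) (z : X.presheaf.stalk (h p)) :
    ∃ a b : R, b ∉ PrimeSpectrum.asIdeal p ∧ z * (stalkHom h p).hom b = (stalkHom h p).hom a := by
  have hp : (PrimeSpectrum.asIdeal p).IsPrime := PrimeSpectrum.isPrime p
  let _ : Algebra R ((Spec (CommRingCat.of R)).presheaf.stalk p) :=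
    (StructureSheaf.toStalk R p).hom.toAlgebra
  have : IsLocalization.AtPrime ((Spec (CommRingCat.of R)).presheaf.stalk p)
    (PrimeSpectrum.asIdeal p) := StructureSheaf.IsLocalization.to_stalk R p
  obtain ⟨⟨a, b⟩, hab⟩ := IsLocalization.surj (PrimeSpectrum.asIdeal p).primeCompl
    (S := (Spec (CommRingCat.of R)).presheaf.stalk p) ((h.stalkMap p).hom z)
  refine ⟨a, b, b.2, ?_⟩
  have h1 := congr_arg (inv (h.stalkMap p)).hom hab
  have h2 : (inv (h.stalkMap p)).hom ((h.stalkMap p).hom z) = z := by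
    rw [← CommRingCat.comp_apply, IsIso.hom_inv_id]
    rfl
  rw [map_mul, h2] at h1
  exact h1

lemma coheight_chart (p : Spec (CommRingCat.of R)) :
    Order.coheight (h p) = (PrimeSpectrum.asIdeal p).height := by
  rw [idealHeight_eq_coheight (CommRingCat.of R) p]
  exact coheight_eq_of_isOpenImmersion h

variable [IsIntegral X] [Nonempty (Spec (CommRingCat.of R))]

lemma range_fromSpecStalk_subset :
    Set.range (X.fromSpecStalk (genericPoint X)) ⊆ Set.range h := by
  rw [Scheme.range_fromSpecStalk]
  intro y hy
  have h1 : genericPoint X ∈ h.opensRange := by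
    obtain ⟨p⟩ := ‹Nonempty (Spec (CommRingCat.of R))›
    exact ((genericPoint_spec X).specializes (Set.mem_univ (h p))).mem_open h.opensRange.2 ⟨p, rfl⟩
  exact hy.mem_open h.opensRange.2 h1

/-- The homomorphism from the coordinate ring of an affine chart to the function field. -/
def functionFieldHom : R →+* X.functionField :=
  (Spec.preimage (IsOpenImmersion.lift h _ (range_fromSpecStalk_subset h))).hom

lemma spec_functionFieldHom : Spec.map (CommRingCat.ofHom (functionFieldHom h)) ≫ h =
    X.fromSpecStalk (genericPoint X) := by
  have : Spec.map (CommRingCat.ofHom (functionFieldHom h)) =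
    IsOpenImmersion.lift h _ (range_fromSpecStalk_subset h) := Spec.map_preimage _
  rw [this, IsOpenImmersion.lift_fac]

lemma functionFieldHom_comp {S : Type} [CommRing S] [Nonempty (Spec (CommRingCat.of S))]
    {j : Spec (CommRingCat.of S) ⟶ X} [IsOpenImmersion j] {θ : R →+* S}
    (hj : Spec.map (CommRingCat.ofHom θ) ≫ h = j) :
    (functionFieldHom j).comp θ = functionFieldHom h := by
  have h1 : Spec.map (CommRingCat.ofHom ((functionFieldHom j).comp θ)) =
      Spec.map (CommRingCat.ofHom (functionFieldHom h)) := by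
    rw [← cancel_mono h, spec_functionFieldHom, CommRingCat.ofHom_comp, Spec.map_comp,
      Category.assoc, hj, spec_functionFieldHom]
  exact congr_arg CommRingCat.Hom.hom (Spec.map_injective h1)

lemma algebraMap_stalkHom (p : Spec (CommRingCat.of R)) (a : R) :
    algebraMap (X.presheaf.stalk (h p)) X.functionField ((stalkHom h p).hom a) =
      functionFieldHom h a := by
  have h1 : stalkHom h p ≫ X.presheaf.stalkSpecializes
      ((genericPoint_spec X).specializes (Set.mem_univ (h p))) =
      CommRingCat.ofHom (functionFieldHom h) := by
    apply Spec.map_injective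
    rw [← cancel_mono h]
    refine Eq.trans ?_ (spec_functionFieldHom h).symm
    rw [Spec.map_comp, Category.assoc, spec_stalkHom]
    exact Scheme.SpecMap_stalkSpecializes_fromSpecStalk _
  exact congr_arg (fun φ ↦ φ.hom a) h1

lemma functionFieldHom_injective [IsDomain R] : Function.Injective (functionFieldHom h) := by
  rw [injective_iff_map_eq_zero]
  intro a ha
  let p : Spec (CommRingCat.of R) := (⊥ : PrimeSpectrum R)
  rw [← algebraMap_stalkHom h p] at ha
  have h1 := IsFractionRing.injective (X.presheaf.stalk (h p)) X.functionField
    (ha.trans (map_zero _).symm)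
  by_contra h2
  have h3 : IsUnit ((stalkHom h p).hom a) := (isUnit_stalkHom_iff h p a).2 fun h4 ↦ h2 h4
  rw [h1] at h3
  exact h3.ne_zero rfl

variable [IsLocallyNoetherian X]

lemma ord_functionFieldHom_of_notMem [IsDomain R] {p : Spec (CommRingCat.of R)} {a : R}
    (ha : a ∉ PrimeSpectrum.asIdeal p) : Scheme.ord (functionFieldHom h a) (h p) = 0 := by
  by_cases hz : Order.coheight (h p) = 1
  · have ha0 : functionFieldHom h a ≠ 0 := by
      intro h1
      rw [functionFieldHom_injective h (h1.trans (map_zero _).symm)] at ha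
      exact ha (Ideal.zero_mem _)
    rw [Scheme.ord_eq_iff hz ha0, ← algebraMap_stalkHom h p]
    have : Ring.KrullDimLE 1 (X.presheaf.stalk (h p)) := krullDimLE_of_coheight_le hz.le
    exact Ring.ordFrac_of_isUnit ((isUnit_stalkHom_iff h p a).2 ha)
  · exact Scheme.ord_eq_zero_of_coheight_neq_one hz _

open Classical in
/-- The order of vanishing of a prime element of the coordinate ring of a chart. -/
lemma ord_functionFieldHom_prime [IsDomain R] [IsNoetherianRing R] (p : Spec (CommRingCat.of R))
    {Q : R} (hQ : Prime Q) : Scheme.ord (functionFieldHom h Q) (h p) =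
      if PrimeSpectrum.asIdeal p = Ideal.span {Q} then 1 else 0 := by
  have hQ0 : functionFieldHom h Q ≠ 0 := fun h1 ↦
    hQ.ne_zero (functionFieldHom_injective h (h1.trans (map_zero _).symm))
  split_ifs with hp
  · have hz : Order.coheight (h p) = 1 := by
      rw [coheight_chart, hp]
      exact Ideal.height_span_singleton_eq_one_of_mem_nonZeroDivisors
        (mem_nonZeroDivisors_of_ne_zero hQ.ne_zero) hQ.2.1
    have hm : IsLocalRing.maximalIdeal (X.presheaf.stalk (h p)) =
        Ideal.span {(stalkHom h p).hom Q} := by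
      apply le_antisymm
      · intro z hz
        obtain ⟨a, b, hb, e⟩ := exists_stalkHom_mul_eq h p z
        have hbu := (isUnit_stalkHom_iff h p b).2 hb
        have ha : a ∈ PrimeSpectrum.asIdeal p := by
          by_contra ha
          rw [← isUnit_stalkHom_iff h p a, ← e] at ha
          exact hz (isUnit_of_mul_isUnit_left ha)
        rw [hp] at ha
        obtain ⟨c, rfl⟩ := Ideal.mem_span_singleton.1 ha
        rw [← Ideal.mul_unit_mem_iff_mem _ hbu, e, map_mul]
        exact Ideal.mul_mem_right _ _ (Ideal.mem_span_singleton_self _)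
      · rw [Ideal.span_singleton_le_iff_mem]
        change ¬ IsUnit _
        rw [isUnit_stalkHom_iff, not_not, hp]
        exact Ideal.mem_span_singleton_self _
    have hne : (stalkHom h p).hom Q ≠ 0 := by
      intro h1
      rw [← algebraMap_stalkHom h p, h1, map_zero] at hQ0
      exact hQ0 rfl
    have hf : ¬ IsField (X.presheaf.stalk (h p)) := by
      rw [IsLocalRing.isField_iff_maximalIdeal_eq, hm, Ideal.span_singleton_eq_bot]
      exact hne
    have : IsDiscreteValuationRing (X.presheaf.stalk (h p)) :=
      ((IsDiscreteValuationRing.TFAE (X.presheaf.stalk (h p)) hf).out 4 0).1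
        (⟨⟨_, hm⟩⟩ : (IsLocalRing.maximalIdeal (X.presheaf.stalk (h p))).IsPrincipal)
    have hirr := (IsDiscreteValuationRing.irreducible_iff_uniformizer
      ((stalkHom h p).hom Q)).2 hm
    rw [Scheme.ord_eq_iff hz hQ0, ← algebraMap_stalkHom h p]
    exact Ring.ordFrac_irreducible hirr
  · by_cases hQp : Q ∈ PrimeSpectrum.asIdeal p
    · refine Scheme.ord_eq_zero_of_coheight_neq_one (fun hz ↦ hp ?_) _
      rw [coheight_chart] at hz
      have := p.2
      exact Ideal.eq_span_singleton_of_height_eq_one hz hQp hQ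
    · exact ord_functionFieldHom_of_notMem h hQp

end Order


open ToricData

/-! ### Dimension of toric varieties -/

namespace ToricData

section Global

variable {n : ℕ} {D : ToricData n} {V : Type} {C : V → D.Chart}

lemma isLocallyNoetherian (hC : ∀ y, ∃ v, y ∈ Set.range (C v).map) : IsLocallyNoetherian D.X := by
  let 𝒰 : D.X.OpenCover := Scheme.Cover.mkOfCovers V (fun _ ↦ Spec (CommRingCat.of (AR n)))
    (fun v ↦ (C v).map) hC
  rw [isLocallyNoetherian_iff_openCover 𝒰]
  intro v
  exact inferInstanceAs (IsLocallyNoetherian (Spec (CommRingCat.of (AR n))))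

/-- Separatedness, by the valuative criterion: a morphism from an integral scheme to a toric variety
is determined by its restriction to the generic point. -/
lemma isSeparated (hC : ∀ y, ∃ v, y ∈ Set.range (C v).map) : D.X.IsSeparated := by
  have := isLocallyNoetherian hC
  refine ⟨IsSeparated.of_valuativeCriterion _ fun S ↦ ⟨?_⟩⟩
  rintro ⟨l₁, h₁, h₁'⟩ ⟨l₂, h₂, h₂'⟩
  have : IsDominant (Spec.map (CommRingCat.ofHom (algebraMap S.R S.K))) := by
    constructor
    exact (PrimeSpectrum.denseRange_comap_iff_ker_le_nilRadical (algebraMap S.R S.K)).2 (by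
      rw [(RingHom.injective_iff_ker_eq_bot _).1 (IsFractionRing.injective S.R S.K)]
      exact bot_le)
  have e : l₁ = l₂ := ext_of_dominant (Spec.map (CommRingCat.ofHom (algebraMap S.R S.K)))
    (h₁.trans h₂.symm)
  subst e
  rfl

lemma krullDim_le (hC : ∀ y, ∃ v, y ∈ Set.range (C v).map) : Order.krullDim D.X ≤ n := by
  rw [Order.krullDim_eq_iSup_coheight]
  refine iSup_le fun x ↦ ?_
  obtain ⟨v, p, rfl⟩ := hC x
  rw [coheight_chart]
  have h1 : ringKrullDim (AR n) = n := by
    rw [MvPolynomial.ringKrullDim_of_isNoetherianRing, ringKrullDim_eq_zero_of_field]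
    simp
  have := PrimeSpectrum.isPrime p
  rw [← h1]
  exact Ideal.height_le_ringKrullDim_of_ne_top this.ne_top

lemma height_add_coheight_le (hC : ∀ y, ∃ v, y ∈ Set.range (C v).map) (x : D.X) :
    Order.height x + Order.coheight x ≤ n := by
  have h1 := krullDim_le hC
  have : Nonempty D.X := ⟨x⟩
  rw [Order.krullDim_eq_iSup_height_add_coheight_of_nonempty] at h1
  have h2 : ⨆ a : D.X, Order.height a + Order.coheight a ≤ (n : ℕ∞) := by exact_mod_cast h1
  exact (le_iSup (fun a : D.X ↦ Order.height a + Order.coheight a) x).trans h2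

end Global

end ToricData

/-- A closed immersion preserves the dimension of points. -/
lemma height_closedImmersion {X Y : Scheme.{0}} (g : X ⟶ Y) [IsClosedImmersion g] (x : X) :
    Order.height (g x) = Order.height x := by
  have hle : ∀ a b : X, g a ≤ g b ↔ a ≤ b := fun a b ↦
    g.isClosedEmbedding.isInducing.specializes_iff
  symm
  refine Order.height_eq_of_strictMono g ?_ ?_ x
  · intro a b h
    rw [lt_iff_le_not_ge, hle, hle]
    exact lt_iff_le_not_ge.1 h
  · intro a b h
    obtain ⟨a', rfl⟩ : b ∈ Set.range g := by
      have h1 : g a ⤳ b := h.le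
      exact h1.mem_closed g.isClosedEmbedding.isClosed_range ⟨a, rfl⟩
    refine ⟨a', ?_, rfl⟩
    rw [lt_iff_le_not_ge, hle, hle] at h
    exact lt_iff_le_not_ge.2 h

/-! ### Curves in affine charts of surfaces -/

/-- The kernel of a homomorphism to a field extension of `ℂ` is not a maximal ideal if a
non-constant function is not mapped to a constant. -/
lemma ker_not_isMaximal {n : ℕ} {ev : AR n →+* FF}
    (hev : ∀ z, ev (MvPolynomial.C z) = algebraMap ℂ FF z) {t : AR n}
    (ht : FF.Nonconst (ev t)) : ¬ (RingHom.ker ev).IsMaximal := by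
  intro h
  obtain ⟨a, ha⟩ := (MvPolynomial.isMaximal_iff_eq_vanishingIdeal_singleton).1 h
  refine ht (MvPolynomial.eval a t) ?_
  have h1 : t - MvPolynomial.C (MvPolynomial.eval a t) ∈ RingHom.ker ev := by
    rw [ha]
    simp [MvPolynomial.mem_vanishingIdeal_iff]
  rw [RingHom.mem_ker, map_sub, hev, sub_eq_zero] at h1
  exact h1.symm

lemma exists_isMaximal_gt {ev : AR 2 →+* FF}
    (hev : ∀ z, ev (MvPolynomial.C z) = algebraMap ℂ FF z) {t : AR 2} (ht : FF.Nonconst (ev t)) :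
    ∃ m : Ideal (AR 2), m.IsMaximal ∧ RingHom.ker ev < m := by
  have hp : (RingHom.ker ev).IsPrime := RingHom.ker_isPrime ev
  obtain ⟨m, hm, hle⟩ := Ideal.exists_le_maximal _ hp.ne_top
  exact ⟨m, hm, lt_of_le_of_ne hle fun h ↦ ker_not_isMaximal hev ht (h ▸ hm)⟩

lemma one_le_height_ker {ev : AR 2 →+* FF} {P : AR 2} (hP0 : P ≠ 0) (hP : ev P = 0) :
    1 ≤ (RingHom.ker ev).height := by
  have hp : (RingHom.ker ev).IsPrime := RingHom.ker_isPrime ev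
  have h1 : (⊥ : Ideal (AR 2)) < RingHom.ker ev := by
    rw [bot_lt_iff_ne_bot]
    intro h
    have : P ∈ RingHom.ker ev := hP
    rw [h] at this
    exact hP0 this
  exact le_trans (by simp) (Ideal.height_add_one_le_of_lt_of_isPrime h1)

lemma ker_eq_span {ev : AR 2 →+* FF} (hev : ∀ z, ev (MvPolynomial.C z) = algebraMap ℂ FF z)
    {t : AR 2} (ht : FF.Nonconst (ev t)) {P : AR 2} (hP : Prime P) (hP0 : ev P = 0) :
    RingHom.ker ev = Ideal.span {P} := by
  have hp : (RingHom.ker ev).IsPrime := RingHom.ker_isPrime ev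
  refine Ideal.eq_span_singleton_of_height_eq_one ?_ hP0 hP
  obtain ⟨m, hm, hlt⟩ := exists_isMaximal_gt hev ht
  have h2 := Ideal.height_add_one_le_of_lt_of_isPrime hlt
  have h3 : (m.height : WithBot ℕ∞) ≤ ringKrullDim (AR 2) :=
    Ideal.height_le_ringKrullDim_of_ne_top hm.ne_top
  rw [MvPolynomial.ringKrullDim_of_isNoetherianRing, ringKrullDim_eq_zero_of_field, zero_add] at h3
  have h4 : m.height ≤ 1 + 1 := by
    rw [Nat.card_fin] at h3
    rw [one_add_one_eq_two]
    exact WithBot.coe_le_coe.1 h3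
  exact le_antisymm ((ENat.add_le_add_iff_right ENat.one_ne_top).1 (h2.trans h4)) (one_le_height_ker hP.ne_zero hP0)

section Surface

variable {D : ToricData 2} {V : Type} {C : V → D.Chart}

lemma height_chart_ker (hC : ∀ y, ∃ v, y ∈ Set.range (C v).map) (v : V) {ev : AR 2 →+* FF}
    (hev : ∀ z, ev (MvPolynomial.C z) = algebraMap ℂ FF z) {t : AR 2} (ht : FF.Nonconst (ev t))
    {P : AR 2} (hP0 : P ≠ 0) (hP : ev P = 0) {p : Spec (CommRingCat.of (AR 2))}
    (hp : PrimeSpectrum.asIdeal p = RingHom.ker ev) : Order.height ((C v).map p) = 1 := by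
  apply le_antisymm
  · have h1 := height_add_coheight_le hC ((C v).map p)
    rw [coheight_chart, hp] at h1
    have h2 : Order.height ((C v).map p) + 1 ≤ 1 + 1 :=
      (add_le_add_right (one_le_height_ker hP0 hP) _).trans (h1.trans (by norm_num))
    exact (ENat.add_le_add_iff_right ENat.one_ne_top).1 h2
  · obtain ⟨m, hm, hlt⟩ := exists_isMaximal_gt hev ht
    let m' : Spec (CommRingCat.of (AR 2)) := (⟨m, hm.isPrime⟩ : PrimeSpectrum (AR 2))
    have h1 : (C v).map m' < (C v).map p := by
      have hle : ∀ a b : Spec (CommRingCat.of (AR 2)), (C v).map a ≤ (C v).map b ↔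
          PrimeSpectrum.asIdeal b ≤ PrimeSpectrum.asIdeal a := fun a b ↦
        ((C v).map.isOpenEmbedding.isInducing.specializes_iff).trans
          (PrimeSpectrum.le_iff_specializes _ _).symm
      rw [lt_iff_le_not_ge, hle, hle, hp]
      exact lt_iff_le_not_ge.1 hlt
    exact le_trans (by simp) (Order.height_add_one_le h1)

lemma height_genericPoint (hC : ∀ y, ∃ v, y ∈ Set.range (C v).map) :
    Order.height (genericPoint D.X) = 2 := by
  apply le_antisymm
  · exact le_self_add.trans (height_add_coheight_le hC (genericPoint D.X))
  · obtain ⟨v, -⟩ := hC (genericPoint D.X)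
    let ev : AR 2 →+* FF := MvPolynomial.eval₂Hom (algebraMap ℂ FF) ![0, (FF.s : FF)]
    have hev : ∀ z, ev (MvPolynomial.C z) = algebraMap ℂ FF z := fun z ↦ by simp [ev]
    have ht : FF.Nonconst (ev (MvPolynomial.X 1)) := by
      simpa [ev] using FF.nonconst_zpow one_ne_zero
    have h0 : ev (MvPolynomial.X 0) = 0 := by simp [ev]
    let p : Spec (CommRingCat.of (AR 2)) :=
      (⟨RingHom.ker ev, RingHom.ker_isPrime ev⟩ : PrimeSpectrum (AR 2))
    have h1 : Order.height ((C v).map p) = 1 :=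
      height_chart_ker hC v hev ht (MvPolynomial.X_ne_zero 0) h0 rfl
    have h2 : (C v).map p < genericPoint D.X := by
      refine lt_iff_le_not_ge.2 ⟨(genericPoint_spec D.X).specializes (Set.mem_univ _), fun h ↦ ?_⟩
      have h3 : IsMax ((C v).map p) := fun y _ ↦
        le_trans ((genericPoint_spec D.X).specializes (Set.mem_univ y)) h
      rw [← Order.coheight_eq_zero, coheight_chart] at h3
      have := one_le_height_ker (MvPolynomial.X_ne_zero 0) h0
      rw [← show PrimeSpectrum.asIdeal p = RingHom.ker ev from rfl, h3] at this
      simp at this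
    have := Order.height_add_one_le h2
    rw [h1] at this
    exact le_trans (by norm_num) this

end Surface


open ToricData

/-! ### Toric surfaces in the permutohedral variety -/

section Eval

/-- The character of the torus with weight `m` at the point with the coordinates `t`. -/
def charVal (t : Fin 2 → FFˣ) (m : Fin 2 → ℤ) : FFˣ := t 0 ^ m 0 * t 1 ^ m 1

lemma charVal_add (t : Fin 2 → FFˣ) (m m' : Fin 2 → ℤ) :
    charVal t (m + m') = charVal t m * charVal t m' := by
  simp only [charVal, Pi.add_apply, zpow_add]
  exact mul_mul_mul_comm _ _ _ _

lemma charVal_zero (t : Fin 2 → FFˣ) : charVal t 0 = 1 := by simp [charVal]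

lemma charVal_sub (t : Fin 2 → FFˣ) (m m' : Fin 2 → ℤ) :
    charVal t (m - m') = charVal t m / charVal t m' := by
  rw [eq_div_iff_mul_eq', mul_comm, ← charVal_add, add_sub_cancel]

lemma charVal_zsmul (t : Fin 2 → FFˣ) (k : ℤ) (m : Fin 2 → ℤ) :
    charVal t (k • m) = charVal t m ^ k := by
  simp only [charVal, Pi.smul_apply, smul_eq_mul, mul_zpow, ← zpow_mul, mul_comm k]

/-- The evaluation of functions on the torus at the point with the coordinates `t`. -/
def evTorus (t : Fin 2 → FFˣ) : TR 2 →+* FF :=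
  (AddMonoidAlgebra.lift ℂ FF (Fin 2 → ℤ)
    { toFun := fun m ↦ (charVal t m.toAdd : FF)
      map_one' := by simp [charVal_zero]
      map_mul' := fun m m' ↦ by simp [charVal_add] }).toRingHom

lemma evTorus_mono (t : Fin 2 → FFˣ) (m : Fin 2 → ℤ) : evTorus t (mono m) = charVal t m := by
  simp [evTorus, mono]

lemma evTorus_algebraMap (t : Fin 2 → FFˣ) (z : ℂ) :
    evTorus t (algebraMap ℂ (TR 2) z) = algebraMap ℂ FF z := by
  unfold evTorus
  exact AlgHom.commutes _ z

end Eval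

/-- The characters `κ i * x ^ (w i)` of the torus, as units. -/
def torusCoord (w : Fin 4 → Fin 2 → ℤ) (κ : Fin 4 → ℂˣ) (i : Fin 4) : (TR 2)ˣ :=
  Units.map (algebraMap ℂ (TR 2)).toMonoidHom (κ i) * (isUnit_mono (w i)).unit

lemma coe_torusCoord (w : Fin 4 → Fin 2 → ℤ) (κ : Fin 4 → ℂˣ) (i : Fin 4) :
    (torusCoord w κ i : TR 2) = algebraMap ℂ (TR 2) (κ i) * mono (w i) := rfl

section Map

variable {D : ToricData 2} {V : Type} (C : V → D.Chart) (w : Fin 4 → Fin 2 → ℤ) (Λ : Fin 4 → ℤ)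
  (κ : Fin 4 → ℂˣ)

/-- The ratio of the `i`-th and the `j`-th homogeneous coordinate is regular on the chart. -/
def RatioRegular (v : V) (i j : Fin 4) : Prop :=
  Λ j < Λ i ∨ (Λ i = Λ j ∧ (C v).Nonneg (w i - w j))

/-- The ratio of the `i`-th and the `j`-th homogeneous coordinate, if it is regular on the chart. -/
def chartRatio (v : V) (i j : Fin 4) : AR 2 :=
  if Λ i = Λ j then MvPolynomial.C ((κ i / κ j : ℂˣ) : ℂ) * (C v).monomial (w i - w j) else 0

/-- The toric morphism from a surface to the permutohedral variety with the homogeneous coordinates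
`ε ^ (Λ i) * κ i * x ^ (w i)`, in the limit `ε → 0`. -/
structure IsSurfaceMap (g : D.X ⟶ (permData 3).X) : Prop where
  map_q : ∀ v i j, RatioRegular C w Λ v i j →
    ((C v).map ≫ g) ≫ (permData 3).q (i, j) =
      PP.pt (ι := Fin 2) MvPolynomial.C ![chartRatio C w Λ κ v i j, 1] 1 isUnit_one ∧
    ((C v).map ≫ g) ≫ (permData 3).q (j, i) =
      PP.pt (ι := Fin 2) MvPolynomial.C ![1, chartRatio C w Λ κ v i j] 0 isUnit_one
  torus_comp : D.torus ≫ g = orbitPt (algebraMap ℂ (TR 2)) Λ (torusCoord w κ)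

variable {C w Λ κ}

lemma ratioRegular_total
    (htot : ∀ v i j, Λ i = Λ j → (C v).Nonneg (w i - w j) ∨ (C v).Nonneg (w j - w i))
    (v : V) (i j : Fin 4) : RatioRegular C w Λ v i j ∨ RatioRegular C w Λ v j i := by
  unfold RatioRegular
  rcases lt_trichotomy (Λ i) (Λ j) with h | h | h
  · exact .inr (.inl h)
  · rcases htot v i j h with h1 | h1
    · exact .inl (.inr ⟨h, h1⟩)
    · exact .inr (.inr ⟨h.symm, h1⟩)
  · exact .inl (.inl h)

lemma exists_surfaceMap (hC : ∀ y, ∃ v, y ∈ Set.range (C v).map)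
    (htot : ∀ v i j, Λ i = Λ j → (C v).Nonneg (w i - w j) ∨ (C v).Nonneg (w j - w i))
    (κ : Fin 4 → ℂˣ) : ∃ g, IsSurfaceMap C w Λ κ g := by
  have hex : ∀ v, ∃ f : Spec (CommRingCat.of (AR 2)) ⟶ (permData 3).X, ∀ i j,
      RatioRegular C w Λ v i j →
      f ≫ (permData 3).q (i, j) =
        PP.pt (ι := Fin 2) MvPolynomial.C ![chartRatio C w Λ κ v i j, 1] 1 isUnit_one ∧
      f ≫ (permData 3).q (j, i) =
        PP.pt (ι := Fin 2) MvPolynomial.C ![1, chartRatio C w Λ κ v i j] 0 isUnit_one := by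
    intro v
    refine exists_permPoint MvPolynomial.C (RatioRegular C w Λ v) (ratioRegular_total htot v) ?_ _
      ?_ ?_
    · rintro i j k (h | ⟨h, h1⟩) (h' | ⟨h', h1'⟩)
      · exact .inl (h'.trans h)
      · exact .inl (h'.symm.trans_lt h)
      · exact .inl (h'.trans_eq h.symm)
      · refine .inr ⟨h.trans h', ?_⟩
        have := Chart.Nonneg.add h1 h1'
        rwa [sub_add_sub_cancel] at this
    · intro i
      simp [chartRatio]
    · rintro i j k (h | ⟨h, h1⟩) (h' | ⟨h', h1'⟩)
      · have e1 : Λ i ≠ Λ j := by omega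
        have e2 : Λ i ≠ Λ k := by omega
        simp [chartRatio, e1, e2]
      · have e1 : Λ i ≠ Λ j := by omega
        have e2 : Λ i ≠ Λ k := by omega
        simp [chartRatio, e1, e2]
      · have e1 : Λ j ≠ Λ k := by omega
        have e2 : Λ i ≠ Λ k := by omega
        simp [chartRatio, e1, e2]
      · unfold chartRatio
        rw [if_pos h, if_pos h', if_pos (h.trans h'), mul_mul_mul_comm, ← map_mul, ← Units.val_mul,
          div_mul_div_cancel, ← Chart.monomial_add h1 h1', sub_add_sub_cancel]
  choose f hf using hex
  have hθ : ∀ v, Spec.map (CommRingCat.ofHom (C v).θ) ≫ f v =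
      orbitPt (algebraMap ℂ (TR 2)) Λ (torusCoord w κ) := by
    intro v
    rw [← (C v).θ_comp_C]
    refine comp_eq_orbitPt (ratioRegular_total htot v) (hf v) _ ?_
    rintro i j (h | ⟨h, h1⟩)
    · refine .inr ⟨h, ?_⟩
      have : Λ i ≠ Λ j := by omega
      simp [chartRatio, this]
    · refine .inl ⟨h, ?_⟩
      unfold chartRatio
      rw [if_pos h, map_mul, (C v).θ_monomial h1, coe_torusCoord, coe_torusCoord]
      have e : (C v).θ (MvPolynomial.C ((κ i / κ j : ℂˣ) : ℂ)) =
          algebraMap ℂ (TR 2) ((κ i / κ j : ℂˣ) : ℂ) := by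
        rw [← (C v).θ_comp_C]
        rfl
      rw [e, mul_mul_mul_comm, ← map_mul, ← mono_add, sub_add_cancel, ← Units.val_mul,
        div_mul_cancel]
  -- the local morphisms agree on the torus, which is dense in every overlap
  obtain ⟨g, hg⟩ := exists_glue C hC f fun a b ↦ (hθ a).trans (hθ b).symm
  refine ⟨g, fun v ↦ ?_, ?_⟩
  · rw [hg]
    exact hf v
  · obtain ⟨v, -⟩ := hC (Classical.arbitrary _)
    rw [← (C v).θ_map, Category.assoc, hg, hθ]

variable {g : D.X ⟶ (permData 3).X}

/-- A morphism from the surface is a closed immersion if the coordinates of the surface are recovered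
from those of the image: the composite with the recovering maps is the closed embedding of the
surface in its ambient product. -/
lemma isClosedImmersion_of_coordinates
    (hq : ∀ k, ∃ u : (permData 3).X ⟶ PP (D.ι k), D.torus ≫ g ≫ u = D.torusPt k) :
    IsClosedImmersion g := by
  choose u hu using hq
  obtain ⟨U, hU⟩ := exists_ambient_lift u
  have := isSeparated (C := permChart (n := 3)) exists_mem_range_permChart
  have h1 : ∀ k, g ≫ u k = D.q k := fun k ↦
    ext_of_isDominant D.torus ((hu k).trans (D.torus_q k).symm)
  have h2 : g ≫ U = D.embed := by
    refine ambient_hom_ext fun k ↦ ?_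
    rw [Category.assoc, hU, h1]
    rfl
  have h3 : IsClosedImmersion (g ≫ U) := h2 ▸ inferInstance
  exact IsClosedImmersion.of_comp g U

/-- The image in the permutohedral variety of the generic point of a curve in the surface. -/
lemma IsSurfaceMap.apply (hg : IsSurfaceMap C w Λ κ g)
    (htot : ∀ v i j, Λ i = Λ j → (C v).Nonneg (w i - w j) ∨ (C v).Nonneg (w j - w i))
    {v : V} {φ : AR 2 →+* FF} (hφ : ∀ z, φ (MvPolynomial.C z) = algebraMap ℂ FF z)
    {l : Fin 4 → ℤ} {a : Fin 4 → FFˣ}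
    (H : ∀ i j, RatioRegular C w Λ v i j →
      (l i = l j ∧ φ (chartRatio C w Λ κ v i j) * a j = a i) ∨
        (l j < l i ∧ φ (chartRatio C w Λ κ v i j) = 0))
    {p : Spec (CommRingCat.of (AR 2))} (hp : PrimeSpectrum.asIdeal p = RingHom.ker φ) :
    g ((C v).map p) = orbitPoint (algebraMap ℂ FF) l a := by
  have h1 := comp_eq_orbitPt (ratioRegular_total htot v) (hg.map_q v) φ H
  have h2 : φ.comp MvPolynomial.C = algebraMap ℂ FF := RingHom.ext hφ
  have h3 : Spec.map (CommRingCat.ofHom φ) (fieldPt FF) = p := by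
    apply PrimeSpectrum.ext
    exact hp.symm
  rw [h2] at h1
  unfold orbitPoint
  rw [← h1, ← h3, Scheme.Hom.comp_apply, Scheme.Hom.comp_apply]

/-- The levels of the homogeneous coordinates along a boundary curve of the surface; the levels on
the surface are multiplied by `N`, to become dominant. -/
def boundaryLevel (C : V → D.Chart) (w : Fin 4 → Fin 2 → ℤ) (Λ : Fin 4 → ℤ) (N : ℤ) (v : V)
    (l : Fin 2) (i : Fin 4) : ℤ := N * Λ i + (C v).ρ l ⬝ᵥ w i

/-- The evaluation of functions on the chart at the generic point of the boundary curve where the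
coordinate of index `l` vanishes. -/
def boundaryEval (l : Fin 2) : AR 2 →+* FF :=
  MvPolynomial.eval₂Hom (algebraMap ℂ FF) fun k ↦ if k = l then 0 else (FF.s : FF)

lemma boundaryEval_C (l : Fin 2) (z : ℂ) :
    boundaryEval l (MvPolynomial.C z) = algebraMap ℂ FF z := by simp [boundaryEval]

lemma boundaryEval_X_self (l : Fin 2) : boundaryEval l (MvPolynomial.X l) = 0 := by
  simp [boundaryEval]

lemma boundaryEval_X_add_one (l : Fin 2) :
    boundaryEval l (MvPolynomial.X (l + 1)) = (FF.s : FF) := by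
  have : l + 1 ≠ l := by revert l; decide
  simp [boundaryEval, this]

lemma boundaryEval_monomial (l : Fin 2) (c : D.Chart) (m : Fin 2 → ℤ) :
    boundaryEval l (c.monomial m) =
      0 ^ (c.ρ l ⬝ᵥ m).toNat * (FF.s : FF) ^ (c.ρ (l + 1) ⬝ᵥ m).toNat := by
  have h : ∀ f : Fin 2 → FF, ∏ k, f k = f l * f (l + 1) := by
    intro f
    have hb : ∀ b : Fin 2, b = 0 ∨ b = 1 := by decide
    rcases hb l with rfl | rfl
    · rw [Fin.prod_univ_two, zero_add]
    · rw [Fin.prod_univ_two, mul_comm]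
      rfl
  unfold Chart.monomial
  rw [map_prod, h, map_pow, map_pow, boundaryEval_X_self, boundaryEval_X_add_one]

lemma IsSurfaceMap.apply_boundary (hg : IsSurfaceMap C w Λ κ g)
    (htot : ∀ v i j, Λ i = Λ j → (C v).Nonneg (w i - w j) ∨ (C v).Nonneg (w j - w i))
    {N : ℤ} (hN : ∀ v l i j, Λ j < Λ i → boundaryLevel C w Λ N v l j < boundaryLevel C w Λ N v l i)
    (v : V) (l : Fin 2) {p : Spec (CommRingCat.of (AR 2))}
    (hp : PrimeSpectrum.asIdeal p = RingHom.ker (boundaryEval l)) :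
    g ((C v).map p) = orbitPoint (algebraMap ℂ FF) (boundaryLevel C w Λ N v l)
      fun i ↦ FF.c (κ i) * FF.s ^ ((C v).ρ (l + 1) ⬝ᵥ w i) := by
  refine hg.apply htot (boundaryEval_C l) ?_ hp
  rintro i j (h | ⟨h, h1⟩)
  · refine .inr ⟨hN v l i j h, ?_⟩
    have : Λ i ≠ Λ j := by omega
    simp [chartRatio, this]
  · unfold chartRatio
    rw [if_pos h, map_mul, boundaryEval_monomial, boundaryEval_C]
    have h2 := h1 l
    have h3 := h1 (l + 1)
    rcases h2.eq_or_lt with h4 | h4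
    · refine .inl ⟨?_, ?_⟩
      · rw [dotProduct_sub] at h4
        unfold boundaryLevel
        rw [h]
        omega
      · rw [← h4, Int.toNat_zero, pow_zero, one_mul, ← zpow_natCast, Int.toNat_of_nonneg h3]
        have e : algebraMap ℂ FF ((κ i / κ j : ℂˣ) : ℂ) = ((FF.c (κ i / κ j) : FFˣ) : FF) := rfl
        rw [e, ← Units.val_zpow_eq_zpow_val, ← Units.val_mul, ← Units.val_mul, map_div,
          mul_mul_mul_comm, div_mul_cancel, ← zpow_add, dotProduct_sub, sub_add_cancel]
    · refine .inr ⟨?_, ?_⟩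
      · rw [dotProduct_sub] at h4
        unfold boundaryLevel
        rw [h]
        omega
      · rw [zero_pow (by omega), zero_mul, mul_zero]

lemma IsSurfaceMap.apply_torus (hg : IsSurfaceMap C w Λ κ g)
    (htot : ∀ v i j, Λ i = Λ j → (C v).Nonneg (w i - w j) ∨ (C v).Nonneg (w j - w i))
    (t : Fin 2 → FFˣ) (v : V) {p : Spec (CommRingCat.of (AR 2))}
    (hp : PrimeSpectrum.asIdeal p = RingHom.ker ((evTorus t).comp (C v).θ)) :
    g ((C v).map p) = orbitPoint (algebraMap ℂ FF) Λ fun i ↦ FF.c (κ i) * charVal t (w i) := by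
  have hc : ∀ z, ((evTorus t).comp (C v).θ) (MvPolynomial.C z) = algebraMap ℂ FF z := by
    intro z
    have := DFunLike.congr_fun ((C v).θ_comp_C) z
    rw [RingHom.comp_apply] at this ⊢
    rw [this, evTorus_algebraMap]
  refine hg.apply htot hc ?_ hp
  rintro i j (h | ⟨h, h1⟩)
  · refine .inr ⟨h, ?_⟩
    have : Λ i ≠ Λ j := by omega
    simp [chartRatio, this]
  · refine .inl ⟨h, ?_⟩
    unfold chartRatio
    rw [if_pos h, map_mul, hc, RingHom.comp_apply, (C v).θ_monomial h1, evTorus_mono]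
    have e : algebraMap ℂ FF ((κ i / κ j : ℂˣ) : ℂ) = ((FF.c (κ i / κ j) : FFˣ) : FF) := rfl
    rw [e, ← Units.val_mul, ← Units.val_mul, map_div, mul_mul_mul_comm, div_mul_cancel, charVal_sub,
      div_mul_cancel]

end Map


open ToricData

/-! ### Rational equivalence from rational functions on toric surfaces -/

/-- The coefficient of a cycle at a point. -/
def coeffAt {X : Scheme.{0}} (k : ℕ) (x : X) : cycles X k →+ ℤ where
  toFun c := c.1 x
  map_zero' := rfl
  map_add' _ _ := rfl

open Classical in
lemma coeffAt_primeCycle {X : Scheme.{0}} {k : ℕ} {z : X} (hz : Order.height z = k) (x : X) :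
    coeffAt k x (primeCycle k (closure {z})) = if x = z then 1 else 0 := by
  change (if IsGenericPoint x (closure {z}) ∧ Order.height x = k then (1 : ℤ) else 0) = _
  by_cases h : x = z
  · subst h
    rw [if_pos rfl, if_pos ⟨isGenericPoint_closure, hz⟩]
  · rw [if_neg h, if_neg]
    rintro ⟨h1, -⟩
    exact h (h1.eq isGenericPoint_closure)

lemma prime_mul_X_add_C {f : AR 2} {i : Fin 2} (hf : f ≠ 0) (hi : i ∉ f.vars) {c : ℂ}
    (hc : c ≠ 0) : Prime (f * MvPolynomial.X i + MvPolynomial.C c) := by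
  refine (MvPolynomial.irreducible_mul_X_add f (MvPolynomial.C c) i hf hi (by simp) ?_).prime
  exact ((hc.isUnit.map (MvPolynomial.C (σ := Fin 2))).isRelPrime_right)

section Divisor

variable {D : ToricData 2} {V : Type} {C : V → D.Chart}

open Classical in
/-- The order of the product of a monomial and a prime element along a curve in a chart. -/
lemma ord_chart [IsLocallyNoetherian D.X] [IsOpenImmersion D.torus] (c : D.Chart) (m : Fin 2 → ℤ)
    {P : AR 2} (hP : Prime P) (p : Spec (CommRingCat.of (AR 2))) :
    Scheme.ord (functionFieldHom D.torus (mono m * c.θ P)) (c.map p) =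
      (if PrimeSpectrum.asIdeal p = Ideal.span {P} then 1 else 0) +
      ∑ l, (if PrimeSpectrum.asIdeal p = Ideal.span {MvPolynomial.X l} then 1 else 0) *
        (c.ρ l ⬝ᵥ m) := by
  have hθ : ∀ x, functionFieldHom D.torus (c.θ x) = functionFieldHom c.map x := fun x ↦
    DFunLike.congr_fun (functionFieldHom_comp c.map c.θ_map) x
  have hne : ∀ m', functionFieldHom D.torus (mono m') ≠ 0 := fun m' ↦
    ((isUnit_mono m').map (functionFieldHom D.torus)).ne_zero
  have hPne : functionFieldHom c.map P ≠ 0 := fun h ↦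
    hP.ne_zero (functionFieldHom_injective c.map (h.trans (map_zero _).symm))
  have hadd : ∀ m₁ m₂, Scheme.ord (functionFieldHom D.torus (mono (m₁ + m₂))) (c.map p) =
      Scheme.ord (functionFieldHom D.torus (mono m₁)) (c.map p) +
        Scheme.ord (functionFieldHom D.torus (mono m₂)) (c.map p) := by
    intro m₁ m₂
    rw [mono_add, map_mul, Scheme.ord_mul (hne _) (hne _)]
  let o : (Fin 2 → ℤ) →+ ℤ := AddMonoidHom.mk'
    (fun m' ↦ Scheme.ord (functionFieldHom D.torus (mono m')) (c.map p)) hadd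
  have ho : ∀ l, o (c.E l) =
      if PrimeSpectrum.asIdeal p = Ideal.span {MvPolynomial.X l} then 1 else 0 := by
    intro l
    change Scheme.ord (functionFieldHom D.torus (mono (c.E l))) (c.map p) = _
    rw [← c.θ_X, hθ]
    exact ord_functionFieldHom_prime c.map p MvPolynomial.X_prime
  have hm : o m = ∑ l, (if PrimeSpectrum.asIdeal p = Ideal.span {MvPolynomial.X l} then 1 else 0) *
      (c.ρ l ⬝ᵥ m) := by
    conv_lhs => rw [← c.sum_smul m, map_sum]
    exact Finset.sum_congr rfl fun l _ ↦ by rw [map_zsmul, ho, smul_eq_mul, mul_comm]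
  rw [map_mul, hθ, Scheme.ord_mul (hne _) hPne, ord_functionFieldHom_prime c.map p hP, ← hm,
    add_comm]
  rfl

variable {w : Fin 4 → Fin 2 → ℤ} {Λ : Fin 4 → ℤ} {κ : Fin 4 → ℂˣ} {g : D.X ⟶ (permData 3).X}

/-- The orders of the levels agree. -/
def SameOrder (l l' : Fin 4 → ℤ) : Prop := ∀ i j, l i ≤ l j ↔ l' i ≤ l' j

instance (l l' : Fin 4 → ℤ) : Decidable (SameOrder l l') :=
  inferInstanceAs (Decidable (∀ i j, l i ≤ l j ↔ l' i ≤ l' j))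

/-- If the exponents agree, or agree up to a common sign, for coordinates of equal level, then the
points of the boundary curves agree. -/
lemma orbitPoint_eq_of_sameOrder {l l' : Fin 4 → ℤ} (h : SameOrder l l') {e e' : Fin 4 → ℤ}
    (he : (∀ i j, l i = l j → e i - e j = e' i - e' j) ∨
      ∀ i j, l i = l j → e i - e j = e' j - e' i) (κ : Fin 4 → ℂˣ) :
    orbitPoint (algebraMap ℂ FF) l (fun i ↦ FF.c (κ i) * FF.s ^ e i) =
      orbitPoint (algebraMap ℂ FF) l' (fun i ↦ FF.c (κ i) * FF.s ^ e' i) := by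
  have key : ∀ (u : FFˣ) (_ : ∀ i j, l i = l j → u ^ (e i - e j) = FF.s ^ (e' i - e' j))
      (_ : FF.Nonconst (u : FF)), orbitPoint (algebraMap ℂ FF) l (fun i ↦ FF.c (κ i) * FF.s ^ e i) =
      orbitPoint (algebraMap ℂ FF) l' (fun i ↦ FF.c (κ i) * FF.s ^ e' i) := by
    intro u hu hc
    obtain ⟨φ, hφ, hs⟩ := FF.exists_subst hc
    refine orbitPoint_eq φ hφ h fun i j hij ↦ ?_
    have hs' : Units.map φ.toMonoidHom FF.s = u := Units.ext hs
    have hk : ∀ i, Units.map φ.toMonoidHom (FF.c (κ i)) = FF.c (κ i) := fun i ↦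
      Units.ext (DFunLike.congr_fun hφ (κ i : ℂ))
    have h1 : Units.map φ.toMonoidHom (FF.c (κ i) * FF.s ^ e i) * (FF.c (κ j) * FF.s ^ e' j) =
        Units.map φ.toMonoidHom (FF.c (κ j) * FF.s ^ e j) * (FF.c (κ i) * FF.s ^ e' i) := by
      rw [map_mul, map_mul, hk, hk, map_zpow, map_zpow, hs', mul_mul_mul_comm,
        mul_mul_mul_comm (FF.c (κ j)), mul_comm (FF.c (κ j))]
      congr 1
      have h2 := hu i j hij
      rw [zpow_sub, zpow_sub, ← div_eq_mul_inv, ← div_eq_mul_inv, div_eq_div_iff_mul_eq_mul] at h2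
      rw [h2, mul_comm]
    exact congr_arg Units.val h1
  rcases he with he | he
  · refine key FF.s (fun i j hij ↦ by rw [he i j hij]) ?_
    simpa using FF.nonconst_zpow one_ne_zero
  · refine key FF.s⁻¹ (fun i j hij ↦ ?_) ?_
    · rw [he i j hij, inv_zpow, ← zpow_neg, neg_sub]
    · simpa using FF.nonconst_zpow (k := -1) (by decide)

/-- The relation in the Chow group given by a rational function `T` on a toric surface. The zeros
of `T` form a curve that meets the torus in the points with parametrization `t`; the poles are
boundary curves, which are described by their levels `lev d` and exponents `e d`. -/
theorem orbitClass_eq_sum (hC : ∀ y, ∃ v, y ∈ Set.range (C v).map)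
    (htot : ∀ v i j, Λ i = Λ j → (C v).Nonneg (w i - w j) ∨ (C v).Nonneg (w j - w i))
    {N : ℤ} (hN : ∀ v l i j, Λ j < Λ i → boundaryLevel C w Λ N v l j < boundaryLevel C w Λ N v l i)
    (κ : Fin 4 → ℂˣ)
    (hq : ∀ k, ∃ u : (permData 3).X ⟶ PP (D.ι k),
      orbitPt (algebraMap ℂ (TR 2)) Λ (torusCoord w κ) ≫ u = D.torusPt k)
    {T : TR 2} (m : V → Fin 2 → ℤ) (P : V → AR 2) (hP : ∀ v, Prime (P v))
    (hT : ∀ v, T = mono (m v) * (C v).θ (P v))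
    (t : Fin 2 → FFˣ) (ht : evTorus t T = 0) (m₀ : Fin 2 → ℤ)
    (hm₀ : FF.Nonconst (charVal t m₀ : FF))
    {δ : Type} [Fintype δ] (lev e : δ → Fin 4 → ℤ)
    (hord : ∀ v l, -((C v).ρ l ⬝ᵥ m v) =
      ∑ d, if SameOrder (boundaryLevel C w Λ N v l) (lev d) then 1 else 0)
    (hexp : ∀ v l d, SameOrder (boundaryLevel C w Λ N v l) (lev d) →
      (∀ i j, boundaryLevel C w Λ N v l i = boundaryLevel C w Λ N v l j →
        (C v).ρ (l + 1) ⬝ᵥ w i - (C v).ρ (l + 1) ⬝ᵥ w j = e d i - e d j) ∨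
      ∀ i j, boundaryLevel C w Λ N v l i = boundaryLevel C w Λ N v l j →
        (C v).ρ (l + 1) ⬝ᵥ w i - (C v).ρ (l + 1) ⬝ᵥ w j = e d j - e d i)
    (hex : ∀ d, ∃ v l, SameOrder (boundaryLevel C w Λ N v l) (lev d)) :
    orbitClass Λ (fun i ↦ FF.c (κ i) * charVal t (w i)) =
      ∑ d, orbitClass (lev d) fun i ↦ FF.c (κ i) * FF.s ^ e d i := by
  classical
  obtain ⟨g, hg⟩ := exists_surfaceMap hC htot κ
  have hcl : IsClosedImmersion g := isClosedImmersion_of_coordinates fun k ↦ by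
    obtain ⟨u, hu⟩ := hq k
    exact ⟨u, by rw [← Category.assoc, hg.torus_comp, hu]⟩
  have := isLocallyNoetherian hC
  have : IsOpenImmersion D.torus := by
    obtain ⟨v, -⟩ := hC (Classical.arbitrary _)
    exact (C v).isOpenImmersion_torus
  -- the generic points of the boundary curves
  let b : Fin 2 → Spec (CommRingCat.of (AR 2)) := fun l ↦
    (⟨RingHom.ker (boundaryEval l), RingHom.ker_isPrime _⟩ : PrimeSpectrum (AR 2))
  have hbc : ∀ l, FF.Nonconst (boundaryEval l (MvPolynomial.X (l + 1))) := by
    intro l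
    rw [boundaryEval_X_add_one]
    simpa using FF.nonconst_zpow one_ne_zero
  have hbs : ∀ l, PrimeSpectrum.asIdeal (b l) = Ideal.span {MvPolynomial.X l} := fun l ↦
    ker_eq_span (boundaryEval_C l) (hbc l) MvPolynomial.X_prime (boundaryEval_X_self l)
  have hbg := fun v l ↦ hg.apply_boundary htot hN v l (p := b l) rfl
  have hbh : ∀ v l, Order.height ((C v).map (b l)) = 1 := fun v l ↦
    height_chart_ker hC v (boundaryEval_C l) (hbc l) (MvPolynomial.X_ne_zero l)
      (boundaryEval_X_self l) rfl
  -- the generic point of the zeros of `T`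
  let z : V → Spec (CommRingCat.of (AR 2)) := fun v ↦
    (⟨RingHom.ker ((evTorus t).comp (C v).θ), RingHom.ker_isPrime _⟩ : PrimeSpectrum (AR 2))
  have hz : ∀ v v', (C v).map (z v) = (C v').map (z v') := by
    have h1 : ∀ v, (C v).map (z v) = D.torus
        (⟨RingHom.ker (evTorus t), RingHom.ker_isPrime _⟩ : PrimeSpectrum (TR 2)) := by
      intro v
      rw [← (C v).θ_map]
      refine Eq.trans ?_ (Scheme.Hom.comp_apply (Spec.map (CommRingCat.ofHom (C v).θ)) _ _).symm
      exact congr_arg (C v).map (PrimeSpectrum.ext rfl)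
    exact fun v v' ↦ (h1 v).trans (h1 v').symm
  have hevC : ∀ v x, ((evTorus t).comp (C v).θ) (MvPolynomial.C x) = algebraMap ℂ FF x := by
    intro v x
    have := DFunLike.congr_fun ((C v).θ_comp_C) x
    rw [RingHom.comp_apply] at this ⊢
    rw [this, evTorus_algebraMap]
  have hevP : ∀ v, ((evTorus t).comp (C v).θ) (P v) = 0 := by
    intro v
    rw [hT v, map_mul, evTorus_mono] at ht
    exact (mul_eq_zero.1 ht).resolve_left (Units.ne_zero _)
  have hevX : ∀ v l, ((evTorus t).comp (C v).θ) (MvPolynomial.X l) = charVal t ((C v).E l) := by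
    intro v l
    rw [RingHom.comp_apply, (C v).θ_X, evTorus_mono]
  have hnc : ∀ v, ∃ l, FF.Nonconst (((evTorus t).comp (C v).θ) (MvPolynomial.X l)) := by
    intro v
    by_contra! hcon
    simp only [hevX, FF.Nonconst, not_forall, not_not] at hcon
    choose y hy using hcon
    refine hm₀ (∏ l, y l ^ ((C v).ρ l ⬝ᵥ m₀)) ?_
    conv_rhs => rw [← (C v).sum_smul m₀]
    rw [Fin.sum_univ_two, Fin.prod_univ_two, charVal_add, charVal_zsmul, charVal_zsmul, map_mul,
      map_zpow₀, map_zpow₀, hy, hy, Units.val_mul, Units.val_zpow_eq_zpow_val,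
      Units.val_zpow_eq_zpow_val]
  have hzs : ∀ v, PrimeSpectrum.asIdeal (z v) = Ideal.span {P v} := fun v ↦
    ker_eq_span (hevC v) (hnc v).choose_spec (hP v) (hevP v)
  have hzg := fun v ↦ hg.apply_torus htot t v (p := z v) rfl
  have hzh : ∀ v, Order.height ((C v).map (z v)) = 1 := fun v ↦
    height_chart_ker hC v (hevC v) (hnc v).choose_spec (hP v).ne_zero (hevP v) rfl
  have hzb : ∀ v l, (C v).map (z v) ≠ (C v).map (b l) := by
    intro v l h
    have h1 : z v = b l := (C v).map.isOpenEmbedding.injective h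
    have h2 : MvPolynomial.X l ∈ RingHom.ker ((evTorus t).comp (C v).θ) := by
      change MvPolynomial.X l ∈ PrimeSpectrum.asIdeal (z v)
      rw [h1]
      exact boundaryEval_X_self l
    rw [RingHom.mem_ker, hevX] at h2
    exact Units.ne_zero _ h2
  have hginj : Function.Injective g := g.isClosedEmbedding.injective
  have hgh := height_closedImmersion g
  -- the divisor of `T`
  let Z := orbitPoint (algebraMap ℂ FF) Λ fun i ↦ FF.c (κ i) * charVal t (w i)
  let Δ : δ → (permData 3).X := fun d ↦
    orbitPoint (algebraMap ℂ FF) (lev d) fun i ↦ FF.c (κ i) * FF.s ^ e d i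
  have hΔ : ∀ v l d, g ((C v).map (b l)) = Δ d ↔ SameOrder (boundaryLevel C w Λ N v l) (lev d) := by
    intro v l d
    rw [hbg v l]
    exact ⟨fun h ↦ le_iff_of_orbitPoint_eq h,
      fun h ↦ orbitPoint_eq_of_sameOrder h (hexp v l d h) κ⟩
  have hZh : Order.height Z = (1 : ℕ) := by
    obtain ⟨v, -⟩ := hC (Classical.arbitrary _)
    have h1 : g ((C v).map (z v)) = Z := hzg v
    rw [← h1, hgh, hzh]
    rfl
  have hΔh : ∀ d, Order.height (Δ d) = (1 : ℕ) := by
    intro d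
    obtain ⟨v, l, h⟩ := hex d
    rw [← (hΔ v l d).2 h, hgh, hbh]
    rfl
  let c : cycles (permData 3).X 1 :=
    primeCycle 1 (closure {Z}) - ∑ d, primeCycle 1 (closure {Δ d})
  have hc : ∀ x, c.1 x = (if x = Z then 1 else 0) - ∑ d, if x = Δ d then 1 else 0 := by
    intro x
    change coeffAt 1 x c = _
    rw [map_sub, map_sum, coeffAt_primeCycle hZh]
    exact congr_arg _ (Finset.sum_congr rfl fun d _ ↦ coeffAt_primeCycle (hΔh d) x)
  suffices h : c ∈ ratEquivZero (permData 3).X 1 by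
    have h1 := (QuotientAddGroup.eq_zero_iff c).2 h
    have h2 : (QuotientAddGroup.mk' (ratEquivZero (permData 3).X 1)) c = 0 := h1
    rw [map_sub, map_sum, sub_eq_zero] at h2
    exact h2
  refine AddSubgroup.subset_closure ⟨D.X, inferInstance, inferInstance, g, hcl,
    functionFieldHom D.torus T, ?_, ?_, ?_, ?_⟩
  · rw [hgh, height_genericPoint hC]
    rfl
  · intro h
    have h1 := functionFieldHom_injective D.torus (h.trans (map_zero _).symm)
    obtain ⟨v, -⟩ := hC (Classical.arbitrary _)
    rw [hT v, mul_eq_zero] at h1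
    rcases h1 with h1 | h1
    · exact (isUnit_mono (m v)).ne_zero h1
    · exact (hP v).ne_zero ((C v).θ_injective (h1.trans (map_zero _).symm))
  -- the order of `T` at a point `y`: on the curve of zeros, on a boundary curve, elsewhere
  · intro y
    rw [hc]
    by_cases hy : ∃ v, y = (C v).map (z v)
    · obtain ⟨v, rfl⟩ := hy
      rw [if_pos (hzg v), Finset.sum_eq_zero, hT v, ord_chart (C v) (m v) (hP v),
        if_pos (hzs v), Finset.sum_eq_zero]
      · rfl
      · intro l _
        rw [if_neg, zero_mul]
        intro h
        exact hzb v l (congr_arg _ (PrimeSpectrum.ext (h.trans (hbs l).symm)))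
      · intro d _
        refine if_neg fun h ↦ ?_
        obtain ⟨v', l, h'⟩ := hex d
        rw [← (hΔ v' l d).2 h'] at h
        exact hzb v' l ((hz v' v).trans (hginj h))
    have hyZ : g y ≠ Z := by
      intro h
      obtain ⟨v, -⟩ := hC (Classical.arbitrary _)
      exact hy ⟨v, hginj (h.trans (hzg v).symm)⟩
    rw [if_neg hyZ]
    by_cases hy' : ∃ v l, y = (C v).map (b l)
    · obtain ⟨v, l, rfl⟩ := hy'
      simp only [hΔ]
      rw [← hord v l, hT v, ord_chart (C v) (m v) (hP v), if_neg, Finset.sum_eq_single l]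
      · rw [if_pos (hbs l)]
        ring
      · intro l' _ hl
        rw [if_neg, zero_mul]
        intro h
        have h1 : boundaryEval l (MvPolynomial.X l') = 0 := by
          change MvPolynomial.X l' ∈ PrimeSpectrum.asIdeal (b l)
          rw [h]
          exact Ideal.mem_span_singleton_self _
        have h2 : ∀ l l' : Fin 2, l' ≠ l → l' = l + 1 := by decide
        rw [h2 l l' hl, boundaryEval_X_add_one] at h1
        exact Units.ne_zero _ h1
      · simp
      · intro h
        exact hzb v l (congr_arg _ (PrimeSpectrum.ext ((hzs v).trans h.symm)))
    · obtain ⟨v, p, rfl⟩ := hC y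
      rw [hT v, ord_chart (C v) (m v) (hP v), if_neg, Finset.sum_eq_zero, Finset.sum_eq_zero]
      · rfl
      · intro l _
        rw [if_neg, zero_mul]
        intro h
        exact hy' ⟨v, l, congr_arg _ (PrimeSpectrum.ext (h.trans (hbs l).symm))⟩
      · intro d _
        refine if_neg fun h ↦ ?_
        obtain ⟨v', l, h'⟩ := hex d
        rw [← (hΔ v' l d).2 h'] at h
        exact hy' ⟨v', l, hginj h⟩
      · intro h
        exact hy ⟨v, congr_arg _ (PrimeSpectrum.ext (h.trans (hzs v).symm))⟩
  -- all components of the cycle lie on the surface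
  · intro x hx
    rw [hc, if_neg, Finset.sum_eq_zero]
    · rfl
    · intro d _
      refine if_neg fun h ↦ hx ?_
      obtain ⟨v, l, h'⟩ := hex d
      exact ⟨_, ((hΔ v l d).2 h').trans h.symm⟩
    · intro h
      obtain ⟨v, -⟩ := hC (Classical.arbitrary _)
      exact hx ⟨_, (hzg v).trans h.symm⟩

end Divisor


open ToricData

/-! ### Classes of monomial curves -/

/-- The class of the closure of the curve with the parametrization `ε ^ (l i) * κ i * s ^ (e i)` of
the homogeneous coordinates, in the limit `ε → 0`. -/
def monomialClass (l : Fin 4 → ℤ) (κ : Fin 4 → ℂˣ) (e : Fin 4 → ℤ) : Chow (permData 3).X 1 :=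
  orbitClass l fun i ↦ FF.c (κ i) * FF.s ^ e i

lemma FF.nonconst_mul (μ : ℂˣ) {y : FF} (h : FF.Nonconst y) : FF.Nonconst ((FF.c μ : FFˣ) * y) := by
  intro z hz
  refine h (μ⁻¹ * z) ?_
  rw [map_mul, hz]
  exact Units.inv_mul_cancel_left (FF.c μ) y

/-- The class of a monomial curve is invariant under the substitution `s ↦ μ * s ^ r` and under
scaling of the homogeneous coordinates of equal level. -/
lemma monomialClass_congr {l l' : Fin 4 → ℤ} (h : SameOrder l l') {κ κ' : Fin 4 → ℂˣ}
    {e e' : Fin 4 → ℤ} {r : ℤ} (hr : r ≠ 0) (μ : ℂˣ)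
    (he : ∀ i j, l i = l j → r * (e i - e j) = e' i - e' j)
    (hκ : ∀ i j, l i = l j → κ i * μ ^ e i * κ' j = κ j * μ ^ e j * κ' i) :
    monomialClass l κ e = monomialClass l' κ' e' := by
  refine orbitClass_eq (FF.nonconst_mul μ (FF.nonconst_zpow hr)) h fun φ hφ hφ' i j hij ↦ ?_
  have hs : Units.map φ.toMonoidHom FF.s = FF.c μ * FF.s ^ r := Units.ext (hφ.trans (by simp))
  have hk : ∀ x, Units.map φ.toMonoidHom (FF.c x) = FF.c x := fun x ↦ Units.ext (hφ' (x : ℂ))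
  have key : ∀ i j, l i = l j →
      Units.map φ.toMonoidHom (FF.c (κ i) * FF.s ^ e i) * (FF.c (κ' j) * FF.s ^ e' j) =
        FF.c (κ i * μ ^ e i * κ' j) * FF.s ^ (r * e i + e' j) := by
    intro i j _
    rw [map_mul, map_zpow, hs, hk, mul_zpow, ← zpow_mul, zpow_add, map_mul, map_mul, map_zpow]
    simp only [mul_assoc, mul_left_comm, mul_comm]
  have h1 : Units.map φ.toMonoidHom (FF.c (κ i) * FF.s ^ e i) * (FF.c (κ' j) * FF.s ^ e' j) =
      Units.map φ.toMonoidHom (FF.c (κ j) * FF.s ^ e j) * (FF.c (κ' i) * FF.s ^ e' i) := by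
    rw [key i j hij, key j i hij.symm, hκ i j hij]
    congr 2
    have := he i j hij
    linarith
  exact congr_arg Units.val h1

lemma pushforward_permIso_monomialClass (π : Equiv.Perm (Fin 4)) (l : Fin 4 → ℤ) (κ : Fin 4 → ℂˣ)
    (e : Fin 4 → ℤ) : pushforward (permIso π) 1 (monomialClass l κ e) =
      monomialClass (l ∘ π) (κ ∘ π) (e ∘ π) :=
  pushforward_permIso_orbitClass π _ _

lemma pushforward_invIso_monomialClass (l : Fin 4 → ℤ) (κ : Fin 4 → ℂˣ) (e : Fin 4 → ℤ) :
    pushforward (invIso 3) 1 (monomialClass l κ e) = monomialClass (-l) κ⁻¹ (-e) := by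
  unfold monomialClass
  rw [pushforward_invIso_orbitClass]
  congr 1
  funext i
  simp [zpow_neg, mul_comm]

/-- The exponent is one for a homogeneous coordinate whose level is the level of an earlier one. -/
def toricExp (l : Fin 4 → ℤ) (i : Fin 4) : ℤ := if ∃ j, j < i ∧ l j = l i then 1 else 0

/-- The class of a torus invariant curve: the closure of the torus orbit belonging to the order of
the levels `l`, exactly two of which are supposed to coincide. -/
def toricClass (l : Fin 4 → ℤ) : Chow (permData 3).X 1 := monomialClass l 1 (toricExp l)

/-- Exactly two levels coincide, and the exponents of these coordinates differ by one. -/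
def IsToricLevel (l e : Fin 4 → ℤ) : Prop :=
  ∃ i j, (∀ i' j', l i' = l j' ↔ i' = j' ∨ (i' = i ∧ j' = j) ∨ (i' = j ∧ j' = i)) ∧
    (e i - e j = 1 ∨ e i - e j = -1)

instance (l e : Fin 4 → ℤ) : Decidable (IsToricLevel l e) :=
  inferInstanceAs (Decidable (∃ i j, (∀ i' j', l i' = l j' ↔
    i' = j' ∨ (i' = i ∧ j' = j) ∨ (i' = j ∧ j' = i)) ∧ (e i - e j = 1 ∨ e i - e j = -1)))

lemma monomialClass_eq_of_isToricLevel {l l' e e' : Fin 4 → ℤ} (h : SameOrder l l')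
    (he : IsToricLevel l e) (he' : IsToricLevel l' e') (κ κ' : Fin 4 → ℂˣ) :
    monomialClass l κ e = monomialClass l' κ' e' := by
  obtain ⟨i, j, hij, he⟩ := he
  obtain ⟨i', j', hij', he'⟩ := he'
  have h2 : l' i = l' j := by
    have h1 : l i = l j := (hij i j).2 (by simp)
    exact le_antisymm ((h i j).1 h1.le) ((h j i).1 h1.ge)
  have hd : e' i - e' j = 1 ∨ e' i - e' j = -1 := by
    rcases (hij' i j).1 h2 with rfl | ⟨rfl, rfl⟩ | ⟨rfl, rfl⟩
    · exfalso
      omega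
    · exact he'
    · omega
  have hr : (e i - e j) * (e i - e j) = 1 := by
    rcases he with he | he <;> rw [he] <;> norm_num
  have hd0 : e' i - e' j ≠ 0 := by omega
  have he0 : e i - e j ≠ 0 := by omega
  refine monomialClass_congr h (mul_ne_zero hd0 he0)
    ((κ j * κ' i / (κ i * κ' j)) ^ (e i - e j)) ?_ ?_
  · intro a b hab
    rcases (hij a b).1 hab with rfl | ⟨rfl, rfl⟩ | ⟨rfl, rfl⟩
    · simp
    · rw [mul_assoc, hr, mul_one]
    · linear_combination -(e' b - e' a) * hr
  · have key : κ i * ((κ j * κ' i / (κ i * κ' j)) ^ (e i - e j)) ^ e i * κ' j =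
        κ j * ((κ j * κ' i / (κ i * κ' j)) ^ (e i - e j)) ^ e j * κ' i := by
      have h3 : ((κ j * κ' i / (κ i * κ' j)) ^ (e i - e j)) ^ (e i - e j) =
          κ j * κ' i / (κ i * κ' j) := by rw [← zpow_mul, hr, zpow_one]
      generalize (κ j * κ' i / (κ i * κ' j)) ^ (e i - e j) = u at h3 ⊢
      rw [zpow_sub, ← div_eq_mul_inv, div_eq_div_iff_mul_eq_mul] at h3
      calc κ i * u ^ e i * κ' j = u ^ e i * (κ i * κ' j) := by
            rw [mul_comm (κ i), mul_assoc]
        _ = κ j * κ' i * u ^ e j := h3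
        _ = κ j * u ^ e j * κ' i := mul_right_comm _ _ _
    intro a b hab
    rcases (hij a b).1 hab with rfl | ⟨rfl, rfl⟩ | ⟨rfl, rfl⟩
    · rfl
    · exact key
    · exact key.symm

lemma monomialClass_eq_toricClass {l l' e : Fin 4 → ℤ} (h : SameOrder l l' ∧ IsToricLevel l e ∧
    IsToricLevel l' (toricExp l')) (κ : Fin 4 → ℂˣ) : monomialClass l κ e = toricClass l' :=
  monomialClass_eq_of_isToricLevel h.1 h.2.1 h.2.2 _ _

lemma pushforward_permIso_toricClass (π : Equiv.Perm (Fin 4)) {l l' : Fin 4 → ℤ}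
    (h : SameOrder (l ∘ π) l' ∧ IsToricLevel (l ∘ π) (toricExp l ∘ π) ∧
      IsToricLevel l' (toricExp l')) :
    pushforward (permIso π) 1 (toricClass l) = toricClass l' := by
  unfold toricClass
  rw [pushforward_permIso_monomialClass]
  exact monomialClass_eq_of_isToricLevel h.1 h.2.1 h.2.2 _ _

lemma pushforward_invIso_toricClass {l l' : Fin 4 → ℤ}
    (h : SameOrder (-l) l' ∧ IsToricLevel (-l) (-toricExp l) ∧ IsToricLevel l' (toricExp l')) :
    pushforward (invIso 3) 1 (toricClass l) = toricClass l' := by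
  unfold toricClass
  rw [pushforward_invIso_monomialClass]
  exact monomialClass_eq_of_isToricLevel h.1 h.2.1 h.2.2 _ _


open ToricData

/-! ### Relations between classes of curves -/

section Ratios

variable {w : Fin 4 → Fin 2 → ℤ} {Λ : Fin 4 → ℤ} {κ : Fin 4 → ℂˣ}

/-- The ratio of two homogeneous coordinates of equal level on a toric surface. -/
lemma orbitPt_torusCoord_q {i j : Fin 4} (hΛ : Λ i = Λ j) (hκ : κ i = κ j) {x y : Fin 2 → ℤ}
    (h : w i - w j = x - y) :
    orbitPt (algebraMap ℂ (TR 2)) Λ (torusCoord w κ) ≫ (permData 3).q (i, j) =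
      PP.pt (ι := Fin 2) (algebraMap ℂ (TR 2)) (fun b ↦ mono ((![x, y] : Fin 2 → Fin 2 → ℤ) b)) 1
        (isUnit_mono _) := by
  have h1 : w i + y = w j + x := by
    rw [sub_eq_sub_iff_add_eq_add] at h
    rw [h, add_comm]
  rw [orbitPt_q]
  refine PP.pt_eq_pt fun b b' ↦ ?_
  have hb : ∀ b : Fin 2, b = 0 ∨ b = 1 := by decide
  have h2 : (torusCoord w κ i : TR 2) * mono y = torusCoord w κ j * mono x := by
    rw [coe_torusCoord, coe_torusCoord, hκ, mul_assoc, mul_assoc, ← mono_add, ← mono_add, h1]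
  rcases hb b with rfl | rfl <;> rcases hb b' with rfl | rfl <;>
    simp [limitRatio, hΛ, h2]

end Ratios

section PermSurface

/-- The polynomial of a linear form on a chart of the permutohedral surface: the linear form with
the coefficients `c` is divided by the homogeneous coordinate of the greatest index, in the order
of the chart, at which its coefficient does not vanish. -/
def linearPoly (c : Fin 3 → ℂ) (σ : Equiv.Perm (Fin 3)) : AR 2 :=
  if c (σ 2) = 0 then MvPolynomial.C (c (σ 0)) * MvPolynomial.X 0 + MvPolynomial.C (c (σ 1))
  else (MvPolynomial.C (c (σ 0)) * MvPolynomial.X 0 + MvPolynomial.C (c (σ 1))) * MvPolynomial.X 1 +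
    MvPolynomial.C (c (σ 2))

lemma θ_C {n : ℕ} {D : ToricData n} (C : D.Chart) (z : ℂ) :
    C.θ (MvPolynomial.C z) = algebraMap ℂ (TR n) z := DFunLike.congr_fun C.θ_comp_C z

lemma linearForm_eq (c : Fin 3 → ℂ) (b : Fin 2 → ℤ) (σ : Equiv.Perm (Fin 3)) :
    ∑ i, algebraMap ℂ (TR 2) (c i) * mono (hw i - b) =
      mono (hw (if c (σ 2) = 0 then σ 1 else σ 2) - b) * (permChart σ).θ (linearPoly c σ) := by
  have hE0 : (permChart σ).E 0 = hw (σ 0) - hw (σ 1) := rfl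
  have hE1 : (permChart σ).E 1 = hw (σ 1) - hw (σ 2) := rfl
  have key : ∀ x y : Fin 3, (mono (hw y - b) * mono (hw x - hw y) : TR 2) = mono (hw x - b) := by
    intro x y
    rw [← mono_add]
    congr 1
    abel
  rw [← Equiv.sum_comp σ, Fin.sum_univ_three]
  unfold linearPoly
  split_ifs with h
  · have h0 : algebraMap ℂ (TR 2) (c (σ 2)) = 0 := (congr_arg _ h).trans (map_zero _)
    rw [h0, map_add, map_mul, θ_C, θ_C, Chart.θ_X, hE0]
    linear_combination (-algebraMap ℂ (TR 2) (c (σ 0))) * key (σ 0) (σ 1)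
  · rw [map_add, map_mul, map_add, map_mul, θ_C, θ_C, θ_C, Chart.θ_X, Chart.θ_X, hE0, hE1]
    linear_combination (-algebraMap ℂ (TR 2) (c (σ 0))) * key (σ 0) (σ 1) -
      (algebraMap ℂ (TR 2) (c (σ 1)) + algebraMap ℂ (TR 2) (c (σ 0)) * mono (hw (σ 0) - hw (σ 1))) *
        key (σ 1) (σ 2)

lemma notMem_vars_C_mul_X_add_C (a b : ℂ) :
    (1 : Fin 2) ∉ (MvPolynomial.C a * MvPolynomial.X 0 + MvPolynomial.C b : AR 2).vars := by
  intro h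
  have h1 := MvPolynomial.vars_add_subset _ _ h
  rw [MvPolynomial.vars_C, Finset.union_empty] at h1
  have h2 := MvPolynomial.vars_mul _ _ h1
  rw [MvPolynomial.vars_C, Finset.empty_union, MvPolynomial.vars_X] at h2
  simp at h2

lemma C_mul_X_add_C_ne_zero {a b : ℂ} (h : a ≠ 0 ∨ b ≠ 0) :
    (MvPolynomial.C a * MvPolynomial.X 0 + MvPolynomial.C b : AR 2) ≠ 0 := by
  intro h0
  have h1 : ∀ t : ℂ, a * t + b = 0 := fun t ↦ by
    simpa using congr_arg (MvPolynomial.eval (fun _ ↦ t)) h0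
  have hb : b = 0 := by simpa using h1 0
  have ha : a = 0 := by simpa [hb] using h1 1
  exact h.elim (· ha) (· hb)

lemma prime_linearPoly {c : Fin 3 → ℂ} (hc : ∀ i j, i ≠ j → c i ≠ 0 ∨ c j ≠ 0)
    (σ : Equiv.Perm (Fin 3)) : Prime (linearPoly c σ) := by
  unfold linearPoly
  have h1 := hc (σ 0) (σ 1) (by simp)
  split_ifs with h
  · have h2 := (hc (σ 1) (σ 2) (by simp)).resolve_right (not_not.2 h)
    have h3 := (hc (σ 0) (σ 2) (by simp)).resolve_right (not_not.2 h)
    exact prime_mul_X_add_C (by simpa using h3) (by simp) h2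
  · exact prime_mul_X_add_C (C_mul_X_add_C_ne_zero h1) (notMem_vars_C_mul_X_add_C _ _) h

/-- The relation given by a linear form on the permutohedral surface, divided by one of the
homogeneous coordinates. At most one coefficient vanishes: the last one, if `z` holds. -/
lemma permSurface_relation {w : Fin 4 → Fin 2 → ℤ} {Λ : Fin 4 → ℤ} {N : ℤ} (κ : Fin 4 → ℂˣ)
    (f : Fin 3 → Fin 4) (hf : ∀ a b, Λ (f a) = Λ (f b) ∧ w (f a) - w (f b) = hw a - hw b)
    (hfκ : ∀ a b, κ (f a) = κ (f b))
    (htot : ∀ (v : Equiv.Perm (Fin 3)) i j, Λ i = Λ j →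
      (permChart v).Nonneg (w i - w j) ∨ (permChart v).Nonneg (w j - w i))
    (hN : ∀ (v : Equiv.Perm (Fin 3)) l i j, Λ j < Λ i →
      boundaryLevel permChart w Λ N v l j < boundaryLevel permChart w Λ N v l i)
    (c : Fin 3 → ℂ) (z : Bool) (hc : ∀ i, c i = 0 ↔ (i = 2 ∧ z = true)) (b : Fin 2 → ℤ)
    (t : Fin 2 → FFˣ) (ht : ∑ i, algebraMap ℂ FF (c i) * charVal t (hw i) = 0)
    (m₀ : Fin 2 → ℤ) (hm₀ : FF.Nonconst (charVal t m₀ : FF))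
    {δ : Type} [Fintype δ] (lev e : δ → Fin 4 → ℤ)
    (hord : ∀ (v : Equiv.Perm (Fin 3)) l,
      -((permChart v).ρ l ⬝ᵥ (hw (if v 2 = 2 ∧ z = true then v 1 else v 2) - b)) =
      ∑ d, if SameOrder (boundaryLevel permChart w Λ N v l) (lev d) then 1 else 0)
    (hexp : ∀ (v : Equiv.Perm (Fin 3)) l d,
      SameOrder (boundaryLevel permChart w Λ N v l) (lev d) →
      (∀ i j, boundaryLevel permChart w Λ N v l i = boundaryLevel permChart w Λ N v l j →
        (permChart v).ρ (l + 1) ⬝ᵥ w i - (permChart v).ρ (l + 1) ⬝ᵥ w j = e d i - e d j) ∨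
      ∀ i j, boundaryLevel permChart w Λ N v l i = boundaryLevel permChart w Λ N v l j →
        (permChart v).ρ (l + 1) ⬝ᵥ w i - (permChart v).ρ (l + 1) ⬝ᵥ w j = e d j - e d i)
    (hex : ∀ d, ∃ (v : Equiv.Perm (Fin 3)) (l : Fin 2),
      SameOrder (boundaryLevel permChart w Λ N v l) (lev d)) :
    orbitClass Λ (fun i ↦ FF.c (κ i) * charVal t (w i)) = ∑ d, monomialClass (lev d) κ (e d) := by
  refine orbitClass_eq_sum (C := permChart (n := 2)) exists_mem_range_permChart htot hN κ ?_ _ _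
    (prime_linearPoly (c := c) fun i j hij ↦ ?_) (fun σ ↦ linearForm_eq c b σ) t ?_ m₀ hm₀ lev e
    ?_ hexp hex
  · rintro ⟨x, y⟩
    exact ⟨(permData 3).q (f x, f y),
      orbitPt_torusCoord_q (hf x y).1 (hfκ x y) (hf x y).2⟩
  · by_contra! h
    rw [hc, hc] at h
    exact hij (h.1.1.trans h.2.1.symm)
  · rw [map_sum]
    have h1 : ∀ i, evTorus t (algebraMap ℂ (TR 2) (c i) * mono (hw i - b)) =
        (algebraMap ℂ FF (c i) * charVal t (hw i)) * ((charVal t b)⁻¹ : FFˣ) := by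
      intro i
      rw [map_mul, evTorus_algebraMap, evTorus_mono, charVal_sub, div_eq_mul_inv, Units.val_mul,
        mul_assoc]
    rw [Finset.sum_congr rfl fun i _ ↦ h1 i, ← Finset.sum_mul, ht, zero_mul]
  · intro v l
    rw [← hord v l]
    simp only [hc]

end PermSurface


open ToricData

/-! ### Relations from degenerations on toric surfaces -/

section LinearRelations

lemma charVal_hw (t : Fin 2 → FFˣ) (i : Fin 3) : charVal t (hw i) = ![1, t 0, t 1] i := by
  have h : ∀ i : Fin 3, (hw i 0 : ℤ) = ![0, 1, 0] i ∧ (hw i 1 : ℤ) = ![0, 0, 1] i := by decide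
  unfold charVal
  rw [(h i).1, (h i).2]
  fin_cases i <;> simp

/-- A line degenerates: the functions `t 1` and `t 2` have a constant ratio on the line and this
ratio is a rational function on a surface containing the line. -/
lemma line_relation (κ κ' : ℂˣ) :
    monomialClass 0 ![κ, 1, κ', 1] ![0, 0, 0, 1] =
      monomialClass ![1, 1, 0, 0] ![κ, 1, 1, 1] ![0, 0, 1, 0] +
      monomialClass ![1, 1, 0, 1] ![κ, 1, 1, 1] ![0, 0, 0, 1] := by
  have h := permSurface_relation (w := ![hw 0, hw 0, hw 1, hw 2]) (Λ := 0) (N := 10) ![κ, 1, 1, 1]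
    Fin.succ (by decide +kernel) (by intro a b; fin_cases a <;> fin_cases b <;> rfl)
    (by decide +kernel) (by decide +kernel) ![-(κ' : ℂ), 1, 0] true
    (by intro i; fin_cases i <;> simp) (hw 0) ![FF.c κ', FF.s]
    (by
      simp only [charVal_hw, Fin.sum_univ_three]
      simp [FF.c])
    (hw 2) (by
      rw [charVal_hw]
      simpa using FF.nonconst_zpow one_ne_zero)
    ![![1, 1, 0, 0], ![1, 1, 0, 1]] ![![0, 0, 1, 0], ![0, 0, 0, 1]]
    (by decide +kernel) (by decide +kernel) (by decide +kernel)
  rw [Fin.sum_univ_two] at h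
  refine Eq.trans ?_ h
  unfold monomialClass
  congr 1
  funext i
  fin_cases i <;> simp [charVal_hw]

/-- A line in a plane that joins a vertex to the opposite edge of the triangle of torus invariant
curves. -/
lemma pencil_relation (κ : ℂˣ) :
    monomialClass ![1, 1, 1, 0] ![1, κ, 1, 1] ![0, 0, 1, 0] =
      toricClass ![2, 1, 1, 0] + toricClass ![2, 1, 2, 0] := by
  have h := permSurface_relation (w := ![hw 0, hw 1, hw 2, 0]) (Λ := ![1, 1, 1, 0]) (N := 10) 1
    Fin.castSucc (by decide +kernel) (fun _ _ ↦ rfl)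
    (by decide +kernel) (by decide +kernel) ![-(κ : ℂ), 1, 0] true
    (by intro i; fin_cases i <;> simp) (hw 0) ![FF.c κ, FF.s]
    (by
      simp only [charVal_hw, Fin.sum_univ_three]
      simp [FF.c])
    (hw 2) (by
      rw [charVal_hw]
      simpa using FF.nonconst_zpow one_ne_zero)
    ![![2, 1, 1, 0], ![2, 1, 2, 0]] ![![0, 0, 1, 0], ![0, 0, 1, 0]]
    (by decide +kernel) (by decide +kernel) (by decide +kernel)
  rw [Fin.sum_univ_two] at h
  have h1 : monomialClass ![2, 1, 1, 0] 1 ![0, 0, 1, 0] = toricClass ![2, 1, 1, 0] :=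
    monomialClass_eq_toricClass (by decide +kernel) _
  have h2 : monomialClass ![2, 1, 2, 0] 1 ![0, 0, 1, 0] = toricClass ![2, 1, 2, 0] :=
    monomialClass_eq_toricClass (by decide +kernel) _
  refine Eq.trans ?_ (h.trans (congr_arg₂ (· + ·) h1 h2))
  unfold monomialClass
  congr 1
  funext i
  fin_cases i <;> simp [charVal_hw, charVal_zero]

/-- A general line in a plane. -/
lemma plane_relation (α β γ : ℂˣ) (y : FFˣ) (hy : (FF.c α + FF.c β * FF.s + FF.c γ * y : FF) = 0) :
    orbitClass ![1, 1, 1, 0] ![1, FF.s, y, 1] =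
      toricClass ![1, 1, 2, 0] + toricClass ![2, 1, 2, 0] + toricClass ![1, 2, 2, 0] := by
  have h := permSurface_relation (w := ![hw 0, hw 1, hw 2, 0]) (Λ := ![1, 1, 1, 0]) (N := 10) 1
    Fin.castSucc (by decide +kernel) (fun _ _ ↦ rfl)
    (by decide +kernel) (by decide +kernel) ![(α : ℂ), β, γ] false
    (by intro i; fin_cases i <;> simp) (hw 2) ![FF.s, y]
    (by
      simp only [charVal_hw, Fin.sum_univ_three]
      simpa [FF.c] using hy)
    (hw 1) (by
      rw [charVal_hw]
      simpa using FF.nonconst_zpow one_ne_zero)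
    ![![1, 1, 2, 0], ![2, 1, 2, 0], ![1, 2, 2, 0]] ![![0, 1, 0, 0], ![0, 0, 1, 0], ![0, 0, 1, 0]]
    (by decide +kernel) (by decide +kernel) (by decide +kernel)
  rw [Fin.sum_univ_three] at h
  have h1 : monomialClass ![1, 1, 2, 0] 1 ![0, 1, 0, 0] = toricClass ![1, 1, 2, 0] :=
    monomialClass_eq_toricClass (by decide +kernel) _
  have h2 : monomialClass ![2, 1, 2, 0] 1 ![0, 0, 1, 0] = toricClass ![2, 1, 2, 0] :=
    monomialClass_eq_toricClass (by decide +kernel) _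
  have h3 : monomialClass ![1, 2, 2, 0] 1 ![0, 0, 1, 0] = toricClass ![1, 2, 2, 0] :=
    monomialClass_eq_toricClass (by decide +kernel) _
  refine Eq.trans ?_ (h.trans (congr_arg₂ (· + ·) (congr_arg₂ (· + ·) h1 h2) h3))
  congr 1
  funext i
  fin_cases i <;> simp [charVal_hw, charVal_zero]

end LinearRelations

section Square

/-- The toric data of `ℙ¹ × ℙ¹`. -/
abbrev squareData : ToricData 2 where
  K := Fin 2
  ι _ := Fin 2
  χ k := ![stdE k, 0]
  base _ := 1

/-- The affine chart of `ℙ¹ × ℙ¹` around the torus fixed point where the homogeneous coordinate of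
index `v k` of the `k`-th factor vanishes. -/
def squareChart (v : Fin 2 → Fin 2) : squareData.Chart :=
  Chart.mk' (fun l ↦ sgn (v l) • stdE l) (fun l ↦ sgn (v l) • stdE l) (fun k ↦ (v k + 1 : Fin 2))
    (by
      have : ∀ (v : Fin 2 → Fin 2) (l k : Fin 2) (i : Fin 2), 0 ≤ (sgn (v l) • stdE l) ⬝ᵥ
        ((![stdE k, 0] : Fin 2 → Fin 2 → ℤ) i - (![stdE k, 0] : Fin 2 → Fin 2 → ℤ) (v k + 1)) := by
        decide +kernel
      exact this v)
    (by
      have : ∀ (v : Fin 2 → Fin 2) (l : Fin 2), ∃ (k : Fin 2) (i : Fin 2), sgn (v l) • stdE l =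
        (![stdE k, 0] : Fin 2 → Fin 2 → ℤ) i - (![stdE k, 0] : Fin 2 → Fin 2 → ℤ) (v k + 1) := by
        decide +kernel
      exact this v)
    (by revert v; decide +kernel)

lemma exists_mem_range_squareChart (x : squareData.X) :
    ∃ v, x ∈ Set.range (squareChart v).map := by
  have h : ∀ k : Fin 2, ∃ b : Fin 2, squareData.q k x ∈ PP.dPlus b :=
    fun k ↦ PP.exists_mem_dPlus _
  choose b hb using h
  refine ⟨fun k ↦ b k - 1, (Chart.mem_range_map _).2 fun k ↦ ?_⟩
  have : (squareChart fun k ↦ b k - 1).c k = b k := sub_add_cancel _ _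
  rw [this]
  exact hb k

/-- The polynomial `x - κ` in a chart of the affine line `ℙ¹` of the first factor. -/
def squarePoly (κ : ℂ) (v : Fin 2 → Fin 2) : AR 2 :=
  if v 0 = 0 then MvPolynomial.C 1 * MvPolynomial.X 0 + MvPolynomial.C (-κ)
  else MvPolynomial.C (-κ) * MvPolynomial.X 0 + MvPolynomial.C 1

lemma square_ratios (k : Fin 2) : ∃ u : (permData 3).X ⟶ PP (Fin 2),
    orbitPt (algebraMap ℂ (TR 2)) ![1, 1, 0, 0] (torusCoord ![stdE 0, 0, stdE 1, 0] 1) ≫ u =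
      squareData.torusPt k := by
  have h : ∀ k : Fin 2, ∃ i j : Fin 4,
      (![1, 1, 0, 0] : Fin 4 → ℤ) i = (![1, 1, 0, 0] : Fin 4 → ℤ) j ∧
      (![stdE 0, 0, stdE 1, 0] : Fin 4 → Fin 2 → ℤ) i -
        (![stdE 0, 0, stdE 1, 0] : Fin 4 → Fin 2 → ℤ) j = stdE k - 0 := by decide +kernel
  obtain ⟨i, j, h1, h2⟩ := h k
  exact ⟨(permData 3).q (i, j), orbitPt_torusCoord_q h1 rfl h2⟩

/-- The fibres of a projection of `ℙ¹ × ℙ¹` are rationally equivalent. -/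
lemma fiber_relation (κ : ℂˣ) : monomialClass ![1, 1, 0, 0] ![κ, 1, 1, 1] ![0, 0, 1, 0] =
    toricClass ![1, 2, 0, 0] := by
  have hκ : -(κ : ℂ) ≠ 0 := neg_ne_zero.2 κ.ne_zero
  have h := orbitClass_eq_sum (C := squareChart) (w := ![stdE 0, 0, stdE 1, 0])
    (Λ := ![1, 1, 0, 0]) (N := 10) exists_mem_range_squareChart
    (by decide +kernel) (by decide +kernel) 1 (T := mono (stdE 0) - algebraMap ℂ (TR 2) κ)
    square_ratios
    (fun v ↦ if v 0 = 0 then 0 else stdE 0) (squarePoly κ)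
    (fun v ↦ by
      unfold squarePoly
      split_ifs
      · exact prime_mul_X_add_C (by simp) (by simp) hκ
      · exact prime_mul_X_add_C (by simp) (by simp) one_ne_zero)
    (fun v ↦ by
      have hb : ∀ b : Fin 2, b = 0 ∨ b = 1 := by decide
      have hE : (squareChart v).E 0 = sgn (v 0) • stdE 0 := rfl
      unfold squarePoly
      rcases hb (v 0) with h | h
      · rw [if_pos h, if_pos h, mono_zero, map_add, map_mul, θ_C, θ_C, Chart.θ_X, hE, h, map_one,
          map_neg]
        simp only [sgn, if_true, one_smul]
        ring
      · have h0 : v 0 ≠ 0 := by rw [h]; decide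
        rw [if_neg h0, if_neg h0, map_add, map_mul, θ_C, θ_C, Chart.θ_X, hE, h, map_one, map_neg]
        have h1 : sgn 1 • (stdE 0 : Fin 2 → ℤ) = - stdE 0 := by decide +kernel
        rw [h1]
        linear_combination algebraMap ℂ (TR 2) κ * mono_mul_neg (stdE 0 : Fin 2 → ℤ))
    ![FF.c κ, FF.s] (by
      rw [map_sub, evTorus_mono, evTorus_algebraMap, sub_eq_zero]
      simp [charVal, stdE, FF.c]) (stdE 1)
    (by simpa [charVal, stdE] using FF.nonconst_zpow one_ne_zero)
    (δ := Unit) (fun _ ↦ ![1, 2, 0, 0]) (fun _ ↦ ![0, 0, 1, 0])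
    (by decide +kernel) (by decide +kernel) (by decide +kernel)
  rw [Fintype.sum_unique] at h
  have h1 : monomialClass ![1, 2, 0, 0] 1 ![0, 0, 1, 0] = toricClass ![1, 2, 0, 0] :=
    monomialClass_eq_toricClass (by decide +kernel) _
  refine Eq.trans ?_ (h.trans h1)
  unfold monomialClass
  congr 1
  funext i
  fin_cases i <;> simp [charVal, stdE]

end Square


open ToricData

/-! ### The classes of lines, planar lines and fibres -/

/-- The sum of the classes of torus invariant curves with the given levels. -/
def toricSum (L : List (Fin 4 → ℤ)) : Chow (permData 3).X 1 := (L.map toricClass).sum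

lemma toricSum_append (L L' : List (Fin 4 → ℤ)) : toricSum (L ++ L') = toricSum L + toricSum L' := by
  simp [toricSum]

/-- The number of smaller levels. -/
def levelRank (l : Fin 4 → ℤ) (i : Fin 4) : Fin 5 :=
  ⟨(Finset.univ.filter fun j ↦ l j < l i).card, by
    have := Finset.card_filter_le Finset.univ fun j ↦ l j < l i
    rw [Finset.card_univ, Fintype.card_fin] at this
    omega⟩

lemma levelRank_le_iff (l : Fin 4 → ℤ) (i j : Fin 4) : levelRank l i ≤ levelRank l j ↔ l i ≤ l j := by
  constructor
  · intro h
    by_contra! hlt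
    have h' : (Finset.univ.filter fun k ↦ l k < l i).card ≤
        (Finset.univ.filter fun k ↦ l k < l j).card := Fin.le_def.1 h
    refine (Finset.card_lt_card ?_).not_ge h'
    refine Finset.ssubset_iff_of_subset ?_ |>.2 ⟨j, by simpa using hlt, by simp⟩
    intro k hk
    simp only [Finset.mem_filter, Finset.mem_univ, true_and] at hk ⊢
    exact hk.trans hlt
  · intro h
    change (Finset.univ.filter fun k ↦ l k < l i).card ≤
        (Finset.univ.filter fun k ↦ l k < l j).card
    refine Finset.card_le_card ?_
    intro k hk
    simp only [Finset.mem_filter, Finset.mem_univ, true_and] at hk ⊢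
    exact hk.trans_le h

/-- The class of a torus invariant curve depends only on the order of the levels. -/
lemma toricClass_congr {l l' : Fin 4 → ℤ} (h : levelRank l = levelRank l')
    (hl : IsToricLevel l (toricExp l)) (hl' : IsToricLevel l' (toricExp l')) :
    toricClass l = toricClass l' :=
  monomialClass_eq_of_isToricLevel
    (fun i j ↦ by rw [← levelRank_le_iff, h, levelRank_le_iff]) hl hl' _ _

lemma toricSum_congr {L L' : List (Fin 4 → ℤ)} (h : (L.map levelRank).Perm (L'.map levelRank))
    (hL : ∀ l ∈ L, IsToricLevel l (toricExp l)) (hL' : ∀ l ∈ L', IsToricLevel l (toricExp l)) :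
    toricSum L = toricSum L' := by
  classical
  let T : (Fin 4 → Fin 5) → Chow (permData 3).X 1 := fun r ↦
    if h : ∃ l, levelRank l = r ∧ IsToricLevel l (toricExp l) then toricClass h.choose else 0
  have hT : ∀ L : List (Fin 4 → ℤ), (∀ l ∈ L, IsToricLevel l (toricExp l)) →
      toricSum L = ((L.map levelRank).map T).sum := by
    intro L hL
    unfold toricSum
    rw [List.map_map]
    congr 1
    refine List.map_congr_left fun l hl ↦ ?_
    have hex : ∃ l', levelRank l' = levelRank l ∧ IsToricLevel l' (toricExp l') :=
      ⟨l, rfl, hL l hl⟩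
    simp only [T, Function.comp_apply, dif_pos hex]
    exact toricClass_congr hex.choose_spec.1.symm (hL l hl) hex.choose_spec.2
  rw [hT L hL, hT L' hL']
  exact (h.map T).sum_eq

/-- The levels in the list `L`, permuted by `v`; their opposites if `ε` is true. -/
def permLevels (L : List (Fin 4 → ℤ)) (ε : Bool) (v : Fin 4 → Fin 4) : List (Fin 4 → ℤ) :=
  L.map fun l ↦ if ε then -(l ∘ v) else l ∘ v

lemma pushforward_permIso_toricSum (π : Equiv.Perm (Fin 4)) {L : List (Fin 4 → ℤ)} {ε : Bool}
    {v : Fin 4 → Fin 4} (hL : ∀ l ∈ permLevels L ε v, IsToricLevel (l ∘ π) (toricExp l ∘ π) ∧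
      IsToricLevel (l ∘ π) (toricExp (l ∘ π))) :
    pushforward (permIso π) 1 (toricSum (permLevels L ε v)) =
      toricSum (permLevels L ε (v ∘ π)) := by
  have h : permLevels L ε (v ∘ π) = (permLevels L ε v).map (· ∘ π) := by
    unfold permLevels
    rw [List.map_map]
    refine List.map_congr_left fun l _ ↦ ?_
    cases ε <;> rfl
  unfold toricSum
  rw [map_list_sum, h, List.map_map, List.map_map]
  congr 1
  exact List.map_congr_left fun l hl ↦
    pushforward_permIso_toricClass π ⟨fun _ _ ↦ Iff.rfl, hL l hl⟩

lemma pushforward_invIso_toricSum {L : List (Fin 4 → ℤ)} {v : Fin 4 → Fin 4}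
    (hL : ∀ l ∈ permLevels L false v, IsToricLevel (-l) (-toricExp l) ∧
      IsToricLevel (-l) (toricExp (-l))) :
    pushforward (invIso 3) 1 (toricSum (permLevels L false v)) =
      toricSum (permLevels L true v) := by
  have h : permLevels L true v = (permLevels L false v).map (- ·) := by
    unfold permLevels
    rw [List.map_map]
    rfl
  unfold toricSum
  rw [map_list_sum, h, List.map_map, List.map_map]
  congr 1
  exact List.map_congr_left fun l hl ↦
    pushforward_invIso_toricClass ⟨fun _ _ ↦ Iff.rfl, hL l hl⟩

/-- The torus invariant curves in the class of a line. -/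
def lineLevels : List (Fin 4 → ℤ) := [![1, 2, 0, 0], ![2, 1, 0, 1], ![2, 1, 0, 2]]

/-- The torus invariant curves in the class of a line in an exceptional plane. -/
def planeLevels : List (Fin 4 → ℤ) := [![1, 1, 2, 0], ![2, 1, 2, 0], ![1, 2, 2, 0]]

/-- The torus invariant curves in the class of a fibre. -/
def fiberLevels : List (Fin 4 → ℤ) := [![1, 2, 0, 0]]

lemma fiberClass_base (κ : Fin 4 → ℂˣ) :
    monomialClass ![1, 1, 0, 0] κ ![0, 0, 1, 0] = toricSum (permLevels fiberLevels false id) := by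
  have h : monomialClass ![1, 1, 0, 0] κ ![0, 0, 1, 0] =
      monomialClass ![1, 1, 0, 0] ![κ 0 / κ 1, 1, 1, 1] ![0, 0, 1, 0] := by
    refine monomialClass_congr (fun _ _ ↦ Iff.rfl) one_ne_zero (κ 3 / κ 2)
      (fun i j _ ↦ one_mul _) ?_
    intro i j
    fin_cases i <;> fin_cases j <;> simp
  rw [h, fiber_relation]
  simp [toricSum, permLevels, fiberLevels]

lemma lineClass_base (κ : Fin 4 → ℂˣ) :
    monomialClass 0 κ ![0, 0, 0, 1] = toricSum (permLevels lineLevels false id) := by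
  have h : monomialClass 0 κ ![0, 0, 0, 1] =
      monomialClass 0 ![κ 0 / κ 1, 1, κ 2 / κ 1, 1] ![0, 0, 0, 1] := by
    refine monomialClass_congr (fun _ _ ↦ Iff.rfl) one_ne_zero (κ 1 / κ 3)
      (fun i j _ ↦ one_mul _) ?_
    intro i j _
    fin_cases i <;> fin_cases j <;> simp
    all_goals rw [← mul_div_assoc, ← mul_div_assoc, mul_comm]
  have h1 := pencil_relation (κ 0 / κ 1)⁻¹
  have h2 := congr_arg (pushforward (permIso (Equiv.swap 2 3)) 1) h1
  rw [map_add, pushforward_permIso_monomialClass,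
    pushforward_permIso_toricClass _ (l' := ![2, 1, 0, 1]) (by decide +kernel),
    pushforward_permIso_toricClass _ (l' := ![2, 1, 0, 2]) (by decide +kernel)] at h2
  have h3 : monomialClass ![1, 1, 0, 1] ![κ 0 / κ 1, 1, 1, 1] ![0, 0, 0, 1] =
      monomialClass (![1, 1, 1, 0] ∘ Equiv.swap (2 : Fin 4) 3)
        (![1, (κ 0 / κ 1)⁻¹, 1, 1] ∘ Equiv.swap (2 : Fin 4) 3)
        (![0, 0, 1, 0] ∘ Equiv.swap (2 : Fin 4) 3) := by
    refine monomialClass_congr (by decide +kernel) one_ne_zero (κ 0 / κ 1) (by decide +kernel) ?_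
    intro i j
    have e1 : Equiv.swap (2 : Fin 4) 3 0 = 0 := by decide
    have e2 : Equiv.swap (2 : Fin 4) 3 1 = 1 := by decide
    have e3 : Equiv.swap (2 : Fin 4) 3 2 = 3 := by decide
    have e4 : Equiv.swap (2 : Fin 4) 3 3 = 2 := by decide
    fin_cases i <;> fin_cases j <;> simp [e1, e2, e3, e4]
  rw [h, line_relation, fiber_relation, h3, h2]
  simp [toricSum, permLevels, lineLevels]


open ToricData

/-! ### The classes of all lines, planar lines and fibres -/

lemma isToricLevel_permLevels (L : List (Fin 4 → ℤ)) (hL : L = lineLevels ∨ L = planeLevels ∨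
    L = fiberLevels) (p : Equiv.Perm (Fin 4)) :
    (∀ l ∈ permLevels L false id, IsToricLevel (l ∘ p) (toricExp l ∘ p) ∧
      IsToricLevel (l ∘ p) (toricExp (l ∘ p))) ∧
    ∀ l ∈ permLevels L false p, IsToricLevel (-l) (-toricExp l) ∧
      IsToricLevel (-l) (toricExp (-l)) := by
  revert p
  rcases hL with rfl | rfl | rfl <;> decide +kernel

/-- The class of a line is a sum of classes of torus invariant curves, in several ways. -/
lemma lineClass_eq (κ : Fin 4 → ℂˣ) {c : Fin 4} (ε : Bool) {v : Fin 4 → Fin 4}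
    (hv : v.Bijective) (hc : v c = 3) :
    monomialClass 0 κ (Pi.single c 1) = toricSum (permLevels lineLevels ε v) := by
  obtain ⟨p, rfl⟩ : ∃ p : Equiv.Perm (Fin 4), ⇑p = v := ⟨Equiv.ofBijective v hv, rfl⟩
  obtain ⟨h1, h2⟩ := isToricLevel_permLevels lineLevels (by simp) p
  have he : Pi.single c 1 = (![0, 0, 0, 1] : Fin 4 → ℤ) ∘ p := by
    revert p c
    decide +kernel
  have key : ∀ κ : Fin 4 → ℂˣ, monomialClass 0 κ (![0, 0, 0, 1] ∘ p) =
      toricSum (permLevels lineLevels false p) := by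
    intro κ
    have h := congr_arg (pushforward (permIso p) 1) (lineClass_base (κ ∘ p.symm))
    rw [pushforward_permIso_monomialClass, pushforward_permIso_toricSum p h1, Function.comp_assoc,
      Equiv.symm_comp_self] at h
    exact h
  rw [he]
  cases ε
  · exact key κ
  · have h := congr_arg (pushforward (invIso 3) 1) (key κ⁻¹)
    rw [pushforward_invIso_monomialClass, pushforward_invIso_toricSum h2] at h
    rw [← h]
    refine monomialClass_congr (fun _ _ ↦ by simp) (r := -1) (by simp) 1 ?_ ?_
    · intro i j _
      simp only [Pi.neg_apply, Function.comp_apply]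
      ring
    · intro i j _
      simp [mul_comm]

/-- The class of a fibre is the class of a torus invariant curve. -/
lemma fiberClass_eq (κ : Fin 4 → ℂˣ) (ε : Bool) {v : Fin 4 → Fin 4}
    (hv : v.Bijective) :
    monomialClass (if ε then -(![1, 1, 0, 0] ∘ v) else ![1, 1, 0, 0] ∘ v) κ (![0, 0, 1, 0] ∘ v) =
      toricSum (permLevels fiberLevels ε v) := by
  obtain ⟨p, rfl⟩ : ∃ p : Equiv.Perm (Fin 4), ⇑p = v := ⟨Equiv.ofBijective v hv, rfl⟩
  obtain ⟨h1, h2⟩ := isToricLevel_permLevels fiberLevels (by simp) p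
  have key : ∀ κ : Fin 4 → ℂˣ, monomialClass (![1, 1, 0, 0] ∘ p) κ (![0, 0, 1, 0] ∘ p) =
      toricSum (permLevels fiberLevels false p) := by
    intro κ
    have h := congr_arg (pushforward (permIso p) 1) (fiberClass_base (κ ∘ p.symm))
    rw [pushforward_permIso_monomialClass, pushforward_permIso_toricSum p h1, Function.comp_assoc,
      Equiv.symm_comp_self] at h
    exact h
  cases ε
  · exact key κ
  · have h := congr_arg (pushforward (invIso 3) 1) (key κ⁻¹)
    rw [pushforward_invIso_monomialClass, pushforward_invIso_toricSum h2] at h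
    rw [← h]
    refine monomialClass_congr (fun _ _ ↦ by simp) (r := -1) (by simp) 1 ?_ ?_
    · intro i j _
      simp only [Pi.neg_apply, Function.comp_apply]
      ring
    · intro i j _
      simp [mul_comm]

lemma FF.exists_linear (α β γ : ℂˣ) :
    ∃ y : FFˣ, (FF.c α + FF.c β * FF.s + FF.c γ * y : FF) = 0 := by
  have h1 : (FF.c α + FF.c β * FF.s : FF) ≠ 0 := by
    intro h
    refine FF.nonconst_zpow one_ne_zero (-(α : ℂ) / β) ?_
    have hβ : algebraMap ℂ FF β ≠ 0 := (FF.c β).ne_zero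
    rw [zpow_one, map_div₀, map_neg, div_eq_iff hβ]
    have h' : algebraMap ℂ FF α + algebraMap ℂ FF β * FF.s = 0 := h
    linear_combination -h'
  refine ⟨-Units.mk0 _ h1 * (FF.c γ)⁻¹, ?_⟩
  simp only [Units.val_neg, Units.val_mul, Units.val_mk0]
  linear_combination (-(FF.c α + FF.c β * FF.s) : FF) * (FF.c γ).mul_inv

/-- The class of a line in the exceptional plane over a fixed point does not depend on the
parametrization. -/
lemma planeClass_base (α : Fin 3 → ℂˣ) (x : Fin 4 → FFˣ)
    (hx : (FF.c (α 0) * x 0 + FF.c (α 1) * x 1 + FF.c (α 2) * x 2 : FF) = 0)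
    (hnc : FF.Nonconst (x 1 / x 0)) :
    orbitClass ![1, 1, 1, 0] x = toricSum (permLevels planeLevels false id) := by
  obtain ⟨y, hy⟩ := FF.exists_linear (α 0) (α 1) (α 2)
  have h : orbitClass ![1, 1, 1, 0] ![1, FF.s, y, 1] = orbitClass ![1, 1, 1, 0] x := by
    refine orbitClass_eq hnc (fun _ _ ↦ Iff.rfl) fun φ hφ hφ' ↦ ?_
    have hφc : ∀ z : ℂˣ, φ (FF.c z) = FF.c z := fun z ↦ hφ' z
    have h0 : φ FF.s * x 0 = x 1 := by
      rw [hφ]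
      exact div_mul_cancel₀ _ (x 0).ne_zero
    have h2 : φ y * x 0 = x 2 := by
      have h3 := congr_arg φ hy
      simp only [map_add, map_mul, map_zero, hφc] at h3
      refine mul_left_cancel₀ (FF.c (α 2)).ne_zero ?_
      linear_combination (x 0 : FF) * h3 - hx - (FF.c (α 1) : FF) * h0
    have key : ∀ i, (![1, 1, 1, 0] : Fin 4 → ℤ) i = 1 →
        φ ((![1, FF.s, y, 1] : Fin 4 → FFˣ) i) * x 0 = x i := by
      intro i hi
      fin_cases i
      · simp
      · exact h0
      · exact h2
      · simp at hi
    intro i j hij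
    have hcase : (![1, 1, 1, 0] : Fin 4 → ℤ) i = 1 ∨ i = j := by
      revert i j
      decide
    rcases hcase with hi | rfl
    · refine mul_right_cancel₀ (x 0).ne_zero ?_
      linear_combination (x j : FF) * key i hi - (x i : FF) * key j (hij ▸ hi)
    · rfl
  rw [← h, plane_relation _ _ _ y hy]
  simp [toricSum, permLevels, planeLevels, add_assoc]

/-- The class of a general line in the plane does not change if the coordinates of the plane are
permuted: the line `1 + s + y = 0` is symmetric in `s` and `y`, so the relations obtained from it for
both orders of the coordinates agree. -/
lemma planeSum_swap (ε : Bool) {v : Fin 4 → Fin 4} (hv : v.Bijective) :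
    toricSum (permLevels planeLevels ε (Equiv.swap 1 2 ∘ v)) =
      toricSum (permLevels planeLevels ε v) := by
  obtain ⟨p, rfl⟩ : ∃ p : Equiv.Perm (Fin 4), ⇑p = v := ⟨Equiv.ofBijective v hv, rfl⟩
  obtain ⟨h1, h2⟩ := isToricLevel_permLevels planeLevels (by simp) p
  obtain ⟨h3, h4⟩ := isToricLevel_permLevels planeLevels (by simp) (p.trans (Equiv.swap 1 2))
  have h5 := isToricLevel_permLevels planeLevels (by simp) (Equiv.swap 1 2)
  obtain ⟨y, hy⟩ := FF.exists_linear 1 1 1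
  have hy' : (1 + FF.s + y : FF) = 0 := by simpa using hy
  have e1 := planeClass_base 1 ![1, FF.s, y, 1] (by simpa using hy')
    (by simpa using FF.nonconst_zpow one_ne_zero)
  have e2 := planeClass_base 1 ![1, y, FF.s, 1]
    (by
      simp only [Pi.one_apply, map_one, Units.val_one, Matrix.cons_val]
      linear_combination hy')
    (by
      intro z hz
      refine FF.nonconst_zpow one_ne_zero (-1 - z) ?_
      simp only [Matrix.cons_val, Units.val_one, div_one] at hz
      rw [map_sub, map_neg, map_one, hz, zpow_one]
      linear_combination -hy')
  have e3 := congr_arg (pushforward (permIso (Equiv.swap 1 2)) 1) e1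
  rw [pushforward_permIso_orbitClass, pushforward_permIso_toricSum _ h5.1] at e3
  have e4 : orbitClass (![1, 1, 1, 0] ∘ Equiv.swap (1 : Fin 4) 2)
      (![1, FF.s, y, 1] ∘ Equiv.swap (1 : Fin 4) 2) = orbitClass ![1, 1, 1, 0] ![1, y, FF.s, 1] := by
    have e5 : (![1, 1, 1, 0] : Fin 4 → ℤ) ∘ Equiv.swap (1 : Fin 4) 2 = ![1, 1, 1, 0] := by
      decide +kernel
    have e6 : (![1, FF.s, y, 1] : Fin 4 → FFˣ) ∘ Equiv.swap (1 : Fin 4) 2 = ![1, y, FF.s, 1] := by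
      funext i
      fin_cases i <;> rfl
    rw [e5, e6]
  rw [e4, e2] at e3
  have key : toricSum (permLevels planeLevels false (Equiv.swap 1 2 ∘ p)) =
      toricSum (permLevels planeLevels false p) := by
    have h := congr_arg (pushforward (permIso p) 1) e3
    rw [pushforward_permIso_toricSum p h1] at h
    refine Eq.trans ?_ h.symm
    refine (pushforward_permIso_toricSum p ?_).symm
    clear h h1 h2 h3 h4 hv
    revert p
    decide +kernel
  cases ε
  · exact key
  · have h := congr_arg (pushforward (invIso 3) 1) key
    rw [pushforward_invIso_toricSum h2] at h
    exact (pushforward_invIso_toricSum h4).symm.trans h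

/-- The class of a line in the exceptional plane over one of the fixed points. -/
lemma planeClass_eq (α : Fin 3 → ℂˣ) (x : Fin 4 → FFˣ)
    (hx : (FF.c (α 0) * x 1 + FF.c (α 1) * x 2 + FF.c (α 2) * x 3 : FF) = 0)
    (hnc : FF.Nonconst (x 1 / x 3)) :
    orbitClass ![0, 1, 1, 1] x = toricSum (permLevels planeLevels false ![3, 1, 2, 0]) ∧
    orbitClass (-![0, 1, 1, 1]) x⁻¹ = toricSum (permLevels planeLevels true ![3, 1, 2, 0]) := by
  obtain ⟨h1, h2⟩ := isToricLevel_permLevels planeLevels (by simp) (Equiv.swap 0 3)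
  have hp : ⇑(Equiv.swap (0 : Fin 4) 3) = ![3, 1, 2, 0] := by decide +kernel
  have h := congr_arg (pushforward (permIso (Equiv.swap 0 3)) 1)
    (planeClass_base ![α 2, α 0, α 1] (x ∘ ![3, 1, 2, 0])
    (by
      simp only [Function.comp_apply, Matrix.cons_val]
      linear_combination hx)
    (by simpa using hnc))
  have e1 : (![1, 1, 1, 0] : Fin 4 → ℤ) ∘ ![3, 1, 2, 0] = ![0, 1, 1, 1] := by decide +kernel
  have e2 : (x ∘ ![3, 1, 2, 0]) ∘ ![3, 1, 2, 0] = x := by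
    funext i
    fin_cases i <;> rfl
  rw [pushforward_permIso_orbitClass, pushforward_permIso_toricSum _ h1, hp, e1, e2] at h
  refine ⟨h, ?_⟩
  have h' := congr_arg (pushforward (invIso 3) 1) h
  rw [pushforward_invIso_orbitClass] at h'
  rw [hp] at h2
  exact h'.trans (pushforward_invIso_toricSum h2)

lemma toricSum_add_congr {A B C D : List (Fin 4 → ℤ)}
    (h : ((A ++ B).map levelRank).Perm ((C ++ D).map levelRank) ∧
      (∀ l ∈ A ++ B, IsToricLevel l (toricExp l)) ∧ ∀ l ∈ C ++ D, IsToricLevel l (toricExp l)) :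
    toricSum A + toricSum B = toricSum C + toricSum D := by
  rw [← toricSum_append, ← toricSum_append]
  exact toricSum_congr h.1 h.2.1 h.2.2

/-- The class of lines on which all homogeneous coordinates but the one with label `c` are
constant. -/
def labelLine (c : Fin 4) : Chow (permData 3).X 1 := monomialClass 0 1 (Pi.single c 1)

/-- The class of lines in an exceptional plane: over the fixed point where the coordinates of index
zero vanish if `ε` is false, over the antipodal fixed point if `ε` is true. -/
def planeSum (ε : Bool) : Chow (permData 3).X 1 := toricSum (permLevels planeLevels ε ![3, 1, 2, 0])

/-- The permutation that moves the label `0` and the label of the `j`-th factor to the first two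
places. -/
def fiberVec (j : Fin 3) : Fin 4 → Fin 4 := ![![0, 1, 2, 3], ![0, 2, 1, 3], ![0, 2, 3, 1]] j

/-- The class of fibres over an invariant line parallel to the `j`-th factor: through the fixed
point where the coordinates of index one vanish if `ε` is false, through the antipodal fixed point
if `ε` is true. -/
def fiberSum (ε : Bool) (j : Fin 3) : Chow (permData 3).X 1 :=
  toricSum (permLevels fiberLevels ε (fiberVec j))

lemma labelLine_eq {c : Fin 4} (ε : Bool) (v : Fin 4 → Fin 4) (hv : v.Bijective ∧ v c = 3) :
    labelLine c = toricSum (permLevels lineLevels ε v) :=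
  lineClass_eq 1 ε hv.1 hv.2

lemma fiberSum_swap (ε : Bool) {v : Fin 4 → Fin 4} (hv : v.Bijective) :
    toricSum (permLevels fiberLevels ε (Equiv.swap 0 1 ∘ v)) =
      toricSum (permLevels fiberLevels ε v) := by
  rw [← fiberClass_eq 1 ε hv, ← fiberClass_eq 1 ε ((Equiv.bijective _).comp hv)]
  have e1 : (![1, 1, 0, 0] : Fin 4 → ℤ) ∘ Equiv.swap (0 : Fin 4) 1 = ![1, 1, 0, 0] := by
    decide +kernel
  have e2 : (![0, 0, 1, 0] : Fin 4 → ℤ) ∘ Equiv.swap (0 : Fin 4) 1 = ![0, 0, 1, 0] := by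
    decide +kernel
  rw [← Function.comp_assoc, ← Function.comp_assoc, e1, e2]

lemma planeSum_eq (ε : Bool) :
    planeSum ε = toricSum (permLevels planeLevels ε ![3, 2, 0, 1]) ∧
      planeSum ε = toricSum (permLevels planeLevels ε ![3, 1, 0, 2]) := by
  have h1 := planeSum_swap ε (v := ![3, 1, 2, 0]) (by decide +kernel)
  have h2 := planeSum_swap ε (v := ![3, 2, 0, 1]) (by decide +kernel)
  have h3 : toricSum (permLevels planeLevels ε (Equiv.swap 1 2 ∘ ![3, 1, 2, 0])) =
      toricSum (permLevels planeLevels ε ![3, 2, 0, 1]) := by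
    refine toricSum_congr ?_ ?_ ?_ <;> clear h1 h2 <;> revert ε <;> decide +kernel
  have h4 : toricSum (permLevels planeLevels ε (Equiv.swap 1 2 ∘ ![3, 2, 0, 1])) =
      toricSum (permLevels planeLevels ε ![3, 1, 0, 2]) := by
    refine toricSum_congr ?_ ?_ ?_ <;> clear h1 h2 h3 <;> revert ε <;> decide +kernel
  refine ⟨h1.symm.trans h3, (h1.symm.trans h3).trans (h2.symm.trans h4)⟩

/-- The exchange of the first two homogeneous coordinates on the permutohedral variety. -/
def swapIso : (permData 3).X ≅ (permData 3).X := permIso (Equiv.swap 0 1)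

/-- The sum of the classes of a line in one exceptional plane and of the image of a line in the other
one is a sum of two classes of lines, as both sides are the same sum of invariant curves. -/
lemma pushforward_swapIso_planeSum (ε : Bool) :
    pushforward swapIso 1 (planeSum ε) = labelLine 2 + labelLine 3 - planeSum !ε := by
  have h : pushforward swapIso 1 (planeSum ε) + planeSum (!ε) = labelLine 2 + labelLine 3 := by
    cases ε
    · rw [(planeSum_eq !false).2, labelLine_eq true ![2, 1, 3, 0] (by decide +kernel),
        labelLine_eq false ![1, 2, 0, 3] (by decide +kernel), planeSum, swapIso,
        pushforward_permIso_toricSum _ (by decide +kernel)]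
      exact toricSum_add_congr (by decide +kernel)
    · rw [(planeSum_eq true).2, labelLine_eq true ![1, 2, 3, 0] (by decide +kernel),
        labelLine_eq false ![2, 1, 0, 3] (by decide +kernel), planeSum, swapIso,
        pushforward_permIso_toricSum _ (by decide +kernel)]
      exact toricSum_add_congr (by decide +kernel)
  rw [← h, add_sub_cancel_right]

lemma pushforward_swapIso_labelLine (c : Fin 4) :
    pushforward swapIso 1 (labelLine c) = labelLine (Equiv.swap 0 1 c) := by
  unfold labelLine swapIso
  rw [pushforward_permIso_monomialClass]
  congr 1
  revert c
  decide +kernel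

/-- The standard relation for the class of the curves on which only the label `0` varies, from the
action of `swapIso` on the class of a further contracted plane, which it fixes. -/
lemma labelLine_zero :
    labelLine 0 = labelLine 1 + labelLine 2 + labelLine 3 - planeSum false - planeSum true := by
  -- `b` is the class of a line in the plane that is contracted when the third label is smallest
  let b := toricSum (permLevels planeLevels false ![0, 1, 3, 2])
  have h1 : planeSum true + b = labelLine 1 + labelLine 3 := by
    rw [(planeSum_eq true).1, labelLine_eq false ![1, 3, 2, 0] (by decide +kernel),
        labelLine_eq true ![2, 0, 1, 3] (by decide +kernel)]
    exact toricSum_add_congr (by decide +kernel)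
  have h2 : pushforward swapIso 1 b = b := by
    unfold swapIso b
    rw [pushforward_permIso_toricSum _ (by decide +kernel)]
    exact toricSum_congr (by decide +kernel) (by decide +kernel) (by decide +kernel)
  have h3 := congr_arg (pushforward swapIso 1) h1
  rw [map_add, map_add, pushforward_swapIso_planeSum, pushforward_swapIso_labelLine,
    pushforward_swapIso_labelLine, h2, eq_sub_of_add_eq' h1] at h3
  have e1 : Equiv.swap (0 : Fin 4) 1 1 = 0 := by decide
  have e2 : Equiv.swap (0 : Fin 4) 1 3 = 3 := by decide
  rw [e1, e2] at h3
  rw [eq_sub_of_add_eq h3.symm]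
  simp only [Bool.not_true]
  abel

lemma pushforward_swapIso_fiberSum (ε : Bool) :
    pushforward swapIso 1 (fiberSum ε 0) = fiberSum ε 0 ∧
    pushforward swapIso 1 (fiberSum ε 1) = labelLine 3 - planeSum ε + fiberSum (!ε) 2 ∧
    pushforward swapIso 1 (fiberSum ε 2) = labelLine 2 - planeSum ε + fiberSum (!ε) 1 := by
  refine ⟨?_, ?_, ?_⟩
  · refine Eq.trans ?_ (fiberSum_swap ε (v := ![0, 1, 2, 3]) (by decide +kernel))
    unfold swapIso fiberSum
    rw [pushforward_permIso_toricSum _ (by revert ε; decide +kernel)]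
    refine toricSum_congr ?_ ?_ ?_ <;> revert ε <;> decide +kernel
  · rw [sub_add_eq_add_sub, eq_sub_iff_add_eq]
    refine Eq.trans ?_ (congr_arg (_ + ·) (fiberSum_swap (!ε) (v := ![0, 2, 3, 1]) (by decide +kernel)))
    rw [(planeSum_eq ε).1, labelLine_eq ε ![2, 0, 1, 3] (by decide +kernel)]
    unfold swapIso fiberSum
    rw [pushforward_permIso_toricSum _ (by revert ε; decide +kernel)]
    refine toricSum_add_congr ?_
    revert ε
    decide +kernel
  · rw [sub_add_eq_add_sub, eq_sub_iff_add_eq]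
    refine Eq.trans ?_ (congr_arg (_ + ·) (fiberSum_swap (!ε) (v := ![0, 2, 1, 3]) (by decide +kernel)))
    rw [(planeSum_eq ε).1, labelLine_eq ε ![2, 0, 3, 1] (by decide +kernel)]
    unfold swapIso fiberSum
    rw [pushforward_permIso_toricSum _ (by revert ε; decide +kernel)]
    refine toricSum_add_congr ?_
    revert ε
    decide +kernel


open ToricData

/-! ### Curves in the permutohedral variety as closures of orbit points -/

lemma eq_or_eq_add_one (b i : Fin 2) : i = b ∨ i = b + 1 := by
  revert b i
  decide

lemma add_one_ne (b : Fin 2) : b + 1 ≠ b := by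
  revert b
  decide

lemma secondBlowdown_q (k : Fin 3) :
    secondBlowdown ≫ twoPointData.q (some k) = (permData 3).q (k.succ, 0) := by
  apply ext_of_isDominant (permData 3).torus
  rw [← Category.assoc, torus_secondBlowdown, torus_q]
  refine Eq.trans ?_ (torus_q (permData 3) (k.succ, 0)).symm
  refine PP.pt_eq_pt fun i j ↦ ?_
  have hb : ∀ b : Fin 2, b = 0 ∨ b = 1 := by decide
  rcases hb i with rfl | rfl <;> rcases hb j with rfl | rfl <;> exact mul_comm _ _

lemma toricModel_π_pr (k : Fin 3) :
    toricModel.π ≫ P1Cube.pr k = (permData 3).q (k.succ, 0) := by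
  refine (Category.assoc _ _ _).trans ((congr_arg (secondBlowdown ≫ ·) (firstπ_pr k)).trans ?_)
  exact secondBlowdown_q k

lemma chart_pr (b : Fin 2) (k : Fin 3) : P1Cube.chart b ≫ P1Cube.pr k =
    PP.pt (ι := Fin 2) MvPolynomial.C (fun c ↦ if c = b then MvPolynomial.X k else 1) (b + 1)
      (by rw [if_neg (by revert b; decide)]; exact isUnit_one) :=
  P1Cube.point_pr _ _ _ k

section

variable {K : Type} [CommRing K]

lemma orbitPt_π {γ : ℂ →+* K} {l : Fin 4 → ℤ} {a : Fin 4 → Kˣ} {b : Fin 2} {t : Fin 3 → K}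
    (ht : ∀ k, limitRatio l a k.succ 0 b = t k * limitRatio l a k.succ 0 (b + 1)) :
    orbitPt γ l a ≫ toricModel.π =
      Spec.map (CommRingCat.ofHom (MvPolynomial.eval₂Hom γ t)) ≫ P1Cube.chart b := by
  apply P1Cube.jointlyMono_pr
  intro k
  have h1 : (orbitPt γ l a ≫ toricModel.π) ≫ P1Cube.pr k = orbitPt γ l a ≫ (permData 3).q (k.succ, 0) :=
    (Category.assoc _ _ _).trans (congr_arg _ (toricModel_π_pr k))
  rw [h1, orbitPt_q, Category.assoc, chart_pr]
  refine (PP.map_pt_eq (RingHom.ext fun z ↦ by simp) fun i j ↦ ?_).symm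
  have hne := add_one_ne b
  rcases eq_or_eq_add_one b i with h | h <;> rcases eq_or_eq_add_one b j with h' | h' <;>
    simp [h, h', hne, ht]

end

variable {K : Type} [Field K]

lemma π_orbitPoint_mem {γ : ℂ →+* K} {l : Fin 4 → ℤ} {a : Fin 4 → Kˣ} {b : Fin 2} {t : Fin 3 → K}
    (ht : ∀ k, limitRatio l a k.succ 0 b = t k * limitRatio l a k.succ 0 (b + 1))
    {S : Set (MvPolynomial (Fin 3) ℂ)} (hS : ∀ f ∈ S, MvPolynomial.eval₂Hom γ t f = 0) :
    toricModel.π (orbitPoint γ l a) ∈ P1Cube.chart b '' PrimeSpectrum.zeroLocus S := by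
  refine ⟨Spec.map (CommRingCat.ofHom (MvPolynomial.eval₂Hom γ t)) (fieldPt K), ?_, ?_⟩
  · intro f hf
    exact hS f hf
  · have h := congr_arg (fun g ↦ g (fieldPt K)) (orbitPt_π (γ := γ) ht)
    simp only [Scheme.Hom.comp_apply] at h
    exact h.symm

lemma limitRatio_of_π_mem_closure {γ : ℂ →+* K} {l : Fin 4 → ℤ} {a : Fin 4 → Kˣ} {b : Fin 2}
    {S : Set (MvPolynomial (Fin 3) ℂ)}
    (h : toricModel.π (orbitPoint γ l a) ∈ closure (P1Cube.chart b '' PrimeSpectrum.zeroLocus S))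
    {k : Fin 3} {c : ℂ} (hc : MvPolynomial.X k - MvPolynomial.C c ∈ S) :
    limitRatio l a k.succ 0 b = γ c * limitRatio l a k.succ 0 (b + 1) := by
  have hne := add_one_ne b
  have hsum : ∀ {R : Type} [CommRing R] (γ : ℂ →+* R) (x : Fin 2 → R),
      ∑ i, γ ((if i = b then 1 else -c : ℂ)) * x i = x b - γ c * x (b + 1) := by
    intro R _ γ x
    have hb : ∀ b : Fin 2, b = 0 ∨ b = 1 := by decide
    rcases hb b with rfl | rfl <;> simp <;> ring
  let U := PP.hyperplaneCompl Finset.univ fun i : Fin 2 ↦ if i = b then 1 else -c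
  have hcl : IsClosed {x : P1Cube | P1Cube.pr k x ∉ U} :=
    U.2.isClosed_compl.preimage (P1Cube.pr k).continuous
  have hsub : P1Cube.chart b '' PrimeSpectrum.zeroLocus S ⊆ {x : P1Cube | P1Cube.pr k x ∉ U} := by
    rintro _ ⟨p, hp, rfl⟩
    have h1 : P1Cube.pr k (P1Cube.chart b p) = _ :=
      (Scheme.Hom.comp_apply _ _ _).symm.trans (congr_arg (fun g ↦ g p) (chart_pr b k))
    rw [Set.mem_ofPred_eq, h1, PP.mem_hyperplaneCompl_pt, not_not, hsum]
    simpa [hne] using hp hc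
  have h2 := closure_minimal hsub hcl h
  have h3 : P1Cube.pr k (toricModel.π (orbitPoint γ l a)) =
      (permData 3).q (k.succ, 0) (orbitPoint γ l a) :=
    (Scheme.Hom.comp_apply _ _ _).symm.trans 
      (congr_arg (fun g : (permData 3).X ⟶ PP (Fin 2) ↦ g (orbitPoint γ l a)) (toricModel_π_pr k))
  rw [Set.mem_ofPred_eq, h3, q_orbitPoint, PP.mem_hyperplaneCompl_pt, not_not, hsum,
    mem_fieldPt] at h2
  exact sub_eq_zero.1 h2

/-- A substitution of a nonconstant function for the variable of a polynomial ring. -/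
lemma FF.exists_polynomial_subst {y : FF} (hy : FF.Nonconst y) :
    ∃ φ : Polynomial ℂ →+* FF, Function.Injective φ ∧ φ.comp Polynomial.C = algebraMap ℂ FF ∧
      φ Polynomial.X = y := by
  obtain ⟨φ, h1, h2⟩ := FF.exists_subst hy
  refine ⟨φ.comp (algebraMap (Polynomial ℂ) FF), φ.injective.comp (RatFunc.algebraMap_injective ℂ),
    ?_, ?_⟩
  · rw [← h1, RingHom.comp_assoc]
    rfl
  · rw [← h2, RingHom.comp_apply, RatFunc.algebraMap_X]
    rfl

/-- The points of a curve on which one homogeneous coordinate varies and the others are constant. -/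
lemma monomial_specializes {γ : ℂ →+* K} {l m : Fin 4 → ℤ} {κ : Fin 4 → ℂˣ} {a : Fin 4 → Kˣ}
    {J J' : Fin 4} (hJ : J' ≠ J) (hl : l J' = l J)
    (h1 : ∀ i j, i ≠ J → j ≠ J → (l i ≤ l j ↔ m i ≤ m j) ∧
      (l i = l j → γ (κ i) * a j = γ (κ j) * a i))
    (h2 : ∀ i, i ≠ J → (l i < l J → m i < m J) ∧ (l J < l i → m J < m i)) :
    orbitPoint (algebraMap ℂ FF) l (fun i ↦ FF.c (κ i) * FF.s ^ (Pi.single J 1 : Fin 4 → ℤ) i) ⤳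
      orbitPoint γ m a := by
  set A : Fin 4 → FFˣ := fun i ↦ FF.c (κ i) * FF.s ^ (Pi.single J 1 : Fin 4 → ℤ) i with hA
  have hAi : ∀ i, i ≠ J → (A i : FF) = algebraMap ℂ FF (κ i) := by
    intro i hi
    simp [hA, hi, FF.c]
  have hAJ : (A J : FF) = algebraMap ℂ FF (κ J) * FF.s := by simp [hA, FF.c]
  have hγ : ∀ i, γ (κ i) ≠ 0 := fun i ↦ by simp
  -- the ratios that do not involve the varying coordinate
  have aux : ∀ (φ : Polynomial ℂ →+* FF) (_ : Function.Injective φ)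
      (_ : φ.comp Polynomial.C = algebraMap ℂ FF) (t : K),
      (∀ j, j ≠ J → l j = l J → (m j ≤ m J → ∃ x x', Polynomial.eval₂ γ t x' ≠ 0 ∧
          φ x * A j = φ x' * A J ∧
          ((m J = m j ∧ Polynomial.eval₂ γ t x * a j = Polynomial.eval₂ γ t x' * a J) ∨
            (m j < m J ∧ Polynomial.eval₂ γ t x = 0))) ∧
        (m J ≤ m j → ∃ x x', Polynomial.eval₂ γ t x' ≠ 0 ∧ φ x * A J = φ x' * A j ∧
          ((m j = m J ∧ Polynomial.eval₂ γ t x * a J = Polynomial.eval₂ γ t x' * a j) ∨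
            (m J < m j ∧ Polynomial.eval₂ γ t x = 0)))) →
      orbitPoint (algebraMap ℂ FF) l A ⤳ orbitPoint γ m a := by
    intro φ hφ hφC t H
    have hψ : (Polynomial.eval₂RingHom γ t).comp Polynomial.C = γ := by
      ext z
      simp
    have hφκ : ∀ i, φ (Polynomial.C (κ i : ℂ)) = algebraMap ℂ FF (κ i) :=
      fun i ↦ RingHom.congr_fun hφC _
    rw [← hφC, ← hψ]
    refine orbitPoint_specializes _ φ hφ _ fun i j hij ↦ ?_
    simp only [Polynomial.coe_eval₂RingHom]
    by_cases hi : i = J <;> by_cases hj : j = J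
    · subst hi hj
      exact ⟨1, 1, by simp, .inl ⟨rfl, rfl⟩, .inl ⟨rfl, rfl⟩⟩
    · subst hi
      rcases lt_trichotomy (l i) (l j) with h | h | h
      · exact absurd ((h2 j hj).2 h) hij.not_gt
      · obtain ⟨x, x', e1, e2, e3⟩ := (H j hj h.symm).1 hij
        exact ⟨x, x', e1, .inl ⟨h, e2⟩, e3⟩
      · exact ⟨0, 1, by simp, .inr ⟨h, rfl⟩, .inr ⟨(h2 j hj).1 h, by simp⟩⟩
    · subst hj
      rcases lt_trichotomy (l i) (l j) with h | h | h
      · exact absurd ((h2 i hi).1 h) hij.not_gt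
      · obtain ⟨x, x', e1, e2, e3⟩ := (H i hi h).2 hij
        exact ⟨x, x', e1, .inl ⟨h, e2⟩, e3⟩
      · exact ⟨0, 1, by simp, .inr ⟨h, rfl⟩, .inr ⟨(h2 i hi).2 h, by simp⟩⟩
    · have hlij := ((h1 j i hj hi).1).2 hij
      rcases hlij.eq_or_lt with h | h
      · refine ⟨Polynomial.C (κ i : ℂ), Polynomial.C (κ j : ℂ), by simp, .inl ⟨h.symm, ?_⟩,
          .inl ⟨le_antisymm (((h1 i j hi hj).1).1 h.ge) hij, ?_⟩⟩
        · rw [hφκ, hφκ, hAi i hi, hAi j hj, mul_comm]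
        · simpa using (h1 i j hi hj).2 h.symm
      · refine ⟨0, 1, by simp, .inr ⟨h, rfl⟩, .inr ⟨hij.lt_of_ne fun h' ↦ ?_, by simp⟩⟩
        exact h.not_ge (((h1 i j hi hj).1).2 h'.ge)
  have hm : ∀ j, j ≠ J → l j = l J → m j = m J' := fun j hj h ↦
    le_antisymm (((h1 j J' hj hJ).1).1 (h.trans hl.symm).le)
      (((h1 J' j hJ hj).1).1 (h.trans hl.symm).ge)
  have ha : ∀ j, j ≠ J → l j = l J → γ (κ j) * a J' = γ (κ J') * a j := fun j hj h ↦
    (h1 j J' hj hJ).2 (h.trans hl.symm)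
  have hs : FF.Nonconst FF.s := by simpa using FF.nonconst_zpow one_ne_zero
  have hs' : FF.Nonconst (FF.s⁻¹ : FFˣ) := by
    simpa using FF.nonconst_zpow (k := -1) (by decide)
  rcases lt_trichotomy (m J) (m J') with h | h | h
  · obtain ⟨φ, i1, i2, i3⟩ := FF.exists_polynomial_subst hs'
    refine aux φ i1 i2 0 fun j hj hjl ↦ ⟨fun h' ↦ absurd h ((hm j hj hjl) ▸ h'.not_gt), fun _ ↦ ?_⟩
    refine ⟨Polynomial.C (κ j : ℂ) * Polynomial.X, Polynomial.C (κ J : ℂ), by simp, ?_,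
      .inr ⟨h.trans_eq (hm j hj hjl).symm, by simp⟩⟩
    rw [map_mul, i3, hAJ, hAi j hj]
    have hC : ∀ z, φ (Polynomial.C z) = algebraMap ℂ FF z := fun z ↦ RingHom.congr_fun i2 z
    rw [hC, hC]
    linear_combination (algebraMap ℂ FF (κ j) * algebraMap ℂ FF (κ J)) * FF.s.inv_mul
  all_goals
    obtain ⟨φ, i1, i2, i3⟩ := FF.exists_polynomial_subst hs
    have hC : ∀ z, φ (Polynomial.C z) = algebraMap ℂ FF z := fun z ↦ RingHom.congr_fun i2 z
  · refine aux φ i1 i2 (γ (κ J') * a J / (γ (κ J) * a J')) fun j hj hjl ↦ ?_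
    have e := hm j hj hjl
    have e' := ha j hj hjl
    have ht : γ (κ J) * (γ (κ J') * a J / (γ (κ J) * a J')) * a j = γ (κ j) * a J := by
      have := hγ J
      field_simp
      linear_combination -e'
    have ht0 : (γ (κ J') * a J / (γ (κ J) * a J')) ≠ 0 := by simp
    refine ⟨fun _ ↦ ⟨Polynomial.C (κ J : ℂ) * Polynomial.X, Polynomial.C (κ j : ℂ), by simp, ?_,
        .inl ⟨h.trans e.symm, ?_⟩⟩,
      fun _ ↦ ⟨Polynomial.C (κ j : ℂ), Polynomial.C (κ J : ℂ) * Polynomial.X, ?_, ?_,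
        .inl ⟨e.trans h.symm, ?_⟩⟩⟩
    · rw [map_mul, i3, hC, hC, hAJ, hAi j hj]
      ring
    · rw [Polynomial.eval₂_mul, Polynomial.eval₂_C, Polynomial.eval₂_X, Polynomial.eval₂_C, ht]
    · rw [Polynomial.eval₂_mul, Polynomial.eval₂_C, Polynomial.eval₂_X]
      exact mul_ne_zero (hγ J) ht0
    · rw [map_mul, i3, hC, hC, hAJ, hAi j hj]
      ring
    · rw [Polynomial.eval₂_mul, Polynomial.eval₂_C, Polynomial.eval₂_X, Polynomial.eval₂_C, ht]
  · refine aux φ i1 i2 0 fun j hj hjl ↦ ⟨fun _ ↦ ?_, fun h' ↦ absurd h ((hm j hj hjl) ▸ h'.not_gt)⟩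
    refine ⟨Polynomial.C (κ J : ℂ) * Polynomial.X, Polynomial.C (κ j : ℂ), by simp, ?_,
      .inr ⟨(hm j hj hjl).trans_lt h, by simp⟩⟩
    rw [map_mul, i3, hC, hC, hAJ, hAi j hj]
    ring


open ToricData

/-! ### The classes of lines and fibres on the toric model -/

section

variable {K : Type} [Field K] {l : Fin 4 → ℤ} {a : Fin 4 → Kˣ} {i j : Fin 4} {x : K}

lemma limitRatio_eq_mul_iff (hx : x ≠ 0) :
    (limitRatio l a i j 0 = x * limitRatio l a i j 1 ↔ l i = l j ∧ a i = x * a j) ∧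
      (limitRatio l a i j 1 = x * limitRatio l a i j 0 ↔ l i = l j ∧ a j = x * a i) := by
  rcases lt_trichotomy (l i) (l j) with h | h | h
  · simp [limitRatio, h.le, h.not_ge, h.ne, hx]
  · simp [limitRatio, h]
  · simp [limitRatio, h.le, h.not_ge, h.ne', hx]

lemma limitRatio_eq_zero_iff : (limitRatio l a i j 0 = 0 ↔ l j < l i) ∧
    (limitRatio l a i j 1 = 0 ↔ l i < l j) := by
  simp [limitRatio]

end

/-- The proper transform of the chosen line is the closure of an orbit point over the torus in which one
label varies. -/
lemma lineClass_toricModel (p : GeneralChoice) (j : Fin 3) :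
    toricModel.lineClass p j = labelLine j.succ := by
  let κ : Fin 4 → ℂˣ := Fin.cons 1 (p.line j)
  have h : toricModel.lineClass p j = monomialClass 0 κ (Pi.single j.succ 1) := by
    refine congr_arg (fundClass 1) ?_
    apply Set.Subset.antisymm
    · intro y hy
      obtain ⟨K, _, γ, m, a, rfl⟩ := exists_eq_orbitPoint y
      refine specializes_iff_mem_closure.1 ?_
      have hk : ∀ k : Fin 3, k ≠ j → m k.succ = m 0 ∧ (a k.succ : K) = γ (κ k.succ) * a 0 := by
        intro k hk
        exact (limitRatio_eq_mul_iff (by simp)).1.1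
          (limitRatio_of_π_mem_closure (k := k) (c := p.line j k) hy ⟨k, hk, rfl⟩)
      have hi : ∀ i : Fin 4, i ≠ j.succ → m i = m 0 ∧ (a i : K) = γ (κ i) * a 0 := by
        intro i hi
        cases i using Fin.cases with
        | zero => exact ⟨rfl, by simp [κ]⟩
        | succ k => exact hk k fun h ↦ hi (h ▸ rfl)
      refine monomial_specializes (J' := 0) (Fin.succ_ne_zero j).symm rfl ?_ ?_
      · intro i k h1 h2
        refine ⟨by simp [hi i h1, hi k h2], fun _ ↦ ?_⟩
        rw [(hi i h1).2, (hi k h2).2]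
        ring
      · intro i _
        simp
    · refine closure_minimal ?_ (isClosed_closure.preimage toricModel.π.continuous)
      rw [Set.singleton_subset_iff]
      refine subset_closure (π_orbitPoint_mem
        (t := fun k ↦ if k = j then algebraMap ℂ FF (p.line j j) * FF.s
          else algebraMap ℂ FF (p.line j k)) ?_ ?_)
      · intro k
        by_cases hk : k = j
        · simp [limitRatio, hk, κ, FF.c]
        · simp [limitRatio, hk, κ, FF.c]
      · rintro f ⟨i, hi, rfl⟩
        simp [hi]
  have hv : ∀ j : Fin 3, (Equiv.swap j.succ 3) j.succ = 3 := by simp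
  rw [h, lineClass_eq κ false (Equiv.bijective (Equiv.swap j.succ 3)) (hv j),
    labelLine_eq false _ ⟨Equiv.bijective (Equiv.swap j.succ 3), hv j⟩]

/-- The levels of the general point of a fibre. -/
def fiberLevel (b : Fin 2) (j : Fin 3) : Fin 4 → ℤ :=
  if decide (b = 0) then -(![1, 1, 0, 0] ∘ fiberVec j) else ![1, 1, 0, 0] ∘ fiberVec j

lemma fiberLevel_spec (j : Fin 3) : ∃ J J' : Fin 4, J' ≠ J ∧
    ![0, 0, 1, 0] ∘ fiberVec j = (Pi.single J 1 : Fin 4 → ℤ) ∧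
    (J ≠ 0 ∧ J ≠ j.succ ∧ J' ≠ 0 ∧ J' ≠ j.succ) ∧
    (∀ i, i ≠ J → i = 0 ∨ i = j.succ ∨ i = J') ∧
    ∀ b, fiberLevel b j J' = fiberLevel b j J ∧ fiberLevel b j j.succ = fiberLevel b j 0 ∧
      (b = 0 → fiberLevel b j 0 < fiberLevel b j J) ∧
      (b = 1 → fiberLevel b j J < fiberLevel b j 0) := by
  revert j
  decide +kernel

/-- The constant coordinates of the general point of a fibre. -/
def fiberConst (c : ℂˣ) (b : Fin 2) (j : Fin 3) : Fin 4 → ℂˣ :=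
  Function.update 1 (if b = 0 then j.succ else 0) c

/-- The points of a fibre. -/
lemma fiber_iff {K : Type} [Field K] (γ : ℂ →+* K) (m : Fin 4 → ℤ) (a : Fin 4 → Kˣ) (c : ℂˣ)
    (b : Fin 2) (j : Fin 3) :
    (∀ k : Fin 3, limitRatio m a k.succ 0 b =
      γ (if k = j then (c : ℂ) else 0) * limitRatio m a k.succ 0 (b + 1)) ↔
    (m j.succ = m 0 ∧ γ (fiberConst c b j j.succ) * a 0 = γ (fiberConst c b j 0) * a j.succ) ∧
      ∀ k : Fin 3, k ≠ j → (b = 0 → m 0 < m k.succ) ∧ (b = 1 → m k.succ < m 0) := by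
  have hc : γ c ≠ 0 := by simp
  have h1 : (limitRatio m a j.succ 0 b = γ c * limitRatio m a j.succ 0 (b + 1)) ↔
      (m j.succ = m 0 ∧
        γ (fiberConst c b j j.succ) * a 0 = γ (fiberConst c b j 0) * a j.succ) := by
    have hb : ∀ b : Fin 2, b = 0 ∨ b = 1 := by decide
    rcases hb b with rfl | rfl
    · refine (limitRatio_eq_mul_iff hc).1.trans (and_congr_right fun _ ↦ ?_)
      simp [fiberConst, (Fin.succ_ne_zero j).symm, eq_comm]
    · refine (limitRatio_eq_mul_iff hc).2.trans (and_congr_right fun _ ↦ ?_)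
      simp [fiberConst, Fin.succ_ne_zero j]
  have h2 : ∀ k : Fin 3, limitRatio m a k.succ 0 b = 0 ↔
      (b = 0 → m 0 < m k.succ) ∧ (b = 1 → m k.succ < m 0) := by
    intro k
    have hb : ∀ b : Fin 2, b = 0 ∨ b = 1 := by decide
    rcases hb b with rfl | rfl
    · simpa using limitRatio_eq_zero_iff.1
    · simpa using limitRatio_eq_zero_iff.2
  rw [← h1]
  constructor
  · intro h
    refine ⟨by simpa using h j, fun k hk ↦ (h2 k).1 (by simpa [hk] using h k)⟩
  · rintro ⟨h3, h4⟩ k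
    by_cases hk : k = j
    · subst hk
      simpa using h3
    · simpa [hk] using (h2 k).2 (h4 k hk)

lemma fiberClass_toricModel (p : GeneralChoice) (b : Fin 2) (j : Fin 3) :
    toricModel.fiberClass p b j = fiberSum (b = 0) j := by
  obtain ⟨J, J', hJ, he, ⟨n1, n2, n3, n4⟩, hcase, hl⟩ := fiberLevel_spec j
  obtain ⟨l1, l2, l3, l4⟩ := hl b
  have hv : ∀ j, (fiberVec j).Bijective := by decide +kernel
  refine Eq.trans ?_ (fiberClass_eq (fiberConst (p.point b j) b j) (b = 0) (hv j))
  rw [he]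
  refine congr_arg (fundClass 1) ?_
  let S : Set (MvPolynomial (Fin 3) ℂ) :=
    {f | f = MvPolynomial.X j - MvPolynomial.C (p.point b j : ℂ) ∨ ∃ i ≠ j, f = MvPolynomial.X i}
  let C : Set P1Cube := P1Cube.chart b '' PrimeSpectrum.zeroLocus S
  have hmem : ∀ {K : Type} [Field K] (γ : ℂ →+* K) (m : Fin 4 → ℤ) (a : Fin 4 → Kˣ),
      (∀ k : Fin 3, limitRatio m a k.succ 0 b =
        γ (if k = j then (p.point b j : ℂ) else 0) * limitRatio m a k.succ 0 (b + 1)) →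
      toricModel.π (orbitPoint γ m a) ∈ C := by
    intro K _ γ m a hm
    refine π_orbitPoint_mem hm ?_
    rintro f (rfl | ⟨i, hi, rfl⟩)
    · simp
    · simp [hi]
  have hmem' : ∀ {K : Type} [Field K] (γ : ℂ →+* K) (m : Fin 4 → ℤ) (a : Fin 4 → Kˣ),
      toricModel.π (orbitPoint γ m a) ∈ closure C →
      ∀ k : Fin 3, limitRatio m a k.succ 0 b =
        γ (if k = j then (p.point b j : ℂ) else 0) * limitRatio m a k.succ 0 (b + 1) := by
    intro K _ γ m a hm k
    refine limitRatio_of_π_mem_closure hm ?_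
    by_cases hk : k = j
    · exact .inl (by rw [if_pos hk, hk])
    · exact .inr ⟨k, hk, by simp [hk]⟩
  have hcl : toricModel.π ⁻¹' C = toricModel.π ⁻¹' closure C := by
    refine (Set.preimage_mono subset_closure).antisymm fun y hy ↦ ?_
    obtain ⟨K, _, γ, m, a, rfl⟩ := exists_eq_orbitPoint y
    exact hmem γ m a (hmem' γ m a hy)
  have hb : b = 0 ∨ b = 1 := (by decide : ∀ b : Fin 2, b = 0 ∨ b = 1) b
  refine hcl.trans (Set.Subset.antisymm ?_ ?_)
  · intro y hy
    obtain ⟨K, _, γ, m, a, rfl⟩ := exists_eq_orbitPoint y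
    refine specializes_iff_mem_closure.1 ?_
    obtain ⟨⟨m1, m2⟩, m3⟩ := (fiber_iff γ m a _ b j).1 (hmem' γ m a hy)
    have m4 : ∀ i, i ≠ 0 → i ≠ j.succ → (b = 0 → m 0 < m i) ∧ (b = 1 → m i < m 0) := by
      intro i h1 h2
      obtain ⟨k, rfl⟩ := Fin.exists_succ_eq.2 h1
      exact m3 k fun h ↦ h2 (h ▸ rfl)
    have m5 := m4 J n1 n2
    have m6 := m4 J' n3 n4
    change orbitPoint _ (fiberLevel b j) _ ⤳ _
    refine monomial_specializes hJ l1 (fun i k hi hk ↦ ?_) fun i hi ↦ ?_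
    · rcases hcase i hi with rfl | rfl | rfl <;> rcases hcase k hk with rfl | rfl | rfl
      all_goals refine ⟨by rcases hb with rfl | rfl <;> simp at l3 l4 m5 m6 <;> omega, fun h ↦ ?_⟩
      all_goals first | rfl | exact m2 | exact m2.symm | skip
      all_goals exfalso; rcases hb with rfl | rfl <;> simp at l3 l4 <;> omega
    · rcases hcase i hi with rfl | rfl | rfl <;> rcases hb with rfl | rfl <;>
        simp at l3 l4 m5 m6 <;> omega
  · refine closure_minimal ?_ (isClosed_closure.preimage toricModel.π.continuous)
    rw [Set.singleton_subset_iff, ← hcl]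
    refine hmem _ _ _ ((fiber_iff _ _ _ _ _ _).2 ⟨⟨l2, ?_⟩, fun k hk ↦ ?_⟩)
    · simp [FF.c, n1.symm, n2.symm, mul_comm]
    · have h1 : k.succ ≠ 0 := Fin.succ_ne_zero k
      have h2 : k.succ ≠ j.succ := fun h ↦ hk (Fin.succ_injective _ h)
      by_cases h3 : k.succ = J
      · rw [h3]
        exact ⟨l3, l4⟩
      · rcases hcase _ h3 with h | h | h
        · exact absurd h h1
        · exact absurd h h2
        · rw [h]
          exact ⟨fun hb ↦ (l3 hb).trans_eq l1.symm, fun hb ↦ l1.trans_lt (l4 hb)⟩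


open ToricData

/-! ### Lines in the exceptional planes -/

section Plane

/-- All ratios of three functions that satisfy a linear relation are nonconstant if one is. -/
lemma FF.nonconst_ratio {α : Fin 3 → ℂˣ} {x : Fin 3 → FFˣ}
    (hx : ∑ k, algebraMap ℂ FF (α k) * x k = 0) {i₀ j₀ : Fin 3}
    (h : FF.Nonconst (x i₀ / x j₀ : FF)) {i j : Fin 3} (hij : i ≠ j) :
    FF.Nonconst (x i / x j : FF) := by
  intro z hz
  have hzx : (x i : FF) = algebraMap ℂ FF z * x j := by
    rw [hz, div_mul_cancel₀ _ (x j).ne_zero]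
  have hα : ∀ k, algebraMap ℂ FF (α k) ≠ 0 := fun k ↦ by simp
  have hall : ∀ k, ∃ z : ℂ, (x k : FF) = algebraMap ℂ FF z * x j := by
    intro k
    by_cases hki : k = i
    · exact ⟨z, hki ▸ hzx⟩
    by_cases hkj : k = j
    · exact ⟨1, by rw [hkj, map_one, one_mul]⟩
    refine ⟨-(α i * z + α j) / α k, ?_⟩
    have huniv : (Finset.univ : Finset (Fin 3)) = {i, j, k} := by
      clear hα hzx hz hx h
      revert i j k
      decide +kernel
    rw [huniv, Finset.sum_insert (by simp [hij, Ne.symm hki]),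
      Finset.sum_pair (Ne.symm hkj), hzx] at hx
    rw [map_div₀, map_neg, map_add, map_mul, div_mul_eq_mul_div, eq_div_iff (hα k)]
    linear_combination hx
  obtain ⟨z₁, h₁⟩ := hall i₀
  obtain ⟨z₂, h₂⟩ := hall j₀
  refine h (z₁ / z₂) ?_
  rw [h₁, h₂, mul_div_mul_right _ _ (x j).ne_zero, map_div₀]

variable {K : Type} [Field K]

/-- The points of a line in the exceptional plane over a fixed point. -/
lemma plane_specializes {γ : ℂ →+* K} {m : Fin 4 → ℤ} {a : Fin 4 → Kˣ} {α : Fin 3 → ℂˣ}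
    {x : Fin 3 → FFˣ} (hx : ∑ k, algebraMap ℂ FF (α k) * x k = 0)
    (hnc : ∀ i j, i ≠ j → FF.Nonconst (x i / x j : FF)) (hm : ∀ k : Fin 3, m 0 < m k.succ)
    {k₀ : Fin 3} (hk₀ : ∀ k : Fin 3, m k₀.succ ≤ m k.succ)
    (ha : ∑ k : Fin 3, γ (α k) * (if m k.succ = m k₀.succ then (a k.succ : K) else 0) = 0) :
    orbitPoint (algebraMap ℂ FF) ![0, 1, 1, 1] (Fin.cons 1 x) ⤳ orbitPoint γ m a := by
  have hγ : ∀ k, γ (α k) ≠ 0 := fun k ↦ by simp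
  -- a second label of minimal level
  obtain ⟨k₁, hk₁, hk₁m⟩ : ∃ k₁, k₁ ≠ k₀ ∧ m k₁.succ = m k₀.succ := by
    by_contra! hcon
    rw [Finset.sum_eq_single k₀ (fun k _ hk ↦ by rw [if_neg (hcon k hk), mul_zero])
      (fun h ↦ absurd (Finset.mem_univ _) h), if_pos rfl] at ha
    exact mul_ne_zero (hγ k₀) (a k₀.succ).ne_zero ha
  obtain ⟨k₂, h02, h12, hcase⟩ : ∃ k₂, k₂ ≠ k₀ ∧ k₂ ≠ k₁ ∧ ∀ k, k = k₀ ∨ k = k₁ ∨ k = k₂ := by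
    clear hk₁m ha hk₀
    revert k₀ k₁
    decide
  have huniv : (Finset.univ : Finset (Fin 3)) = {k₀, k₁, k₂} := by
    ext k
    simpa using hcase k
  have hsum : ∀ {R : Type} [AddCommMonoid R] (f : Fin 3 → R), ∑ k, f k = f k₀ + (f k₁ + f k₂) := by
    intro R _ f
    rw [huniv, Finset.sum_insert (by simp [hk₁.symm, h02.symm]), Finset.sum_pair h12.symm]
  obtain ⟨φ, i1, i2, i3⟩ := FF.exists_polynomial_subst (hnc k₂ k₀ h02)
  have hC : ∀ z, φ (Polynomial.C z) = algebraMap ℂ FF z := fun z ↦ RingHom.congr_fun i2 z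
  let r : K := if m k₂.succ = m k₀.succ then a k₂.succ / a k₀.succ else 0
  let ψ : Polynomial ℂ →+* K := Polynomial.eval₂RingHom γ r
  have hψC : ∀ z, ψ (Polynomial.C z) = γ z := fun z ↦ by simp [ψ]
  have hψX : ψ Polynomial.X = r := by simp [ψ]
  have hψ : ψ.comp Polynomial.C = γ := RingHom.ext hψC
  -- the coordinates as polynomials in the ratio of two of them
  let u : Fin 3 → Polynomial ℂ := fun k ↦ if k = k₀ then 1 else if k = k₂ then Polynomial.X else
    Polynomial.C (-(α k₁ : ℂ)⁻¹) * (Polynomial.C (α k₀ : ℂ) + Polynomial.C (α k₂ : ℂ) * Polynomial.X)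
  have hu0 : u k₀ = 1 := by simp [u]
  have hu2 : u k₂ = Polynomial.X := by simp [u, h02]
  have hu1 : u k₁ = Polynomial.C (-(α k₁ : ℂ)⁻¹) *
      (Polynomial.C (α k₀ : ℂ) + Polynomial.C (α k₂ : ℂ) * Polynomial.X) := by
    simp [u, hk₁, h12.symm]
  have hφu : ∀ k, φ (u k) * x k₀ = x k := by
    intro k
    rcases hcase k with rfl | rfl | rfl
    · rw [hu0, map_one, one_mul]
    · rw [hsum] at hx
      have h0 : algebraMap ℂ FF (α k) ≠ 0 := by simp
      rw [hu1, map_mul, map_add, map_mul, hC, hC, hC, i3, map_neg, map_inv₀]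
      field_simp
      linear_combination -hx
    · rw [hu2, i3, div_mul_cancel₀ _ (x k₀).ne_zero]
  have hr : r * a k₀.succ = if m k₂.succ = m k₀.succ then (a k₂.succ : K) else 0 := by
    simp only [r]
    split_ifs
    · rw [div_mul_cancel₀ _ (a k₀.succ).ne_zero]
    · rw [zero_mul]
  have hψu : ∀ k, ψ (u k) * a k₀.succ = if m k.succ = m k₀.succ then (a k.succ : K) else 0 := by
    intro k
    rcases hcase k with rfl | rfl | rfl
    · rw [hu0, map_one, one_mul, if_pos rfl]
    · rw [hsum, if_pos rfl, if_pos hk₁m, ← hr] at ha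
      have h0 := hγ k
      rw [hu1, map_mul, map_add, map_mul, hψC, hψC, hψC, hψX, map_neg, map_inv₀, if_pos hk₁m]
      field_simp
      linear_combination -ha
    · rw [hu2, hψX, hr]
  rw [← i2, ← hψ]
  refine orbitPoint_specializes _ φ i1 ψ fun i j hij ↦ ?_
  by_cases hne : i = j
  · subst hne
    exact ⟨1, 1, by simp, .inl ⟨rfl, rfl⟩, .inl ⟨rfl, rfl⟩⟩
  cases i using Fin.cases with
  | zero =>
    obtain ⟨k, rfl⟩ := Fin.exists_succ_eq.2 (Ne.symm hne)
    exact absurd (hm k) hij.not_gt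
  | succ k =>
    have hl : ∀ k : Fin 3, (![0, 1, 1, 1] : Fin 4 → ℤ) k.succ = 1 := by decide
    cases j using Fin.cases with
    | zero =>
      exact ⟨0, 1, by simp, .inr ⟨by rw [hl]; decide, rfl⟩, .inr ⟨hm k, map_zero _⟩⟩
    | succ k' =>
      have hmin : m k'.succ = m k₀.succ := by
        by_contra hcon
        have h1 : k' = k₂ := by
          rcases hcase k' with rfl | rfl | rfl
          · exact absurd rfl hcon
          · exact absurd hk₁m hcon
          · rfl
        have h2 : m k.succ = m k₀.succ := by
          rcases hcase k with rfl | rfl | rfl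
          · rfl
          · exact hk₁m
          · exact absurd (congr_arg Fin.succ h1.symm) hne
        exact hcon (le_antisymm (hij.trans h2.le) (hk₀ k'))
      have h0 : (a k₀.succ : K) ≠ 0 := (a k₀.succ).ne_zero
      have hk' : ψ (u k') * a k₀.succ = a k'.succ := by rw [hψu, if_pos hmin]
      refine ⟨u k, u k', ?_, .inl ⟨by rw [hl, hl], ?_⟩, ?_⟩
      · intro h
        rw [h, zero_mul] at hk'
        exact (a k'.succ).ne_zero hk'.symm
      · change φ (u k) * (x k' : FF) = φ (u k') * x k
        rw [← hφu k, ← hφu k']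
        ring
      · by_cases hk : m k.succ = m k₀.succ
        · refine .inl ⟨hk.trans hmin.symm, mul_right_cancel₀ h0 ?_⟩
          have hk2 : ψ (u k) * a k₀.succ = a k.succ := by rw [hψu, if_pos hk]
          linear_combination (a k'.succ : K) * hk2 - (a k.succ : K) * hk'
        · refine .inr ⟨hij.lt_of_ne fun h ↦ hk (h.symm.trans hmin), ?_⟩
          have hk2 := hψu k
          rw [if_neg hk] at hk2
          exact (mul_eq_zero.1 hk2).resolve_right h0

/-- The general point of a line in an exceptional plane is the limit of a point of the torus. -/
lemma specializes_plane (x : Fin 3 → FFˣ) :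
    ∃ (L : Type) (_ : Field L) (γ : ℂ →+* L) (ε : L) (x' : Fin 3 → Lˣ) (f : FF →+* L),
      f.comp (algebraMap ℂ FF) = γ ∧ (∀ k, (x' k : L) = ε * f (x k)) ∧
      orbitPoint γ 0 (Fin.cons 1 x' : Fin 4 → Lˣ) ⤳
        orbitPoint (algebraMap ℂ FF) ![0, 1, 1, 1] (Fin.cons 1 x) := by
  let L := RatFunc FF
  let f : FF →+* L := algebraMap FF L
  let ε : Lˣ := Units.mk0 (RatFunc.X : L) RatFunc.X_ne_zero
  let C : ℂ →+* Polynomial FF := Polynomial.C.comp (algebraMap ℂ FF)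
  let φ : Polynomial FF →+* L := algebraMap (Polynomial FF) L
  let ψ : Polynomial FF →+* FF := Polynomial.evalRingHom 0
  have hφC : ∀ z, φ (Polynomial.C z) = f z := fun z ↦ RatFunc.algebraMap_C z
  refine ⟨L, inferInstance, φ.comp C, ε, fun k ↦ ε * Units.map f.toMonoidHom (x k), f,
    RingHom.ext fun z ↦ (hφC _).symm, fun k ↦ rfl, ?_⟩
  have hψ : ψ.comp C = algebraMap ℂ FF := RingHom.ext fun z ↦ by simp [ψ, C]
  rw [← hψ]
  refine orbitPoint_specializes C φ (RatFunc.algebraMap_injective FF) ψ fun i j hij ↦ ?_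
  have hl : ∀ k : Fin 3, (![0, 1, 1, 1] : Fin 4 → ℤ) k.succ = 1 := by decide
  cases i using Fin.cases with
  | zero =>
    cases j using Fin.cases with
    | zero => exact ⟨1, 1, by simp, .inl ⟨rfl, rfl⟩, .inl ⟨rfl, rfl⟩⟩
    | succ k => rw [hl] at hij; exact absurd hij (by decide)
  | succ k =>
    cases j using Fin.cases with
    | zero =>
      refine ⟨Polynomial.X * Polynomial.C (x k : FF), 1, by simp, .inl ⟨rfl, ?_⟩,
        .inr ⟨by rw [hl]; decide, by simp [ψ]⟩⟩
      rw [map_mul, hφC, map_one, one_mul]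
      have : φ Polynomial.X = ε := RatFunc.algebraMap_X
      rw [this]
      exact mul_one _
    | succ k' =>
      refine ⟨Polynomial.C (x k : FF), Polynomial.C (x k' : FF), by simp [ψ], .inl ⟨rfl, ?_⟩,
        .inl ⟨by rw [hl, hl], by simp [ψ, mul_comm]⟩⟩
      rw [hφC, hφC]
      change f (x k) * ((ε : L) * f (x k')) = f (x k') * (ε * f (x k))
      ring

end Plane


open ToricData

/-! ### The classes of lines in the exceptional planes on the toric model -/

/-- The complement of the hyperplane `∑ α k * X k = 0`, for the homogeneous coordinates `X k` that
restrict to those of the exceptional plane over the fixed point with index `b`. -/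
def lineCompl (α : Fin 3 → ℂˣ) (b : Fin 2) : (PP (Fin 6)).Opens :=
  PP.hyperplaneCompl (Finset.univ.image (tpIndex b)) fun i ↦ (α ⟨i % 3, Nat.mod_lt _ (by decide)⟩ : ℂ)

lemma mem_lineCompl_pt {R : Type} [CommRing R] (γ : ℂ →+* R) (a : Fin 6 → R) (c : Fin 6)
    (h : IsUnit (a c)) (α : Fin 3 → ℂˣ) (b : Fin 2) (p : Spec (CommRingCat.of R)) :
    PP.pt γ a c h p ∈ lineCompl α b ↔ ∑ k, γ (α k) * a (tpIndex b k) ∉ p.asIdeal := by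
  have hinj : Function.Injective (tpIndex b) := by
    revert b
    decide +kernel
  have hmod : ∀ k : Fin 3, (⟨(tpIndex b k : ℕ) % 3, Nat.mod_lt _ (by decide)⟩ : Fin 3) = k := by
    clear hinj p h a c
    revert b
    decide +kernel
  unfold lineCompl
  rw [PP.mem_hyperplaneCompl_pt, Finset.sum_image fun _ _ _ _ h ↦ hinj h]
  simp only [hmod]

section Coords

variable {K : Type} [Field K]

lemma mul_eq_mul_div_mul (A : K) {c₁ c₂ d₁ d₂ x y : K} (h₁ : c₂ ≠ 0) (h₂ : d₁ ≠ 0)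
    (h : d₁ * c₂ * x = d₂ * c₁ * y) : A * x = A * (c₁ / c₂) * (d₂ / d₁ * y) := by
  field_simp
  linear_combination A * h

lemma coords_relation (v : TPIndex) {k₁ k₂ k₃ : Option (Fin 3)} (i₁ j₁ : twoPointData.ι k₁)
    (i₂ j₂ : twoPointData.ι k₂) (i₃ j₃ : twoPointData.ι k₃)
    (h : twoPointData.χ k₁ i₁ + twoPointData.χ k₂ i₂ + twoPointData.χ k₃ i₃ =
      twoPointData.χ k₁ j₁ + twoPointData.χ k₂ j₂ + twoPointData.χ k₃ j₃) :
    (tpChart v).coords k₁ i₁ * (tpChart v).coords k₂ i₂ * (tpChart v).coords k₃ i₃ =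
      (tpChart v).coords k₁ j₁ * (tpChart v).coords k₂ j₂ * (tpChart v).coords k₃ j₃ := by
  apply (tpChart v).θ_injective
  simp only [map_mul, Chart.θ_coords, ← mono_add]
  congr 1
  linear_combination h

lemma weights_relation (b : Fin 2) (i j : Fin 3) : twoPointData.χ (some i) b +
    twoPointData.χ (some j) (b + 1 : Fin 2) + monomialWeights (tpIndex b j) =
      twoPointData.χ (some i) (b + 1 : Fin 2) + twoPointData.χ (some j) b +
        monomialWeights (tpIndex b i) := by
  change (![stdE i, 0] : Fin 2 → Fin 3 → ℤ) b + (![stdE j, 0] : Fin 2 → Fin 3 → ℤ) (b + 1) + _ =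
    (![stdE i, 0] : Fin 2 → Fin 3 → ℤ) (b + 1) + (![stdE j, 0] : Fin 2 → Fin 3 → ℤ) b + _
  revert b i j
  decide +kernel

lemma weights_relation' (b : Fin 2) (i : Fin 3) : monomialWeights (tpIndex (b + 1) i) +
    twoPointData.χ (some (i + 1)) (b + 1 : Fin 2) + twoPointData.χ (some 0) (b + 1 : Fin 2) =
      monomialWeights (tpIndex b (i + 2)) + twoPointData.χ (some (i + 1)) b +
        twoPointData.χ (some 0) (b + 1 : Fin 2) := by
  change _ + (![stdE (i + 1), 0] : Fin 2 → Fin 3 → ℤ) (b + 1) +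
    (![stdE 0, 0] : Fin 2 → Fin 3 → ℤ) (b + 1) = _ + (![stdE (i + 1), 0] : Fin 2 → Fin 3 → ℤ) b +
    (![stdE 0, 0] : Fin 2 → Fin 3 → ℤ) (b + 1)
  revert b i
  decide +kernel

lemma tpChart_π (v : TPIndex) (ev : AR 3 →+* K) (b : Fin 2)
    (hu : ∀ k : Fin 3, ev ((tpChart v).coords (some k) (b + 1)) ≠ 0) :
    Spec.map (CommRingCat.ofHom ev) ≫ (tpChart v).map ≫ firstπ =
      Spec.map (CommRingCat.ofHom (MvPolynomial.eval₂Hom (ev.comp MvPolynomial.C) fun k ↦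
        ev ((tpChart v).coords (some k) b) / ev ((tpChart v).coords (some k) (b + 1)))) ≫
        P1Cube.chart b := by
  apply P1Cube.jointlyMono_pr
  intro k
  rw [Category.assoc, Category.assoc, firstπ_pr, Category.assoc, chart_pr]
  refine (congr_arg (Spec.map (CommRingCat.ofHom ev) ≫ ·) ((tpChart v).map_q (some k))).trans ?_
  have hu' : IsUnit (ev ((tpChart v).coords (some k) ((tpChart v).c (some k)))) := by
    rw [Chart.coords_c, map_one]
    exact isUnit_one
  refine (PP.map_pt_eq (γ' := ev.comp MvPolynomial.C)
    (a' := fun i ↦ ev ((tpChart v).coords (some k) i)) (h' := hu') rfl fun i j ↦ mul_comm _ _).trans ?_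
  refine (PP.map_pt_eq (RingHom.ext fun z ↦ by simp) fun i j ↦ ?_).symm
  have hne := add_one_ne b
  have h0 := hu k
  rcases eq_or_eq_add_one b i with h | h <;> rcases eq_or_eq_add_one b j with h' | h' <;>
    rw [h, h'] <;> simp [hne] <;>
    first | exact div_mul_cancel₀ _ h0 | exact (div_mul_cancel₀ _ h0).symm

lemma firstπ_mem_dPlus (v : TPIndex) (ev : AR 3 →+* K) (k : Fin 3) (c : Fin 2) :
    P1Cube.pr k (firstπ ((tpChart v).map (Spec.map (CommRingCat.ofHom ev) (fieldPt K)))) ∈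
      PP.dPlus c ↔ ev ((tpChart v).coords (some k) c) ≠ 0 := by
  have h := congr_arg (fun g : Spec (CommRingCat.of (AR 3)) ⟶ PP (Fin 2) ↦
    g (Spec.map (CommRingCat.ofHom ev) (fieldPt K))) ((congr_arg ((tpChart v).map ≫ ·)
      (firstπ_pr k)).trans ((tpChart v).map_q (some k)))
  simp only [Scheme.Hom.comp_apply] at h
  rw [h]
  exact PP.mem_dPlus_pt _ _ _ _ _ _

lemma weights_eq : (∀ i j : Fin 3, monomialWeights (tpIndex 0 i) - hw i.succ =
    monomialWeights (tpIndex 0 j) - hw j.succ) ∧ ∀ i j : Fin 3,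
      monomialWeights (tpIndex 1 i) - hw j.succ = monomialWeights (tpIndex 1 j) - hw i.succ := by
  decide +kernel

lemma limitRatio_of_le {n : ℕ} {l : Fin (n + 1) → ℤ} {a : Fin (n + 1) → Kˣ} {i j : Fin (n + 1)}
    (h : l j ≤ l i) (c : Fin 2) :
    limitRatio l a i j c * (![if l i = l j then (a i / a j : K) else 0, 1] : Fin 2 → K) 1 =
      limitRatio l a i j 1 *
        (![if l i = l j then (a i / a j : K) else 0, 1] : Fin 2 → K) c ∧
      limitRatio l a i j 1 ≠ 0 := by
  rcases (by decide : ∀ c : Fin 2, c = 0 ∨ c = 1) c with rfl | rfl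
  · rcases h.eq_or_lt with h' | h'
    · simp [limitRatio, h', mul_div_cancel₀]
    · simp [limitRatio, h, h'.not_ge, h'.ne']
  · simp [limitRatio, h]

end Coords

/-- The equation of the proper transform of a surface through a fixed point. -/
lemma properTransform_subset (α : Fin 3 → ℂˣ) (b : Fin 2) :
    firstπ ⁻¹' (P1Cube.chart b '' PrimeSpectrum.zeroLocus
      {∑ i : Fin 3, MvPolynomial.C (α i : ℂ) * MvPolynomial.X i} \ fixedPoint b) ⊆
      {x | twoPointData.q none x ∉ lineCompl α b} := by
  rintro x ⟨⟨p, hp, hpx⟩, hx⟩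
  obtain ⟨v, p', rfl⟩ := exists_mem_range_tpChart x
  change PrimeSpectrum (AR 3) at p'
  let K := p'.asIdeal.ResidueField
  let ev : AR 3 →+* K := algebraMap (AR 3) K
  have hev : Spec.map (CommRingCat.ofHom ev) (fieldPt K) = p' := by
    apply PrimeSpectrum.ext
    change RingHom.ker ev = p'.asIdeal
    exact Ideal.ker_algebraMap_residueField _
  rw [← hev] at hpx hx ⊢
  set c : Fin 3 → Fin 2 → K := fun k i ↦ ev ((tpChart v).coords (some k) i) with hc
  have hu : ∀ k, c k (b + 1) ≠ 0 := by
    intro k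
    refine (firstπ_mem_dPlus v ev k (b + 1)).1 ?_
    rw [← hpx]
    have h := congr_arg (fun g : Spec (CommRingCat.of (AR 3)) ⟶ PP (Fin 2) ↦ g p) (chart_pr b k)
    simp only [Scheme.Hom.comp_apply] at h
    rw [h, PP.mem_dPlus_pt]
    simpa using (Ideal.ne_top_iff_one _).1 p.2.ne_top
  obtain ⟨k₀, hk₀⟩ : ∃ k, c k b ≠ 0 := by
    by_contra! hcon
    refine hx (P1Cube.mem_fixedPoint.2 fun k h ↦ ?_)
    exact (firstπ_mem_dPlus v ev k b).1 h (hcon k)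
  have hsum : ∑ k, ev (MvPolynomial.C (α k : ℂ)) * (c k b / c k (b + 1)) = 0 := by
    have h1 := congr_arg (fun g : Spec (CommRingCat.of K) ⟶ P1Cube ↦ g (fieldPt K))
      (tpChart_π v ev b hu)
    simp only [Scheme.Hom.comp_apply] at h1
    rw [← hpx] at h1
    have : IsOpenImmersion (P1Cube.chart b) := by
      rw [chart_eq]
      infer_instance
    have h2 := (P1Cube.chart b).isOpenEmbedding.injective h1
    have h3 := hp rfl
    rw [SetLike.mem_coe, h2] at h3
    have h4 : MvPolynomial.eval₂Hom (ev.comp MvPolynomial.C) (fun k ↦ c k b / c k (b + 1))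
      (∑ i : Fin 3, MvPolynomial.C (α i : ℂ) * MvPolynomial.X i) = 0 := h3
    simpa using h4
  have hrel : ∀ i j, c i b * c j (b + 1) * ev ((tpChart v).coords none (tpIndex b j)) =
      c i (b + 1) * c j b * ev ((tpChart v).coords none (tpIndex b i)) := by
    intro i j
    have h := congr_arg ev (coords_relation v (k₃ := none) _ _ _ _ _ _ (weights_relation b i j))
    rw [map_mul, map_mul, map_mul, map_mul] at h
    exact h
  have h := congr_arg (fun g : Spec (CommRingCat.of (AR 3)) ⟶ PP (Fin 6) ↦
    g (Spec.map (CommRingCat.ofHom ev) (fieldPt K))) ((tpChart v).map_q none)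
  rw [Set.mem_ofPred_eq]
  refine fun h' ↦ ?_
  have h'' := h ▸ h'
  refine (mem_lineCompl_pt _ _ _ _ _ _ _).1 h'' ?_
  change ev _ = 0
  rw [map_sum]
  have hk : ∀ k, ev (MvPolynomial.C (α k : ℂ) * (tpChart v).coords none (tpIndex b k)) =
      ev (MvPolynomial.C (α k : ℂ)) * (c k b / c k (b + 1)) *
        (c k₀ (b + 1) / c k₀ b * ev ((tpChart v).coords none (tpIndex b k₀))) := by
    intro k
    rw [map_mul]
    exact mul_eq_mul_div_mul _ (hu k) hk₀ (hrel k₀ k)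
  rw [Finset.sum_congr rfl fun k _ ↦ hk k, ← Finset.sum_mul, hsum, zero_mul]

lemma π_orbitPoint_mem_fixedPoint {K : Type} [Field K] {γ : ℂ →+* K} {m : Fin 4 → ℤ}
    {a : Fin 4 → Kˣ} {b : Fin 2} : toricModel.π (orbitPoint γ m a) ∈ fixedPoint b ↔
      ∀ k : Fin 3, limitRatio m a k.succ 0 b = 0 := by
  rw [P1Cube.mem_fixedPoint]
  refine forall_congr' fun k ↦ ?_
  have h : P1Cube.pr k (toricModel.π (orbitPoint γ m a)) =
      (permData 3).q (k.succ, 0) (orbitPoint γ m a) :=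
    congr_arg (fun g : (permData 3).X ⟶ PP (Fin 2) ↦ g (orbitPoint γ m a)) (toricModel_π_pr k)
  rw [h, q_orbitPoint, PP.mem_dPlus_pt, not_not, mem_fieldPt]

/-- The conditions on the points of a line in the exceptional plane: `M` and `A` are the levels and
the coordinates of the point, inverted for the second fixed point. -/
lemma exceptional_conditions {K : Type} [Field K] {γ : ℂ →+* K} {m : Fin 4 → ℤ} {a : Fin 4 → Kˣ}
    {α : Fin 3 → ℂˣ} {b : Fin 2} {M : Fin 4 → ℤ} {A : Fin 4 → Kˣ}
    (hMA : b = 0 ∧ M = m ∧ A = a ∨ b = 1 ∧ M = -m ∧ A = a⁻¹)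
    (h1 : toricModel.π (orbitPoint γ m a) ∈ fixedPoint b)
    (h2 : twoPointData.q none (secondBlowdown (orbitPoint γ m a)) ∉ lineCompl α b) :
    (∀ k : Fin 3, M 0 < M k.succ) ∧ ∀ k₀ : Fin 3, (∀ k : Fin 3, M k₀.succ ≤ M k.succ) →
      ∑ k : Fin 3, γ (α k) * (if M k.succ = M k₀.succ then (A k.succ : K) else 0) = 0 := by
  have hM : ∀ k : Fin 3, M 0 < M k.succ := by
    intro k
    have h := π_orbitPoint_mem_fixedPoint.1 h1 k
    rcases hMA with ⟨rfl, rfl, rfl⟩ | ⟨rfl, rfl, rfl⟩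
    · exact limitRatio_eq_zero_iff.1.1 h
    · exact neg_lt_neg (limitRatio_eq_zero_iff.2.1 h)
  refine ⟨hM, fun k₀ hk₀ ↦ ?_⟩
  -- the point in terms of the coordinates of a chart of the first blowup
  obtain ⟨v, p, hp⟩ := exists_mem_range_tpChart (secondBlowdown (orbitPoint γ m a))
  have hr : Set.range (orbitPt γ m a ≫ secondBlowdown) ⊆ Set.range (tpChart v).map := by
    rintro _ ⟨t, rfl⟩
    rw [eq_fieldPt t, Scheme.Hom.comp_apply]
    exact ⟨p, hp⟩
  obtain ⟨ev, hev⟩ : ∃ ev : AR 3 →+* K,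
      orbitPt γ m a ≫ secondBlowdown = Spec.map (CommRingCat.ofHom ev) ≫ (tpChart v).map := by
    refine ⟨(Spec.preimage (IsOpenImmersion.lift (tpChart v).map _ hr)).hom, ?_⟩
    have h : CommRingCat.ofHom (Spec.preimage (IsOpenImmersion.lift (tpChart v).map _ hr)).hom =
      Spec.preimage (IsOpenImmersion.lift (tpChart v).map _ hr) := rfl
    rw [h, Spec.map_preimage, IsOpenImmersion.lift_fac]
  have hpt : secondBlowdown (orbitPoint γ m a) =
      (tpChart v).map (Spec.map (CommRingCat.ofHom ev) (fieldPt K)) :=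
    congr_arg (fun g : Spec (CommRingCat.of K) ⟶ twoPointData.X ↦ g (fieldPt K)) hev
  set X : Fin 6 → K := fun i ↦ ev ((tpChart v).coords none i) with hX
  set c : Fin 3 → Fin 2 → K := fun k i ↦ ev ((tpChart v).coords (some k) i) with hc
  have hγ : ev.comp MvPolynomial.C = γ := by
    have h4 : secondBlowdown ≫ twoPointData.toSpecC = (permData 3).toSpecC :=
      (congr_arg (secondBlowdown ≫ ·) (twoPointData.q_toSpecC (some 0)).symm).trans
        ((Category.assoc _ _ _).symm.trans ((congr_arg (· ≫ PP.toSpecC (Fin 2))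
          (secondBlowdown_q 0)).trans ((permData 3).q_toSpecC (1, 0))))
    have h5 : orbitPt γ m a ≫ (permData 3).toSpecC = Spec.map (CommRingCat.ofHom γ) :=
      (congr_arg (orbitPt γ m a ≫ ·) ((permData 3).q_toSpecC (1, 0)).symm).trans
        ((Category.assoc _ _ _).symm.trans ((congr_arg (· ≫ PP.toSpecC (Fin 2))
          (orbitPt_q γ m a 1 0)).trans (PP.pt_toSpecC _ _ _ _)))
    rw [← h4, ← Category.assoc, hev, Category.assoc, Chart.map_toSpecC, ← specMap_comp] at h5
    exact congr_arg CommRingCat.Hom.hom (Spec.map_injective h5)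
  have hsum : ∑ k, γ (α k) * X (tpIndex b k) = 0 := by
    have h := congr_arg (fun g : Spec (CommRingCat.of (AR 3)) ⟶ PP (Fin 6) ↦
      g (Spec.map (CommRingCat.ofHom ev) (fieldPt K))) ((tpChart v).map_q none)
    rw [hpt] at h2
    have h4 := not_not.1 fun h5 ↦ h2 (h.symm ▸ (mem_lineCompl_pt MvPolynomial.C _ _ _ α b _).2 h5)
    have h5 : ev _ = 0 := h4
    rw [map_sum] at h5
    rw [← hγ]
    simpa [hX] using h5
  have hc0 : ∀ k, c k b = 0 := by
    intro k
    by_contra hcon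
    refine P1Cube.mem_fixedPoint.1 h1 k ?_
    have h := (firstπ_mem_dPlus v ev k b).2 hcon
    rw [← hpt] at h
    exact h
  have hc1 : ∀ k, c k (b + 1) ≠ 0 := by
    intro k hcon
    have h : ev ((tpChart v).coords (some k) ((tpChart v).c (some k))) = 1 := by
      rw [Chart.coords_c, map_one]
    rcases eq_or_eq_add_one b ((tpChart v).c (some k)) with h' | h'
    · exact one_ne_zero ((h.symm.trans (congr_arg (c k) h')).trans (hc0 k))
    · exact one_ne_zero ((h.symm.trans (congr_arg (c k) h')).trans hcon)
  -- the homogeneous coordinates of the exceptional plane are proportional to those of the point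
  have hprop : ∀ i j : Fin 3, M j.succ ≤ M i.succ → X (tpIndex b i) =
      (if M i.succ = M j.succ then (A i.succ / A j.succ : K) else 0) * X (tpIndex b j) := by
    intro i j hij
    have key : ∀ (i' j' : Fin 4) (r : K), monomialWeights (tpIndex b i) - hw i' =
        monomialWeights (tpIndex b j) - hw j' → (∀ c : Fin 2,
          limitRatio m a i' j' c * (![r, 1] : Fin 2 → K) 1 =
            limitRatio m a i' j' 1 * (![r, 1] : Fin 2 → K) c) →
        limitRatio m a i' j' 1 ≠ 0 → X (tpIndex b i) = r * X (tpIndex b j) := by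
      intro i' j' r h1 h2 h3
      let w := monomialWeights (tpIndex b i) - hw i' - monomialWeights ((tpChart v).c none)
      have w0 : (permData 3).χ (i', j') (0 : Fin 2) + w =
          twoPointData.χ none (tpIndex b i) - twoPointData.χ none ((tpChart v).c none) := by
        change hw i' + (monomialWeights (tpIndex b i) - hw i' - _) = monomialWeights (tpIndex b i) - _
        abel
      have w1 : (permData 3).χ (i', j') (1 : Fin 2) + w =
          twoPointData.χ none (tpIndex b j) - twoPointData.χ none ((tpChart v).c none) := by
        change hw j' + (monomialWeights (tpIndex b i) - hw i' - _) = monomialWeights (tpIndex b j) - _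
        rw [h1]
        abel
      have hpos : ∀ c, (tpChart v).Nonneg ((permData 3).χ (i', j') c + w) := by
        intro c
        rcases (by decide : ∀ c : Fin 2, c = 0 ∨ c = 1) c with rfl | rfl
        · rw [w0]
          exact fun l ↦ (tpChart v).pos l none _
        · rw [w1]
          exact fun l ↦ (tpChart v).pos l none _
      have h4 : orbitPt γ m a ≫ (permData 3).q (i', j') =
          PP.pt (ι := Fin 2) γ ![r, 1] 1 isUnit_one := by
        rw [orbitPt_q]
        refine PP.pt_eq_pt fun c c' ↦ mul_left_cancel₀ h3 ?_
        have e1 := h2 c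
        have e2 := h2 c'
        have e3 : (![r, 1] : Fin 2 → K) 1 = 1 := rfl
        rw [e3, mul_one] at e1 e2
        rw [e1, e2]
        ring
      have h5 := mul_eq_of_comp_q torus_secondBlowdown (tpChart v) hpos hev
        (i := (1 : Fin 2)) rfl h4 (0 : Fin 2)
      rw [w0, w1] at h5
      exact h5
    rcases hMA with ⟨rfl, rfl, rfl⟩ | ⟨rfl, rfl, rfl⟩
    · exact key i.succ j.succ _ (weights_eq.1 i j) (fun c ↦ (limitRatio_of_le hij c).1)
        (limitRatio_of_le hij 0).2
    · refine (key j.succ i.succ _ (weights_eq.2 i j)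
        (fun c ↦ (limitRatio_of_le (neg_le_neg_iff.1 hij) c).1)
        (limitRatio_of_le (neg_le_neg_iff.1 hij) 0).2).trans (congr_arg (· * _) ?_)
      simp [div_eq_mul_inv, mul_comm, eq_comm]
  have hX0 : X (tpIndex b k₀) ≠ 0 := by
    intro h0
    have hall : ∀ k, X (tpIndex b k) = 0 := fun k ↦ by rw [hprop k k₀ (hk₀ k), h0, mul_zero]
    have hall' : ∀ i, X (tpIndex (b + 1) i) = 0 := by
      intro i
      have h := congr_arg ev (coords_relation v (k₁ := none) _ _ _ _ _ _ (weights_relation' b i))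
      rw [map_mul, map_mul, map_mul, map_mul] at h
      have h' : X (tpIndex (b + 1) i) * c (i + 1) (b + 1) * c 0 (b + 1) =
        X (tpIndex b (i + 2)) * c (i + 1) b * c 0 (b + 1) := h
      rw [hall, zero_mul, zero_mul] at h'
      exact (mul_eq_zero.1 ((mul_eq_zero.1 h').resolve_right (hc1 0))).resolve_right (hc1 _)
    have h : X ((tpChart v).c none) = 1 := by
      rw [hX]
      change ev ((tpChart v).coords none ((tpChart v).c none)) = 1
      rw [Chart.coords_c, map_one]
    have hcase : ∀ (b : Fin 2) (i : Fin 6), (∃ k, i = tpIndex b k) ∨ ∃ k, i = tpIndex (b + 1) k := by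
      decide +kernel
    rcases hcase b ((tpChart v).c none) with ⟨k, hk⟩ | ⟨k, hk⟩
    · exact one_ne_zero ((h.symm.trans (congr_arg X hk)).trans (hall k))
    · exact one_ne_zero ((h.symm.trans (congr_arg X hk)).trans (hall' k))
  refine mul_right_cancel₀ hX0 ?_
  rw [zero_mul, Finset.sum_mul]
  refine mul_left_cancel₀ (inv_ne_zero (A k₀.succ).ne_zero) ?_
  rw [mul_zero, Finset.mul_sum]
  refine Eq.trans (Finset.sum_congr rfl fun k _ ↦ ?_) hsum
  rw [hprop k k₀ (hk₀ k)]
  split_ifs <;> ring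


open ToricData

/-- The inversion of the torus exchanges the two fixed points, which reduces statements about the
fixed point with index `1` to the one with index `0`. -/
lemma exists_flip (b : Fin 2) : ∃ e : (permData 3).X ⟶ (permData 3).X,
    ∀ {K : Type} [Field K] (γ : ℂ →+* K) {m M : Fin 4 → ℤ} {a A : Fin 4 → Kˣ},
      (b = 0 ∧ M = m ∧ A = a ∨ b = 1 ∧ M = -m ∧ A = a⁻¹) →
        e (orbitPoint γ M A) = orbitPoint γ m a := by
  rcases (by decide : ∀ b : Fin 2, b = 0 ∨ b = 1) b with rfl | rfl
  · refine ⟨𝟙 _, fun γ _ _ _ _ h ↦ ?_⟩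
    rcases h with ⟨-, rfl, rfl⟩ | ⟨h, -⟩
    · rfl
    · exact absurd h (by decide)
  · refine ⟨(invIso 3).hom, fun γ _ _ _ _ h ↦ ?_⟩
    rcases h with ⟨h, -⟩ | ⟨-, rfl, rfl⟩
    · exact absurd h (by decide)
    · rw [invIso_orbitPoint, neg_neg, inv_inv]

/-- The levels and coordinates of a point after the exchange of the two fixed points. -/
lemma exists_levels {K : Type} [Field K] (b : Fin 2) (m : Fin 4 → ℤ) (a : Fin 4 → Kˣ) :
    ∃ (M : Fin 4 → ℤ) (A : Fin 4 → Kˣ), (b = 0 ∧ M = m ∧ A = a ∨ b = 1 ∧ M = -m ∧ A = a⁻¹) ∧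
      (b = 0 ∧ m = M ∧ a = A ∨ b = 1 ∧ m = -M ∧ a = A⁻¹) := by
  rcases (by decide : ∀ b : Fin 2, b = 0 ∨ b = 1) b with rfl | rfl
  · exact ⟨m, a, .inl ⟨rfl, rfl, rfl⟩, .inl ⟨rfl, rfl, rfl⟩⟩
  · exact ⟨-m, a⁻¹, .inr ⟨rfl, rfl, rfl⟩, .inr ⟨rfl, by simp, by simp⟩⟩

/-- A line in an exceptional plane is the closure of the limit point whose coordinates satisfy the
equation of the line. Both inclusions are checked on limit points: `exceptional_conditions` bounds
the line from above, and `specializes_plane` places its general point in the closure of the surface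
without the fixed point. -/
lemma exceptionalClass_toricModel (p : GeneralChoice) (b : Fin 2) :
    toricModel.exceptionalClass p b = planeSum (b = 1) := by
  let α : Fin 3 → ℂˣ := p.plane b
  obtain ⟨y, hy⟩ := FF.exists_linear (α 2) (α 0) (α 1)
  let x : Fin 3 → FFˣ := ![FF.s, y, 1]
  have hx : ∑ k, algebraMap ℂ FF (α k) * x k = 0 := by
    rw [Fin.sum_univ_three]
    refine Eq.trans ?_ hy
    simp [x, FF.c, α]
    ring
  have hnc : ∀ i j, i ≠ j → FF.Nonconst (x i / x j : FF) := fun i j hij ↦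
    FF.nonconst_ratio hx (i₀ := 0) (j₀ := 2) (by simpa [x] using FF.nonconst_zpow one_ne_zero) hij
  obtain ⟨m, a, hm, hm'⟩ := exists_levels b ![0, 1, 1, 1] (Fin.cons 1 x : Fin 4 → FFˣ)
  obtain ⟨e, he⟩ := exists_flip b
  have h : toricModel.exceptionalClass p b = orbitClass m a := by
    refine congr_arg (fundClass 1) (Set.Subset.antisymm ?_ ?_)
    · rintro z ⟨hz1, hz2⟩
      obtain ⟨K, _, γ, n, c, rfl⟩ := exists_eq_orbitPoint z
      have hz3 : twoPointData.q none (secondBlowdown (orbitPoint γ n c)) ∉ lineCompl α b := by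
        have hcl : IsClosed {x | twoPointData.q none x ∉ lineCompl α b} :=
          ((lineCompl α b).isOpen.preimage (twoPointData.q none).continuous).isClosed_compl
        exact closure_minimal (properTransform_subset α b) hcl hz2
      obtain ⟨M, A, hM, hM'⟩ := exists_levels b n c
      obtain ⟨c1, c2⟩ := exceptional_conditions hM hz1 hz3
      obtain ⟨k₀, hk₀⟩ := Finite.exists_min fun k : Fin 3 ↦ M k.succ
      have key := (plane_specializes hx hnc c1 hk₀ (c2 k₀ hk₀)).map e.continuous
      rw [he γ hM, he _ hm'] at key
      exact specializes_iff_mem_closure.1 key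
    · refine closure_minimal ?_ ?_
      · obtain ⟨L, _, γ, ε, x', f, hf, hx', hs⟩ := specializes_plane x
        obtain ⟨m', a', hm1, hm2⟩ := exists_levels (K := L) b 0 (Fin.cons 1 x' : Fin 4 → Lˣ)
        have hs := hs.map e.continuous
        rw [he γ hm2, he _ hm'] at hs
        rw [Set.singleton_subset_iff]
        refine ⟨π_orbitPoint_mem_fixedPoint.2 fun k ↦ ?_, (hs.map toricModel.π₂.continuous).mem_closed
          isClosed_closure (subset_closure ⟨π_orbitPoint_mem (t := fun k ↦ (x' k : L)) ?_ ?_, fun h0 ↦ ?_⟩)⟩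
        · have hk : ∀ k : Fin 3, (![0, 1, 1, 1] : Fin 4 → ℤ) k.succ = 1 := by decide
          rcases hm' with ⟨rfl, h1, -⟩ | ⟨rfl, h1, -⟩
          · refine limitRatio_eq_zero_iff.1.2 ?_
            rw [← h1, hk]
            decide
          · refine limitRatio_eq_zero_iff.2.2 (neg_lt_neg_iff.1 ?_)
            have h2 := congr_fun h1 k.succ
            have h3 := congr_fun h1 0
            rw [hk, Pi.neg_apply] at h2
            rw [Pi.neg_apply] at h3
            rw [← h2, ← h3]
            decide
        · intro k
          rcases hm1 with ⟨rfl, rfl, rfl⟩ | ⟨rfl, rfl, rfl⟩ <;> simp [limitRatio]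
        · rintro _ rfl
          simp only [map_sum, map_mul, MvPolynomial.coe_eval₂Hom, MvPolynomial.eval₂_C,
            MvPolynomial.eval₂_X, hx', ← hf]
          have h1 := congr_arg (ε * f ·) hx
          simp only [map_sum, map_mul, map_zero, mul_zero, Finset.mul_sum] at h1
          refine Eq.trans (Finset.sum_congr rfl fun k _ ↦ ?_) h1
          change f (algebraMap ℂ FF _) * _ = _
          ring
        · have h1 := π_orbitPoint_mem_fixedPoint.1 h0 0
          rcases hm1 with ⟨rfl, rfl, rfl⟩ | ⟨rfl, rfl, rfl⟩ <;> simp [limitRatio] at h1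
      · exact ((fixedPoint b).isClosed.preimage toricModel.π.continuous).inter
          (isClosed_closure.preimage toricModel.π₂.continuous)
  rw [h]
  have hp := planeClass_eq α (Fin.cons 1 x) ((Fin.sum_univ_three _).symm.trans hx)
    (by simpa [x] using FF.nonconst_zpow one_ne_zero)
  rcases hm with ⟨rfl, rfl, rfl⟩ | ⟨rfl, rfl, rfl⟩
  · exact hp.1
  · exact hp.2


open ToricData

/-! ### The action of the symmetry on curve classes -/

lemma zetaIso_eq_swapIso : zetaIso = swapIso := by
  apply Iso.ext
  apply (permData 3).jointlyMono
  rintro ⟨i, j⟩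
  exact (zetaHom_q i j).trans (permIso_q (Equiv.swap 0 1) i j).symm

lemma curveClass_toricModel (p : GeneralChoice) (d₁ d₂ d₃ a₁ a₂ b₁ b₂ b₃ b₄ b₅ b₆ : ℤ) :
    toricModel.curveClass p ![d₁, d₂, d₃] ![a₁, a₂] ![b₁, b₂, b₃, b₄, b₅, b₆] =
      d₁ • labelLine 3 + d₂ • labelLine 2 + d₃ • labelLine 1 -
        (a₁ • planeSum false + a₂ • planeSum true) -
        (b₁ • fiberSum true 2 + b₂ • fiberSum true 1 + b₃ • fiberSum true 0 +
          b₄ • fiberSum false 2 + b₅ • fiberSum false 1 + b₆ • fiberSum false 0) := by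
  unfold PermutohedralBlowup.curveClass PermutohedralBlowup.h PermutohedralBlowup.e
    PermutohedralBlowup.f
  simp only [lineClass_toricModel, exceptionalClass_toricModel, fiberClass_toricModel]
  rw [Fin.sum_univ_three, Fin.sum_univ_two, Fin.sum_univ_six]
  rfl

lemma pushforward_zetaIso_curveClass (p q : GeneralChoice)
    (d₁ d₂ d₃ a₁ a₂ b₁ b₂ b₃ b₄ b₅ b₆ : ℤ) :
    pushforward zetaIso 1
        (toricModel.curveClass p ![d₁, d₂, d₃] ![a₁, a₂] ![b₁, b₂, b₃, b₄, b₅, b₆]) =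
      toricModel.curveClass q
        ![d₁ + d₃ - a₁ - a₂ - b₂ - b₅, d₂ + d₃ - a₁ - a₂ - b₁ - b₄, d₃]
        ![d₃ - a₂ - b₄ - b₅, d₃ - a₁ - b₁ - b₂] ![b₅, b₄, b₃, b₂, b₁, b₆] := by
  have s1 : Equiv.swap 0 1 (1 : Fin 4) = 0 := by decide
  have s2 : Equiv.swap 0 1 (2 : Fin 4) = 2 := by decide
  have s3 : Equiv.swap 0 1 (3 : Fin 4) = 3 := by decide
  obtain ⟨t0, t1, t2⟩ := pushforward_swapIso_fiberSum true
  obtain ⟨f0, f1, f2⟩ := pushforward_swapIso_fiberSum false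
  rw [curveClass_toricModel, curveClass_toricModel, zetaIso_eq_swapIso]
  simp only [map_add, map_sub, map_zsmul]
  rw [pushforward_swapIso_labelLine, pushforward_swapIso_labelLine, pushforward_swapIso_labelLine,
    pushforward_swapIso_planeSum, pushforward_swapIso_planeSum, t0, t1, t2, f0, f1, f2, s1, s2, s3,
    labelLine_zero]
  simp only [Bool.not_true, Bool.not_false]
  module

/-! ### Transport to an arbitrary model of the blowup -/

namespace PermutohedralBlowup

variable {B B' : PermutohedralBlowup} {e₁ : B.X₁ ≅ B'.X₁} {e₂ : B.X₂ ≅ B'.X₂}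
  (h₁ : e₁.hom ≫ B'.π₁ = B.π₁) (h₂ : e₂.hom ≫ B'.π₂ = B.π₂ ≫ e₁.hom) {ζ : B'.X₂ ≅ B'.X₂}

include h₁ h₂

lemma IsToricSymmetry.conj {A : Matrix (Fin 3) (Fin 3) ℤ} (h : B'.IsToricSymmetry ζ A) :
    B.IsToricSymmetry (e₂ ≪≫ ζ ≪≫ e₂.symm) A := by
  have hπ := iso_π h₁ h₂
  have hπ' : e₂.inv ≫ B.π = B'.π := by rw [← hπ, Iso.inv_hom_id_assoc]
  obtain ⟨h3, ι, i1, i2, i3, i4⟩ := h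
  refine ⟨?_, ι ≫ e₂.inv, inferInstance, inferInstance, ?_, ?_⟩
  · simp only [Iso.trans_hom, Iso.symm_hom, Category.assoc]
    rw [reassoc_of% hπ', h3, reassoc_of% hπ]
  · rw [Category.assoc, hπ', i3]
  · simp only [Iso.trans_hom, Iso.symm_hom, Category.assoc, Iso.inv_hom_id_assoc]
    rw [reassoc_of% i4]

lemma Resolves.conj {r : Torus ⟶ P1Cube} (h : B'.Resolves ζ r) :
    B.Resolves (e₂ ≪≫ ζ ≪≫ e₂.symm) r := by
  have hπ := iso_π h₁ h₂
  have hπ' : e₂.inv ≫ B.π = B'.π := by rw [← hπ, Iso.inv_hom_id_assoc]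
  unfold Resolves at h ⊢
  let t : pullback torusInclusion B.π ⟶ pullback torusInclusion B'.π :=
    pullback.lift (pullback.fst _ _) (pullback.snd _ _ ≫ e₂.hom) (by
      rw [Category.assoc, hπ, pullback.condition])
  have t1 : t ≫ pullback.fst _ _ = pullback.fst _ _ := pullback.lift_fst _ _ _
  have t2 : t ≫ pullback.snd _ _ = pullback.snd _ _ ≫ e₂.hom := pullback.lift_snd _ _ _
  have h' := congr_arg (t ≫ ·) h
  simp only [reassoc_of% t1, reassoc_of% t2] at h'
  simp only [Iso.trans_hom, Iso.symm_hom, Category.assoc]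
  rw [hπ', h']

end PermutohedralBlowup

end CubeCremona

end

theorem mainTheorem4 :
    Nonempty CubeCremona.PermutohedralBlowup ∧
    ∀ B : CubeCremona.PermutohedralBlowup,
      ∃ ζ : B.X₂ ≅ B.X₂,
        ζ.hom ≠ 𝟙 B.X₂ ∧
        B.IsToricSymmetry ζ CubeCremona.zetaMatrix ∧
        B.Resolves ζ CubeCremona.zetaOnTorus ∧
        ∀ (p q : CubeCremona.GeneralChoice)
          (d₁ d₂ d₃ a₁ a₂ b₁ b₂ b₃ b₄ b₅ b₆ : ℤ),
          CubeCremona.pushforward ζ 1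
              (B.curveClass p ![d₁, d₂, d₃] ![a₁, a₂] ![b₁, b₂, b₃, b₄, b₅, b₆]) =
            B.curveClass q
              ![d₁ + d₃ - a₁ - a₂ - b₂ - b₅, d₂ + d₃ - a₁ - a₂ - b₁ - b₄, d₃]
              ![d₃ - a₂ - b₄ - b₅, d₃ - a₁ - b₁ - b₂]
              ![b₅, b₄, b₃, b₂, b₁, b₆] := by
  refine ⟨⟨CubeCremona.toricModel⟩, fun B ↦ ?_⟩
  obtain ⟨e₁, e₂, h₁, h₂⟩ := CubeCremona.PermutohedralBlowup.exists_iso B CubeCremona.toricModel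
  refine ⟨e₂ ≪≫ CubeCremona.zetaIso ≪≫ e₂.symm, fun h ↦ ?_,
    CubeCremona.isToricSymmetry_zetaIso.conj h₁ h₂, CubeCremona.resolves_zetaIso.conj h₁ h₂, ?_⟩
  · refine CubeCremona.zetaIso_ne_id ?_
    have h' := congr_arg (fun g ↦ e₂.inv ≫ g ≫ e₂.hom) h
    simpa using h'
  · intro p q d₁ d₂ d₃ a₁ a₂ b₁ b₂ b₃ b₄ b₅ b₆
    have h₁' : e₁.symm.hom ≫ B.π₁ = CubeCremona.toricModel.π₁ := by
      rw [← h₁, Iso.symm_hom, Iso.inv_hom_id_assoc]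
    have h₂' : e₂.symm.hom ≫ B.π₂ = CubeCremona.toricModel.π₂ ≫ e₁.symm.hom := by
      rw [Iso.symm_hom, Iso.symm_hom, Iso.inv_comp_eq, ← Category.assoc, h₂, Category.assoc,
        Iso.hom_inv_id, Category.comp_id]
    rw [CubeCremona.pushforward_trans, CubeCremona.pushforward_trans,
      CubeCremona.PermutohedralBlowup.pushforward_curveClass h₁ h₂,
      CubeCremona.pushforward_zetaIso_curveClass p q,
      CubeCremona.PermutohedralBlowup.pushforward_curveClass h₁' h₂']
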